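/- Let $B$ be a smooth separated integral scheme of finite type over $\mathbb{C}$, of dimension $n$, let $\mathscr{L}$ be a line bundle on $B$, let $\mathcal{D}$ be the divisor of a section $\sigma$ of a line bundle $\mathscr{O}(\mathcal{D})$, and let $N\ge 0$. Let $a_1\in H^0(\mathscr{L})$, $a_{2,1}\in H^0(\mathscr{L}^2(-\mathcal{D}))$, $a_{2,2}\in H^0(\mathscr{L}^2(-2\mathcal{D}))$, $a_3'\in H^0(\mathscr{L}^3(-\lfloor N/2\rfloor\mathcal{D}))$, $a_4'\in H^0(\mathscr{L}^4(-\lceil N/2\rceil\mathcal{D}))$, $a_6'\in H^0(\mathscr{L}^6(-N\mathcal{D}))$, so that $a_2=\sigma a_{2,1}$, $a_3=\sigma^{\lfloor N/2\rfloor}a_3'$, $a_4=\sigma^{\lceil N/2\rceil}a_4'$, $a_6=\sigma^Na_6'$ is the Tate form of $\mathrm{SU}(N)$ over $\sigma=0$. Consider the family of Weierstrass models $y^2+a_1xy+a_3y=x^3+a_2x^2+a_4x+a_6$ with parameter $\epsilon$ obtained by $$a_{2,1}\to\epsilon a_{2,1}+\sigma a_{2,2},\quad a_3'\to\epsilon a_3',\quad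 a_4'\to\epsilon a_4',\quad a_6'\to\epsilon^2a_6'.$$ Put $h=a_1^2+4\sigma^2a_{2,2}$ and $Z=\{\sigma=a_1=0\}\subset B$. Assume that the sections are generic in the following sense: $d\sigma,da_1$ are linearly independent at every point of $Z$; $da_1,da_{2,2}$ are linearly independent at every point of $Z\cap\{a_{2,2}=0\}$; and the divisor $h=0$ is smooth away from $Z$. Let $\rho:X\to B$ be the double cover $\xi^2=b_2|_{\epsilon=0}$, where $b_2=a_1^2+4a_2$ and $\xi$ takes values in $\mathscr{L}$; assume that $X$ is integral, and let $\iota:\xi\mapsto-\xi$ be its covering (orientifold) involution. Then: 1. $b_2|_{\epsilon=0}=h$, so $X$ is $\xi^2=a_1^2+4\sigma^2a_{2,2}$. Moreover $\epsilon\mid b_4$, $\epsilon^2\mid b_6$, and $\Delta=\epsilon^2h^2\sigma^N\delta+O(\epsilon^3)$, where $\delta=a_4'^2+a_1(a_3'a_4'-a_1a_6')-\sigma^2a_{2,2}(a_3'^2+4a_6')$ for $N$ even and $\delta=a_1(a_3'a_4'-a_1a_6')+\sigma\bigl(a_4'^2-a_{2,2}(a_3'^2+4\sigma a_6')\bigr)$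 for $N$ odd. 2. The singular locus of $X$ is $Z_X=\{\xi=a_1=\sigma=0\}$; if non-empty, it is of pure codimension two. The inverse image of $\sigma=0$ in $X$ is the scheme-theoretic union of the stack $D_+=\{\sigma=\xi-a_1=0\}$ and its image $D_-=\{\sigma=\xi+a_1=0\}$, which are exchanged by $\iota$ and satisfy $D_+\cap D_-=Z_X$. 3. The blow-up $\pi:\tilde X\to X$ of the ideal $(\xi,a_1,\sigma)$ exists and is a crepant resolution of singularities: $\tilde X$ is integral and smooth of dimension $n$, $\pi$ is proper and an isomorphism over the smooth locus of $X$, and $K_{\tilde X}=\pi^*K_X$. The involution $\iota$ lifts to an involution $\tilde\iota$ of $\tilde X$. 4. The blow-up $\beta:\tilde B\to B$ of the ideal $(\sigma,a_1)$ exists and is smooth of dimension $n$, and there is an affine morphism $\tilde\rho:\tilde X\to\tilde B$ with $\beta\tilde\rho=\rho\pi$ and $\tilde\rho\,\tilde\iota=\tilde\rho$, which is a double cover: wherever $w$ is a local equation of the exceptional divisor of $\beta$ on an affine open set over a common trivialisation of $\mathscr{L}$ and $\mathscr{O}(\mathcal{D})$, it is $\tilde\xi^2=\tilde h$ with $w^2\tilde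 h=h$, $w\tilde\xi=\xi$. 5. Over every affine open subset of $B$ on which $\mathscr{L}$ and $\mathscr{O}(\mathcal{D})$ are trivialised, $\tilde B$ is given in homogeneous coordinates $s,a,w$ of weights $1,1,-1$ ($s,a$ not both zero) by $ws=\sigma$, $wa=a_1$, and $\tilde X$ is given in homogeneous coordinates $s,a,\xi,w$ of weights $1,1,1,-1$ ($s,a,\xi$ not all zero) by $\xi^2=a^2+4s^2a_{2,2}$, $ws=\sigma$, $wa=a_1$, the map to $X$ sending its coordinate $\xi$ to $w\xi$. With $u_\pm=a_1\pm\xi$, $x=\sigma$, $z=-4a_{2,2}$, so that $X$ is $u_+u_-=x^2z$, the scheme $\tilde X$ is also the small resolution $$\beta_+u_+=x\alpha_+,\qquad\beta_-u_-=x\alpha_-,\qquad\alpha_+\alpha_-=z\beta_+\beta_-$$ in $X\times\mathbb{P}^1_{[\alpha_+:\beta_+]}\times\mathbb{P}^1_{[\alpha_-:\beta_-]}$. 6. The proper transforms $\tilde D_\pm$ of $D_\pm$ in $\tilde X$ are disjoint and exchanged by $\tilde\iota$. They are the zero sets of the ideal quotients $I_\pm=\bigl((\sigma,\xi\mp a_1)\mathscr{O}_{\tilde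 X}:(\xi,a_1,\sigma)\mathscr{O}_{\tilde X}\bigr)$, and $\sigma\mathscr{O}_{\tilde X}=(\xi,a_1,\sigma)\mathscr{O}_{\tilde X}\cdot I_+\cdot I_-$, i.e. the total transform of $\sigma=0$ is $E+\tilde D_++\tilde D_-$ with $E$ the exceptional divisor. -/

import Mathlib

open AlgebraicGeometry CategoryTheory
open scoped Polynomial

namespace SppLimit

noncomputable section

/-! ## Complex schemes: scalars, differentials, smooth points -/

/-- The spectrum of the complex numbers. -/
abbrev SpecC : Scheme.{0} := Spec (CommRingCat.of ℂ)

/-- Restriction of regular functions to a smaller open set. -/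
def res {Y : Scheme.{0}} {V W : Y.Opens} (h : V ≤ W) : Γ(Y, W) →+* Γ(Y, V) :=
  (Y.presheaf.map (homOfLE h).op).hom

/-- The germ of a regular function at a point. -/
def germAt {Y : Scheme.{0}} (U : Y.Opens) (y : Y) (hy : y ∈ U) :
    Γ(Y, U) →+* Y.presheaf.stalk y :=
  (Y.presheaf.germ U y hy).hom

/-- The complex constants in a local ring of a complex scheme. -/
def scalars {Y : Scheme.{0}} (f : Y ⟶ SpecC) (y : Y) : ℂ →+* Y.presheaf.stalk y :=
  (germAt ⊤ y trivial).comp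
    ((Scheme.ΓSpecIso (CommRingCat.of ℂ)).inv ≫ f.appTop).hom

/-- The differential of `x` does not vanish at the closed point of the local `ℂ`-algebra `R`,
i.e. it is nonzero in `Ω[R⁄ℂ] ⊗ κ`. -/
def DiffNonzero {R : Type} [CommRing R] [IsLocalRing R] (φ : ℂ →+* R) (x : R) : Prop :=
  letI : Algebra ℂ R := φ.toAlgebra
  KaehlerDifferential.D ℂ R x ∉ IsLocalRing.maximalIdeal R • (⊤ : Submodule R (Ω[R⁄ℂ]))

/-- The differentials of `x` and `y` are linearly independent at the closed point of the local
`ℂ`-algebra `R`, i.e. in `Ω[R⁄ℂ] ⊗ κ`. -/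
def DiffIndep {R : Type} [CommRing R] [IsLocalRing R] (φ : ℂ →+* R) (x y : R) : Prop :=
  letI : Algebra ℂ R := φ.toAlgebra
  ∀ u v : R, u • KaehlerDifferential.D ℂ R x + v • KaehlerDifferential.D ℂ R y ∈
      IsLocalRing.maximalIdeal R • (⊤ : Submodule R (Ω[R⁄ℂ])) →
    u ∈ IsLocalRing.maximalIdeal R ∧ v ∈ IsLocalRing.maximalIdeal R

/-- The open set of points at which `Y` is smooth over `ℂ`. -/
def smoothPart {Y : Scheme.{0}} (f : Y ⟶ SpecC) : Y.Opens :=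
  sSup {U | Smooth (U.ι ≫ f)}

/-! ## Ideals given by their stalks, and blow-ups -/

/-- An ideal of `𝒪_Y`, given by its stalks. -/
abbrev StalkIdeal (Y : Scheme.{0}) := ∀ y : Y, Ideal (Y.presheaf.stalk y)

/-- The closed set cut out by an ideal. -/
def zeroSet {Y : Scheme.{0}} (J : StalkIdeal Y) : Set Y := {y | J y ≠ ⊤}

/-- The inverse image ideal `J · 𝒪_T` of `J` under `g : T ⟶ Y`. -/
def pullIdeal {T Y : Scheme.{0}} (g : T ⟶ Y) (J : StalkIdeal Y) : StalkIdeal T :=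
  fun t => (J (g t)).map (g.stalkMap t).hom

/-- Every stalk is generated by one non-zero-divisor; for an ideal of finite type this says that
it is the ideal of an effective Cartier divisor. -/
def IsCartier {T : Scheme.{0}} (J : StalkIdeal T) : Prop :=
  ∀ t, ∃ d ∈ nonZeroDivisors (T.presheaf.stalk t), J t = Ideal.span {d}

/-- `π : Y' ⟶ Y` is the blow-up of `Y` along the ideal `J` (of finite type): `J · 𝒪_{Y'}` is the
ideal of an effective Cartier divisor, and `π` is universal for this property. -/
structure IsBlowup {Y' Y : Scheme.{0}} (J : StalkIdeal Y) (π : Y' ⟶ Y) : Prop where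
  cartier : IsCartier (pullIdeal π J)
  universal : ∀ (T : Scheme.{0}) (g : T ⟶ Y), IsCartier (pullIdeal g J) →
    ∃! l : T ⟶ Y', l ≫ π = g

/-! ## Crepant resolutions -/

/-- For a subring `S` of the field `K` over `k`: the `S`-module of those rational `n`-forms that
are `S`-combinations of the forms `da₁ ∧ ⋯ ∧ daₙ` with all `aᵢ` in `S`, i.e. the image of the
`n`-forms of `S`. -/
def formLattice (k K : Type) [Field k] [Field K] [Algebra k K] (n : ℕ) (S : Subring K) :
    Submodule S (⋀[K]^n (Ω[K⁄k])) :=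
  Submodule.span S (Set.range fun a : Fin n → S =>
    exteriorPower.ιMulti K n fun i => KaehlerDifferential.D k K (a i : K))

/-- The rational `n`-form `η` generates the module of regular `n`-forms of the subring `S`. -/
def GeneratesForms (k K : Type) [Field k] [Field K] [Algebra k K] (n : ℕ) (S : Subring K)
    (η : ⋀[K]^n (Ω[K⁄k])) : Prop :=
  Submodule.span S {η} = formLattice k K n S

/-- A birational morphism `π : Y ⟶ X` from a smooth variety of dimension `n` to a normal variety is
crepant: locally on `X` there is a rational `n`-form which generates the canonical sheaf of `X` at
all smooth points of `X` (so `K_X` is Cartier with this generator), and the pull-back of which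
generates the sheaf of `n`-forms of `Y`; that is, `K_Y = π^* K_X`. -/
def IsCrepant {Y X : Scheme.{0}} [IsIntegral Y] (f : X ⟶ SpecC) (π : Y ⟶ X) (n : ℕ) : Prop :=
  letI : Algebra ℂ Y.functionField := (scalars (π ≫ f) (genericPoint Y)).toAlgebra
  ∀ x : X, ∃ U : X.Opens, x ∈ U ∧ ∃ η : ⋀[Y.functionField]^n (Ω[Y.functionField⁄ℂ]),
    ∀ y : Y, π y ∈ U →
      (π y ∈ smoothPart f → GeneratesForms ℂ Y.functionField n
        ((algebraMap (Y.presheaf.stalk y) Y.functionField).comp (π.stalkMap y).hom).range η) ∧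
      GeneratesForms ℂ Y.functionField n
        (algebraMap (Y.presheaf.stalk y) Y.functionField).range η

/-- `π : Y ⟶ X` is a crepant resolution of singularities of the `n`-dimensional variety `X`: a
proper morphism from a smooth variety, an isomorphism over the smooth points of `X`, with
`K_Y = π^* K_X`. -/
structure IsCrepantResolution {Y X : Scheme.{0}} (f : X ⟶ SpecC) (π : Y ⟶ X) (n : ℕ) : Prop where
  integral : IsIntegral Y
  smooth : SmoothOfRelativeDimension n (π ≫ f)
  proper : IsProper π
  isIso : IsIso (π ∣_ smoothPart f)
  crepant : IsCrepant f π n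

/-! ## Line bundles and sections, by trivialisations -/

/-- Two line bundles `ℒ` and `𝒩` on `B`, given by their transition functions with respect to an
open cover on which both are trivial. -/
structure Bundles (B : Scheme.{0}) where
  I : Type
  U : I → B.Opens
  cover : ∀ b : B, ∃ i, b ∈ U i
  L : ∀ i j, (Γ(B, U i ⊓ U j))ˣ
  N : ∀ i j, (Γ(B, U i ⊓ U j))ˣ
  cocycle_L : ∀ i j k,
    res (le_inf (inf_le_left.trans inf_le_left) (inf_le_left.trans inf_le_right) :
        U i ⊓ U j ⊓ U k ≤ U i ⊓ U j) (L i j : Γ(B, U i ⊓ U j)) *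
      res (le_inf (inf_le_left.trans inf_le_right) inf_le_right :
        U i ⊓ U j ⊓ U k ≤ U j ⊓ U k) (L j k : Γ(B, U j ⊓ U k)) =
    res (le_inf (inf_le_left.trans inf_le_left) inf_le_right :
        U i ⊓ U j ⊓ U k ≤ U i ⊓ U k) (L i k : Γ(B, U i ⊓ U k))
  cocycle_N : ∀ i j k,
    res (le_inf (inf_le_left.trans inf_le_left) (inf_le_left.trans inf_le_right) :
        U i ⊓ U j ⊓ U k ≤ U i ⊓ U j) (N i j : Γ(B, U i ⊓ U j)) *
      res (le_inf (inf_le_left.trans inf_le_right) inf_le_right :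
        U i ⊓ U j ⊓ U k ≤ U j ⊓ U k) (N j k : Γ(B, U j ⊓ U k)) =
    res (le_inf (inf_le_left.trans inf_le_left) inf_le_right :
        U i ⊓ U j ⊓ U k ≤ U i ⊓ U k) (N i k : Γ(B, U i ⊓ U k))

/-- A global section of `ℒ^p ⊗ 𝒩^q`. -/
structure Sec {B : Scheme.{0}} (P : Bundles B) (p q : ℤ) where
  val : ∀ i, Γ(B, P.U i)
  compat : ∀ i j, res (inf_le_left : P.U i ⊓ P.U j ≤ P.U i) (val i) =
    (P.L i j ^ p * P.N i j ^ q : (Γ(B, P.U i ⊓ P.U j))ˣ) *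
      res (inf_le_right : P.U i ⊓ P.U j ≤ P.U j) (val j)

/-! ## The Tate form of `SU(N)` and its limit -/

/-- The coefficients of a Weierstrass model in the Tate form of `SU(N)` over the divisor `σ = 0`,
where `𝒩 = 𝒪(𝒟)` and `𝒟` is the divisor of `σ`:
`a₂ = σ a₂₁`, `a₃ = σ^⌊N/2⌋ a₃'`, `a₄ = σ^⌈N/2⌉ a₄'`, `a₆ = σ^N a₆'`, with `aₚ` a section of `ℒ^p`,
together with the section `a₂₂` of `ℒ^2(-2𝒟)` which enters the limit. -/
structure TateData (B : Scheme.{0}) (N : ℕ) where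
  P : Bundles B
  σ : Sec P 0 1
  a₁ : Sec P 1 0
  a₂₁ : Sec P 2 (-1)
  a₂₂ : Sec P 2 (-2)
  a₃' : Sec P 3 (-((N / 2 : ℕ) : ℤ))
  a₄' : Sec P 4 (-(((N + 1) / 2 : ℕ) : ℤ))
  a₆' : Sec P 6 (-(N : ℤ))

namespace TateData

variable {B : Scheme.{0}} {N : ℕ} (D : TateData B N)

/-- The family of Weierstrass equations over the local trivialisation `i`, with deformation
parameter `ε` the polynomial variable, obtained by the replacements `a₂₁ → ε a₂₁ + σ a₂₂`,
`a₃' → ε a₃'`, `a₄' → ε a₄'`, `a₆' → ε² a₆'`. -/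
def family (i : D.P.I) : WeierstrassCurve (Γ(B, D.P.U i)[X]) where
  a₁ := Polynomial.C (D.a₁.val i)
  a₂ := Polynomial.C (D.σ.val i) * (Polynomial.X * Polynomial.C (D.a₂₁.val i) +
    Polynomial.C (D.σ.val i) * Polynomial.C (D.a₂₂.val i))
  a₃ := Polynomial.C (D.σ.val i ^ (N / 2)) * (Polynomial.X * Polynomial.C (D.a₃'.val i))
  a₄ := Polynomial.C (D.σ.val i ^ ((N + 1) / 2)) * (Polynomial.X * Polynomial.C (D.a₄'.val i))
  a₆ := Polynomial.C (D.σ.val i ^ N) * (Polynomial.X ^ 2 * Polynomial.C (D.a₆'.val i))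

/-- The value at `ε = 0` of `b₂ = a₁² + 4 a₂`: the branch section of the double cover at weak
coupling. -/
def limitBranch (i : D.P.I) : Γ(B, D.P.U i) := (D.family i).b₂.eval 0

/-- The branch section `a₁² + 4 σ² a₂₂` of the suspended pinch point. -/
def sppBranch (i : D.P.I) : Γ(B, D.P.U i) :=
  D.a₁.val i ^ 2 + 4 * D.σ.val i ^ 2 * D.a₂₂.val i

/-- The equation of the residual brane in the leading term of the discriminant. -/
def residualBrane (i : D.P.I) : Γ(B, D.P.U i) :=
  if Even N then
    D.a₄'.val i ^ 2 + D.a₁.val i * (D.a₃'.val i * D.a₄'.val i - D.a₁.val i * D.a₆'.val i) -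
      D.σ.val i ^ 2 * D.a₂₂.val i * (D.a₃'.val i ^ 2 + 4 * D.a₆'.val i)
  else
    D.a₁.val i * (D.a₃'.val i * D.a₄'.val i - D.a₁.val i * D.a₆'.val i) +
      D.σ.val i * (D.a₄'.val i ^ 2 -
        D.a₂₂.val i * (D.a₃'.val i ^ 2 + 4 * D.σ.val i * D.a₆'.val i))

/-- The ideal `(σ, a₁)` of the base. -/
def baseCenter : StalkIdeal B := fun b =>
  Ideal.span {t | ∃ (i : D.P.I) (hb : b ∈ D.P.U i),
    t = germAt (D.P.U i) b hb (D.σ.val i) ∨ t = germAt (D.P.U i) b hb (D.a₁.val i)}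

/-- Genericity of the sections `σ`, `a₁`, `a₂₂`. -/
structure Generic (f : B ⟶ SpecC) : Prop where
  /-- `σ = 0` and `a₁ = 0` are smooth and transverse along their intersection. -/
  transverse : ∀ (i : D.P.I) (b : B) (hb : b ∈ D.P.U i), b ∈ zeroSet D.baseCenter →
    DiffIndep (scalars f b) (germAt _ b hb (D.σ.val i)) (germAt _ b hb (D.a₁.val i))
  /-- `a₁ = 0` and `a₂₂ = 0` are smooth and transverse at the points with
  `σ = a₁ = a₂₂ = 0`. -/
  transverse_pinch : ∀ (i : D.P.I) (b : B) (hb : b ∈ D.P.U i), b ∈ zeroSet D.baseCenter →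
    germAt _ b hb (D.a₂₂.val i) ∈ IsLocalRing.maximalIdeal (B.presheaf.stalk b) →
    DiffIndep (scalars f b) (germAt _ b hb (D.a₁.val i)) (germAt _ b hb (D.a₂₂.val i))
  /-- The branch divisor is smooth away from `σ = a₁ = 0`. -/
  branch_smooth : ∀ (i : D.P.I) (b : B) (hb : b ∈ D.P.U i), b ∉ zeroSet D.baseCenter →
    germAt _ b hb (D.sppBranch i) ∈ IsLocalRing.maximalIdeal (B.presheaf.stalk b) →
    DiffNonzero (scalars f b) (germAt _ b hb (D.sppBranch i))

end TateData

/-! ## Double covers -/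

/-- Over the open set `V`, the scheme `X` is the double cover `ξ² = h`: functions upstairs are
uniquely of the form `p + q ξ` with `p`, `q` functions on `V`. -/
def IsDoubleCoverOn {X B : Scheme.{0}} (ρ : X ⟶ B) (V : B.Opens) (h : Γ(B, V))
    (ξ : Γ(X, ρ ⁻¹ᵁ V)) : Prop :=
  ξ ^ 2 = (ρ.app V).hom h ∧
    ∀ z : Γ(X, ρ ⁻¹ᵁ V), ∃! pq : Γ(B, V) × Γ(B, V),
      z = (ρ.app V).hom pq.1 + (ρ.app V).hom pq.2 * ξ

/-- `ρ : X ⟶ B` is the double cover `ξ² = h` in the total space of `ℒ`, where `h` is the section of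
`ℒ²` with the local expressions `h i`. -/
structure DoubleCover {X B : Scheme.{0}} (P : Bundles B) (ρ : X ⟶ B)
    (h : ∀ i, Γ(B, P.U i)) where
  affine : IsAffineHom ρ
  ξ : ∀ i, Γ(X, ρ ⁻¹ᵁ P.U i)
  compat : ∀ i j,
    res (ρ.preimage_mono inf_le_left : ρ ⁻¹ᵁ (P.U i ⊓ P.U j) ≤ ρ ⁻¹ᵁ P.U i) (ξ i) =
      (ρ.app (P.U i ⊓ P.U j)).hom (P.L i j : Γ(B, P.U i ⊓ P.U j)) *
      res (ρ.preimage_mono inf_le_right : ρ ⁻¹ᵁ (P.U i ⊓ P.U j) ≤ ρ ⁻¹ᵁ P.U j) (ξ j)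
  isDoubleCoverOn : ∀ (i : P.I) (V : B.Opens) (hV : V ≤ P.U i), IsAffineOpen V →
    IsDoubleCoverOn ρ V (res hV (h i)) (res (ρ.preimage_mono hV) (ξ i))

theorem preimage_le_of_over {X B : Scheme.{0}} {ρ : X ⟶ B} {ι : X ⟶ X} (e : ι ≫ ρ = ρ)
    (U : B.Opens) : ρ ⁻¹ᵁ U ≤ ι ⁻¹ᵁ ρ ⁻¹ᵁ U := by
  rw [← Scheme.Hom.comp_preimage, e]

theorem preimage_le_of_square {Y X C B : Scheme.{0}} {π : Y ⟶ X} {ρ : X ⟶ B} {ρ' : Y ⟶ C}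
    {β : C ⟶ B} (e : ρ' ≫ β = π ≫ ρ) {U : B.Opens} {V : C.Opens} (h : V ≤ β ⁻¹ᵁ U) :
    ρ' ⁻¹ᵁ V ≤ π ⁻¹ᵁ ρ ⁻¹ᵁ U := by
  rw [← Scheme.Hom.comp_preimage, ← e, Scheme.Hom.comp_preimage]
  exact ρ'.preimage_mono h

namespace DoubleCover

variable {X B : Scheme.{0}} {P : Bundles B} {ρ : X ⟶ B} {h : ∀ i, Γ(B, P.U i)}

/-- `ι` is the covering involution `ξ ↦ -ξ` (the orientifold involution). -/
def IsInvolution (C : DoubleCover P ρ h) (ι : X ⟶ X) : Prop :=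
  ∃ e : ι ≫ ρ = ρ, ∀ i,
    (ι.appLE (ρ ⁻¹ᵁ P.U i) (ρ ⁻¹ᵁ P.U i) (preimage_le_of_over e _)).hom (C.ξ i) = -C.ξ i

end DoubleCover

namespace TateData

variable {B : Scheme.{0}} {N : ℕ} (D : TateData B N) {X : Scheme.{0}} {ρ : X ⟶ B}

/-- The ideal `(ξ, a₁, σ)` of the double cover. -/
def coverCenter (C : DoubleCover D.P ρ D.limitBranch) : StalkIdeal X := fun x =>
  Ideal.span {t | ∃ (i : D.P.I) (hx : x ∈ ρ ⁻¹ᵁ D.P.U i),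
    t = germAt _ x hx (C.ξ i) ∨ t = germAt _ x hx ((ρ.app (D.P.U i)).hom (D.a₁.val i)) ∨
      t = germAt _ x hx ((ρ.app (D.P.U i)).hom (D.σ.val i))}

/-- The ideal `(σ)` of the double cover: the inverse image of the divisor `𝒟`. -/
def coverSigma (_C : DoubleCover D.P ρ D.limitBranch) : StalkIdeal X := fun x =>
  Ideal.span {t | ∃ (i : D.P.I) (hx : x ∈ ρ ⁻¹ᵁ D.P.U i),
    t = germAt _ x hx ((ρ.app (D.P.U i)).hom (D.σ.val i))}

/-- The ideal `(σ, ξ - s a₁)` of the double cover, for a sign `s`. For `s = 1` this is the stack of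
branes over `𝒟`, for `s = -1` its orientifold image. -/
def stack (C : DoubleCover D.P ρ D.limitBranch) (s : ℤ) : StalkIdeal X := fun x =>
  Ideal.span {t | ∃ (i : D.P.I) (hx : x ∈ ρ ⁻¹ᵁ D.P.U i),
    t = germAt _ x hx ((ρ.app (D.P.U i)).hom (D.σ.val i)) ∨
      t = germAt _ x hx (C.ξ i - (s : Γ(X, ρ ⁻¹ᵁ D.P.U i)) *
        (ρ.app (D.P.U i)).hom (D.a₁.val i))}

/-- The proper transform of the stack (as a closed set) under `π : X' ⟶ X`. -/
def properTransform (C : DoubleCover D.P ρ D.limitBranch) {X' : Scheme.{0}} (π : X' ⟶ X) (s : ℤ) :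
    Set X' :=
  closure (π ⁻¹' (zeroSet (D.stack C s) \ zeroSet (D.coverCenter C)))

/-- The ideal quotient `((σ, ξ - s a₁) · 𝒪_{X'} : (ξ, a₁, σ) · 𝒪_{X'})`: the total transform of the
stack, with the exceptional divisor removed once. -/
def properTransformIdeal (C : DoubleCover D.P ρ D.limitBranch) {X' : Scheme.{0}} (π : X' ⟶ X)
    (s : ℤ) : StalkIdeal X' := fun y =>
  (pullIdeal π (D.stack C s) y).colon (pullIdeal π (D.coverCenter C) y : Set (X'.presheaf.stalk y))

end TateData

/-! ## Explicit models by affine charts -/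

/-- Over the affine open set `W` of `S`, the morphism `p : Y ⟶ S` is obtained by gluing the affine
schemes `Spec (R k)`, where `t k l` is the function on the `k`-th one whose nonvanishing describes
its overlap with the `l`-th one. -/
def HasCharts {Y S : Scheme.{0}} (p : Y ⟶ S) {W : S.Opens} (hW : IsAffineOpen W) {K : Type}
    (R : K → Type) [∀ k, CommRing (R k)] [∀ k, Algebra Γ(S, W) (R k)] (t : ∀ k, K → R k) : Prop :=
  ∃ j : ∀ k, Spec (CommRingCat.of (R k)) ⟶ Y,
    (∀ k, IsOpenImmersion (j k)) ∧
    (∀ k, j k ≫ p =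
      Spec.map (CommRingCat.ofHom (algebraMap Γ(S, W) (R k))) ≫ hW.fromSpec) ∧
    (⋃ k, Set.range (j k)) = p ⁻¹' (W : Set S) ∧
    ∀ k l, (j k) '' {q : PrimeSpectrum (R k) | t k l ∉ q.asIdeal} =
      Set.range (j k) ∩ Set.range (j l)

/-- Homogeneous coordinates `s, a, ξ, w` (here `X 0, X 1, X 2, X 3`) of weights `1, 1, 1, -1`, with
`s, a, ξ` not vanishing simultaneously, subject to `ξ² = a² + 4 s² a₂₂`, `w s = σ`, `w a = a₁`. The
map to the double cover sends its coordinate `ξ₀` to `w ξ`. The chart `k` is the slice on which the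
`k`-th of the coordinates `s, a, ξ` is `1`. -/
abbrev ResSppChart {A : Type} [CommRing A] (σ a₁ a₂₂ ξ₀ : A) (k : Fin 3) : Type :=
  MvPolynomial (Fin 4) A ⧸ (Ideal.span
    {MvPolynomial.X 2 ^ 2 - (MvPolynomial.X 1 ^ 2 +
        4 * MvPolynomial.X 0 ^ 2 * MvPolynomial.C a₂₂),
      MvPolynomial.X 3 * MvPolynomial.X 0 - MvPolynomial.C σ,
      MvPolynomial.X 3 * MvPolynomial.X 1 - MvPolynomial.C a₁,
      MvPolynomial.X 3 * MvPolynomial.X 2 - MvPolynomial.C ξ₀,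
      MvPolynomial.X k.castSucc - 1} : Ideal (MvPolynomial (Fin 4) A))

/-- The `l`-th of the coordinates `s, a, ξ` on the `k`-th chart. -/
def resSppCoord {A : Type} [CommRing A] (σ a₁ a₂₂ ξ₀ : A) (k l : Fin 3) :
    ResSppChart σ a₁ a₂₂ ξ₀ k :=
  Ideal.Quotient.mk _ (MvPolynomial.X l.castSucc)

/-- Homogeneous coordinates `s, a, w` (here `X 0, X 1, X 2`) of weights `1, 1, -1`, with `s, a` not
vanishing simultaneously, subject to `w s = σ`, `w a = a₁`. The chart `k` is the slice on which the
`k`-th of the coordinates `s, a` is `1`. -/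
abbrev ResBaseChart {A : Type} [CommRing A] (σ a₁ : A) (k : Fin 2) : Type :=
  MvPolynomial (Fin 3) A ⧸ (Ideal.span
    {MvPolynomial.X 2 * MvPolynomial.X 0 - MvPolynomial.C σ,
      MvPolynomial.X 2 * MvPolynomial.X 1 - MvPolynomial.C a₁,
      MvPolynomial.X k.castSucc - 1} : Ideal (MvPolynomial (Fin 3) A))

/-- The `l`-th of the coordinates `s, a` on the `k`-th chart. -/
def resBaseCoord {A : Type} [CommRing A] (σ a₁ : A) (k l : Fin 2) : ResBaseChart σ a₁ k :=
  Ideal.Quotient.mk _ (MvPolynomial.X l.castSucc)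

/-- The homogeneous coordinate of the first line `[α₊ : β₊]` (numbered `X 0, X 1`) that is
normalised to `1`. -/
def plusIdx (k : Fin 2 × Fin 2) : Fin 4 := ![0, 1] k.1

/-- The homogeneous coordinate of the second line `[α₋ : β₋]` (numbered `X 2, X 3`) that is
normalised to `1`. -/
def minusIdx (k : Fin 2 × Fin 2) : Fin 4 := ![2, 3] k.2

/-- The standard affine charts of the closed subscheme
`β₊ u₊ = x α₊`, `β₋ u₋ = x α₋`, `α₊ α₋ = z β₊ β₋`
of `Spec A × ℙ¹ × ℙ¹`, the small resolution of the suspended pinch point `u₊ u₋ = x² z`. -/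
abbrev SmallResChart {A : Type} [CommRing A] (uplus uminus x z : A) (k : Fin 2 × Fin 2) : Type :=
  MvPolynomial (Fin 4) A ⧸ (Ideal.span
    {MvPolynomial.X 1 * MvPolynomial.C uplus - MvPolynomial.C x * MvPolynomial.X 0,
      MvPolynomial.X 3 * MvPolynomial.C uminus - MvPolynomial.C x * MvPolynomial.X 2,
      MvPolynomial.X 0 * MvPolynomial.X 2 -
        MvPolynomial.C z * MvPolynomial.X 1 * MvPolynomial.X 3,
      MvPolynomial.X (plusIdx k) - 1,
      MvPolynomial.X (minusIdx k) - 1} : Ideal (MvPolynomial (Fin 4) A))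

/-- The function on chart `k` whose nonvanishing describes the overlap with chart `l`. -/
def smallResCoord {A : Type} [CommRing A] (uplus uminus x z : A) (k l : Fin 2 × Fin 2) :
    SmallResChart uplus uminus x z k :=
  Ideal.Quotient.mk _ (MvPolynomial.X (plusIdx l) * MvPolynomial.X (minusIdx l))

end

end SppLimit

namespace SppLimit

noncomputable section

section Algebra

theorem span_singleton_unit_of_mem_nonZeroDivisors {S : Type*} [CommRing S] {d e : S}
    (hd : d ∈ nonZeroDivisors S) (h : Ideal.span {d} = Ideal.span {d * e}) : IsUnit e := by
  have : d ∈ Ideal.span {d * e} := h ▸ Ideal.mem_span_singleton_self d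
  obtain ⟨c, hc⟩ := Ideal.mem_span_singleton'.mp this
  refine IsUnit.of_mul_eq_one c ?_
  have : d * (e * c - 1) = 0 := by linear_combination hc
  have := (mul_left_mem_nonZeroDivisors_eq_zero_iff hd).mp this
  linear_combination this

theorem mem_nonZeroDivisors_of_span_eq {S : Type*} [CommRing S] {d e : S}
    (hd : d ∈ nonZeroDivisors S) (h : Ideal.span {d} = Ideal.span {e}) :
    e ∈ nonZeroDivisors S := by
  have : d ∈ Ideal.span {e} := h ▸ Ideal.mem_span_singleton_self d
  obtain ⟨c, rfl⟩ := Ideal.mem_span_singleton'.mp this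
  exact (mul_mem_nonZeroDivisors.mp hd).2

/-- In a local ring, an invertible ideal generated by finitely many elements is generated by
one of them. -/
theorem exists_span_eq_of_isLocalRing {S : Type*} [CommRing S] [IsLocalRing S] {K : Type*}
    [Finite K] (f : K → S) {d : S} (hd : d ∈ nonZeroDivisors S)
    (h : Ideal.span (Set.range f) = Ideal.span {d}) : ∃ k, Ideal.span {f k} = Ideal.span {d} := by
  have := Fintype.ofFinite K
  have h1 : ∀ k, ∃ e, f k = d * e := fun k => by
    have : f k ∈ Ideal.span {d} := h ▸ Ideal.subset_span ⟨k, rfl⟩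
    obtain ⟨e, he⟩ := Ideal.mem_span_singleton'.mp this
    exact ⟨e, by rw [← he, mul_comm]⟩
  choose e he using h1
  have h2 : d ∈ Ideal.span (Set.range f) := h ▸ Ideal.mem_span_singleton_self d
  obtain ⟨c, hc⟩ := (Ideal.mem_span_range_iff_exists_fun).mp h2
  have h3 : ∑ k, c k * e k = 1 := by
    have : d * (∑ k, c k * e k - 1) = 0 := by
      rw [mul_sub, Finset.mul_sum, mul_one, sub_eq_zero]
      exact (Finset.sum_congr rfl fun k _ => by rw [he]; ring).trans hc
    have := (mul_left_mem_nonZeroDivisors_eq_zero_iff hd).mp this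
    linear_combination this
  have : ∃ k, IsUnit (e k) := by
    by_contra! hk
    have : (1 : S) ∈ IsLocalRing.maximalIdeal S := h3 ▸ Ideal.sum_mem _ fun k _ =>
      Ideal.mul_mem_left _ _ ((IsLocalRing.mem_maximalIdeal _).mpr (hk k))
    exact (Ideal.ne_top_iff_one _).mp (IsLocalRing.maximalIdeal.isMaximal S).ne_top this
  obtain ⟨k, hk⟩ := this
  exact ⟨k, by rw [he, Ideal.span_singleton_mul_right_unit hk]⟩

end Algebra

section Stalks

variable {S T Y : Scheme.{0}}

theorem germAt_res {V W : Y.Opens} (h : V ≤ W) (y : Y) (hy : y ∈ V) (s : Γ(Y, W)) :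
    germAt V y hy (res h s) = germAt W y (h hy) s :=
  Y.presheaf.germ_res_apply (homOfLE h) y hy s

theorem stalkMap_germAt (g : T ⟶ Y) (W : Y.Opens) (t : T) (h : g t ∈ W) (s : Γ(Y, W)) :
    (g.stalkMap t).hom (germAt W (g t) h s) = germAt (g ⁻¹ᵁ W) t h ((g.app W).hom s) :=
  g.germ_stalkMap_apply W t h s

theorem germAt_surjective (y : Y) (s : Y.presheaf.stalk y) :
    ∃ (W : Y.Opens) (h : y ∈ W) (t : Γ(Y, W)), germAt W y h t = s := by
  obtain ⟨W, h, t, ht⟩ := Y.presheaf.exists_germ_eq s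
  exact ⟨W, h, t, ht⟩

theorem germAt_eq_iff (y : Y) {V W : Y.Opens} (hV : y ∈ V) (hW : y ∈ W) (s : Γ(Y, V))
    (t : Γ(Y, W)) (h : germAt V y hV s = germAt W y hW t) :
    ∃ (U : Y.Opens) (_ : y ∈ U) (hUV : U ≤ V) (hUW : U ≤ W), res hUV s = res hUW t := by
  obtain ⟨U, hU, i, j, h⟩ := TopCat.Presheaf.germ_eq Y.presheaf y hV hW s t h
  exact ⟨U, hU, i.le, j.le, h⟩

theorem pullIdeal_comp (k : S ⟶ T) (g : T ⟶ Y) (J : StalkIdeal Y) :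
    pullIdeal (k ≫ g) J = pullIdeal k (pullIdeal g J) := by
  funext s
  have h : ((k ≫ g).stalkMap s).hom = (k.stalkMap s).hom.comp (g.stalkMap (k s)).hom :=
    congrArg CommRingCat.Hom.hom (Scheme.Hom.stalkMap_comp k g s)
  exact (congrArg (fun φ => Ideal.map φ (J (g (k s)))) h).trans (Ideal.map_map _ _).symm

theorem pullIdeal_top (g : T ⟶ Y) (J : StalkIdeal Y) (t : T) (h : J (g t) = ⊤) :
    pullIdeal g J t = ⊤ := by
  simp [pullIdeal, h, Ideal.map_top]

theorem zeroSet_pullIdeal (g : T ⟶ Y) (J : StalkIdeal Y) :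
    zeroSet (pullIdeal g J) = g ⁻¹' zeroSet J := by
  ext t
  simp only [zeroSet, Set.mem_ofPred_eq, Set.mem_preimage, ne_eq, not_iff_not]
  refine ⟨fun h => ?_, pullIdeal_top g J t⟩
  by_contra hne
  have := IsLocalRing.le_maximalIdeal hne
  have h2 : pullIdeal g J t ≤ IsLocalRing.maximalIdeal _ :=
    Ideal.map_le_iff_le_comap.mpr fun x hx => by
      rw [Ideal.mem_comap, IsLocalRing.mem_maximalIdeal, mem_nonunits_iff]
      exact fun hu => (IsLocalRing.mem_maximalIdeal _).mp (this hx)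
        (isUnit_of_map_unit (g.stalkMap t).hom x hu)
  rw [h] at h2
  exact (IsLocalRing.maximalIdeal.isMaximal _).ne_top (top_le_iff.mp h2)

/-- The ideal `J` is, over the open set `W`, generated by the family `f` of functions. -/
def GeneratedOn (J : StalkIdeal Y) (W : Y.Opens) {K : Type} (f : K → Γ(Y, W)) : Prop :=
  ∀ (y : Y) (hy : y ∈ W), J y = Ideal.span (Set.range fun k => germAt W y hy (f k))

/-- The ideal `J` is of finite type. -/
def LocallyFG (J : StalkIdeal Y) : Prop :=
  ∀ y : Y, ∃ (W : Y.Opens) (_ : y ∈ W) (m : ℕ) (f : Fin m → Γ(Y, W)), GeneratedOn J W f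

theorem GeneratedOn.restrict {J : StalkIdeal Y} {W : Y.Opens} {K : Type} {f : K → Γ(Y, W)}
    (h : GeneratedOn J W f) {V : Y.Opens} (hV : V ≤ W) :
    GeneratedOn J V fun k => res hV (f k) := by
  intro y hy
  rw [h y (hV hy)]
  simp only [germAt_res]

theorem GeneratedOn.pullIdeal {J : StalkIdeal Y} {W : Y.Opens} {K : Type} {f : K → Γ(Y, W)}
    (h : GeneratedOn J W f) (g : T ⟶ Y) :
    GeneratedOn (pullIdeal g J) (g ⁻¹ᵁ W) fun k => (g.app W).hom (f k) := by
  intro y hy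
  rw [SppLimit.pullIdeal, h (g y) hy, Ideal.map_span, ← Set.range_comp]
  congr 2
  funext k
  exact stalkMap_germAt g W y hy (f k)

theorem LocallyFG.pullIdeal {J : StalkIdeal Y} (h : LocallyFG J) (g : T ⟶ Y) :
    LocallyFG (pullIdeal g J) := fun t => by
  obtain ⟨W, hW, m, f, hf⟩ := h (g t)
  exact ⟨g ⁻¹ᵁ W, hW, m, _, hf.pullIdeal g⟩

/-- At `y`, the ideal `J` is generated by the non-zero-divisor `u`. -/
def GenAt (J : StalkIdeal Y) (W : Y.Opens) (u : Γ(Y, W)) (y : Y) : Prop :=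
  ∃ h : y ∈ W, J y = Ideal.span {germAt W y h u} ∧ germAt W y h u ∈ nonZeroDivisors _

theorem exists_res_eq_sum {W : Y.Opens} (y : Y) (hy : y ∈ W) {m : ℕ} (f : Fin m → Γ(Y, W))
    (s : Γ(Y, W)) (h : germAt W y hy s ∈ Ideal.span (Set.range fun k => germAt W y hy (f k))) :
    ∃ (V : Y.Opens) (hV : V ≤ W) (_ : y ∈ V) (c : Fin m → Γ(Y, V)),
      res hV s = ∑ k, c k * res hV (f k) := by
  obtain ⟨c, hc⟩ := (Ideal.mem_span_range_iff_exists_fun).mp h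
  choose V hV t ht using fun k => germAt_surjective y (c k)
  let V' : Y.Opens := W ⊓ Finset.univ.inf V
  have hV' : y ∈ V' := ⟨hy, by
    have : y ∈ (Finset.univ.inf V : Y.Opens) ↔ ∀ k, y ∈ V k := by
      rw [← SetLike.mem_coe, TopologicalSpace.Opens.coe_finset_inf]
      simp
    exact this.mpr hV⟩
  have hk : ∀ k, V' ≤ V k := fun k => inf_le_right.trans (Finset.inf_le (Finset.mem_univ k))
  have h1 : germAt V' y hV' (res inf_le_left s) =
      germAt V' y hV' (∑ k, res (hk k) (t k) * res inf_le_left (f k)) := by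
    rw [map_sum, germAt_res, ← hc]
    simp only [map_mul, germAt_res, ht]
  obtain ⟨U, hU, h1, h2, h3⟩ := germAt_eq_iff y hV' hV' _ _ h1
  refine ⟨U, h1.trans inf_le_left, hU, fun k => res (h1.trans (hk k)) (t k), ?_⟩
  have hres : ∀ {A B C : Y.Opens} (a : A ≤ B) (b : B ≤ C) (s : Γ(Y, C)),
      res a (res b s) = res (a.trans b) s := fun a b s => by
    simp only [res, ← CommRingCat.comp_apply, ← Functor.map_comp]; rfl
  rw [← hres h1 inf_le_left, h3, map_sum]
  simp only [map_mul, hres]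

theorem isOpen_genAt {J : StalkIdeal Y} (hJ : LocallyFG J) (hc : IsCartier J) (W : Y.Opens)
    (u : Γ(Y, W)) : IsOpen {y | GenAt J W u y} := by
  rw [isOpen_iff_forall_mem_open]
  rintro y ⟨hy, h1, h2⟩
  obtain ⟨W', hy', m, f, hf⟩ := hJ y
  let V : Y.Opens := W ⊓ W'
  have hV : y ∈ V := ⟨hy, hy'⟩
  have hfV := hf.restrict (inf_le_right : V ≤ W')
  have hu : germAt V y hV (res inf_le_left u) ∈
      Ideal.span (Set.range fun k => germAt V y hV (res inf_le_right (f k))) := by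
    rw [← hfV y hV, h1, germAt_res]
    exact Ideal.mem_span_singleton_self _
  obtain ⟨V1, hV1, hy1, c, hcu⟩ := exists_res_eq_sum y hV _ _ hu
  have h3 : ∀ k, ∃ (V2 : Y.Opens) (hV2 : V2 ≤ V) (_ : y ∈ V2) (e : Γ(Y, V2)),
      res hV2 (res inf_le_right (f k)) = e * res hV2 (res inf_le_left u) := fun k => by
    have : germAt V y hV (res inf_le_right (f k)) ∈
        Ideal.span (Set.range fun _ : Fin 1 => germAt V y hV (res inf_le_left u)) := by
      rw [Set.range_const, germAt_res inf_le_left, ← h1, hfV y hV]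
      exact Ideal.subset_span ⟨k, rfl⟩
    obtain ⟨V2, hV2, hy2, e, he⟩ := exists_res_eq_sum y hV _ _ this
    exact ⟨V2, hV2, hy2, e 0, by simpa using he⟩
  choose V2 hV2 hy2 e he using h3
  have hy2' : y ∈ (Finset.univ.inf V2 : Y.Opens) := by
    rw [← SetLike.mem_coe, TopologicalSpace.Opens.coe_finset_inf]
    simpa using hy2
  refine ⟨(V1 ⊓ Finset.univ.inf V2 : Y.Opens), ?_, (V1 ⊓ Finset.univ.inf V2 : Y.Opens).isOpen,
    hy1, hy2'⟩
  rintro z ⟨hz1, hz2⟩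
  have hz2' : ∀ k, z ∈ V2 k := fun k =>
    (Finset.inf_le (Finset.mem_univ k) : Finset.univ.inf V2 ≤ V2 k) hz2
  have hzV : z ∈ V := hV1 hz1
  have key : J z = Ideal.span {germAt W z hzV.1 u} := by
    refine le_antisymm ?_ ?_
    · rw [hfV z hzV, Ideal.span_le]
      rintro _ ⟨k, rfl⟩
      have := congrArg (germAt (V2 k) z (hz2' k)) (he k)
      rw [map_mul, germAt_res, germAt_res, germAt_res, germAt_res] at this
      simp only [germAt_res]
      rw [this]
      exact Ideal.mul_mem_left _ _ (Ideal.mem_span_singleton_self _)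
    · rw [Ideal.span_singleton_le_iff_mem, hfV z hzV]
      have := congrArg (germAt V1 z hz1) hcu
      rw [germAt_res, germAt_res, map_sum] at this
      rw [this]
      refine Ideal.sum_mem _ fun k _ => ?_
      rw [map_mul, germAt_res]
      exact Ideal.mul_mem_left _ _ (Ideal.subset_span ⟨k, rfl⟩)
  obtain ⟨d, hd, hJd⟩ := hc z
  exact ⟨hzV.1, key, mem_nonZeroDivisors_of_span_eq hd (hJd.symm.trans key)⟩

/-- The pull-back of `u` generates the pull-back of `J` at `t`. -/
abbrev GoodAt (J : StalkIdeal Y) (W : Y.Opens) (u : Γ(Y, W)) (g : T ⟶ Y) (t : T) : Prop :=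
  GenAt (pullIdeal g J) (g ⁻¹ᵁ W) ((g.app W).hom u) t

/-- The function `u` on `W` is a section of `J`. -/
def MemOn (J : StalkIdeal Y) (W : Y.Opens) (u : Γ(Y, W)) : Prop :=
  ∀ (y : Y) (hy : y ∈ W), germAt W y hy u ∈ J y

theorem MemOn.pullIdeal {J : StalkIdeal Y} {W : Y.Opens} {u : Γ(Y, W)} (h : MemOn J W u)
    (g : T ⟶ Y) : MemOn (pullIdeal g J) (g ⁻¹ᵁ W) ((g.app W).hom u) := fun t ht => by
  rw [← stalkMap_germAt g W t ht]
  exact Ideal.mem_map_of_mem _ (h _ ht)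

theorem genAt_pull {J : StalkIdeal T} {W : T.Opens} {u : Γ(T, W)} (hu : MemOn J W u) (k : S ⟶ T)
    (hc : IsCartier J) (hc' : IsCartier (pullIdeal k J)) (s : S) :
    GenAt (pullIdeal k J) (k ⁻¹ᵁ W) ((k.app W).hom u) s ↔ GenAt J W u (k s) := by
  obtain ⟨d', hd', hJd'⟩ := hc' s
  constructor
  · rintro ⟨h, h1, h2⟩
    refine ⟨h, ?_⟩
    obtain ⟨d, hd, hJd⟩ := hc (k s)
    rw [← stalkMap_germAt k W s h] at h1 h2
    have h3 : pullIdeal k J s = Ideal.span {(k.stalkMap s).hom d} := by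
      rw [pullIdeal, hJd, Ideal.map_span, Set.image_singleton]
    have h4 : (k.stalkMap s).hom d ∈ nonZeroDivisors _ :=
      mem_nonZeroDivisors_of_span_eq hd' (hJd'.symm.trans h3)
    have h5 : germAt W (k s) h u ∈ Ideal.span {d} := hJd ▸ hu _ h
    obtain ⟨e, he⟩ := Ideal.mem_span_singleton'.mp h5
    have h6 : IsUnit e := by
      refine isUnit_of_map_unit (k.stalkMap s).hom e
        (span_singleton_unit_of_mem_nonZeroDivisors h4 ?_)
      rw [← h3, h1, ← he, map_mul, mul_comm]
    have h7 : J (k s) = Ideal.span {germAt W (k s) h u} := by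
      rw [hJd, ← he, Ideal.span_singleton_mul_left_unit h6]
    exact ⟨h7, mem_nonZeroDivisors_of_span_eq hd (hJd.symm.trans h7)⟩
  · rintro ⟨h, h1, h2⟩
    refine ⟨h, ?_⟩
    rw [← stalkMap_germAt k W s h]
    have h3 : pullIdeal k J s = Ideal.span {(k.stalkMap s).hom (germAt W (k s) h u)} := by
      rw [pullIdeal, h1, Ideal.map_span, Set.image_singleton]
    exact ⟨h3, mem_nonZeroDivisors_of_span_eq hd' (hJd'.symm.trans h3)⟩

theorem goodAt_comp {J : StalkIdeal Y} {W : Y.Opens} {u : Γ(Y, W)} (hu : MemOn J W u) (k : S ⟶ T)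
    (g : T ⟶ Y) (hc : IsCartier (pullIdeal g J)) (hc' : IsCartier (pullIdeal (k ≫ g) J)) (s : S) :
    GoodAt J W u (k ≫ g) s ↔ GoodAt J W u g (k s) := by
  rw [pullIdeal_comp] at hc'
  refine Iff.trans ?_ (genAt_pull (hu.pullIdeal g) k hc hc' s)
  rw [GoodAt, pullIdeal_comp]
  rfl

theorem isCartier_of_goodAt {J : StalkIdeal Y} {W : Y.Opens} {u : Γ(Y, W)} {g : T ⟶ Y}
    (h : ∀ t, GoodAt J W u g t) : IsCartier (pullIdeal g J) := fun t => by
  obtain ⟨h, h1, h2⟩ := h t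
  exact ⟨_, h2, h1⟩

theorem stalkMap_bijective (k : S ⟶ T) [IsOpenImmersion k] (s : S) :
    Function.Bijective (k.stalkMap s).hom :=
  ConcreteCategory.bijective_of_isIso (k.stalkMap s)

theorem isCartier_comp_iff {J : StalkIdeal T} (k : S ⟶ T) [IsOpenImmersion k] :
    IsCartier (pullIdeal k J) ↔ ∀ s, ∃ d ∈ nonZeroDivisors (T.presheaf.stalk (k s)),
      J (k s) = Ideal.span {d} := by
  refine forall_congr' fun s => ?_
  let e := RingEquiv.ofBijective (k.stalkMap s).hom (stalkMap_bijective k s)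
  have he : (e : T.presheaf.stalk (k s) →+* S.presheaf.stalk s) = (k.stalkMap s).hom := rfl
  constructor
  · rintro ⟨d, hd, h⟩
    refine ⟨e.symm d, ?_, ?_⟩
    · exact (MulEquivClass.map_nonZeroDivisors e.symm) ▸ Submonoid.mem_map_of_mem e.symm hd
    · have := congrArg (Ideal.map (e.symm : S.presheaf.stalk s →+* T.presheaf.stalk (k s))) h
      rw [pullIdeal, ← he, Ideal.map_map, Ideal.map_span, Set.image_singleton] at this
      simpa using this
  · rintro ⟨d, hd, h⟩
    refine ⟨e d, ?_, ?_⟩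
    · exact (MulEquivClass.map_nonZeroDivisors e) ▸ Submonoid.mem_map_of_mem e hd
    · rw [pullIdeal, h, Ideal.map_span, Set.image_singleton]
      rfl

theorem IsCartier.comp_openImmersion {J : StalkIdeal Y} {g : T ⟶ Y}
    (h : IsCartier (pullIdeal g J)) (k : S ⟶ T) [IsOpenImmersion k] :
    IsCartier (pullIdeal (k ≫ g) J) := by
  rw [pullIdeal_comp, isCartier_comp_iff]
  exact fun s => h (k s)

/-- The open set where `u` generates the pull-back of `J`. -/
def goodLocus {J : StalkIdeal Y} (hJ : LocallyFG J) (W : Y.Opens) (u : Γ(Y, W)) {g : T ⟶ Y}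
    (hc : IsCartier (pullIdeal g J)) : T.Opens :=
  ⟨{t | GoodAt J W u g t}, isOpen_genAt (hJ.pullIdeal g) hc _ _⟩

/-- A chart of the blow-up of `J`: the universal morphism for which the pull-back of `J` is
generated by the non-zero-divisor `u`. -/
structure IsChart {C : Scheme.{0}} (J : StalkIdeal Y) (W : Y.Opens) (u : Γ(Y, W)) (c : C ⟶ Y) :
    Prop where
  mem : MemOn J W u
  good : ∀ t, GoodAt J W u c t
  universal : ∀ (T : Scheme.{0}) (g : T ⟶ Y), (∀ t, GoodAt J W u g t) → ∃! l : T ⟶ C, l ≫ c = g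

namespace IsChart

variable {C : Scheme.{0}} {J : StalkIdeal Y} {W : Y.Opens} {u : Γ(Y, W)} {c : C ⟶ Y}

theorem cartier (h : IsChart J W u c) : IsCartier (pullIdeal c J) := isCartier_of_goodAt h.good

theorem hom_ext (h : IsChart J W u c) {l l' : T ⟶ C} (e : l ≫ c = l' ≫ c)
    (hc : IsCartier (pullIdeal (l ≫ c) J)) : l = l' :=
  (h.universal T (l ≫ c) fun t => (goodAt_comp h.mem l c h.cartier hc t).mpr (h.good _)).unique
    rfl e.symm

def lift (h : IsChart J W u c) (g : T ⟶ Y) (hg : ∀ t, GoodAt J W u g t) : T ⟶ C :=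
  (h.universal T g hg).choose

theorem lift_comp (h : IsChart J W u c) (g : T ⟶ Y) (hg : ∀ t, GoodAt J W u g t) :
    h.lift g hg ≫ c = g :=
  (h.universal T g hg).choose_spec.1

end IsChart

end Stalks

namespace IsBlowup

variable {T Y' Y : Scheme.{0}} {J : StalkIdeal Y} {π : Y' ⟶ Y}

theorem hom_ext (h : IsBlowup J π) {l l' : T ⟶ Y'} (e : l ≫ π = l' ≫ π)
    (hc : IsCartier (pullIdeal (l ≫ π) J)) : l = l' :=
  (h.universal T (l ≫ π) hc).unique rfl e.symm

/-- Charts are open in the blow-up. -/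
theorem exists_chart {C : Scheme.{0}} (h : IsBlowup J π) (hJ : LocallyFG J) {W : Y.Opens}
    {u : Γ(Y, W)} {c : C ⟶ Y} (hc : IsChart J W u c) :
    ∃ j : C ⟶ Y', IsOpenImmersion j ∧ j ≫ π = c ∧ Set.range j = {y | GoodAt J W u π y} := by
  obtain ⟨j, hj, -⟩ := h.universal C c hc.cartier
  let O := goodLocus hJ W u h.cartier
  have hO : ∀ t, GoodAt J W u (O.ι ≫ π) t := fun t =>
    (goodAt_comp hc.mem O.ι π h.cartier (h.cartier.comp_openImmersion O.ι) t).mpr t.2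
  have hjO : Set.range j ⊆ Set.range O.ι := by
    rintro _ ⟨x, rfl⟩
    rw [Scheme.Opens.range_ι]
    exact (goodAt_comp hc.mem j π h.cartier (hj ▸ hc.cartier) x).mp (hj.symm ▸ hc.good x)
  let j' : C ⟶ O := IsOpenImmersion.lift O.ι j hjO
  have hj' : j' ≫ O.ι = j := IsOpenImmersion.lift_fac _ _ _
  let r : (O : Scheme) ⟶ C := hc.lift _ hO
  have hr : r ≫ c = O.ι ≫ π := hc.lift_comp _ hO
  have h1 : j' ≫ r = 𝟙 _ := hc.hom_ext
    (by rw [Category.assoc, hr, ← Category.assoc, hj', hj, Category.id_comp])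
    (by rw [Category.assoc, hr, ← Category.assoc, hj', hj]; exact hc.cartier)
  have h2 : r ≫ j' = 𝟙 _ := by
    rw [← cancel_mono O.ι, Category.assoc, hj', Category.id_comp]
    refine h.hom_ext (by rw [Category.assoc, hj, hr]) ?_
    rw [Category.assoc, hj, hr]
    exact h.cartier.comp_openImmersion O.ι
  have : IsIso j' := ⟨r, h1, h2⟩
  refine ⟨j, hj' ▸ inferInstance, hj, ?_⟩
  rw [← hj', Scheme.Hom.comp_base, TopCat.coe_comp, Set.range_comp,
    Set.range_eq_univ.mpr (Scheme.Hom.surjective j'), Set.image_univ, Scheme.Opens.range_ι]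
  rfl

end IsBlowup

open Limits

/-! ### Gluing charts to a blow-up -/

/-- A family of charts such that every morphism that makes `J` invertible is locally of the form
described by one of them. -/
structure ChartCover {Y : Scheme.{0}} (J : StalkIdeal Y) where
  fg : LocallyFG J
  κ : Type
  W : κ → Y.Opens
  u : ∀ k, Γ(Y, W k)
  C : κ → Scheme.{0}
  c : ∀ k, C k ⟶ Y
  isChart : ∀ k, IsChart J (W k) (u k) (c k)
  covers : ∀ (T : Scheme.{0}) (g : T ⟶ Y), IsCartier (pullIdeal g J) → ∀ t : T, ∃ k,
    GoodAt J (W k) (u k) g t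

namespace ChartCover

variable {Y : Scheme.{0}} {J : StalkIdeal Y} (D : ChartCover J)

/-- The overlap of the chart `k` with the chart `l`. -/
def O (k l : D.κ) : (D.C k).Opens :=
  goodLocus D.fg (D.W l) (D.u l) (D.isChart k).cartier

theorem cartier_ι (k l : D.κ) : IsCartier (pullIdeal ((D.O k l).ι ≫ D.c k) J) :=
  (D.isChart k).cartier.comp_openImmersion _

theorem good_ι (k l : D.κ) (t) : GoodAt J (D.W l) (D.u l) ((D.O k l).ι ≫ D.c k) t :=
  (goodAt_comp (D.isChart l).mem _ _ (D.isChart k).cartier (D.cartier_ι k l) t).mpr t.2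

/-- The overlap of the chart `k` with the chart `l`, as a part of the latter. -/
def s (k l : D.κ) : (D.O k l : Scheme) ⟶ D.C l :=
  (D.isChart l).lift _ (D.good_ι k l)

theorem s_comp (k l : D.κ) : D.s k l ≫ D.c l = (D.O k l).ι ≫ D.c k :=
  (D.isChart l).lift_comp _ _

theorem range_subset_O {T : Scheme.{0}} {k l : D.κ} (a : T ⟶ D.C k)
    (hc : IsCartier (pullIdeal (a ≫ D.c k) J))
    (h : ∀ t, GoodAt J (D.W l) (D.u l) (a ≫ D.c k) t) : Set.range a ⊆ Set.range (D.O k l).ι := by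
  rintro _ ⟨x, rfl⟩
  rw [Scheme.Opens.range_ι]
  exact (goodAt_comp (D.isChart l).mem a _ (D.isChart k).cartier hc x).mp (h x)

theorem range_s (k l : D.κ) : Set.range (D.s k l) ⊆ Set.range (D.O l k).ι := by
  refine D.range_subset_O _ ?_ ?_
  · rw [s_comp]; exact D.cartier_ι k l
  · rw [s_comp]
    exact fun t => (goodAt_comp (D.isChart k).mem _ _ (D.isChart k).cartier (D.cartier_ι k l) t).mpr
      ((D.isChart k).good _)

/-- The transition map. -/
def t (k l : D.κ) : (D.O k l : Scheme) ⟶ D.O l k :=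
  IsOpenImmersion.lift (D.O l k).ι (D.s k l) (D.range_s k l)

theorem t_ι (k l : D.κ) : D.t k l ≫ (D.O l k).ι = D.s k l := IsOpenImmersion.lift_fac _ _ _

theorem fst_cartier (i j k : D.κ) : IsCartier (pullIdeal
    (pullback.fst (D.O i j).ι (D.O i k).ι ≫ (D.O i j).ι ≫ D.c i) J) :=
  (D.cartier_ι i j).comp_openImmersion _

theorem range_fst_s (i j k : D.κ) :
    Set.range (pullback.fst (D.O i j).ι (D.O i k).ι ≫ D.s i j) ⊆ Set.range (D.O j k).ι := by
  refine D.range_subset_O _ ?_ ?_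
  · rw [Category.assoc, s_comp]; exact D.fst_cartier i j k
  · intro x
    rw [Category.assoc, s_comp, pullback.condition_assoc]
    refine (goodAt_comp (D.isChart k).mem _ _ (D.cartier_ι i k) ?_ x).mpr (D.good_ι i k _)
    rw [← pullback.condition_assoc]; exact D.fst_cartier i j k

/-- The transition map on triple overlaps. -/
def t' (i j k : D.κ) : pullback (D.O i j).ι (D.O i k).ι ⟶ pullback (D.O j k).ι (D.O j i).ι :=
  pullback.lift (IsOpenImmersion.lift (D.O j k).ι _ (D.range_fst_s i j k))
    (pullback.fst _ _ ≫ D.t i j) (by rw [IsOpenImmersion.lift_fac, Category.assoc, t_ι])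

theorem t'_comp (i j k : D.κ) : D.t' i j k ≫ pullback.fst _ _ ≫ (D.O j k).ι ≫ D.c j =
    pullback.fst _ _ ≫ (D.O i j).ι ≫ D.c i := by
  rw [t', pullback.lift_fst_assoc, IsOpenImmersion.lift_fac_assoc, Category.assoc, s_comp]

theorem desc_condition (k l : D.κ) : (D.O k l).ι ≫ D.c k = (D.t k l ≫ (D.O l k).ι) ≫ D.c l := by
  rw [t_ι, s_comp]

/-- The glueing datum of the charts. -/
def glueData : Scheme.GlueData where
  J := D.κ
  U := D.C
  V := fun p => D.O p.1 p.2
  f := fun k l => (D.O k l).ι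
  f_mono := inferInstance
  f_hasPullback := inferInstance
  f_id := fun k => by
    have : D.O k k = ⊤ := top_le_iff.mp fun x _ => (D.isChart k).good x
    dsimp only
    rw [this]
    exact (Scheme.topIso (D.C k)).isIso_hom
  t := D.t
  t_id := fun k => by
    rw [← cancel_mono (D.O k k).ι, t_ι, Category.id_comp]
    refine (D.isChart k).hom_ext (D.s_comp k k) ?_
    rw [s_comp]; exact D.cartier_ι k k
  t' := D.t'
  t_fac := fun i j k => by rw [t', pullback.lift_snd]
  cocycle := fun i j k => by
    rw [← cancel_mono (pullback.fst _ _), ← cancel_mono (D.O i j).ι]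
    refine (D.isChart i).hom_ext ?_ ?_
    · simp only [Category.assoc, t'_comp, Category.id_comp]
    · simp only [Category.assoc, t'_comp]
      exact D.fst_cartier i j k
  f_open := inferInstance

/-- The blow-up. -/
def blowup : Scheme.{0} := D.glueData.glued

def ι (k : D.κ) : D.C k ⟶ D.blowup := D.glueData.ι k

instance (k : D.κ) : IsOpenImmersion (D.ι k) := D.glueData.ι_isOpenImmersion k

theorem glue_condition (k l : D.κ) : D.s k l ≫ D.ι l = (D.O k l).ι ≫ D.ι k := by
  rw [← t_ι, Category.assoc]
  exact D.glueData.glue_condition k l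

/-- The blow-up map. -/
def π : D.blowup ⟶ Y :=
  Multicoequalizer.desc _ _ D.c fun p => D.desc_condition p.1 p.2

theorem ι_π (k : D.κ) : D.ι k ≫ D.π = D.c k := Multicoequalizer.π_desc _ _ _ _ _

theorem exists_ι (y : D.blowup) : ∃ (k : D.κ) (x : D.C k), D.ι k x = y :=
  D.glueData.ι_jointly_surjective y

theorem cartier_π : IsCartier (pullIdeal D.π J) := fun y => by
  obtain ⟨k, x, rfl⟩ := D.exists_ι y
  have := (D.isChart k).cartier
  rw [← D.ι_π k, pullIdeal_comp, isCartier_comp_iff] at this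
  exact this x

theorem range_ι (k : D.κ) : Set.range (D.ι k) = {y | GoodAt J (D.W k) (D.u k) D.π y} := by
  ext y
  constructor
  · rintro ⟨x, rfl⟩
    refine (goodAt_comp (D.isChart k).mem (D.ι k) _ D.cartier_π ?_ x).mp ?_
    · rw [ι_π]; exact (D.isChart k).cartier
    · rw [ι_π]; exact (D.isChart k).good x
  · intro hy
    obtain ⟨l, x, rfl⟩ := D.exists_ι y
    have hx : x ∈ D.O l k := by
      have := (goodAt_comp (D.isChart k).mem (D.ι l) _ D.cartier_π ?_ x).mpr hy
      · rwa [ι_π] at this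
      · rw [ι_π]; exact (D.isChart l).cartier
    have := congrArg (fun m => m.base.hom ⟨x, hx⟩) (D.glue_condition l k)
    exact ⟨D.s l k ⟨x, hx⟩, this⟩

theorem lifts_agree {T : Scheme.{0}} {k l : D.κ} (a : T ⟶ D.C k) (b : T ⟶ D.C l)
    (e : a ≫ D.c k = b ≫ D.c l) (hc : IsCartier (pullIdeal (a ≫ D.c k) J)) :
    a ≫ D.ι k = b ≫ D.ι l := by
  have hr : Set.range a ⊆ Set.range (D.O k l).ι := by
    refine D.range_subset_O _ hc fun x => ?_
    rw [e] at hc ⊢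
    exact (goodAt_comp (D.isChart l).mem _ _ (D.isChart l).cartier hc x).mpr ((D.isChart l).good _)
  have h1 := IsOpenImmersion.lift_fac (D.O k l).ι _ hr
  have h2 : IsOpenImmersion.lift (D.O k l).ι _ hr ≫ D.s k l = b := by
    have : (IsOpenImmersion.lift (D.O k l).ι _ hr ≫ D.s k l) ≫ D.c l = a ≫ D.c k := by
      rw [Category.assoc, s_comp, ← Category.assoc, h1]
    refine (D.isChart l).hom_ext (this.trans e) (this ▸ hc)
  rw [← h2, Category.assoc, glue_condition, ← Category.assoc, h1]

theorem exists_lift (T : Scheme.{0}) (g : T ⟶ Y) (hg : IsCartier (pullIdeal g J)) :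
    ∃ l : T ⟶ D.blowup, l ≫ D.π = g := by
  let U : D.κ → T.Opens := fun k => goodLocus D.fg (D.W k) (D.u k) hg
  have hU : ⨆ k, U k = ⊤ := top_le_iff.mp fun t _ => by
    obtain ⟨k, hk⟩ := D.covers T g hg t
    exact TopologicalSpace.Opens.mem_iSup.mpr ⟨k, hk⟩
  let 𝒰 : T.OpenCover := T.openCoverOfIsOpenCover U (.mk hU)
  have hgood : ∀ k t, GoodAt J (D.W k) (D.u k) ((U k).ι ≫ g) t := fun k t =>
    (goodAt_comp (D.isChart k).mem _ g hg (hg.comp_openImmersion _) t).mpr t.2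
  let a : ∀ k, (U k : Scheme) ⟶ D.C k := fun k => (D.isChart k).lift _ (hgood k)
  have ha : ∀ k, a k ≫ D.c k = (U k).ι ≫ g := fun k => (D.isChart k).lift_comp _ _
  have hag : ∀ k l, pullback.fst (U k).ι (U l).ι ≫ a k ≫ D.ι k =
      pullback.snd (U k).ι (U l).ι ≫ a l ≫ D.ι l := fun k l => by
    rw [← Category.assoc, ← Category.assoc]
    refine D.lifts_agree _ _ ?_ ?_
    · rw [Category.assoc, Category.assoc, ha, ha, pullback.condition_assoc]
    · rw [Category.assoc, ha]
      exact (hg.comp_openImmersion (U k).ι).comp_openImmersion _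
  have haπ : ∀ k, (a k ≫ D.ι k) ≫ D.π = (U k).ι ≫ g := fun k => by
    rw [Category.assoc, ι_π, ha]
  refine ⟨𝒰.glueMorphisms (fun k => a k ≫ D.ι k) hag, 𝒰.hom_ext _ _ fun k => ?_⟩
  refine Eq.trans ?_ (haπ k)
  rw [← Category.assoc]
  exact congrArg (· ≫ D.π) (Scheme.Cover.ι_glueMorphisms 𝒰 _ hag k)

theorem isBlowup : IsBlowup J D.π where
  cartier := D.cartier_π
  universal T g hg := by
    obtain ⟨l, hl⟩ := D.exists_lift T g hg
    refine ⟨l, hl, fun l' hl' => ?_⟩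
    refine Scheme.hom_ext_of_forall _ _ fun t => ?_
    obtain ⟨k, hk⟩ := D.covers T g hg t
    let U := goodLocus D.fg (D.W k) (D.u k) hg
    have key : ∀ m : T ⟶ D.blowup, m ≫ D.π = g → ∃ a : (U : Scheme) ⟶ D.C k,
        a ≫ D.ι k = U.ι ≫ m := fun m hm => by
      refine ⟨IsOpenImmersion.lift (D.ι k) (U.ι ≫ m) ?_, IsOpenImmersion.lift_fac _ _ _⟩
      rintro _ ⟨x, rfl⟩
      rw [range_ι]
      refine (goodAt_comp (D.isChart k).mem m D.π D.cartier_π (hm ▸ hg) (U.ι x)).mp ?_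
      rw [hm]
      exact x.2
    obtain ⟨a, ha⟩ := key l hl
    obtain ⟨a', ha'⟩ := key l' hl'
    refine ⟨U, hk, ?_⟩
    rw [← ha, ← ha']
    congr 1
    have hh : ∀ {m : T ⟶ D.blowup} (_ : m ≫ D.π = g) {a : (U : Scheme) ⟶ D.C k}
        (_ : a ≫ D.ι k = U.ι ≫ m), a ≫ D.c k = U.ι ≫ g := fun hm a ha => by
      rw [← ι_π, ← Category.assoc, ha, Category.assoc, hm]
    refine (D.isChart k).hom_ext ((hh hl' ha').trans (hh hl ha).symm) ?_
    rw [hh hl' ha']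
    exact hg.comp_openImmersion _

end ChartCover

theorem ChartCover.exists_isBlowup {Y : Scheme.{0}} {J : StalkIdeal Y} (D : ChartCover J) :
    ∃ (Y' : Scheme.{0}) (π : Y' ⟶ Y), IsBlowup J π := ⟨_, _, D.isBlowup⟩

section Sections

variable {T Y : Scheme.{0}}

theorem section_ext {V : Y.Opens} {s t : Γ(Y, V)}
    (h : ∀ (y : Y) (hy : y ∈ V), germAt V y hy s = germAt V y hy t) : s = t :=
  TopCat.Presheaf.section_ext Y.sheaf V s t h

theorem res_res {A B C : Y.Opens} (a : A ≤ B) (b : B ≤ C) (s : Γ(Y, C)) :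
    res a (res b s) = res (a.trans b) s := by
  simp only [res, ← CommRingCat.comp_apply, ← Functor.map_comp]; rfl

theorem mem_nonZeroDivisors_of_germAt {V : Y.Opens} {u : Γ(Y, V)}
    (h : ∀ (y : Y) (hy : y ∈ V), germAt V y hy u ∈ nonZeroDivisors _) :
    u ∈ nonZeroDivisors Γ(Y, V) := by
  rw [mem_nonZeroDivisors_iff_right]
  intro x hx
  refine section_ext fun y hy => ?_
  rw [map_zero]
  exact (mul_right_mem_nonZeroDivisors_eq_zero_iff (h y hy)).mp (by rw [← map_mul, hx, map_zero])

theorem dvd_of_germAt_dvd {V : Y.Opens} {u s : Γ(Y, V)}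
    (hu : ∀ (y : Y) (hy : y ∈ V), germAt V y hy u ∈ nonZeroDivisors _)
    (h : ∀ (y : Y) (hy : y ∈ V), germAt V y hy u ∣ germAt V y hy s) : u ∣ s := by
  have h1 : ∀ y : V, ∃ (U : Y.Opens) (_ : y.1 ∈ U) (hUV : U ≤ V) (e : Γ(Y, U)),
      res hUV s = res hUV u * e := by
    rintro ⟨y, hy⟩
    have h2 : germAt V y hy s ∈ Ideal.span (Set.range fun _ : Fin 1 => germAt V y hy u) := by
      rw [Set.range_const]; exact Ideal.mem_span_singleton.mpr (h y hy)
    obtain ⟨U, hUV, hyU, c, hc⟩ := exists_res_eq_sum y hy _ _ h2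
    exact ⟨U, hyU, hUV, c 0, by simpa [mul_comm] using hc⟩
  choose U hyU hUV e he using h1
  have hcompat : TopCat.Presheaf.IsCompatible Y.sheaf.1 U e := by
    intro y z
    change res inf_le_left (e y) = res inf_le_right (e z)
    refine section_ext fun x hx => ?_
    rw [germAt_res, germAt_res]
    refine (mul_cancel_left_mem_nonZeroDivisors (hu x (hUV y hx.1))).mp ?_
    have h3 := congrArg (germAt _ x hx.1) (he y)
    have h4 := congrArg (germAt _ x hx.2) (he z)
    rw [map_mul, germAt_res, germAt_res] at h3 h4
    exact h3.symm.trans h4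
  obtain ⟨e', he'⟩ : ∃ e' : Γ(Y, V), ∀ y, res (hUV y) e' = e y := by
    obtain ⟨e', he', -⟩ := Y.sheaf.existsUnique_gluing' U V (fun y => homOfLE (hUV y))
      (fun y hy => TopologicalSpace.Opens.mem_iSup.mpr ⟨⟨y, hy⟩, hyU ⟨y, hy⟩⟩) e hcompat
    exact ⟨e', he'⟩
  refine ⟨e', section_ext fun y hy => ?_⟩
  have h3 := congrArg (germAt _ y (hyU ⟨y, hy⟩)) (he ⟨y, hy⟩)
  rwa [← he', map_mul, germAt_res, germAt_res, germAt_res, ← map_mul] at h3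

/-- The prime ideal of the functions on `V` vanishing at `y`. -/
def ptIdeal (V : Y.Opens) (y : Y) (hy : y ∈ V) : Ideal Γ(Y, V) :=
  (IsLocalRing.maximalIdeal (Y.presheaf.stalk y)).comap (germAt V y hy)

instance (V : Y.Opens) (y : Y) (hy : y ∈ V) : (ptIdeal V y hy).IsPrime :=
  Ideal.comap_isPrime _ _

theorem notMem_ptIdeal {V : Y.Opens} {y : Y} {hy : y ∈ V} {s : Γ(Y, V)} :
    s ∉ ptIdeal V y hy ↔ IsUnit (germAt V y hy s) := by
  rw [ptIdeal, Ideal.mem_comap, IsLocalRing.mem_maximalIdeal, mem_nonunits_iff, not_not]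

set_option linter.style.haveILetI false in
theorem isLocalization_stalk {V : Y.Opens} (hV : IsAffineOpen V) (y : Y) (hy : y ∈ V) :
    letI := (germAt V y hy).toAlgebra
    IsLocalization.AtPrime (Y.presheaf.stalk y) (ptIdeal V y hy) := by
  letI := (germAt V y hy).toAlgebra
  have h : IsLocalization.AtPrime (Y.presheaf.stalk y) (hV.primeIdealOf ⟨y, hy⟩).asIdeal :=
    hV.isLocalization_stalk ⟨y, hy⟩
  have h2 : (hV.primeIdealOf ⟨y, hy⟩).asIdeal = ptIdeal V y hy :=
    (IsLocalization.AtPrime.under_maximalIdeal (Y.presheaf.stalk y) _).symm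
  simp only [← h2]
  exact h

end Sections

section Spec

variable {R : Type} [CommRing R]

/-- The germ of a function on an affine scheme. -/
def germSpec (q : PrimeSpectrum R) : R →+* (Spec (CommRingCat.of R)).presheaf.stalk q :=
  (germAt (Y := Spec (CommRingCat.of R)) ⊤ q trivial).comp
    (Scheme.ΓSpecIso (CommRingCat.of R)).inv.hom

theorem isLocalization_stalk_spec (q : PrimeSpectrum R) :
    letI := (germSpec q).toAlgebra
    IsLocalization.AtPrime ((Spec (CommRingCat.of R)).presheaf.stalk q) q.asIdeal :=
  inferInstanceAs (IsLocalization.AtPrime ((Spec.structureSheaf R).presheaf.stalk q) q.asIdeal)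

theorem isUnit_germSpec {q : PrimeSpectrum R} {r : R} :
    IsUnit (germSpec q r) ↔ r ∉ q.asIdeal := by
  let := (germSpec q).toAlgebra
  have := isLocalization_stalk_spec q
  exact IsLocalization.AtPrime.isUnit_to_map_iff _ q.asIdeal r

theorem germSpec_mem_nonZeroDivisors (q : PrimeSpectrum R) {r : R}
    (hr : r ∈ nonZeroDivisors R) : germSpec q r ∈ nonZeroDivisors _ := by
  let := (germSpec q).toAlgebra
  have := isLocalization_stalk_spec q
  exact IsLocalization.nonZeroDivisors_le_comap q.asIdeal.primeCompl _ hr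

end Spec

section ToAffine

variable {T Y : Scheme.{0}} {W : Y.Opens} (hW : IsAffineOpen W)

/-- The morphism to the affine open set `W` described by a ring homomorphism. -/
def toAffine (φ : Γ(Y, W) →+* Γ(T, ⊤)) : T ⟶ Y :=
  T.toSpecΓ ≫ Spec.map (CommRingCat.ofHom φ) ≫ hW.fromSpec

theorem range_toAffine (φ : Γ(Y, W) →+* Γ(T, ⊤)) : ⊤ ≤ toAffine hW φ ⁻¹ᵁ W := fun t _ => by
  have : toAffine hW φ t ∈ Set.range hW.fromSpec := ⟨_, rfl⟩
  rwa [hW.range_fromSpec] at this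

theorem eq_toAffine (g : T ⟶ Y) (hg : ⊤ ≤ g ⁻¹ᵁ W) :
    g = toAffine hW (g.appLE W ⊤ hg).hom := by
  have h := Scheme.Opens.toSpecΓ_SpecMap_appLE g W ⊤ hg
  have : IsIso (⊤ : T.Opens).ι := (Scheme.topIso T).isIso_hom
  rw [← cancel_epi (⊤ : T.Opens).ι, toAffine, CommRingCat.ofHom_hom, ← Category.assoc,
    ← Scheme.Opens.toSpecΓ_top, ← Category.assoc, h, Category.assoc, hW.toSpecΓ_fromSpec,
    Scheme.Hom.resLE_comp_ι]

theorem toAffine_injective : Function.Injective (toAffine (T := T) hW) := by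
  intro φ ψ h
  rw [toAffine, toAffine, ← Category.assoc, ← Category.assoc, cancel_mono] at h
  have h2 := congrArg (fun m => (Scheme.ΓSpecIso Γ(Y, W)).inv ≫ Scheme.Hom.appTop m) h
  have h3 : ∀ φ : Γ(Y, W) →+* Γ(T, ⊤), (Scheme.ΓSpecIso Γ(Y, W)).inv ≫
      Scheme.Hom.appTop (T.toSpecΓ ≫ Spec.map (CommRingCat.ofHom φ)) = CommRingCat.ofHom φ := by
    intro φ
    rw [Scheme.Hom.comp_appTop, Scheme.toSpecΓ_appTop]
    exact (Scheme.ΓSpecIso_inv_naturality_assoc (CommRingCat.ofHom φ) _).symm.trans (by simp)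
  exact congrArg CommRingCat.Hom.hom ((h3 φ).symm.trans (h2.trans (h3 ψ)))

theorem toAffine_appLE (φ : Γ(Y, W) →+* Γ(T, ⊤)) (h : ⊤ ≤ toAffine hW φ ⁻¹ᵁ W) :
    ((toAffine hW φ).appLE W ⊤ h).hom = φ :=
  (toAffine_injective hW (eq_toAffine hW (toAffine hW φ) h)).symm

variable {R : Type} [CommRing R]

theorem specMap_fromSpec_eq_toAffine (φ : Γ(Y, W) →+* R) :
    Spec.map (CommRingCat.ofHom φ) ≫ hW.fromSpec =
      toAffine hW ((Scheme.ΓSpecIso (CommRingCat.of R)).inv.hom.comp φ) := by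
  rw [toAffine, CommRingCat.ofHom_comp, Spec.map_comp, Category.assoc]
  exact (toSpecΓ_SpecMap_ΓSpecIso_inv_assoc (CommRingCat.of R) _).symm

theorem specMap_fromSpec_mem (φ : Γ(Y, W) →+* R) (q : PrimeSpectrum R) :
    (Spec.map (CommRingCat.ofHom φ) ≫ hW.fromSpec) q ∈ W := by
  rw [specMap_fromSpec_eq_toAffine]
  exact range_toAffine hW _ trivial

theorem stalkMap_germAt_appLE (g : T ⟶ Y) (W : Y.Opens) (V : T.Opens) (hV : V ≤ g ⁻¹ᵁ W) (t : T)
    (ht : t ∈ V) (s : Γ(Y, W)) : (g.stalkMap t).hom (germAt W (g t) (hV ht) s) =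
      germAt V t ht ((g.appLE W V hV).hom s) := by
  refine (stalkMap_germAt g W t (hV ht) s).trans ?_
  rw [← germAt_res hV t ht]
  rfl

theorem stalkMap_specMap_fromSpec (φ : Γ(Y, W) →+* R) (q : PrimeSpectrum R) (s : Γ(Y, W)) :
    ((Spec.map (CommRingCat.ofHom φ) ≫ hW.fromSpec).stalkMap q).hom
      (germAt W _ (specMap_fromSpec_mem hW φ q) s) = germSpec q (φ s) := by
  have h : ⊤ ≤ (Spec.map (CommRingCat.ofHom φ) ≫ hW.fromSpec) ⁻¹ᵁ W :=
    fun t _ => specMap_fromSpec_mem hW φ t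
  rw [stalkMap_germAt_appLE _ W ⊤ h q trivial s]
  have h2 : ((Spec.map (CommRingCat.ofHom φ) ≫ hW.fromSpec).appLE W ⊤ h).hom =
      (Scheme.ΓSpecIso (CommRingCat.of R)).inv.hom.comp φ := by
    refine toAffine_injective hW ?_
    rw [← eq_toAffine, specMap_fromSpec_eq_toAffine]
  rw [h2]
  rfl

end ToAffine

/-! ### Charts described by rings -/

/-- The `A`-algebra `R` is the affine blow-up algebra for the `k`-th member of the family `f`. -/
structure IsRingChart {A K : Type} [CommRing A] (f : K → A) (k : K) (R : Type) [CommRing R]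
    [Algebra A R] : Prop where
  nzd : algebraMap A R (f k) ∈ nonZeroDivisors R
  dvd : ∀ l, algebraMap A R (f k) ∣ algebraMap A R (f l)
  exists_hom : ∀ (C : Type) [CommRing C] [Algebra A C], algebraMap A C (f k) ∈ nonZeroDivisors C →
    (∀ l, algebraMap A C (f k) ∣ algebraMap A C (f l)) → Nonempty (R →ₐ[A] C)
  hom_ext : ∀ (C : Type) [CommRing C] [Algebra A C] (φ ψ : R →ₐ[A] C),
    algebraMap A C (f k) ∈ nonZeroDivisors C → φ = ψ

section Charts

variable {T Y : Scheme.{0}} {J : StalkIdeal Y} {W : Y.Opens} {K : Type}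

theorem GeneratedOn.memOn {f : K → Γ(Y, W)} (hf : GeneratedOn J W f) (k : K) :
    MemOn J W (f k) := fun y hy => by
  rw [hf y hy]; exact Ideal.subset_span ⟨k, rfl⟩

theorem GeneratedOn.goodAt_iff {f : K → Γ(Y, W)} (hf : GeneratedOn J W f) (k : K) (g : T ⟶ Y)
    (t : T) (ht : g t ∈ W) : GoodAt J W (f k) g t ↔
      (∀ l, (g.stalkMap t).hom (germAt W _ ht (f k)) ∣ (g.stalkMap t).hom (germAt W _ ht (f l))) ∧
      (g.stalkMap t).hom (germAt W _ ht (f k)) ∈ nonZeroDivisors _ := by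
  have h1 := hf.pullIdeal g t ht
  simp only [← stalkMap_germAt g W t ht] at h1
  constructor
  · rintro ⟨h, h2, h3⟩
    rw [← stalkMap_germAt g W t ht] at h2 h3
    refine ⟨fun l => ?_, h3⟩
    rw [← Ideal.mem_span_singleton, ← h2, h1]
    exact Ideal.subset_span ⟨l, rfl⟩
  · rintro ⟨h2, h3⟩
    refine ⟨ht, ?_, ?_⟩
    · rw [← stalkMap_germAt g W t ht, h1]
      refine le_antisymm (Ideal.span_le.mpr ?_) (Ideal.span_mono ?_)
      · rintro _ ⟨l, rfl⟩
        exact Ideal.mem_span_singleton.mpr (h2 l)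
      · rintro _ rfl
        exact ⟨k, rfl⟩
    · rwa [← stalkMap_germAt g W t ht]

theorem GeneratedOn.goodAt_spec_iff (hW : IsAffineOpen W) {f : K → Γ(Y, W)}
    (hf : GeneratedOn J W f) (k : K) {R : Type} [CommRing R] (φ : Γ(Y, W) →+* R)
    (q : PrimeSpectrum R) :
    GoodAt J W (f k) (T := Spec (CommRingCat.of R))
      (Spec.map (CommRingCat.ofHom φ) ≫ hW.fromSpec) q ↔
      (∀ l, germSpec q (φ (f k)) ∣ germSpec q (φ (f l))) ∧
        germSpec q (φ (f k)) ∈ nonZeroDivisors _ := by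
  have e := fun l => stalkMap_specMap_fromSpec hW φ q (f l)
  refine (hf.goodAt_iff k (T := Spec (CommRingCat.of R)) _ q
    (specMap_fromSpec_mem hW φ q)).trans (and_congr (forall_congr' fun l => ?_) ?_)
  · exact iff_of_eq (congrArg₂ (· ∣ ·) (e k) (e l))
  · exact iff_of_eq (congrArg (· ∈ nonZeroDivisors _) (e k))

theorem isChart_of_isRingChart (hW : IsAffineOpen W) {f : K → Γ(Y, W)} (hf : GeneratedOn J W f)
    {k : K} {R : Type} [CommRing R] [Algebra Γ(Y, W) R] (h : IsRingChart f k R) :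
    IsChart J W (f k)
      (Spec.map (CommRingCat.ofHom (algebraMap Γ(Y, W) R)) ≫ hW.fromSpec) where
  mem := hf.memOn k
  good q := by
    refine (hf.goodAt_spec_iff hW k _ q).mpr ⟨fun l => map_dvd _ (h.dvd l), germSpec_mem_nonZeroDivisors q h.nzd⟩
  universal T g hg := by
    have hgW : ⊤ ≤ g ⁻¹ᵁ W := fun t _ => (hg t).1
    let := (g.appLE W ⊤ hgW).hom.toAlgebra
    have hmap : algebraMap Γ(Y, W) Γ(T, ⊤) = (g.appLE W ⊤ hgW).hom := rfl
    have hg' := fun t => (hf.goodAt_iff k g t (hg t).1).mp (hg t)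
    have h1 : ∀ t ht, germAt ⊤ t ht (algebraMap Γ(Y, W) Γ(T, ⊤) (f k)) ∈ nonZeroDivisors _ := by
      intro t ht
      rw [hmap, ← stalkMap_germAt_appLE]
      exact (hg' t).2
    have h2 : ∀ l, algebraMap Γ(Y, W) Γ(T, ⊤) (f k) ∣ algebraMap Γ(Y, W) Γ(T, ⊤) (f l) := by
      refine fun l => dvd_of_germAt_dvd h1 fun t ht => ?_
      rw [hmap, ← stalkMap_germAt_appLE, ← stalkMap_germAt_appLE]
      exact (hg' t).1 l
    have h3 := mem_nonZeroDivisors_of_germAt h1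
    obtain ⟨χ⟩ := h.exists_hom _ h3 h2
    have key : ∀ χ : R →+* Γ(T, ⊤),
        (T.toSpecΓ ≫ Spec.map (CommRingCat.ofHom χ)) ≫
          (Spec.map (CommRingCat.ofHom (algebraMap Γ(Y, W) R)) ≫ hW.fromSpec) =
        toAffine hW (χ.comp (algebraMap Γ(Y, W) R)) := fun χ => by
      rw [toAffine, CommRingCat.ofHom_comp, Spec.map_comp]
      simp only [Category.assoc]
    refine ⟨T.toSpecΓ ≫ Spec.map (CommRingCat.ofHom χ.toRingHom), ?_, fun l' hl' => ?_⟩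
    · refine (key _).trans (Eq.trans ?_ (eq_toAffine hW g hgW).symm)
      congr 1
      exact χ.comp_algebraMap
    · obtain ⟨χ', rfl⟩ : ∃ χ' : R →+* Γ(T, ⊤), T.toSpecΓ ≫ Spec.map (CommRingCat.ofHom χ') = l' := by
        refine ⟨((Scheme.ΓSpecIso (CommRingCat.of R)).inv ≫ l'.appTop).hom, ?_⟩
        rw [CommRingCat.ofHom_hom, Spec.map_comp, ← Category.assoc, ← Scheme.toSpecΓ_naturality,
          Category.assoc, toSpecΓ_SpecMap_ΓSpecIso_inv, Category.comp_id]
      have h4 := toAffine_injective hW ((key _).symm.trans (hl'.trans (eq_toAffine hW g hgW)))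
      let χ'' : R →ₐ[Γ(Y, W)] Γ(T, ⊤) := { χ' with commutes' := RingHom.congr_fun h4 }
      have h5 := h.hom_ext _ χ'' χ h3
      rw [← h5]

theorem IsBlowup.hasCharts {Y' : Scheme.{0}} {π : Y' ⟶ Y} (hπ : IsBlowup J π) (hJ : LocallyFG J)
    (hW : IsAffineOpen W) [Finite K] {f : K → Γ(Y, W)} (hf : GeneratedOn J W f)
    {R : K → Type} [∀ k, CommRing (R k)] [∀ k, Algebra Γ(Y, W) (R k)] {t : ∀ k, K → R k}
    (h : ∀ k, IsRingChart f k (R k))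
    (ht : ∀ k l, algebraMap Γ(Y, W) (R k) (f l) = algebraMap Γ(Y, W) (R k) (f k) * t k l) :
    HasCharts π hW R t := by
  have hc := fun k => isChart_of_isRingChart hW hf (h k)
  choose j hj1 hj2 hj3 using fun k => hπ.exists_chart hJ (hc k)
  refine ⟨j, hj1, hj2, ?_, fun k l => ?_⟩
  · ext y
    simp only [hj3, Set.mem_iUnion, Set.mem_preimage, SetLike.mem_coe]
    constructor
    · rintro ⟨k, hk⟩; exact hk.1
    · intro hy
      obtain ⟨d, hd, hJd⟩ := hπ.cartier y
      have h1 := hf.pullIdeal π y hy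
      obtain ⟨k, hk⟩ := exists_span_eq_of_isLocalRing _ hd (h1.symm.trans hJd)
      exact ⟨k, hy, hJd.trans hk.symm, mem_nonZeroDivisors_of_span_eq hd hk.symm⟩
  · have key : ∀ q : PrimeSpectrum (R k), j k q ∈ Set.range (j l) ↔ t k l ∉ q.asIdeal := by
      intro q
      rw [hj3]
      have h1 := goodAt_comp (hf.memOn l) (j k) π hπ.cartier
        ((hj2 k).symm ▸ (hc k).cartier) q
      refine Iff.trans h1.symm ?_
      rw [hj2]
      refine (hf.goodAt_spec_iff hW l _ q).trans ?_
      rw [← isUnit_germSpec]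
      have hk := germSpec_mem_nonZeroDivisors q (h k).nzd
      constructor
      · rintro ⟨h2, -⟩
        obtain ⟨e, he⟩ := h2 k
        refine IsUnit.of_mul_eq_one e ?_
        rw [ht k l, map_mul] at he
        exact (mul_cancel_left_mem_nonZeroDivisors hk).mp (by rw [mul_one, ← mul_assoc, ← he])
      · intro hu
        rw [ht k l, map_mul]
        refine ⟨fun m => ?_, mul_mem hk hu.mem_nonZeroDivisors⟩
        rw [hu.mul_right_dvd]
        exact map_dvd _ ((h k).dvd m)
    ext y
    constructor
    · rintro ⟨q, hq, rfl⟩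
      exact ⟨⟨q, rfl⟩, (key q).mpr hq⟩
    · rintro ⟨⟨q, rfl⟩, hq⟩
      exact ⟨q, (key q).mp hq, rfl⟩

end Charts

/-! ### Exactness of the Koszul complex of two elements -/

/-- The first homology of the Koszul complex of `u` and `v` vanishes. -/
def KoszulExact {A : Type*} [CommRing A] (u v : A) : Prop :=
  ∀ x y : A, u * x = v * y → ∃ c, x = v * c ∧ y = u * c

section Koszul

variable {A P : Type*} [CommRing A] [CommRing P] [Algebra A P] {u v : A}

theorem KoszulExact.symm (h : KoszulExact u v) : KoszulExact v u := fun x y hxy => by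
  obtain ⟨c, h1, h2⟩ := h y x hxy.symm
  exact ⟨c, h2, h1⟩

theorem KoszulExact.of_flat (h : KoszulExact u v) [Module.Flat A P] :
    KoszulExact (algebraMap A P u) (algebraMap A P v) := by
  intro x y hxy
  obtain ⟨l, a, p, h2, h3⟩ := Module.Flat.isTrivialRelation_of_sum_smul_eq_zero
    (R := A) (M := P) (f := ![u, -v]) (x := ![x, y])
    (by simp [Fin.sum_univ_two, Algebra.smul_def, hxy])
  have h4 : ∀ j, ∃ c, a 0 j = v * c ∧ a 1 j = u * c := fun j => by
    refine h _ _ ?_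
    have := h3 j
    simp only [Fin.sum_univ_two, Matrix.cons_val_zero, Matrix.cons_val_one] at this
    linear_combination this
  choose c hc using h4
  refine ⟨∑ j, c j • p j, ?_, ?_⟩
  · have : x = ∑ j, a 0 j • p j := h2 0
    rw [this, Finset.mul_sum]
    exact Finset.sum_congr rfl fun j _ => by
      rw [(hc j).1, ← Algebra.smul_def, smul_smul]
  · have : y = ∑ j, a 1 j • p j := h2 1
    rw [this, Finset.mul_sum]
    exact Finset.sum_congr rfl fun j _ => by
      rw [(hc j).2, ← Algebra.smul_def, smul_smul]

end Koszul

theorem mem_nonZeroDivisors_quotient {S : Type*} [CommRing S] {I : Ideal S} {x : S}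
    (h : ∀ y, x * y ∈ I → y ∈ I) : Ideal.Quotient.mk I x ∈ nonZeroDivisors (S ⧸ I) := by
  rw [mem_nonZeroDivisors_iff_left]
  intro y hy
  obtain ⟨y, rfl⟩ := Ideal.Quotient.mk_surjective y
  rw [← map_mul, Ideal.Quotient.eq_zero_iff_mem] at hy
  exact Ideal.Quotient.eq_zero_iff_mem.mpr (h y hy)

theorem mem_nonZeroDivisors_of_flat {A P : Type*} [CommRing A] [CommRing P] [Algebra A P]
    [Module.Flat A P] {u : A} (h : u ∈ nonZeroDivisors A) :
    algebraMap A P u ∈ nonZeroDivisors P := by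
  have h1 : IsSMulRegular A u := (isRegular_iff_mem_nonZeroDivisors.mpr h).left
  have h2 := h1.of_flat (S := P)
  exact isRegular_iff_mem_nonZeroDivisors.mp (isLeftRegular_iff_isRegular.mp h2)

/-! ### The chart of the blow-up of two elements -/

/-- The ring `A[X]/(uX - v)`. -/
abbrev SlopeChart {A : Type} [CommRing A] (u v : A) : Type :=
  A[X] ⧸ (Ideal.span {Polynomial.C u * Polynomial.X - Polynomial.C v} : Ideal A[X])

namespace SlopeChart

variable {A : Type} [CommRing A] (u v : A)

/-- The coordinate `v / u`. -/
def t : SlopeChart u v := Ideal.Quotient.mk _ Polynomial.X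

theorem algebraMap_mul_t :
    algebraMap A (SlopeChart u v) u * t u v = algebraMap A (SlopeChart u v) v := by
  change Ideal.Quotient.mk _ (Polynomial.C u * Polynomial.X) = Ideal.Quotient.mk _ (Polynomial.C v)
  exact Ideal.Quotient.eq.mpr (Ideal.subset_span rfl)

variable {u v}

theorem nzd (h : KoszulExact u v) : algebraMap A (SlopeChart u v) u ∈ nonZeroDivisors _ := by
  refine mem_nonZeroDivisors_quotient (x := Polynomial.C u) fun p hp => ?_
  obtain ⟨q, hq⟩ := Ideal.mem_span_singleton'.mp hp
  obtain ⟨c, h1, h2⟩ := (h.of_flat (P := A[X])) (q * Polynomial.X - p) q (by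
    rw [Polynomial.algebraMap_eq]; linear_combination hq)
  rw [Polynomial.algebraMap_eq] at h1 h2
  rw [Ideal.mem_span_singleton']
  exact ⟨c, by linear_combination h1 - Polynomial.X * h2⟩

/-- The homomorphism given by a value of `v / u`. -/
def lift {C : Type} [CommRing C] [Algebra A C] (e : C)
    (he : algebraMap A C u * e = algebraMap A C v) : SlopeChart u v →ₐ[A] C :=
  { Ideal.Quotient.lift _ (Polynomial.aeval e).toRingHom fun a ha => by
      obtain ⟨q, rfl⟩ := Ideal.mem_span_singleton'.mp ha
      simp [he] with
    commutes' := fun a => (Ideal.Quotient.lift_mk _ _ _).trans (Polynomial.aeval_C e a) }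

@[simp]
theorem lift_t {C : Type} [CommRing C] [Algebra A C] (e : C)
    (he : algebraMap A C u * e = algebraMap A C v) : lift e he (t u v) = e :=
  (Ideal.Quotient.lift_mk _ _ _).trans (Polynomial.aeval_X e)

theorem hom_ext {C : Type} [CommRing C] [Algebra A C] {φ ψ : SlopeChart u v →ₐ[A] C}
    (h : φ (t u v) = ψ (t u v)) : φ = ψ := by
  refine Ideal.Quotient.algHom_ext _ (Polynomial.algHom_ext h)

theorem isRingChart (h : KoszulExact u v) {K : Type} {f : K → A} {k k' : K} (hk : f k = u)
    (hk' : f k' = v) (hf : ∀ l, f l = u ∨ f l = v) : IsRingChart f k (SlopeChart u v) where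
  nzd := by rw [hk]; exact nzd h
  dvd l := by
    rw [hk]
    rcases hf l with h | h <;> rw [h]
    exact ⟨_, (algebraMap_mul_t u v).symm⟩
  exists_hom C _ _ _ h2 := by
    obtain ⟨e, he⟩ := h2 k'
    rw [hk, hk'] at he
    exact ⟨lift e he.symm⟩
  hom_ext C _ _ φ ψ h1 := by
    refine hom_ext ((mul_cancel_left_mem_nonZeroDivisors h1).mp ?_)
    have key : ∀ χ : SlopeChart u v →ₐ[A] C, algebraMap A C u * χ (t u v) = algebraMap A C v := by
      intro χ
      rw [← χ.commutes, ← map_mul, algebraMap_mul_t, χ.commutes]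
    rw [hk, key, key]

end SlopeChart

/-! ### Quadratic extensions -/

/-- The quadratic extension `A'` of `A` is obtained by adjoining a square root `ξ` of `h`. -/
structure IsQuadratic {A A' : Type} [CommRing A] [CommRing A'] [Algebra A A'] (h : A) (ξ : A') :
    Prop where
  sq : ξ ^ 2 = algebraMap A A' h
  exists_unique : ∀ z : A', ∃! pq : A × A, z = algebraMap A A' pq.1 + algebraMap A A' pq.2 * ξ

namespace IsQuadratic

variable {A A' : Type} [CommRing A] [CommRing A'] [Algebra A A'] {h : A} {ξ : A'}

theorem exists_eq (H : IsQuadratic h ξ) (z : A') :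
    ∃ p q : A, z = algebraMap A A' p + algebraMap A A' q * ξ := by
  obtain ⟨⟨p, q⟩, hz, -⟩ := H.exists_unique z
  exact ⟨p, q, hz⟩

theorem eq_of_eq (H : IsQuadratic h ξ) {p q p' q' : A}
    (e : algebraMap A A' p + algebraMap A A' q * ξ =
      algebraMap A A' p' + algebraMap A A' q' * ξ) : p = p' ∧ q = q' := by
  have := (H.exists_unique (algebraMap A A' p + algebraMap A A' q * ξ)).unique
    (y₁ := (p, q)) (y₂ := (p', q')) rfl e
  exact Prod.mk.inj this

/-- The homomorphism given by a square root of `h`. -/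
theorem exists_lift (H : IsQuadratic h ξ) {C : Type} [CommRing C] [Algebra A C] (c : C)
    (hc : c ^ 2 = algebraMap A C h) : ∃ φ : A' →ₐ[A] C, φ ξ = c := by
  choose p q hpq using H.exists_eq
  have key : ∀ z p' q', z = algebraMap A A' p' + algebraMap A A' q' * ξ →
      algebraMap A C (p z) + algebraMap A C (q z) * c =
        algebraMap A C p' + algebraMap A C q' * c := fun z p' q' e => by
    obtain ⟨h1, h2⟩ := H.eq_of_eq ((hpq z).symm.trans e)
    rw [h1, h2]
  refine ⟨{ toFun := fun z => algebraMap A C (p z) + algebraMap A C (q z) * c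
            map_one' := ?_, map_mul' := ?_, map_zero' := ?_, map_add' := ?_, commutes' := ?_ }, ?_⟩
  · refine (key 1 1 0 (by simp)).trans (by simp)
  · intro x y
    refine (key (x * y) (p x * p y + q x * q y * h) (p x * q y + q x * p y) ?_).trans ?_
    · conv_lhs => rw [hpq x, hpq y]
      simp only [map_add, map_mul, ← H.sq]
      ring
    · simp only [map_add, map_mul, ← hc]
      ring
  · refine (key 0 0 0 (by simp)).trans (by simp)
  · intro x y
    refine (key (x + y) (p x + p y) (q x + q y) ?_).trans ?_
    · conv_lhs => rw [hpq x, hpq y]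
      simp only [map_add]
      ring
    · simp only [map_add]
      ring
  · intro r
    refine (key (algebraMap A A' r) r 0 (by simp)).trans (by simp)
  · exact (key ξ 0 1 (by simp)).trans (by simp)

theorem hom_ext (H : IsQuadratic h ξ) {C : Type} [CommRing C] {φ ψ : A' →+* C}
    (h1 : φ.comp (algebraMap A A') = ψ.comp (algebraMap A A')) (h2 : φ ξ = ψ ξ) : φ = ψ := by
  ext z
  obtain ⟨p, q, rfl⟩ := H.exists_eq z
  have := fun a => RingHom.congr_fun h1 a
  simp only [RingHom.comp_apply] at this
  simp [this, h2]

end IsQuadratic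

/-- The ring `A[ξ]/(ξ² - c)`. -/
abbrev SqrtAlg {A : Type} [CommRing A] (c : A) : Type :=
  AdjoinRoot (Polynomial.X ^ 2 - Polynomial.C c : A[X])

namespace SqrtAlg

variable {A : Type} [CommRing A] (c : A)

theorem monic : (Polynomial.X ^ 2 - Polynomial.C c : A[X]).Monic :=
  Polynomial.monic_X_pow_sub_C c two_ne_zero

theorem root_sq : (AdjoinRoot.root _ : SqrtAlg c) ^ 2 = algebraMap A (SqrtAlg c) c := by
  have := AdjoinRoot.eval₂_root (Polynomial.X ^ 2 - Polynomial.C c : A[X])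
  simp only [Polynomial.eval₂_sub, Polynomial.eval₂_pow, Polynomial.eval₂_X,
    Polynomial.eval₂_C] at this
  exact sub_eq_zero.mp this

instance : Module.Free A (SqrtAlg c) := (monic c).free_adjoinRoot

theorem isQuadratic : IsQuadratic c (AdjoinRoot.root _ : SqrtAlg c) where
  sq := root_sq c
  exists_unique z := by
    rcases subsingleton_or_nontrivial A with hA | hA
    · have : Subsingleton (SqrtAlg c) := Module.subsingleton A _
      exact ⟨(0, 0), Subsingleton.elim _ _, fun _ _ => Subsingleton.elim _ _⟩
    have hdeg : (Polynomial.X ^ 2 - Polynomial.C c : A[X]).natDegree = 2 :=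
      Polynomial.natDegree_X_pow_sub_C
    have key : ∀ p q : A, algebraMap A (SqrtAlg c) p + algebraMap A (SqrtAlg c) q *
        AdjoinRoot.root _ = AdjoinRoot.mk _ (Polynomial.C p + Polynomial.C q * Polynomial.X) := by
      intro p q
      simp [AdjoinRoot.algebraMap_eq]
    obtain ⟨g, rfl⟩ := AdjoinRoot.mk_surjective z
    have hlt := Polynomial.natDegree_modByMonic_lt g (monic c) (by
      intro h; rw [h] at hdeg; simp at hdeg)
    rw [hdeg] at hlt
    have hg := Polynomial.eq_X_add_C_of_natDegree_le_one (Nat.lt_succ_iff.mp hlt)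
    refine ⟨⟨(g %ₘ (Polynomial.X ^ 2 - Polynomial.C c)).coeff 0,
      (g %ₘ (Polynomial.X ^ 2 - Polynomial.C c)).coeff 1⟩, ?_, ?_⟩
    · dsimp only
      rw [key, add_comm, ← hg]
      exact (AdjoinRoot.mk_leftInverse (monic c) (AdjoinRoot.mk _ g)).symm.trans
        (by rw [AdjoinRoot.modByMonicHom_mk])
    · rintro ⟨p, q⟩ h
      dsimp only at h
      rw [key] at h
      have h2 := congrArg (AdjoinRoot.modByMonicHom (monic c)) h
      rw [AdjoinRoot.modByMonicHom_mk, AdjoinRoot.modByMonicHom_mk,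
        (Polynomial.modByMonic_eq_self_iff (monic c) (p := Polynomial.C p + _)).mpr] at h2
      · rw [h2]; simp
      · rw [Polynomial.degree_eq_natDegree (monic c).ne_zero, hdeg]
        refine lt_of_le_of_lt (b := 1) ?_ (by norm_num)
        compute_degree

end SqrtAlg

/-! ### Presented algebras -/

section Presented

variable {τ A : Type} [CommRing A] {S : Set (MvPolynomial τ A)}

theorem exists_presentedHom {C : Type} [CommRing C] [Algebra A C] (e : τ → C)
    (he : ∀ p ∈ S, MvPolynomial.aeval e p = 0) :
    ∃ φ : (MvPolynomial τ A ⧸ Ideal.span S) →ₐ[A] C,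
      ∀ i, φ (Ideal.Quotient.mk _ (MvPolynomial.X i)) = e i := by
  refine ⟨{ Ideal.Quotient.lift _ (MvPolynomial.aeval e).toRingHom fun a ha => ?_ with
    commutes' := fun a => (Ideal.Quotient.lift_mk _ _ _).trans (MvPolynomial.aeval_C e a) },
    fun i => (Ideal.Quotient.lift_mk _ _ _).trans (MvPolynomial.aeval_X e i)⟩
  have : Ideal.span S ≤ RingHom.ker (MvPolynomial.aeval (R := A) e).toRingHom :=
    Ideal.span_le.mpr fun p hp => he p hp
  exact this ha

theorem presentedHom_ext {C : Type} [CommRing C] [Algebra A C]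
    {φ ψ : (MvPolynomial τ A ⧸ Ideal.span S) →ₐ[A] C}
    (h : ∀ i, φ (Ideal.Quotient.mk _ (MvPolynomial.X i)) =
      ψ (Ideal.Quotient.mk _ (MvPolynomial.X i))) : φ = ψ := by
  refine Ideal.Quotient.algHom_ext _ (MvPolynomial.algHom_ext fun i => h i)

theorem presented_rel {p q : MvPolynomial τ A} (h : p - q ∈ S) :
    (Ideal.Quotient.mk (Ideal.span S) p) = Ideal.Quotient.mk _ q :=
  Ideal.Quotient.eq.mpr (Ideal.subset_span h)

end Presented

/-! ### Charts of the total space of a blow-up -/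

/-- The ring `P[w]/(w s - u, w a - v)`. -/
abbrev ConeChart {P : Type} [CommRing P] (u v s a : P) : Type :=
  P[X] ⧸ (Ideal.span {Polynomial.X * Polynomial.C s - Polynomial.C u,
    Polynomial.X * Polynomial.C a - Polynomial.C v} : Ideal P[X])

namespace ConeChart

variable {P : Type} [CommRing P] {u v : P} (s a : P)

theorem nzd (h : KoszulExact u v) :
    (Ideal.Quotient.mk _ Polynomial.X : ConeChart u v s a) ∈ nonZeroDivisors _ := by
  refine mem_nonZeroDivisors_quotient fun p hp => ?_
  obtain ⟨F, G, hFG⟩ := Ideal.mem_span_pair.mp hp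
  obtain ⟨F', hF⟩ : ∃ F', F = Polynomial.X * F' + Polynomial.C (F.coeff 0) :=
    ⟨_, (Polynomial.X_mul_divX_add F).symm⟩
  obtain ⟨G', hG⟩ : ∃ G', G = Polynomial.X * G' + Polynomial.C (G.coeff 0) :=
    ⟨_, (Polynomial.X_mul_divX_add G).symm⟩
  obtain ⟨c, h1, h2⟩ := h (F.coeff 0) (-G.coeff 0) (by
    have := congrArg (Polynomial.coeff · 0) hFG
    simp [Polynomial.mul_coeff_zero] at this
    linear_combination -this)
  have h2' : G.coeff 0 = -(u * c) := by rw [← h2, neg_neg]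
  rw [h1] at hF
  rw [h2'] at hG
  refine Ideal.mem_span_pair.mpr ⟨F' + Polynomial.C (c * a), G' - Polynomial.C (c * s), ?_⟩
  have key : ∀ q : P[X], Polynomial.X * q = 0 → q = 0 := fun q hq => by
    ext n
    have := congrArg (Polynomial.coeff · (n + 1)) hq
    simpa using this
  refine sub_eq_zero.mp (key _ ?_)
  rw [mul_sub, ← hFG]
  conv_rhs => rw [← sub_self (Polynomial.X * p), ← hFG]
  rw [hF, hG]
  simp only [Polynomial.C_mul, Polynomial.C_neg]
  ring

end ConeChart

section Retract

variable {A A' : Type} [CommRing A] [CommRing A'] [Algebra A A'] {σ a₁ a₂₂ : A} {ξ₀ : A'}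

/-- Over a quadratic extension, a ring with a coordinate `w` that is a retract of a cone chart has
`w` as a non-zero-divisor. -/
theorem mem_nonZeroDivisors_of_retract
    (H : IsQuadratic (a₁ ^ 2 + 4 * σ ^ 2 * a₂₂) ξ₀) (hK : KoszulExact σ a₁)
    {P : Type} [CommRing P] [Algebra A P] [Module.Flat A P] {s a ξ : P}
    (hξ : ξ ^ 2 = a ^ 2 + 4 * s ^ 2 * algebraMap A P a₂₂)
    {R : Type} [CommRing R] [Algebra A' R] [Algebra A R] [IsScalarTower A A' R]
    (θ : P →ₐ[A] R) {w : R} (hs : w * θ s = algebraMap A R σ) (ha : w * θ a = algebraMap A R a₁)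
    (hw : w * θ ξ = algebraMap A' R ξ₀)
    (hφ : ∀ (Q : Type) [CommRing Q] [Algebra A' Q] (i : P →+* Q) (x : Q),
      (∀ r, i (algebraMap A P r) = algebraMap A' Q (algebraMap A A' r)) →
      x * i s = algebraMap A' Q (algebraMap A A' σ) →
      x * i a = algebraMap A' Q (algebraMap A A' a₁) → x * i ξ = algebraMap A' Q ξ₀ →
      ∃ φ : R →ₐ[A'] Q, φ w = x ∧ ∀ χ : Q →ₐ[A'] R, (∀ p, χ (i p) = θ p) → χ x = w →
        χ.comp φ = AlgHom.id A' R) :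
    w ∈ nonZeroDivisors R := by
  let Q := ConeChart (algebraMap A P σ) (algebraMap A P a₁) s a
  let i : P →+* Q := (Ideal.Quotient.mk _).comp Polynomial.C
  let x : Q := Ideal.Quotient.mk _ Polynomial.X
  have hx1 : x * i s = algebraMap A Q σ :=
    Ideal.Quotient.eq.mpr (Ideal.subset_span (Or.inl rfl))
  have hx2 : x * i a = algebraMap A Q a₁ :=
    Ideal.Quotient.eq.mpr (Ideal.subset_span (Or.inr rfl))
  have hi : ∀ r, i (algebraMap A P r) = algebraMap A Q r := fun r => rfl
  obtain ⟨g, hg⟩ := H.exists_lift (x * i ξ) (by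
    simp only [map_add, map_mul, map_pow, map_ofNat, ← hx1, ← hx2]
    have h1 := congrArg i hξ
    simp only [map_add, map_mul, map_pow, map_ofNat, hi] at h1
    linear_combination x ^ 2 * h1)
  let algQ : Algebra A' Q := g.toRingHom.toAlgebra
  have hgA : ∀ r, algebraMap A' Q (algebraMap A A' r) = algebraMap A Q r := g.commutes
  obtain ⟨φ, h1, h2⟩ := hφ Q i x (fun r => (hgA r).symm) (by rw [hgA, hx1]) (by rw [hgA, hx2])
    hg.symm
  let χ₀ : Q →+* R := Ideal.Quotient.lift _ (Polynomial.eval₂RingHom θ.toRingHom w) fun p hp => by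
    refine (show Ideal.span _ ≤ RingHom.ker (Polynomial.eval₂RingHom θ.toRingHom w) from
      Ideal.span_le.mpr ?_) hp
    rintro _ (rfl | rfl)
    · simp [RingHom.mem_ker, mul_comm (θ s), hs]
    · simp [RingHom.mem_ker, mul_comm (θ a), ha]
  have hχi : ∀ p, χ₀ (i p) = θ p := fun p =>
    (Ideal.Quotient.lift_mk _ _ _).trans (Polynomial.eval₂_C _ _)
  have hχx : χ₀ x = w := (Ideal.Quotient.lift_mk _ _ _).trans (Polynomial.eval₂_X _ _)
  have hχ : χ₀.comp (algebraMap A' Q) = algebraMap A' R := by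
    refine H.hom_ext ?_ ?_
    · ext r
      simp only [RingHom.comp_apply, hgA, ← hi, hχi, θ.commutes]
      exact IsScalarTower.algebraMap_apply A A' R r
    · simp only [RingHom.comp_apply]
      rw [show algebraMap A' Q ξ₀ = x * i ξ from hg, map_mul, hχx, hχi, hw]
  have h3 := h2 { χ₀ with commutes' := RingHom.congr_fun hχ } hχi hχx
  rw [mem_nonZeroDivisors_iff_left]
  intro r hr
  have h4 : x * φ r = 0 := by rw [← h1, ← map_mul, hr, map_zero]
  have h5 := (mul_cancel_left_mem_nonZeroDivisors
    (ConeChart.nzd (P := P) s a (hK.of_flat (P := P)))).mp (h4.trans (mul_zero _).symm)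
  have h6 := AlgHom.congr_fun h3 r
  rw [AlgHom.comp_apply, h5, map_zero] at h6
  exact h6.symm

end Retract

/-! ### Double covers of charts -/

theorem isRingChart_double {A A' S R K K' : Type} [CommRing A] [CommRing A'] [CommRing S]
    [CommRing R] [Algebra A A'] [Algebra A S] [Algebra A R] [Algebra A' R] [Algebra S R]
    [IsScalarTower A A' R] [IsScalarTower A S R] {h : A} {ξ₀ : A'} (H : IsQuadratic h ξ₀)
    {c : S} {r : R} (HS : IsQuadratic c r) {f : K → A} {k : K} (hS : IsRingChart f k S)
    {f' : K' → A'} {k' : K'} (hk : f' k' = algebraMap A A' (f k))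
    (hf : ∀ l, ∃ l', f' l' = algebraMap A A' (f l)) (hξ : ∃ l', f' l' = ξ₀)
    (hf' : ∀ l', f' l' = ξ₀ ∨ ∃ l, f' l' = algebraMap A A' (f l))
    (hc : algebraMap A S h = algebraMap A S (f k) ^ 2 * c)
    (hr : algebraMap A' R ξ₀ = algebraMap A R (f k) * r)
    (hnzd : algebraMap A R (f k) ∈ nonZeroDivisors R) : IsRingChart f' k' R where
  nzd := by
    rwa [hk, ← IsScalarTower.algebraMap_apply A A' R]
  dvd l' := by
    rw [hk, ← IsScalarTower.algebraMap_apply A A' R]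
    obtain h1 | ⟨l, h1⟩ := hf' l'
    · rw [h1, hr]; exact Dvd.intro _ rfl
    · rw [h1, ← IsScalarTower.algebraMap_apply A A' R, IsScalarTower.algebraMap_apply A S R,
        IsScalarTower.algebraMap_apply A S R]
      exact map_dvd _ (hS.dvd l)
  exists_hom C _ _ h1 h2 := by
    let : Algebra A C := ((algebraMap A' C).comp (algebraMap A A')).toAlgebra
    have hA : ∀ x, algebraMap A' C (algebraMap A A' x) = algebraMap A C x := fun x => rfl
    rw [hk, hA] at h1 h2
    obtain ⟨g⟩ := hS.exists_hom C h1 fun l => by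
      obtain ⟨l', hl'⟩ := hf l
      have := h2 l'
      rwa [hl', hA] at this
    obtain ⟨e, he⟩ : algebraMap A C (f k) ∣ algebraMap A' C ξ₀ := by
      obtain ⟨l', hl'⟩ := hξ
      exact hl' ▸ h2 l'
    let : Algebra S C := g.toRingHom.toAlgebra
    have hgA : ∀ x, algebraMap S C (algebraMap A S x) = algebraMap A C x := g.commutes
    obtain ⟨χ, hχ⟩ := HS.exists_lift e (by
      refine (mul_cancel_left_mem_nonZeroDivisors (pow_mem h1 2)).mp ?_
      rw [← mul_pow, ← he, ← map_pow, H.sq, hA, ← hgA, hc, map_mul, map_pow, hgA])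
    refine ⟨{ χ.toRingHom with commutes' := RingHom.congr_fun (H.hom_ext
      (φ := χ.toRingHom.comp (algebraMap A' R)) (ψ := algebraMap A' C) ?_ ?_) }⟩
    · ext x
      change χ (algebraMap A' R (algebraMap A A' x)) = _
      rw [← IsScalarTower.algebraMap_apply A A' R, IsScalarTower.algebraMap_apply A S R,
        χ.commutes, hgA]
      rfl
    · change χ (algebraMap A' R ξ₀) = _
      rw [hr, map_mul, hχ, IsScalarTower.algebraMap_apply A S R, χ.commutes, hgA, he]
  hom_ext C _ _ φ ψ h1 := by
    let : Algebra A C := ((algebraMap A' C).comp (algebraMap A A')).toAlgebra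
    have hA : ∀ x, algebraMap A' C (algebraMap A A' x) = algebraMap A C x := fun x => rfl
    have hφA : ∀ (φ : R →ₐ[A'] C) (x : A), φ (algebraMap A R x) = algebraMap A C x := fun φ x => by
      rw [IsScalarTower.algebraMap_apply A A' R, φ.commutes]; rfl
    have hφ : ∀ (φ : R →ₐ[A'] C) x,
        φ.toRingHom.comp (algebraMap S R) (algebraMap A S x) = algebraMap A C x := fun φ x => by
      change φ (algebraMap S R (algebraMap A S x)) = _
      rw [← IsScalarTower.algebraMap_apply A S R, hφA]
    rw [hk, hA] at h1
    have h2 := hS.hom_ext C { φ.toRingHom.comp (algebraMap S R) with commutes' := hφ φ }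
      { ψ.toRingHom.comp (algebraMap S R) with commutes' := hφ ψ } h1
    have h3 : φ.toRingHom = ψ.toRingHom := by
      refine HS.hom_ext (RingHom.ext fun x => AlgHom.congr_fun h2 x) ?_
      refine (mul_cancel_left_mem_nonZeroDivisors h1).mp ?_
      change _ * φ r = _ * ψ r
      conv_lhs => rw [← hφA φ, ← map_mul, ← hr, φ.commutes]
      rw [← hφA ψ, ← map_mul, ← hr, ψ.commutes]
    exact AlgHom.ext fun x => RingHom.congr_fun h3 x

/-! ### The charts in homogeneous coordinates -/

section Base

variable {A : Type} [CommRing A] {σ a₁ : A}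

theorem resBaseCoord_self (k : Fin 2) : resBaseCoord σ a₁ k k = 1 :=
  presented_rel (by simp)

theorem resBase_cone (k l : Fin 2) :
    (Ideal.Quotient.mk _ (MvPolynomial.X 2) * resBaseCoord σ a₁ k l : ResBaseChart σ a₁ k) =
      algebraMap A _ (![σ, a₁] l) := by
  refine presented_rel (p := MvPolynomial.X 2 * MvPolynomial.X l.castSucc) (q := MvPolynomial.C _) ?_
  fin_cases l <;> simp

theorem resBase_w (k : Fin 2) :
    (Ideal.Quotient.mk _ (MvPolynomial.X 2) : ResBaseChart σ a₁ k) =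
      algebraMap A _ (![σ, a₁] k) := by
  rw [← resBase_cone, resBaseCoord_self, mul_one]

theorem resBaseCoord_mul (k l : Fin 2) :
    algebraMap A (ResBaseChart σ a₁ k) (![σ, a₁] l) =
      algebraMap A (ResBaseChart σ a₁ k) (![σ, a₁] k) * resBaseCoord σ a₁ k l := by
  rw [← resBase_w k, resBase_cone]

theorem resBase_exists_hom (k : Fin 2) {C : Type} [CommRing C] [Algebra A C] (e : Fin 2 → C)
    (he : ∀ l, algebraMap A C (![σ, a₁] l) = algebraMap A C (![σ, a₁] k) * e l) (hk : e k = 1) :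
    ∃ φ : ResBaseChart σ a₁ k →ₐ[A] C, ∀ l, φ (resBaseCoord σ a₁ k l) = e l := by
  obtain ⟨φ, hφ⟩ := exists_presentedHom (S := {MvPolynomial.X 2 * MvPolynomial.X 0 - MvPolynomial.C σ,
    MvPolynomial.X 2 * MvPolynomial.X 1 - MvPolynomial.C a₁,
    MvPolynomial.X k.castSucc - 1}) (![e 0, e 1, algebraMap A C (![σ, a₁] k)] : Fin 3 → C) (by
      rintro _ (rfl | rfl | rfl)
      · simp [← he 0]
      · simp [← he 1]
      · fin_cases k <;> simpa using sub_eq_zero.mpr hk)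
  refine ⟨φ, fun l => (hφ _).trans ?_⟩
  fin_cases l <;> rfl

theorem resBase_hom_ext {k : Fin 2} {C : Type} [CommRing C] [Algebra A C]
    {φ ψ : ResBaseChart σ a₁ k →ₐ[A] C}
    (h : ∀ l, φ (resBaseCoord σ a₁ k l) = ψ (resBaseCoord σ a₁ k l)) : φ = ψ := by
  refine presentedHom_ext fun i => ?_
  fin_cases i
  · exact h 0
  · exact h 1
  · exact (congrArg φ (resBase_w k)).trans ((φ.commutes _).trans
      ((congrArg ψ (resBase_w k)).trans (ψ.commutes _)).symm)

theorem resBase_nzd (h : KoszulExact σ a₁) (k : Fin 2) :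
    algebraMap A (ResBaseChart σ a₁ k) (![σ, a₁] k) ∈ nonZeroDivisors _ := by
  have key : ∀ (u v : A), KoszulExact u v → u = ![σ, a₁] k → ∀ (φ : ResBaseChart σ a₁ k →ₐ[A]
      SlopeChart u v) (ψ : SlopeChart u v →ₐ[A] ResBaseChart σ a₁ k),
      (∀ l, ψ (φ (resBaseCoord σ a₁ k l)) = resBaseCoord σ a₁ k l) →
      algebraMap A (ResBaseChart σ a₁ k) (![σ, a₁] k) ∈ nonZeroDivisors _ := by
    intro u v huv hu φ ψ hψ
    have h1 : ψ.comp φ = AlgHom.id A _ := resBase_hom_ext hψ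
    rw [mem_nonZeroDivisors_iff_left]
    intro r hr
    have h2 := congrArg φ hr
    rw [map_mul, φ.commutes, map_zero, ← hu] at h2
    have h3 := (mul_cancel_left_mem_nonZeroDivisors (SlopeChart.nzd huv)).mp
      (h2.trans (mul_zero _).symm)
    have h4 := AlgHom.congr_fun h1 r
    rw [AlgHom.comp_apply, h3, map_zero] at h4
    exact h4.symm
  have h0 := fun k => resBaseCoord_mul (σ := σ) (a₁ := a₁) k
  fin_cases k
  · obtain ⟨φ, hφ⟩ := resBase_exists_hom (σ := σ) (a₁ := a₁) 0 (![1, SlopeChart.t σ a₁]) (by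
      intro l
      fin_cases l
      · exact (mul_one _).symm
      · exact (SlopeChart.algebraMap_mul_t σ a₁).symm) rfl
    refine key σ a₁ h rfl φ (SlopeChart.lift (resBaseCoord σ a₁ 0 1) (h0 0 1).symm) fun l => ?_
    refine (congrArg _ (hφ l)).trans ?_
    fin_cases l
    · exact (map_one _).trans (resBaseCoord_self 0).symm
    · exact SlopeChart.lift_t _ _
  · obtain ⟨φ, hφ⟩ := resBase_exists_hom (σ := σ) (a₁ := a₁) 1 (![SlopeChart.t a₁ σ, 1]) (by
      intro l
      fin_cases l
      · exact (SlopeChart.algebraMap_mul_t a₁ σ).symm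
      · exact (mul_one _).symm) rfl
    refine key a₁ σ h.symm rfl φ (SlopeChart.lift (resBaseCoord σ a₁ 1 0) (h0 1 0).symm) fun l => ?_
    refine (congrArg _ (hφ l)).trans ?_
    fin_cases l
    · exact SlopeChart.lift_t _ _
    · exact (map_one _).trans (resBaseCoord_self 1).symm

theorem isRingChart_resBase (h : KoszulExact σ a₁) (k : Fin 2) :
    IsRingChart ![σ, a₁] k (ResBaseChart σ a₁ k) where
  nzd := resBase_nzd h k
  dvd l := ⟨_, resBaseCoord_mul k l⟩
  exists_hom C _ _ h1 h2 := by
    choose e he using h2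
    obtain ⟨φ, -⟩ := resBase_exists_hom k e he
      ((mul_cancel_left_mem_nonZeroDivisors h1).mp (by rw [← he, mul_one]))
    exact ⟨φ⟩
  hom_ext C _ _ φ ψ h1 := by
    refine resBase_hom_ext fun l => (mul_cancel_left_mem_nonZeroDivisors h1).mp ?_
    have key : ∀ χ : ResBaseChart σ a₁ k →ₐ[A] C, algebraMap A C (![σ, a₁] k) *
        χ (resBaseCoord σ a₁ k l) = algebraMap A C (![σ, a₁] l) := fun χ => by
      rw [← χ.commutes, ← map_mul, ← resBaseCoord_mul, χ.commutes]
    rw [key, key]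

end Base

/-- A flat algebra with elements `x`, `r` such that `r² = c(x)`, with a given value. -/
theorem exists_flat_sqrt {A : Type} [CommRing A] (c : A[X]) {R : Type} [CommRing R] [Algebra A R]
    {y z : R} (h : z ^ 2 = Polynomial.aeval y c) :
    ∃ (P : Type) (_ : CommRing P) (_ : Algebra A P) (_ : Module.Flat A P) (x r : P)
      (θ : P →ₐ[A] R), r ^ 2 = Polynomial.aeval x c ∧ θ x = y ∧ θ r = z := by
  let := (Polynomial.aeval (R := A) y).toRingHom.toAlgebra
  obtain ⟨χ, hχ⟩ := (SqrtAlg.isQuadratic c).exists_lift z h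
  refine ⟨SqrtAlg c, inferInstance, inferInstance, Module.Flat.trans A A[X] _,
    algebraMap A[X] _ Polynomial.X, AdjoinRoot.root _,
    { χ.toRingHom with
      commutes' := fun r => (χ.commutes _).trans ((Polynomial.aeval (R := A) y).commutes r) },
    ?_, (χ.commutes _).trans (Polynomial.aeval_X _), hχ⟩
  rw [SqrtAlg.root_sq, Polynomial.aeval_algebraMap_apply, Polynomial.aeval_X_left_apply]

section ResSpp

variable {A' : Type} [CommRing A'] {σ a₁ a₂₂ ξ₀ : A'}

theorem resSppCoord_self (k : Fin 3) : resSppCoord σ a₁ a₂₂ ξ₀ k k = 1 :=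
  presented_rel (by simp)

theorem resSpp_cone (k l : Fin 3) :
    (Ideal.Quotient.mk _ (MvPolynomial.X 3) * resSppCoord σ a₁ a₂₂ ξ₀ k l :
      ResSppChart σ a₁ a₂₂ ξ₀ k) = algebraMap A' _ (![σ, a₁, ξ₀] l) := by
  refine presented_rel (p := MvPolynomial.X 3 * MvPolynomial.X l.castSucc)
    (q := MvPolynomial.C _) ?_
  fin_cases l <;> simp

theorem resSpp_w (k : Fin 3) :
    (Ideal.Quotient.mk _ (MvPolynomial.X 3) : ResSppChart σ a₁ a₂₂ ξ₀ k) =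
      algebraMap A' _ (![σ, a₁, ξ₀] k) := by
  rw [← resSpp_cone, resSppCoord_self, mul_one]

theorem resSppCoord_mul (k l : Fin 3) :
    algebraMap A' (ResSppChart σ a₁ a₂₂ ξ₀ k) (![σ, a₁, ξ₀] l) =
      algebraMap A' (ResSppChart σ a₁ a₂₂ ξ₀ k) (![σ, a₁, ξ₀] k) *
        resSppCoord σ a₁ a₂₂ ξ₀ k l := by
  rw [← resSpp_w k, resSpp_cone]

theorem resSppCoord_sq (k : Fin 3) :
    resSppCoord σ a₁ a₂₂ ξ₀ k 2 ^ 2 = resSppCoord σ a₁ a₂₂ ξ₀ k 1 ^ 2 +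
      4 * resSppCoord σ a₁ a₂₂ ξ₀ k 0 ^ 2 * algebraMap A' _ a₂₂ :=
  presented_rel (p := MvPolynomial.X 2 ^ 2) (q := MvPolynomial.X 1 ^ 2 +
    4 * MvPolynomial.X 0 ^ 2 * MvPolynomial.C a₂₂) (Or.inl rfl)

theorem resSpp_exists_hom (k : Fin 3) {C : Type} [CommRing C] [Algebra A' C] (e : Fin 3 → C) (w : C)
    (he : ∀ l, algebraMap A' C (![σ, a₁, ξ₀] l) = w * e l)
    (hsq : e 2 ^ 2 = e 1 ^ 2 + 4 * e 0 ^ 2 * algebraMap A' C a₂₂) (hk : e k = 1) :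
    ∃ φ : ResSppChart σ a₁ a₂₂ ξ₀ k →ₐ[A'] C, ∀ l, φ (resSppCoord σ a₁ a₂₂ ξ₀ k l) = e l := by
  obtain ⟨φ, hφ⟩ := exists_presentedHom (S := {MvPolynomial.X 2 ^ 2 - (MvPolynomial.X 1 ^ 2 +
        4 * MvPolynomial.X 0 ^ 2 * MvPolynomial.C a₂₂),
      MvPolynomial.X 3 * MvPolynomial.X 0 - MvPolynomial.C σ,
      MvPolynomial.X 3 * MvPolynomial.X 1 - MvPolynomial.C a₁,
      MvPolynomial.X 3 * MvPolynomial.X 2 - MvPolynomial.C ξ₀,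
      MvPolynomial.X k.castSucc - 1}) (![e 0, e 1, e 2, w] : Fin 4 → C) (by
      rintro _ (rfl | rfl | rfl | rfl | rfl)
      · simp [hsq]
      · simp [← he 0]
      · simp [← he 1]
      · simp [← he 2]
      · fin_cases k <;> simpa using sub_eq_zero.mpr hk)
  refine ⟨φ, fun l => (hφ _).trans ?_⟩
  fin_cases l <;> rfl

theorem resSpp_hom_ext {k : Fin 3} {C : Type} [CommRing C] [Algebra A' C]
    {φ ψ : ResSppChart σ a₁ a₂₂ ξ₀ k →ₐ[A'] C}
    (h : ∀ l, φ (resSppCoord σ a₁ a₂₂ ξ₀ k l) = ψ (resSppCoord σ a₁ a₂₂ ξ₀ k l)) : φ = ψ := by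
  refine presentedHom_ext fun i => ?_
  fin_cases i
  · exact h 0
  · exact h 1
  · exact h 2
  · exact (congrArg φ (resSpp_w k)).trans ((φ.commutes _).trans
      ((congrArg ψ (resSpp_w k)).trans (ψ.commutes _)).symm)

theorem resSpp_nzd_of_retract {A : Type} [CommRing A] [Algebra A A'] {σ a₁ a₂₂ : A}
    (H : IsQuadratic (a₁ ^ 2 + 4 * σ ^ 2 * a₂₂) ξ₀) (hK : KoszulExact σ a₁) (k : Fin 3)
    {P : Type} [CommRing P] [Algebra A P] [Module.Flat A P] (e : Fin 3 → P) (hk : e k = 1)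
    (hsq : e 2 ^ 2 = e 1 ^ 2 + 4 * e 0 ^ 2 * algebraMap A P a₂₂)
    (θ : P →ₐ[A] ResSppChart (algebraMap A A' σ) (algebraMap A A' a₁) (algebraMap A A' a₂₂) ξ₀ k)
    (hθ : ∀ l, θ (e l) = resSppCoord _ _ _ _ k l) :
    algebraMap A' (ResSppChart (algebraMap A A' σ) (algebraMap A A' a₁) (algebraMap A A' a₂₂) ξ₀ k)
      (![algebraMap A A' σ, algebraMap A A' a₁, ξ₀] k) ∈ nonZeroDivisors _ := by
  refine mem_nonZeroDivisors_of_retract H hK hsq θ ?_ ?_ ?_ ?_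
  · rw [hθ, ← resSppCoord_mul]
    exact (IsScalarTower.algebraMap_apply A A' _ _).symm
  · rw [hθ, ← resSppCoord_mul]
    exact (IsScalarTower.algebraMap_apply A A' _ _).symm
  · rw [hθ, ← resSppCoord_mul]
    rfl
  · intro Q _ _ i x hA h0 h1 h2
    obtain ⟨φ, hφ⟩ := resSpp_exists_hom (σ := algebraMap A A' σ) (a₁ := algebraMap A A' a₁)
      (a₂₂ := algebraMap A A' a₂₂) (ξ₀ := ξ₀) k (fun l => i (e l)) x (by
        intro l
        fin_cases l
        · exact h0.symm
        · exact h1.symm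
        · exact h2.symm) (by
        have := congrArg i hsq
        simpa only [map_add, map_mul, map_pow, map_ofNat, hA] using this) (by
        simp only [hk, map_one])
    refine ⟨φ, ?_, fun χ hχ _ => resSpp_hom_ext fun l => ?_⟩
    · rw [φ.commutes]
      have : ∀ l, algebraMap A' Q (![algebraMap A A' σ, algebraMap A A' a₁, ξ₀] l) = x * i (e l) := by
        intro l
        fin_cases l
        · exact h0.symm
        · exact h1.symm
        · exact h2.symm
      rw [this, hk, map_one, mul_one]
    · rw [AlgHom.comp_apply, hφ, hχ, hθ]
      rfl

theorem resSpp_nzd {A : Type} [CommRing A] [Algebra A A'] {σ a₁ a₂₂ : A}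
    (H : IsQuadratic (a₁ ^ 2 + 4 * σ ^ 2 * a₂₂) ξ₀) (hK : KoszulExact σ a₁) (k : Fin 3) :
    algebraMap A' (ResSppChart (algebraMap A A' σ) (algebraMap A A' a₁) (algebraMap A A' a₂₂) ξ₀ k)
      (![algebraMap A A' σ, algebraMap A A' a₁, ξ₀] k) ∈ nonZeroDivisors _ := by
  have key : ∀ (c : A[X]) (i j : Fin 3),
      resSppCoord (algebraMap A A' σ) (algebraMap A A' a₁) (algebraMap A A' a₂₂) ξ₀ k j ^ 2 =
        Polynomial.aeval (resSppCoord (algebraMap A A' σ) (algebraMap A A' a₁)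
          (algebraMap A A' a₂₂) ξ₀ k i) c →
      ∃ (P : Type) (_ : CommRing P) (_ : Algebra A P) (_ : Module.Flat A P) (x r : P)
        (θ : P →ₐ[A] ResSppChart (algebraMap A A' σ) (algebraMap A A' a₁)
          (algebraMap A A' a₂₂) ξ₀ k), r ^ 2 = Polynomial.aeval x c ∧
        θ x = resSppCoord _ _ _ _ k i ∧ θ r = resSppCoord _ _ _ _ k j :=
    fun c i j h => exists_flat_sqrt c h
  have hself := resSppCoord_self (σ := algebraMap A A' σ) (a₁ := algebraMap A A' a₁)
    (a₂₂ := algebraMap A A' a₂₂) (ξ₀ := ξ₀) k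
  have hsq := resSppCoord_sq (σ := algebraMap A A' σ) (a₁ := algebraMap A A' a₁)
    (a₂₂ := algebraMap A A' a₂₂) (ξ₀ := ξ₀) k
  have hC' : algebraMap A (ResSppChart (algebraMap A A' σ) (algebraMap A A' a₁)
      (algebraMap A A' a₂₂) ξ₀ k) (4 * a₂₂) = 4 * algebraMap A' _ (algebraMap A A' a₂₂) := by
    rw [map_mul, map_ofNat]
    rfl
  fin_cases k
  · obtain ⟨P, _, _, _, x, r, θ, h0, h1, h2⟩ := key (Polynomial.X ^ 2 + Polynomial.C (4 * a₂₂)) 1 2 (by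
      refine hsq.trans ?_
      rw [show resSppCoord (algebraMap A A' σ) (algebraMap A A' a₁) (algebraMap A A' a₂₂) ξ₀
        _ 0 = 1 from hself]
      simp only [map_add, map_pow, Polynomial.aeval_X, Polynomial.aeval_C]
      rw [hC', one_pow, mul_one])
    refine resSpp_nzd_of_retract H hK 0 ![1, x, r] rfl ?_ θ ?_
    · refine h0.trans ?_
      simp [map_ofNat (algebraMap A P)]
    · intro l
      fin_cases l
      · exact (map_one θ).trans hself.symm
      · exact h1
      · exact h2
  · obtain ⟨P, _, _, _, x, r, θ, h0, h1, h2⟩ :=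
        key (1 + Polynomial.X ^ 2 * Polynomial.C (4 * a₂₂)) 0 2 (by
      refine hsq.trans ?_
      rw [show resSppCoord (algebraMap A A' σ) (algebraMap A A' a₁) (algebraMap A A' a₂₂) ξ₀
        _ 1 = 1 from hself]
      simp only [map_add, map_mul, map_one, map_pow, Polynomial.aeval_X, Polynomial.aeval_C]
      rw [← map_mul, hC']
      ring)
    refine resSpp_nzd_of_retract H hK 1 ![x, 1, r] rfl ?_ θ ?_
    · refine h0.trans ?_
      simp [map_ofNat (algebraMap A P)]
      ring
    · intro l
      fin_cases l
      · exact h1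
      · exact (map_one θ).trans hself.symm
      · exact h2
  · obtain ⟨P, _, _, _, x, r, θ, h0, h1, h2⟩ :=
        key (1 - Polynomial.X ^ 2 * Polynomial.C (4 * a₂₂)) 0 1 (by
      rw [show resSppCoord (algebraMap A A' σ) (algebraMap A A' a₁) (algebraMap A A' a₂₂) ξ₀
        _ 2 = 1 from hself] at hsq
      simp only [map_sub, map_mul, map_one, map_pow, Polynomial.aeval_X, Polynomial.aeval_C]
      rw [← map_mul, hC']
      linear_combination -hsq)
    refine resSpp_nzd_of_retract H hK 2 ![x, r, 1] rfl ?_ θ ?_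
    · change (1 : P) ^ 2 = r ^ 2 + _
      rw [h0]
      simp [map_ofNat (algebraMap A P)]
      ring
    · intro l
      fin_cases l
      · exact h1
      · exact h2
      · exact (map_one θ).trans hself.symm

theorem isRingChart_resSpp {A : Type} [CommRing A] [Algebra A A'] {σ a₁ a₂₂ : A}
    (H : IsQuadratic (a₁ ^ 2 + 4 * σ ^ 2 * a₂₂) ξ₀) (hK : KoszulExact σ a₁) (k : Fin 3) :
    IsRingChart ![algebraMap A A' σ, algebraMap A A' a₁, ξ₀] k
      (ResSppChart (algebraMap A A' σ) (algebraMap A A' a₁) (algebraMap A A' a₂₂) ξ₀ k) where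
  nzd := resSpp_nzd H hK k
  dvd l := ⟨_, resSppCoord_mul k l⟩
  exists_hom C _ _ h1 h2 := by
    choose e he using h2
    obtain ⟨φ, -⟩ := resSpp_exists_hom (a₂₂ := algebraMap A A' a₂₂) k e _ he (by
        refine (mul_cancel_left_mem_nonZeroDivisors (pow_mem h1 2)).mp ?_
        have h3 := congrArg (algebraMap A' C) H.sq
        have e0 := he 0
        have e1 := he 1
        have e2 := he 2
        simp only [map_add, map_mul, map_pow, map_ofNat] at h3
        simp only [Matrix.cons_val_zero, Matrix.cons_val_one, Matrix.cons_val] at e0 e1 e2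
        rw [e0, e1, e2] at h3
        linear_combination h3)
      ((mul_cancel_left_mem_nonZeroDivisors h1).mp (by rw [← he, mul_one]))
    exact ⟨φ⟩
  hom_ext C _ _ φ ψ h1 := by
    refine resSpp_hom_ext fun l => (mul_cancel_left_mem_nonZeroDivisors h1).mp ?_
    have key : ∀ χ : ResSppChart (algebraMap A A' σ) (algebraMap A A' a₁) (algebraMap A A' a₂₂) ξ₀ k
        →ₐ[A'] C, algebraMap A' C (![algebraMap A A' σ, algebraMap A A' a₁, ξ₀] k) *
        χ (resSppCoord _ _ _ _ k l) =
          algebraMap A' C (![algebraMap A A' σ, algebraMap A A' a₁, ξ₀] l) := fun χ => by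
      rw [← χ.commutes, ← map_mul, ← resSppCoord_mul, χ.commutes]
    rw [key, key]

end ResSpp

section SmallRes

variable {A' : Type} [CommRing A'] {up um x z : A'}

/-- The generators of the ideal blown up by the small resolution. -/
def smallGen (up um x z : A') (k : Fin 2 × Fin 2) : A' := ![![x * z, up], ![um, x]] k.1 k.2

variable (up um x z) in
/-- The homogeneous coordinates `α₊, β₊` on a chart of the small resolution. -/
def smallP (k : Fin 2 × Fin 2) (i : Fin 2) : SmallResChart up um x z k :=
  Ideal.Quotient.mk _ (MvPolynomial.X (![0, 1] i))

variable (up um x z) in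
/-- The homogeneous coordinates `α₋, β₋` on a chart of the small resolution. -/
def smallM (k : Fin 2 × Fin 2) (i : Fin 2) : SmallResChart up um x z k :=
  Ideal.Quotient.mk _ (MvPolynomial.X (![2, 3] i))

theorem smallResCoord_eq (k l : Fin 2 × Fin 2) :
    smallResCoord up um x z k l = smallP up um x z k l.1 * smallM up um x z k l.2 := rfl

theorem smallP_self (k : Fin 2 × Fin 2) : smallP up um x z k k.1 = 1 :=
  presented_rel (by simp [plusIdx])

theorem smallM_self (k : Fin 2 × Fin 2) : smallM up um x z k k.2 = 1 :=
  presented_rel (by simp [minusIdx])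

theorem small_rel_plus (k : Fin 2 × Fin 2) :
    smallP up um x z k 1 * algebraMap A' _ up = algebraMap A' _ x * smallP up um x z k 0 :=
  presented_rel (p := MvPolynomial.X 1 * MvPolynomial.C up)
    (q := MvPolynomial.C x * MvPolynomial.X 0) (by simp)

theorem small_rel_minus (k : Fin 2 × Fin 2) :
    smallM up um x z k 1 * algebraMap A' _ um = algebraMap A' _ x * smallM up um x z k 0 :=
  presented_rel (p := MvPolynomial.X 3 * MvPolynomial.C um)
    (q := MvPolynomial.C x * MvPolynomial.X 2) (by simp)

theorem small_rel (k : Fin 2 × Fin 2) :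
    smallP up um x z k 0 * smallM up um x z k 0 =
      algebraMap A' _ z * smallP up um x z k 1 * smallM up um x z k 1 :=
  presented_rel (p := MvPolynomial.X 0 * MvPolynomial.X 2)
    (q := MvPolynomial.C z * MvPolynomial.X 1 * MvPolynomial.X 3) (by simp)

theorem smallResCoord_mul (k l : Fin 2 × Fin 2) :
    algebraMap A' (SmallResChart up um x z k) (smallGen up um x z l) =
      algebraMap A' _ (smallGen up um x z k) * smallResCoord up um x z k l := by
  rw [smallResCoord_eq]
  have h1 := smallP_self (up := up) (um := um) (x := x) (z := z) k
  have h2 := smallM_self (up := up) (um := um) (x := x) (z := z) k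
  have h3 := small_rel_plus (up := up) (um := um) (x := x) (z := z) k
  have h4 := small_rel_minus (up := up) (um := um) (x := x) (z := z) k
  have h5 := small_rel (up := up) (um := um) (x := x) (z := z) k
  generalize smallP up um x z k = p at *
  generalize smallM up um x z k = m at *
  have key : ∀ {R : Type} [CommRing R] (up um x z : R) (p m : Fin 2 → R), p k.1 = 1 → m k.2 = 1 →
      p 1 * up = x * p 0 → m 1 * um = x * m 0 → p 0 * m 0 = z * p 1 * m 1 →
      smallGen up um x z l = smallGen up um x z k * (p l.1 * m l.2) := by
    clear h1 h2 h3 h4 h5 p m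
    intro R _ up um x z p m h1 h2 h3 h4 h5
    obtain ⟨i, j⟩ := k
    obtain ⟨i', j'⟩ := l
    fin_cases i <;> fin_cases j <;> fin_cases i' <;> fin_cases j' <;>
      simp only [smallGen, Fin.zero_eta, Fin.mk_one, Matrix.cons_val_zero, Matrix.cons_val_one,
        Fin.isValue] at * <;> grind
  have := key _ _ _ _ p m h1 h2 h3 h4 h5
  have hmap : ∀ l, algebraMap A' (SmallResChart up um x z k) (smallGen up um x z l) =
      smallGen (algebraMap A' _ up) (algebraMap A' _ um) (algebraMap A' _ x) (algebraMap A' _ z) l := by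
    rintro ⟨i, j⟩
    fin_cases i <;> fin_cases j <;> simp [smallGen]
  rw [hmap, hmap, this]

theorem small_exists_hom (k : Fin 2 × Fin 2) {C : Type} [CommRing C] [Algebra A' C]
    (p m : Fin 2 → C) (hp : p k.1 = 1) (hm : m k.2 = 1)
    (h1 : p 1 * algebraMap A' C up = algebraMap A' C x * p 0)
    (h2 : m 1 * algebraMap A' C um = algebraMap A' C x * m 0)
    (h3 : p 0 * m 0 = algebraMap A' C z * p 1 * m 1) :
    ∃ φ : SmallResChart up um x z k →ₐ[A'] C, (∀ i, φ (smallP up um x z k i) = p i) ∧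
      ∀ i, φ (smallM up um x z k i) = m i := by
  obtain ⟨φ, hφ⟩ := exists_presentedHom (S := {MvPolynomial.X 1 * MvPolynomial.C up -
        MvPolynomial.C x * MvPolynomial.X 0,
      MvPolynomial.X 3 * MvPolynomial.C um - MvPolynomial.C x * MvPolynomial.X 2,
      MvPolynomial.X 0 * MvPolynomial.X 2 -
        MvPolynomial.C z * MvPolynomial.X 1 * MvPolynomial.X 3,
      MvPolynomial.X (plusIdx k) - 1,
      MvPolynomial.X (minusIdx k) - 1}) (![p 0, p 1, m 0, m 1] : Fin 4 → C) (by
      obtain ⟨i, j⟩ := k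
      rintro _ (rfl | rfl | rfl | rfl | rfl)
      · simp [h1]
      · simp [h2]
      · simp [h3]
      · fin_cases i <;> simpa [plusIdx] using sub_eq_zero.mpr hp
      · fin_cases j <;> simpa [minusIdx] using sub_eq_zero.mpr hm)
  refine ⟨φ, fun i => (hφ _).trans ?_, fun i => (hφ _).trans ?_⟩ <;> fin_cases i <;> rfl

theorem small_hom_ext {k : Fin 2 × Fin 2} {C : Type} [CommRing C] [Algebra A' C]
    {φ ψ : SmallResChart up um x z k →ₐ[A'] C}
    (h1 : ∀ i, φ (smallP up um x z k i) = ψ (smallP up um x z k i))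
    (h2 : ∀ i, φ (smallM up um x z k i) = ψ (smallM up um x z k i)) : φ = ψ := by
  refine presentedHom_ext fun i => ?_
  fin_cases i
  · exact h1 0
  · exact h1 1
  · exact h2 0
  · exact h2 1

section

variable {A : Type} [CommRing A] [Algebra A A'] {σ a₁ a₂₂ : A} {ξ₀ : A'} {zA hf : A}

theorem small_nzd_of_retract
    (H : IsQuadratic (a₁ ^ 2 + 4 * σ ^ 2 * a₂₂) ξ₀) (hK : KoszulExact σ a₁)
    (hhf : 2 * hf = 1) (hx : x = algebraMap A A' σ) (hz : z = algebraMap A A' zA)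
    (hzA : zA = -4 * a₂₂)
    (hup : up = algebraMap A A' a₁ + ξ₀) (hum : um = algebraMap A A' a₁ - ξ₀) (k : Fin 2 × Fin 2)
    {P : Type} [CommRing P] [Algebra A P] [Module.Flat A P] (p m : Fin 2 → P) (hp : p k.1 = 1)
    (hm : m k.2 = 1) (hrel : p 0 * m 0 = algebraMap A P zA * p 1 * m 1)
    (θ : P →ₐ[A] SmallResChart up um x z k) (hθp : ∀ i, θ (p i) = smallP up um x z k i)
    (hθm : ∀ i, θ (m i) = smallM up um x z k i) :
    algebraMap A' (SmallResChart up um x z k) (smallGen up um x z k) ∈ nonZeroDivisors _ := by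
  have hcoord : ∀ i j, algebraMap A' (SmallResChart up um x z k) (smallGen up um x z (i, j)) =
      algebraMap A' _ (smallGen up um x z k) * θ (p i * m j) := fun i j => by
    rw [smallResCoord_mul k (i, j), smallResCoord_eq, map_mul, hθp, hθm]
  have hA : ∀ r, algebraMap A (SmallResChart up um x z k) r = algebraMap A' _ (algebraMap A A' r) :=
    fun r => rfl
  have hhf' : ∀ {C : Type} [CommRing C] (g : A →+* C), 2 * g hf = 1 := fun g => by
    rw [← map_ofNat g, ← map_mul, hhf, map_one]
  have e11 : algebraMap A' (SmallResChart up um x z k) x = _ := hcoord 1 1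
  have e01 : algebraMap A' (SmallResChart up um x z k) (algebraMap A A' a₁) +
      algebraMap A' _ ξ₀ = algebraMap A' _ (smallGen up um x z k) * θ (p 0 * m 1) := by
    rw [← map_add, ← hup]
    exact hcoord 0 1
  have e10 : algebraMap A' (SmallResChart up um x z k) (algebraMap A A' a₁) -
      algebraMap A' _ ξ₀ = algebraMap A' _ (smallGen up um x z k) * θ (p 1 * m 0) := by
    rw [← map_sub, ← hum]
    exact hcoord 1 0
  refine mem_nonZeroDivisors_of_retract H hK (P := P) (s := p 1 * m 1)
    (a := algebraMap A P hf * (p 0 * m 1 + p 1 * m 0))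
    (ξ := algebraMap A P hf * (p 0 * m 1 - p 1 * m 0)) ?_ θ ?_ ?_ ?_ ?_
  · have h1 : (algebraMap A P zA) = -(4 * algebraMap A P a₂₂) := by
      rw [hzA, neg_mul, map_neg, map_mul, map_ofNat]
    rw [h1] at hrel
    have h2 := hhf' (algebraMap A P)
    linear_combination (-1 : P) * (2 * algebraMap A P hf) ^ 2 * (p 1 * m 1) * hrel +
      ((4 * algebraMap A P a₂₂ * (p 1 * m 1) ^ 2) * (2 * algebraMap A P hf + 1)) * h2
  · rw [← e11, hA, hx]
  · rw [map_mul, map_add, θ.commutes, mul_left_comm, mul_add, ← e01, ← e10, hA a₁]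
    have h2 := hhf' (algebraMap A (SmallResChart up um x z k))
    linear_combination algebraMap A' (SmallResChart up um x z k) (algebraMap A A' a₁) * h2
  · rw [map_mul, map_sub, θ.commutes, mul_left_comm, mul_sub, ← e01, ← e10]
    have h2 := hhf' (algebraMap A (SmallResChart up um x z k))
    linear_combination algebraMap A' (SmallResChart up um x z k) ξ₀ * h2
  · intro Q _ _ i w hiA h0 h1 h2
    have h3 := hhf' ((algebraMap A' Q).comp (algebraMap A A'))
    simp only [RingHom.comp_apply, map_mul, map_add, map_sub, hiA] at h0 h1 h2 h3
    have hupQ : algebraMap A' Q up = w * (i (p 0) * i (m 1)) := by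
      rw [hup, map_add, ← h1, ← h2]
      linear_combination w * (i (p 0) * i (m 1)) * h3
    have humQ : algebraMap A' Q um = w * (i (p 1) * i (m 0)) := by
      rw [hum, map_sub, ← h1, ← h2]
      linear_combination w * (i (p 1) * i (m 0)) * h3
    have hrelQ := congrArg i hrel
    simp only [map_mul, hiA] at hrelQ
    have hxQ : algebraMap A' Q x = w * (i (p 1) * i (m 1)) := by rw [hx, h0]
    have hzQ : algebraMap A' Q z = algebraMap A' Q (algebraMap A A' zA) := by rw [hz]
    obtain ⟨φ, hφ1, hφ2⟩ := small_exists_hom (up := up) (um := um) (x := x) (z := z) k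
      (fun l => i (p l)) (fun l => i (m l))
      (by simp only [hp, map_one]) (by simp only [hm, map_one])
      (by rw [hupQ, hxQ]; ring) (by rw [humQ, hxQ]; ring) (by rw [hrelQ, hzQ])
    have hgen : algebraMap A' Q (smallGen up um x z k) = w := by
      have h4 : ∀ l : Fin 2 × Fin 2, algebraMap A' Q (smallGen up um x z l) =
          w * (i (p l.1) * i (m l.2)) := by
        rintro ⟨a, b⟩
        fin_cases a <;> fin_cases b
        · change algebraMap A' Q (x * z) = w * (i (p 0) * i (m 0))
          rw [map_mul, hrelQ, hxQ, hzQ]; ring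
        · exact hupQ
        · exact humQ
        · exact hxQ
      rw [h4, hp, hm, map_one, mul_one, mul_one]
    refine ⟨φ, by rw [φ.commutes, hgen], fun χ hχ _ => small_hom_ext (fun l => ?_) fun l => ?_⟩
    · rw [AlgHom.comp_apply, hφ1, hχ, hθp]
      rfl
    · rw [AlgHom.comp_apply, hφ2, hχ, hθm]
      rfl

theorem small_nzd
    (H : IsQuadratic (a₁ ^ 2 + 4 * σ ^ 2 * a₂₂) ξ₀) (hK : KoszulExact σ a₁)
    (hhf : 2 * hf = 1) (hx : x = algebraMap A A' σ) (hz : z = algebraMap A A' zA)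
    (hzA : zA = -4 * a₂₂)
    (hup : up = algebraMap A A' a₁ + ξ₀) (hum : um = algebraMap A A' a₁ - ξ₀)
    (k : Fin 2 × Fin 2) :
    algebraMap A' (SmallResChart up um x z k) (smallGen up um x z k) ∈ nonZeroDivisors _ := by
  have R := fun (P : Type) [CommRing P] [Algebra A P] [Module.Flat A P] =>
    small_nzd_of_retract (P := P) H hK hhf hx hz hzA hup hum k
  have hp := smallP_self (up := up) (um := um) (x := x) (z := z) k
  have hm := smallM_self (up := up) (um := um) (x := x) (z := z) k
  have hrel := small_rel (up := up) (um := um) (x := x) (z := z) k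
  have hzR : algebraMap A' (SmallResChart up um x z k) z = algebraMap A _ zA := by rw [hz]; rfl
  rw [hzR] at hrel
  obtain ⟨i, j⟩ := k
  fin_cases i <;> fin_cases j
  · let y : A[X] := Polynomial.C zA * Polynomial.X
    let L := Localization.Away y
    have : Module.Flat A L := by
      have : Module.Flat A[X] L := IsLocalization.flat L (Submonoid.powers y)
      exact Module.Flat.trans A A[X] L
    let g := Polynomial.aeval (R := A) (smallP up um x z (0, 0) 1)
    have hu : g y * smallM up um x z (0, 0) 1 = 1 := by
      have h1 : smallP up um x z (0, 0) 0 = 1 := hp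
      have h2 : smallM up um x z (0, 0) 0 = 1 := hm
      have h3 := hrel
      simp only [Fin.zero_eta] at h3
      rw [h1, h2, one_mul] at h3
      simp only [g, y, map_mul, Polynomial.aeval_C, Polynomial.aeval_X]
      exact h3.symm
    have hu' : IsUnit (g.toRingHom y) := IsUnit.of_mul_eq_one _ hu
    let θ₀ : L →+* SmallResChart up um x z (0, 0) := IsLocalization.Away.lift y hu'
    have hθ₀ : ∀ q, θ₀ (algebraMap A[X] L q) = g q := fun q => IsLocalization.Away.lift_eq y hu' q
    let θ : L →ₐ[A] SmallResChart up um x z (0, 0) :=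
      { θ₀ with commutes' := fun r => (hθ₀ (Polynomial.C r)).trans (g.commutes r) }
    have hinv : algebraMap A[X] L y * IsLocalization.Away.invSelf y = 1 :=
      IsLocalization.Away.mul_invSelf y
    refine R L ![1, algebraMap A[X] L Polynomial.X] ![1, IsLocalization.Away.invSelf y] rfl rfl ?_ θ
      (fun l => ?_) (fun l => ?_)
    · rw [map_mul] at hinv
      exact (one_mul 1).trans hinv.symm
    · fin_cases l
      · exact (map_one θ).trans hp.symm
      · exact (hθ₀ _).trans (Polynomial.aeval_X _)
    · fin_cases l
      · exact (map_one θ).trans hm.symm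
      · have h1 := congrArg θ₀ hinv
        rw [map_mul, map_one, hθ₀] at h1
        exact hu'.mul_left_cancel (h1.trans hu.symm)
  · refine R A[X] ![1, Polynomial.X] ![Polynomial.C zA * Polynomial.X, 1] rfl rfl ?_
      (Polynomial.aeval (R := A) (smallP up um x z (0, 1) 1)) (fun l => ?_) (fun l => ?_)
    · simp
    · fin_cases l
      · exact (map_one _).trans hp.symm
      · exact Polynomial.aeval_X _
    · fin_cases l
      · change Polynomial.aeval (smallP up um x z (0, 1) 1) (Polynomial.C zA * Polynomial.X) = _
        have h1 : smallP up um x z (0, 1) 0 = 1 := hp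
        have h2 : smallM up um x z (0, 1) 1 = 1 := hm
        have h3 : smallP up um x z (0, 1) 0 * smallM up um x z (0, 1) 0 = _ := hrel
        rw [map_mul, Polynomial.aeval_C, Polynomial.aeval_X]
        simp only [Fin.zero_eta, Fin.mk_one] at h3 ⊢
        rw [h1, one_mul, h2, mul_one] at h3
        exact h3.symm
      · exact (map_one _).trans hm.symm
  · refine R A[X] ![Polynomial.C zA * Polynomial.X, 1] ![1, Polynomial.X] rfl rfl ?_
      (Polynomial.aeval (R := A) (smallM up um x z (1, 0) 1)) (fun l => ?_) (fun l => ?_)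
    · simp
    · fin_cases l
      · change Polynomial.aeval (smallM up um x z (1, 0) 1) (Polynomial.C zA * Polynomial.X) = _
        have h1 : smallP up um x z (1, 0) 1 = 1 := hp
        have h2 : smallM up um x z (1, 0) 0 = 1 := hm
        have h3 : smallP up um x z (1, 0) 0 * smallM up um x z (1, 0) 0 = _ := hrel
        rw [map_mul, Polynomial.aeval_C, Polynomial.aeval_X]
        simp only [Fin.zero_eta, Fin.mk_one] at h3 ⊢
        rw [h2, mul_one, h1, mul_one] at h3
        exact h3.symm
      · exact (map_one _).trans hp.symm
    · fin_cases l
      · exact (map_one _).trans hm.symm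
      · exact Polynomial.aeval_X _
  · have h1 : smallP up um x z (1, 1) 1 = 1 := hp
    have h2 : smallM up um x z (1, 1) 1 = 1 := hm
    have h3 : smallP up um x z (1, 1) 0 * smallM up um x z (1, 1) 0 = _ := hrel
    simp only [Fin.mk_one] at h3
    rw [h1, h2, mul_one, mul_one] at h3
    have hhf' : 2 * algebraMap A (SmallResChart up um x z (1, 1)) hf = 1 := by
      have := congrArg (algebraMap A (SmallResChart up um x z (1, 1))) hhf
      rwa [map_mul, map_ofNat, map_one] at this
    obtain ⟨P, _, _, _, t, r, θ, h4, h5, h6⟩ := exists_flat_sqrt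
      (Polynomial.X ^ 2 - Polynomial.C zA)
      (y := algebraMap A (SmallResChart up um x z (1, 1)) hf *
        (smallP up um x z (1, 1) 0 + smallM up um x z (1, 1) 0))
      (z := algebraMap A (SmallResChart up um x z (1, 1)) hf *
        (smallP up um x z (1, 1) 0 - smallM up um x z (1, 1) 0)) (by
        simp only [map_sub, map_pow, Polynomial.aeval_X, Polynomial.aeval_C]
        linear_combination (-1 : SmallResChart up um x z (1, 1)) *
          (2 * algebraMap A (SmallResChart up um x z (1, 1)) hf) ^ 2 * h3 -
          algebraMap A (SmallResChart up um x z (1, 1)) zA *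
          (2 * algebraMap A (SmallResChart up um x z (1, 1)) hf + 1) * hhf')
    refine R P ![t + r, 1] ![t - r, 1] rfl rfl ?_ θ (fun l => ?_) (fun l => ?_)
    · simp only [map_sub, map_pow, Polynomial.aeval_X, Polynomial.aeval_C] at h4
      simp only [Matrix.cons_val_zero, Matrix.cons_val_one]
      linear_combination -h4
    · fin_cases l
      · refine (map_add θ t r).trans ?_
        rw [h5, h6]
        simp only [Fin.zero_eta, Fin.mk_one]
        linear_combination smallP up um x z (1, 1) 0 * hhf'
      · exact (map_one _).trans hp.symm
    · fin_cases l
      · refine (map_sub θ t r).trans ?_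
        rw [h5, h6]
        simp only [Fin.zero_eta, Fin.mk_one]
        linear_combination smallM up um x z (1, 1) 0 * hhf'
      · exact (map_one _).trans hm.symm

theorem isRingChart_smallRes
    (H : IsQuadratic (a₁ ^ 2 + 4 * σ ^ 2 * a₂₂) ξ₀) (hK : KoszulExact σ a₁)
    (hhf : 2 * hf = 1) (hx : x = algebraMap A A' σ) (hz : z = -4 * algebraMap A A' a₂₂)
    (hup : up = algebraMap A A' a₁ + ξ₀) (hum : um = algebraMap A A' a₁ - ξ₀)
    (k : Fin 2 × Fin 2) :
    IsRingChart (smallGen up um x z) k (SmallResChart up um x z k) where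
  nzd := small_nzd H hK hhf hx (zA := -4 * a₂₂) (by rw [hz]; simp [map_ofNat (algebraMap A A')]) rfl hup hum k
  dvd l := ⟨_, smallResCoord_mul k l⟩
  exists_hom C _ _ h1 h2 := by
    choose e he using h2
    have hcan : ∀ {a b : C}, algebraMap A' C (smallGen up um x z k) ^ 2 * a =
        algebraMap A' C (smallGen up um x z k) ^ 2 * b → a = b :=
      fun h => (mul_cancel_left_mem_nonZeroDivisors (pow_mem h1 2)).mp h
    have hk : e k = 1 := (mul_cancel_left_mem_nonZeroDivisors h1).mp (by rw [← he, mul_one])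
    have hum' : up * um = x ^ 2 * z := by
      have := H.sq
      simp only [map_add, map_mul, map_pow, map_ofNat] at this
      rw [hup, hum, hx, hz]
      linear_combination -this
    have humC := congrArg (algebraMap A' C) hum'
    simp only [map_mul, map_pow] at humC
    have e00 := he (0, 0)
    have e01 := he (0, 1)
    have e10 := he (1, 0)
    have e11 := he (1, 1)
    obtain ⟨φ, -⟩ := small_exists_hom (up := up) (um := um) (x := x) (z := z) k
      (fun i => e (i, k.2)) (fun j => e (k.1, j)) hk hk (by
        refine hcan ?_
        obtain ⟨i, j⟩ := k
        fin_cases i <;> fin_cases j <;> simp only [smallGen, Fin.zero_eta, Fin.mk_one,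
          Matrix.cons_val_zero, Matrix.cons_val_one, map_mul] at * <;> grind) (by
        refine hcan ?_
        obtain ⟨i, j⟩ := k
        fin_cases i <;> fin_cases j <;> simp only [smallGen, Fin.zero_eta, Fin.mk_one,
          Matrix.cons_val_zero, Matrix.cons_val_one, map_mul] at * <;> grind) (by
        refine hcan ?_
        obtain ⟨i, j⟩ := k
        fin_cases i <;> fin_cases j <;> simp only [smallGen, Fin.zero_eta, Fin.mk_one,
          Matrix.cons_val_zero, Matrix.cons_val_one, map_mul] at * <;> grind)
    exact ⟨φ⟩
  hom_ext C _ _ φ ψ h1 := by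
    have key : ∀ (χ : SmallResChart up um x z k →ₐ[A'] C) (l : Fin 2 × Fin 2),
        algebraMap A' C (smallGen up um x z k) * χ (smallResCoord up um x z k l) =
          algebraMap A' C (smallGen up um x z l) := fun χ l => by
      rw [← χ.commutes, ← map_mul, ← smallResCoord_mul, χ.commutes]
    have key2 : ∀ l, φ (smallResCoord up um x z k l) = ψ (smallResCoord up um x z k l) := fun l =>
      (mul_cancel_left_mem_nonZeroDivisors h1).mp (by rw [key, key])
    refine small_hom_ext (fun i => ?_) fun j => ?_
    · have := key2 (i, k.2)
      rwa [smallResCoord_eq, smallM_self, mul_one] at this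
    · have := key2 (k.1, j)
      rwa [smallResCoord_eq, smallP_self, one_mul] at this

end

end SmallRes

/-! ### Derivations -/

section Derivations

variable {k A : Type} [CommRing k] [CommRing A] [Algebra k A]

theorem exists_derivation_polynomial (D : Derivation k A A) (f : A[X]) :
    ∃ δ : Derivation k A[X] A[X], (∀ a, δ (Polynomial.C a) = Polynomial.C (D a)) ∧
      δ Polynomial.X = f := by
  refine ⟨PolynomialModule.equivPolynomialSelf.toLinearMap.compDer D.mapCoeffs +
    f • Polynomial.derivative'.restrictScalars k, fun a => ?_, ?_⟩
  · simp
  · simp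

theorem exists_derivation_quotient {I : Ideal A} (δ : Derivation k A A)
    (h : ∀ a ∈ I, δ a ∈ I) : ∃ δ' : Derivation k (A ⧸ I) (A ⧸ I),
      ∀ a, δ' (Ideal.Quotient.mk I a) = Ideal.Quotient.mk I (δ a) := by
  let L : A ⧸ I →ₗ[k] A ⧸ I := Submodule.mapQ (I.restrictScalars k) (I.restrictScalars k)
    δ.toLinearMap h
  have hL : ∀ a, L (Ideal.Quotient.mk I a) = Ideal.Quotient.mk I (δ a) := fun a => rfl
  refine ⟨Derivation.mk' L fun a b => ?_, hL⟩
  obtain ⟨a, rfl⟩ := Ideal.Quotient.mk_surjective a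
  obtain ⟨b, rfl⟩ := Ideal.Quotient.mk_surjective b
  rw [← map_mul, hL, hL, hL, δ.leibniz, map_add]
  rfl

theorem exists_derivation_quotient_span {g : A} (δ : Derivation k A A) (h : δ g = 0) :
    ∃ δ' : Derivation k (A ⧸ Ideal.span {g}) (A ⧸ Ideal.span {g}),
      ∀ a, δ' (Ideal.Quotient.mk _ a) = Ideal.Quotient.mk _ (δ a) := by
  refine exists_derivation_quotient δ fun a ha => ?_
  obtain ⟨b, rfl⟩ := Ideal.mem_span_singleton'.mp ha
  rw [δ.leibniz, h, smul_zero, zero_add, smul_eq_mul]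
  exact Ideal.mul_mem_right _ _ (Ideal.mem_span_singleton_self g)

end Derivations

/-! ### A Jacobian criterion -/

/-- Jacobian criterion for a hypersurface. -/
theorem formallySmooth_of_derivation {k P R S : Type} [CommRing k] [CommRing P] [Algebra k P]
    [Algebra.FormallySmooth k P] [CommRing R] [Algebra k R] (π : P →ₐ[k] R)
    (hπ : Function.Surjective π) {g : P} (hg0 : π g = 0) (hker : ∀ p, π p = 0 → g ∣ p)
    (δ : Derivation k P P) (M : Submonoid R)
    [CommRing S] [Algebra R S] [Algebra k S] [IsScalarTower k R S] [IsLocalization M S]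
    (h : IsUnit (algebraMap R S (π (δ g)))) : Algebra.FormallySmooth k S := by
  refine Algebra.FormallySmooth.of_comp_surjective fun C _ _ I hI ψ => ?_
  let i : P →ₐ[k] S := (IsScalarTower.toAlgHom k R S).comp π
  have hi : ∀ p, i p = algebraMap R S (π p) := fun p => rfl
  have hnil : IsNilpotent I := ⟨2, hI⟩
  obtain ⟨φ, hφ⟩ := Algebra.FormallySmooth.comp_surjective (R := k) (A := P) I hI (ψ.comp i)
  have hφ' : ∀ p, Ideal.Quotient.mk I (φ p) = ψ (i p) := fun p => AlgHom.congr_fun hφ p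
  have hII : ∀ x ∈ I, ∀ y ∈ I, x * y = 0 := fun x hx y hy => by
    have : x * y ∈ I ^ 2 := by rw [pow_two]; exact Ideal.mul_mem_mul hx hy
    rwa [hI] at this
  have hg : φ g ∈ I := by
    rw [← Ideal.Quotient.eq_zero_iff_mem, hφ', hi, hg0, map_zero, map_zero]
  obtain ⟨e, he⟩ : ∃ e, φ (δ g) * e - 1 ∈ I := by
    obtain ⟨e, he⟩ := (h.map ψ).exists_right_inv
    obtain ⟨e, rfl⟩ := Ideal.Quotient.mk_surjective e
    refine ⟨e, ?_⟩
    rw [← Ideal.Quotient.eq_zero_iff_mem, map_sub, map_mul, hφ', hi, he, map_one, sub_self]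
  let n : C := -(e * φ g)
  have hn : n ∈ I := I.neg_mem (I.mul_mem_left _ hg)
  let φ' : P →ₐ[k] C :=
    { toFun := fun p => φ p + n * φ (δ p)
      map_one' := by simp
      map_mul' := fun p q => by
        simp only [map_mul, Derivation.leibniz, map_add, smul_eq_mul]
        linear_combination (-φ (δ p) * φ (δ q)) * hII n hn n hn
      map_zero' := by simp
      map_add' := fun p q => by simp only [map_add]; ring
      commutes' := fun r => by simp }
  have hφ'def : ∀ p, φ' p = φ p + n * φ (δ p) := fun p => rfl
  have hφ'g : φ' g = 0 := by
    rw [hφ'def]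
    have := hII _ he _ hg
    linear_combination -this
  have hmk : ∀ p, Ideal.Quotient.mk I (φ' p) = ψ (i p) := fun p => by
    rw [hφ'def, map_add, hφ', Ideal.Quotient.eq_zero_iff_mem.mpr (I.mul_mem_right _ hn), add_zero]
  let φ₁ : R →+* C := RingHom.liftOfSurjective π.toRingHom hπ ⟨φ'.toRingHom, fun a ha => by
    obtain ⟨b, rfl⟩ := hker a ha
    change φ' (g * b) = 0
    rw [map_mul, hφ'g, zero_mul]⟩
  have hφ₁ : ∀ p, φ₁ (π p) = φ' p := fun p => RingHom.liftOfRightInverse_comp_apply _ _ _ _ p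
  have hu : ∀ m : M, IsUnit (φ₁ m) := fun m => by
    obtain ⟨p, hp⟩ := hπ m
    rw [← hp, hφ₁, ← hnil.isUnit_quotient_mk_iff, hmk, hi, hp]
    exact (IsLocalization.map_units S m).map ψ
  let φ₂ : S →+* C := IsLocalization.lift hu
  have hφ₂ : ∀ x, φ₂ (algebraMap _ S x) = φ₁ x := fun x => IsLocalization.lift_eq hu x
  refine ⟨{ φ₂ with commutes' := fun r => ?_ }, ?_⟩
  · change φ₂ (algebraMap k S r) = _
    rw [IsScalarTower.algebraMap_apply k R S, hφ₂]
    rw [← π.commutes, hφ₁, φ'.commutes]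
  · have h2 : ((Ideal.Quotient.mk I).comp φ₂) = ψ.toRingHom := by
      refine IsLocalization.ringHom_ext M (RingHom.ext fun x => ?_)
      obtain ⟨p, rfl⟩ := hπ x
      simp only [RingHom.comp_apply, hφ₂, hφ₁, hmk]
      rfl
    exact AlgHom.ext fun s => RingHom.congr_fun h2 s

/-! ### Regular sequences from derivations -/

/-- In a Noetherian `ℚ`-algebra, what `a` annihilates is annihilated by a power of `D a`. -/
theorem exists_pow_derivation_mul_eq_zero {S : Type} [CommRing S] [IsNoetherianRing S] [Algebra ℚ S]
    {k : Type} [CommRing k] [Algebra k S]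
    (D : Derivation k S S) {a x : S} (h : a * x = 0) : ∃ M, (D a) ^ M * x = 0 := by
  obtain ⟨j, hj⟩ : ∃ j, ∀ y, (∃ i, a ^ i * y = 0) → a ^ j * y = 0 := by
    let F : ℕ →o Ideal S := ⟨fun i => LinearMap.ker (LinearMap.mulLeft S (a ^ i)),
      fun i i' hi y hy => by
        obtain ⟨c, rfl⟩ := Nat.exists_eq_add_of_le hi
        simp only [LinearMap.mem_ker, LinearMap.mulLeft_apply] at hy ⊢
        rw [pow_add, mul_comm (a ^ i), mul_assoc, hy, mul_zero]⟩
    obtain ⟨n, hn⟩ := monotone_stabilizes_iff_noetherian.mpr ‹IsNoetherianRing S› F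
    refine ⟨n, fun y ⟨i, hi⟩ => ?_⟩
    have h1 : y ∈ F (n + i) := by
      change a ^ (n + i) * y = 0
      rw [pow_add, mul_assoc, hi, mul_zero]
    rw [← hn (n + i) (Nat.le_add_right _ _)] at h1
    exact h1
  have hD : ∀ y, (∃ i, a ^ i * y = 0) → ∃ i, a ^ i * D y = 0 := fun y ⟨i, hi⟩ => by
    refine ⟨i + 1, ?_⟩
    have h1 := congrArg D hi
    rw [D.leibniz, D.leibniz_pow, map_zero] at h1
    simp only [smul_eq_mul, nsmul_eq_mul] at h1
    rcases i with _ | i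
    · simp only [pow_zero, one_mul] at hi
      rw [hi, map_zero, mul_zero]
    · simp only [Nat.add_sub_cancel] at h1
      push_cast at h1
      linear_combination a * h1 - (i + 1 : S) * D a * hi
  have key : ∀ i, i ≤ j → ∃ m, ∀ y, (∃ i, a ^ i * y = 0) → a ^ (j - i) * (D a) ^ m * y = 0 := by
    intro i
    induction i with
    | zero => exact fun _ => ⟨0, fun y hy => by simpa using hj y hy⟩
    | succ i ih =>
      intro hi
      obtain ⟨m, hm⟩ := ih (by omega)
      obtain ⟨l, hl⟩ : ∃ l, j - i = l + 1 := ⟨j - i - 1, by omega⟩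
      rw [hl] at hm
      rw [show j - (i + 1) = l by omega]
      refine ⟨m + 2, fun y hy => ?_⟩
      have h1 := congrArg D (hm y hy)
      have h2 := hm _ (hD y hy)
      rw [D.leibniz, D.leibniz, D.leibniz_pow, D.leibniz_pow, map_zero] at h1
      simp only [smul_eq_mul, nsmul_eq_mul, Nat.add_sub_cancel] at h1
      have h3 : ((l + 1 : ℕ) : S) * (a ^ l * D a ^ (m + 2) * y) = 0 := by
        rcases m with _ | m
        · simp only [pow_zero, Nat.cast_zero, zero_mul, mul_zero, mul_one, zero_add] at h1 h2 ⊢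
          linear_combination D a * h1 - D a * h2
        · simp only [Nat.add_sub_cancel] at h1
          have h4 := hm y hy
          push_cast at h1 h4 ⊢
          linear_combination D a * h1 - D a * h2 - (m + 1 : S) * D (D a) * h4
      have h5 : IsUnit ((l + 1 : ℕ) : S) := by
        have : ((l + 1 : ℕ) : S) = algebraMap ℚ S ((l + 1 : ℕ) : ℚ) := by simp
        rw [this]
        exact (IsUnit.mk0 _ (by positivity)).map _
      exact h5.mul_right_eq_zero.mp h3
  obtain ⟨m, hm⟩ := key j le_rfl
  refine ⟨m, ?_⟩
  have := hm x ⟨1, by rwa [pow_one]⟩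
  simpa using this

/-! ### Smoothness of quadratic extensions and of slope charts -/

theorem IsQuadratic.exists_presentation {k S R : Type} [CommRing k] [CommRing S] [CommRing R]
    [Algebra k S] [Algebra S R] [Algebra k R] [IsScalarTower k S R] {c : S} {r : R}
    (H : IsQuadratic c r) : ∃ π : S[X] →ₐ[k] R, Function.Surjective π ∧
      (∀ s, π (Polynomial.C s) = algebraMap S R s) ∧ π Polynomial.X = r ∧
      π (Polynomial.X ^ 2 - Polynomial.C c) = 0 ∧
      ∀ p, π p = 0 → Polynomial.X ^ 2 - Polynomial.C c ∣ p := by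
  let π := (Polynomial.aeval (R := S) r).restrictScalars k
  have hC : ∀ s, π (Polynomial.C s) = algebraMap S R s := fun s => Polynomial.aeval_C r s
  have hX : π Polynomial.X = r := Polynomial.aeval_X r
  have h0 : π (Polynomial.X ^ 2 - Polynomial.C c) = 0 := by
    rw [map_sub, map_pow, hC, hX, H.sq, sub_self]
  refine ⟨π, fun z => ?_, hC, hX, h0, fun p hp => ?_⟩
  · obtain ⟨p, q, rfl⟩ := H.exists_eq z
    exact ⟨Polynomial.C p + Polynomial.C q * Polynomial.X, by rw [map_add, map_mul, hC, hC, hX]⟩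
  · rcases subsingleton_or_nontrivial S with hS | hS
    · exact ⟨0, Subsingleton.elim _ _⟩
    have hdeg : (Polynomial.X ^ 2 - Polynomial.C c : S[X]).natDegree = 2 :=
      Polynomial.natDegree_X_pow_sub_C
    have hlt := Polynomial.natDegree_modByMonic_lt p (SqrtAlg.monic c) (by
      intro h; rw [h] at hdeg; simp at hdeg)
    rw [hdeg] at hlt
    have hg := Polynomial.eq_X_add_C_of_natDegree_le_one (Nat.lt_succ_iff.mp hlt)
    have h1 := Polynomial.modByMonic_add_div p (Polynomial.X ^ 2 - Polynomial.C c)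
    have h2 : π (p %ₘ (Polynomial.X ^ 2 - Polynomial.C c)) = 0 := by
      have h3 := congrArg π h1
      rwa [map_add, map_mul, h0, zero_mul, add_zero, hp] at h3
    rw [hg, map_add, map_mul, hC, hC, hX, add_comm] at h2
    obtain ⟨h4, h5⟩ := H.eq_of_eq (p' := 0) (q' := 0) (h2.trans (by simp))
    rw [← Polynomial.modByMonic_eq_zero_iff_dvd (SqrtAlg.monic c), hg, h4, h5]
    simp

theorem IsQuadratic.formallySmooth {k S R T : Type} [CommRing k] [CommRing S] [CommRing R]
    [Algebra k S] [Algebra S R] [Algebra k R] [IsScalarTower k S R] [Algebra.FormallySmooth k S]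
    {c : S} {r : R} (H : IsQuadratic c r) (M : Submonoid R) [CommRing T] [Algebra R T] [Algebra k T]
    [IsScalarTower k R T] [IsLocalization M T]
    (h : IsUnit (algebraMap R T (2 * r)) ∨
      ∃ D : Derivation k S S, IsUnit (algebraMap R T (algebraMap S R (D c)))) :
    Algebra.FormallySmooth k T := by
  obtain ⟨π, hπ, hC, hX, h0, hker⟩ := H.exists_presentation (k := k)
  have : Algebra.FormallySmooth k S[X] := Algebra.FormallySmooth.comp k S S[X]
  obtain h | ⟨D, h⟩ := h
  · obtain ⟨δ, h1, h2⟩ := exists_derivation_polynomial (0 : Derivation k S S) 1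
    refine formallySmooth_of_derivation π hπ h0 hker δ M ?_
    rw [map_sub, h1, δ.leibniz_pow, h2]
    simp only [Derivation.zero_apply, map_zero, sub_zero, smul_eq_mul, mul_one, nsmul_eq_mul,
      map_mul, Nat.cast_ofNat, Nat.add_one_sub_one, pow_one, hX] at h ⊢
    rwa [map_ofNat π]
  · obtain ⟨δ, h1, h2⟩ := exists_derivation_polynomial D 0
    refine formallySmooth_of_derivation π hπ h0 hker δ M ?_
    rw [map_sub, h1, δ.leibniz_pow, h2]
    simpa [hC] using h

theorem IsQuadratic.finitePresentation {k S R : Type} [CommRing k] [CommRing S] [CommRing R]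
    [Algebra k S] [Algebra S R] [Algebra k R] [IsScalarTower k S R]
    [Algebra.FinitePresentation k S]
    {c : S} {r : R} (H : IsQuadratic c r) : Algebra.FinitePresentation k R := by
  obtain ⟨π, hπ, hC, hX, h0, hker⟩ := H.exists_presentation (k := k)
  have : Algebra.FinitePresentation k S[X] := Algebra.FinitePresentation.trans k S S[X]
  refine Algebra.FinitePresentation.of_surjective hπ ⟨{Polynomial.X ^ 2 - Polynomial.C c}, ?_⟩
  refine le_antisymm (Ideal.span_le.mpr (by simpa using h0)) fun p hp => ?_
  simpa [Ideal.mem_span_singleton] using hker p hp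

theorem IsQuadratic.smooth {k S R : Type} [CommRing k] [CommRing S] [CommRing R]
    [Algebra k S] [Algebra S R] [Algebra k R] [IsScalarTower k S R] [Algebra.Smooth k S]
    {c : S} {r : R} (H : IsQuadratic c r) (h2 : IsUnit (2 : R))
    (h : ∀ q : Ideal S, q.IsPrime → c ∈ q → ∃ D : Derivation k S S, D c ∉ q) :
    Algebra.Smooth k R := by
  have := H.finitePresentation (k := k)
  refine ⟨Algebra.smoothLocus_eq_univ_iff.mp (Set.eq_univ_iff_forall.mpr fun q => ?_), this⟩
  change Algebra.FormallySmooth k (Localization.AtPrime q.asIdeal)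
  refine H.formallySmooth q.asIdeal.primeCompl ?_
  by_cases hr : r ∈ q.asIdeal
  · right
    obtain ⟨D, hD⟩ := h (q.asIdeal.comap (algebraMap S R)) inferInstance (by
      rw [Ideal.mem_comap, ← H.sq]
      exact Ideal.pow_mem_of_mem _ hr 2 two_pos)
    exact ⟨D, IsLocalization.map_units _ (⟨_, hD⟩ : q.asIdeal.primeCompl)⟩
  · left
    rw [map_mul]
    exact (h2.map _).mul (IsLocalization.map_units _ (⟨_, hr⟩ : q.asIdeal.primeCompl))

theorem SlopeChart.smooth {k A : Type} [CommRing k] [CommRing A] [Algebra k A] [Algebra.Smooth k A]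
    {u v : A} (h : ∀ q : Ideal A, q.IsPrime → u ∈ q → v ∈ q →
      ∃ D : Derivation k A A, D u = 0 ∧ D v ∉ q) : Algebra.Smooth k (SlopeChart u v) := by
  have : Algebra.FinitePresentation k A[X] := Algebra.FinitePresentation.trans k A A[X]
  have : Algebra.FormallySmooth k A[X] := Algebra.FormallySmooth.comp k A A[X]
  have : Algebra.FinitePresentation k (SlopeChart u v) :=
    Algebra.FinitePresentation.quotient ⟨{_}, by rw [Finset.coe_singleton]⟩
  refine ⟨Algebra.smoothLocus_eq_univ_iff.mp (Set.eq_univ_iff_forall.mpr fun q => ?_), this⟩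
  change Algebra.FormallySmooth k (Localization.AtPrime q.asIdeal)
  have hmem : ∀ x : SlopeChart u v, x ∉ q.asIdeal →
      IsUnit (algebraMap _ (Localization.AtPrime q.asIdeal) x) := fun x hx =>
    IsLocalization.map_units _ (⟨x, hx⟩ : q.asIdeal.primeCompl)
  have hJ := fun δ => formallySmooth_of_derivation (k := k) (P := A[X]) (R := SlopeChart u v)
    (Ideal.Quotient.mkₐ k _) Ideal.Quotient.mk_surjective
    (g := Polynomial.C u * Polynomial.X - Polynomial.C v)
    (Ideal.Quotient.eq_zero_iff_mem.mpr (Ideal.mem_span_singleton_self _))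
    (fun p hp => Ideal.mem_span_singleton.mp (Ideal.Quotient.eq_zero_iff_mem.mp hp)) δ
    q.asIdeal.primeCompl (S := Localization.AtPrime q.asIdeal)
  by_cases hu : algebraMap A _ u ∈ q.asIdeal
  · obtain ⟨D, h1, h2⟩ := h (q.asIdeal.comap (algebraMap A _)) inferInstance hu (by
      rw [Ideal.mem_comap, ← algebraMap_mul_t]
      exact Ideal.mul_mem_right _ _ hu)
    obtain ⟨δ, h3, h4⟩ := exists_derivation_polynomial D 0
    refine hJ δ (hmem _ ?_)
    rw [map_sub, δ.leibniz, h3, h3, h4, h1]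
    simp only [smul_zero, map_zero, zero_sub, add_zero, map_neg, neg_mem_iff]
    exact h2
  · obtain ⟨δ, h3, h4⟩ := exists_derivation_polynomial (0 : Derivation k A A) 1
    refine hJ δ (hmem _ ?_)
    rw [map_sub, δ.leibniz, h3, h3, h4]
    simp only [Derivation.zero_apply, map_zero, smul_eq_mul, mul_one, mul_zero, add_zero, sub_zero]
    exact hu

/-! ### Generic sections -/

/-- Genericity of `σ`, `a₁`, `a₂₂` in terms of derivations. -/
structure SppGeneric {A : Type} [CommRing A] [Algebra ℂ A] (σ a₁ a₂₂ : A) : Prop where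
  transverse : ∀ p : Ideal A, p.IsPrime → σ ∈ p → a₁ ∈ p →
    ∃ D₁ D₂ : Derivation ℂ A A, D₁ σ * D₂ a₁ - D₂ σ * D₁ a₁ ∉ p
  transverse_pinch : ∀ p : Ideal A, p.IsPrime → σ ∈ p → a₁ ∈ p → a₂₂ ∈ p →
    ∃ D₁ D₂ : Derivation ℂ A A, D₁ a₁ * D₂ a₂₂ - D₂ a₁ * D₁ a₂₂ ∉ p
  branch : ∀ p : Ideal A, p.IsPrime → ¬ (σ ∈ p ∧ a₁ ∈ p) → a₁ ^ 2 + 4 * σ ^ 2 * a₂₂ ∈ p →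
    ∃ D : Derivation ℂ A A, D (a₁ ^ 2 + 4 * σ ^ 2 * a₂₂) ∉ p

theorem exists_derivation_eq_zero {k A : Type} [CommRing k] [CommRing A] [Algebra k A] {x y : A}
    {p : Ideal A} (h : ∃ D₁ D₂ : Derivation k A A, D₁ x * D₂ y - D₂ x * D₁ y ∉ p) :
    ∃ D : Derivation k A A, D x = 0 ∧ D y ∉ p := by
  obtain ⟨D₁, D₂, h⟩ := h
  refine ⟨D₁ x • D₂ - D₂ x • D₁, ?_, ?_⟩
  · simp [mul_comm]
  · simpa using h

namespace SppGeneric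

variable {A : Type} [CommRing A] [Algebra ℂ A] {σ a₁ a₂₂ : A}

theorem exists_derivation_a (G : SppGeneric σ a₁ a₂₂) (p : Ideal A) (hp : p.IsPrime) (h : σ ∈ p)
    (h' : a₁ ∈ p) : ∃ D : Derivation ℂ A A, D σ = 0 ∧ D a₁ ∉ p :=
  exists_derivation_eq_zero (G.transverse p hp h h')

theorem exists_derivation_s (G : SppGeneric σ a₁ a₂₂) (p : Ideal A) (hp : p.IsPrime) (h : a₁ ∈ p)
    (h' : σ ∈ p) : ∃ D : Derivation ℂ A A, D a₁ = 0 ∧ D σ ∉ p := by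
  refine exists_derivation_eq_zero ?_
  obtain ⟨D₁, D₂, h⟩ := G.transverse p hp h' h
  refine ⟨D₂, D₁, ?_⟩
  rwa [mul_comm, mul_comm (D₁ a₁)]

theorem koszulExact (G : SppGeneric σ a₁ a₂₂) [IsNoetherianRing A] (hσ : σ ∈ nonZeroDivisors A) :
    KoszulExact σ a₁ := by
  have key : ∀ y, a₁ * y ∈ Ideal.span {σ} → y ∈ Ideal.span {σ} := fun y hy => by
    by_contra hy'
    let I : Ideal A := (Ideal.span {σ}).colon {y}
    have hI : ∀ x, x ∈ I ↔ x * y ∈ Ideal.span {σ} := fun x => Submodule.mem_colon_singleton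
    have hI1 : I ≠ ⊤ := fun h => hy' (by
      have : (1 : A) ∈ I := h ▸ trivial
      simpa [hI] using this)
    obtain ⟨m, hm, hIm⟩ := Ideal.exists_le_maximal I hI1
    have hσI : σ ∈ I := (hI σ).mpr (Ideal.mul_mem_right _ _ (Ideal.mem_span_singleton_self σ))
    obtain ⟨D, hD1, hD2⟩ := G.exists_derivation_a m hm.isPrime (hIm hσI) (hIm ((hI _).mpr hy))
    obtain ⟨δ, hδ⟩ := exists_derivation_quotient_span (g := σ) D hD1
    let : Algebra ℚ (A ⧸ Ideal.span {σ}) := Algebra.compHom _ (algebraMap ℚ ℂ)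
    obtain ⟨M, hM⟩ := exists_pow_derivation_mul_eq_zero δ
      (a := Ideal.Quotient.mk _ a₁) (x := Ideal.Quotient.mk _ y) (by
        rw [← map_mul]; exact Ideal.Quotient.eq_zero_iff_mem.mpr hy)
    rw [hδ, ← map_pow, ← map_mul, Ideal.Quotient.eq_zero_iff_mem, ← hI] at hM
    exact hD2 (hm.isPrime.mem_of_pow_mem M (hIm hM))
  intro x y hxy
  obtain ⟨c, hc⟩ := Ideal.mem_span_singleton'.mp (key y (hxy ▸ Ideal.mul_mem_right _ _
    (Ideal.mem_span_singleton_self σ)))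
  refine ⟨c, ?_, by rw [← hc, mul_comm]⟩
  refine (mul_cancel_left_mem_nonZeroDivisors hσ).mp ?_
  rw [hxy, ← hc]
  ring

theorem smooth_slope_zero (G : SppGeneric σ a₁ a₂₂) [Algebra.Smooth ℂ A] :
    Algebra.Smooth ℂ (SlopeChart σ a₁) :=
  SlopeChart.smooth G.exists_derivation_a

theorem smooth_slope_one (G : SppGeneric σ a₁ a₂₂) [Algebra.Smooth ℂ A] :
    Algebra.Smooth ℂ (SlopeChart a₁ σ) :=
  SlopeChart.smooth G.exists_derivation_s

theorem exists_derivation_slope {u v : A} (D : Derivation ℂ A A) (e f : A[X])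
    {D' : Derivation ℂ A A} {e' : A[X]}
    (h : Polynomial.C u * f + Polynomial.X * (e * Polynomial.C (D u) + e' * Polynomial.C (D' u)) =
      e * Polynomial.C (D v) + e' * Polynomial.C (D' v)) :
    ∃ δ : Derivation ℂ (SlopeChart u v) (SlopeChart u v), (∀ a, δ (algebraMap A _ a) =
      Ideal.Quotient.mk _ (e * Polynomial.C (D a) + e' * Polynomial.C (D' a))) ∧
      δ (SlopeChart.t u v) = Ideal.Quotient.mk _ f := by
  obtain ⟨δ₁, h1, h2⟩ := exists_derivation_polynomial D 0
  obtain ⟨δ₁', h1', h2'⟩ := exists_derivation_polynomial D' 0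
  obtain ⟨δ₂, h3, h4⟩ := exists_derivation_polynomial (0 : Derivation ℂ A A) f
  have h5 : ∀ a, (e • δ₁ + e' • δ₁' + δ₂) (Polynomial.C a) =
      e * Polynomial.C (D a) + e' * Polynomial.C (D' a) := fun a => by
    simp [h1, h3, h1']
  have h6 : (e • δ₁ + e' • δ₁' + δ₂) Polynomial.X = f := by simp [h2, h4, h2']
  obtain ⟨δ, hδ⟩ := exists_derivation_quotient_span
    (g := Polynomial.C u * Polynomial.X - Polynomial.C v) (e • δ₁ + e' • δ₁' + δ₂) (by
      rw [map_sub, Derivation.leibniz, h5, h5, h6, ← h]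
      simp)
  exact ⟨δ, fun a => (hδ (Polynomial.C a)).trans (by rw [h5]), (hδ _).trans (by rw [h6])⟩

theorem exists_derivation_slope_of_notMem {u v : A} {q : Ideal (SlopeChart u v)} (hq : q.IsPrime)
    (hu : algebraMap A _ u ∉ q) {h : A} {c : SlopeChart u v}
    (hc : algebraMap A (SlopeChart u v) h = algebraMap A _ u ^ 2 * c) (hcq : c ∈ q)
    (hD : ∃ D : Derivation ℂ A A, D h ∉ q.comap (algebraMap A _)) :
    ∃ δ : Derivation ℂ (SlopeChart u v) (SlopeChart u v), δ c ∉ q := by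
  obtain ⟨D, hD⟩ := hD
  obtain ⟨δ, h1, h2⟩ := exists_derivation_slope (u := u) (v := v) D (Polynomial.C u)
    (Polynomial.C (D v) - Polynomial.X * Polynomial.C (D u)) (D' := 0) (e' := 0) (by
      simp only [zero_mul, add_zero]; ring)
  refine ⟨δ, fun hδ => ?_⟩
  have h3 := congrArg δ hc
  rw [h1, δ.leibniz, δ.leibniz_pow] at h3
  have h4 : algebraMap A (SlopeChart u v) u * algebraMap A _ (D h) ∈ q := by
    have : Ideal.Quotient.mk _ (Polynomial.C u * Polynomial.C (D h) +
        0 * Polynomial.C ((0 : Derivation ℂ A A) h)) =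
        algebraMap A (SlopeChart u v) u * algebraMap A _ (D h) := by
      rw [zero_mul, add_zero, map_mul]; rfl
    rw [← this, h3]
    exact q.add_mem (q.smul_mem _ hδ) (q.mul_mem_right _ hcq)
  exact (hq.mem_or_mem h4).elim hu hD

theorem exists_derivation_zero (G : SppGeneric σ a₁ a₂₂) (q : Ideal (SlopeChart σ a₁))
    (hq : q.IsPrime)
    (hc : SlopeChart.t σ a₁ ^ 2 + 4 * algebraMap A _ a₂₂ ∈ q) :
    ∃ δ : Derivation ℂ (SlopeChart σ a₁) (SlopeChart σ a₁),
      δ (SlopeChart.t σ a₁ ^ 2 + 4 * algebraMap A _ a₂₂) ∉ q := by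
  have hrel := SlopeChart.algebraMap_mul_t σ a₁
  have hδ4 : ∀ δ : Derivation ℂ (SlopeChart σ a₁) (SlopeChart σ a₁),
      δ (SlopeChart.t σ a₁ ^ 2 + 4 * algebraMap A _ a₂₂) =
        2 * SlopeChart.t σ a₁ * δ (SlopeChart.t σ a₁) + 4 * δ (algebraMap A _ a₂₂) := fun δ => by
    have : δ (4 : SlopeChart σ a₁) = 0 := by exact_mod_cast δ.map_natCast 4
    rw [map_add, δ.leibniz, δ.leibniz_pow, this]
    simp [mul_assoc]
  have h4 : IsUnit (4 : SlopeChart σ a₁) := by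
    rw [← map_ofNat (algebraMap ℂ (SlopeChart σ a₁)) 4]
    exact (IsUnit.mk0 (4 : ℂ) (by norm_num)).map _
  have h2 : IsUnit (2 : SlopeChart σ a₁) := by
    rw [← map_ofNat (algebraMap ℂ (SlopeChart σ a₁)) 2]
    exact (IsUnit.mk0 (2 : ℂ) (by norm_num)).map _
  by_cases hσ : algebraMap A _ σ ∈ q
  · have ha : algebraMap A (SlopeChart σ a₁) a₁ ∈ q := by
      rw [← hrel]; exact q.mul_mem_right _ hσ
    obtain ⟨D, hD1, hD2⟩ := G.exists_derivation_a (q.comap (algebraMap A _)) inferInstance hσ ha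
    by_cases ht : SlopeChart.t σ a₁ ∈ q
    · have ha2 : algebraMap A (SlopeChart σ a₁) a₂₂ ∈ q := by
        have h5 := q.sub_mem hc (Ideal.pow_mem_of_mem _ ht 2 two_pos)
        rw [add_sub_cancel_left] at h5
        exact (Ideal.unit_mul_mem_iff_mem _ h4).mp h5
      obtain ⟨D', hD'1, hD'2⟩ := exists_derivation_eq_zero
        (G.transverse_pinch (q.comap (algebraMap A _)) inferInstance hσ ha ha2)
      obtain ⟨δ, h5, h6⟩ := exists_derivation_slope (u := σ) (v := a₁) D' (Polynomial.C (D a₁)) 0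
        (D' := D) (e' := Polynomial.X * Polynomial.C (D' σ)) (by
          rw [hD1, hD'1, map_zero]; ring)
      refine ⟨δ, fun hδ => ?_⟩
      rw [hδ4, h6, map_zero, mul_zero, zero_add, Ideal.unit_mul_mem_iff_mem _ h4, h5, map_add,
        map_mul, mul_assoc, map_mul] at hδ
      have h7 := (q.add_mem_iff_left (q.mul_mem_right _ ht)).mp hδ
      exact (hq.mem_or_mem h7).elim hD2 hD'2
    · obtain ⟨δ, h5, h6⟩ := exists_derivation_slope (u := σ) (v := a₁) D (Polynomial.C σ)
        (Polynomial.C (D a₁)) (D' := 0) (e' := 0) (by rw [hD1, map_zero]; simp)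
      refine ⟨δ, fun hδ => ?_⟩
      rw [hδ4, h6, h5, zero_mul, add_zero, map_mul] at hδ
      have h7 := (q.add_mem_iff_left (q.mul_mem_left 4 (q.mul_mem_right _ hσ))).mp hδ
      rw [mul_assoc, Ideal.unit_mul_mem_iff_mem _ h2] at h7
      exact (hq.mem_or_mem h7).elim ht hD2
  · have h5 : algebraMap A (SlopeChart σ a₁) (a₁ ^ 2 + 4 * σ ^ 2 * a₂₂) =
        algebraMap A _ σ ^ 2 * (SlopeChart.t σ a₁ ^ 2 + 4 * algebraMap A _ a₂₂) := by
      have h6 : algebraMap A (SlopeChart σ a₁) 4 = 4 := map_ofNat _ _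
      rw [map_add, map_mul, map_mul, map_pow, map_pow, ← hrel, h6]
      ring
    refine exists_derivation_slope_of_notMem hq hσ h5 hc (G.branch _ inferInstance
      (fun h => hσ h.1) ?_)
    rw [Ideal.mem_comap, h5]
    exact q.mul_mem_left _ hc

theorem exists_derivation_one (G : SppGeneric σ a₁ a₂₂) (q : Ideal (SlopeChart a₁ σ))
    (hq : q.IsPrime)
    (hc : 1 + 4 * SlopeChart.t a₁ σ ^ 2 * algebraMap A _ a₂₂ ∈ q) :
    ∃ δ : Derivation ℂ (SlopeChart a₁ σ) (SlopeChart a₁ σ),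
      δ (1 + 4 * SlopeChart.t a₁ σ ^ 2 * algebraMap A _ a₂₂) ∉ q := by
  have hrel := SlopeChart.algebraMap_mul_t a₁ σ
  have h4 : IsUnit (4 : SlopeChart a₁ σ) := by
    rw [← map_ofNat (algebraMap ℂ (SlopeChart a₁ σ)) 4]
    exact (IsUnit.mk0 (4 : ℂ) (by norm_num)).map _
  have h2 : IsUnit (2 : SlopeChart a₁ σ) := by
    rw [← map_ofNat (algebraMap ℂ (SlopeChart a₁ σ)) 2]
    exact (IsUnit.mk0 (2 : ℂ) (by norm_num)).map _
  have hδ4 : ∀ δ : Derivation ℂ (SlopeChart a₁ σ) (SlopeChart a₁ σ),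
      δ (1 + 4 * SlopeChart.t a₁ σ ^ 2 * algebraMap A _ a₂₂) =
        4 * (2 * (SlopeChart.t a₁ σ * algebraMap A _ a₂₂ * δ (SlopeChart.t a₁ σ))) +
          4 * SlopeChart.t a₁ σ ^ 2 * δ (algebraMap A _ a₂₂) := fun δ => by
    have : δ (4 : SlopeChart a₁ σ) = 0 := by exact_mod_cast δ.map_natCast 4
    rw [map_add, δ.leibniz, δ.leibniz, δ.leibniz_pow, this]
    simp only [Derivation.map_one_eq_zero, smul_eq_mul, nsmul_eq_mul,
      Nat.cast_ofNat]
    ring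
  by_cases ha : algebraMap A _ a₁ ∈ q
  · have hσ : algebraMap A (SlopeChart a₁ σ) σ ∈ q := by
      rw [← hrel]; exact q.mul_mem_right _ ha
    obtain ⟨D, hD1, hD2⟩ := G.exists_derivation_s (q.comap (algebraMap A _)) inferInstance ha hσ
    obtain ⟨δ, h5, h6⟩ := exists_derivation_slope (u := a₁) (v := σ) D (Polynomial.C a₁)
      (Polynomial.C (D σ)) (D' := 0) (e' := 0) (by rw [hD1, map_zero]; simp)
    refine ⟨δ, fun hδ => ?_⟩
    rw [hδ4, h6, h5, zero_mul, add_zero, map_mul] at hδ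
    have h7 := (q.add_mem_iff_left (q.mul_mem_left _ (q.mul_mem_right _ ha))).mp hδ
    rw [Ideal.unit_mul_mem_iff_mem _ h4, Ideal.unit_mul_mem_iff_mem _ h2] at h7
    have h1 : ∀ x, 4 * SlopeChart.t a₁ σ ^ 2 * algebraMap A _ a₂₂ = x → x ∉ q := fun x hx hxq => by
      have := q.sub_mem hc hxq
      rw [hx, add_sub_cancel_right] at this
      exact hq.ne_top ((Ideal.eq_top_iff_one _).mpr this)
    refine (hq.mem_or_mem h7).elim (fun h8 => (h1 _ rfl) ?_) hD2
    have : 4 * SlopeChart.t a₁ σ ^ 2 * algebraMap A (SlopeChart a₁ σ) a₂₂ =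
      (4 * SlopeChart.t a₁ σ) * (SlopeChart.t a₁ σ * algebraMap A _ a₂₂) := by ring
    rw [this]
    exact q.mul_mem_left _ h8
  · have h5 : algebraMap A (SlopeChart a₁ σ) (a₁ ^ 2 + 4 * σ ^ 2 * a₂₂) =
        algebraMap A _ a₁ ^ 2 * (1 + 4 * SlopeChart.t a₁ σ ^ 2 * algebraMap A _ a₂₂) := by
      have h6 : algebraMap A (SlopeChart a₁ σ) 4 = 4 := map_ofNat _ _
      rw [map_add, map_mul, map_mul, map_pow, map_pow, ← hrel, h6]
      ring
    refine exists_derivation_slope_of_notMem hq ha h5 hc (G.branch _ inferInstance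
      (fun h => ha h.2) ?_)
    rw [Ideal.mem_comap, h5]
    exact q.mul_mem_left _ hc

end SppGeneric

/-! ### Complex constants of rings of functions -/

section Scalars

variable {Y : Scheme.{0}} (f : Y ⟶ SpecC)

/-- The complex constants in the ring of functions on an open set. -/
def sectionScalars (V : Y.Opens) : ℂ →+* Γ(Y, V) :=
  ((Scheme.ΓSpecIso (CommRingCat.of ℂ)).inv ≫ f.appLE ⊤ V le_top).hom

theorem germAt_sectionScalars (V : Y.Opens) (y : Y) (hy : y ∈ V) :
    (germAt V y hy).comp (sectionScalars f V) = scalars f y := by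
  have : sectionScalars f V = (res (le_top : V ≤ ⊤)).comp
      ((Scheme.ΓSpecIso (CommRingCat.of ℂ)).inv ≫ f.appTop).hom := rfl
  ext c
  rw [this]
  exact germAt_res le_top y hy _

theorem map_sectionScalars {T : Scheme.{0}} (g : T ⟶ Y) (W : Y.Opens) (V : T.Opens)
    (h : V ≤ g ⁻¹ᵁ W) :
    (g.appLE W V h).hom.comp (sectionScalars f W) = sectionScalars (g ≫ f) V := by
  exact congrArg (fun m => ((Scheme.ΓSpecIso (CommRingCat.of ℂ)).inv ≫ m).hom)
    (Scheme.Hom.appLE_comp_appLE g f ⊤ W V le_top h)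

theorem fromSpec_comp_eq {V : Y.Opens} (hV : IsAffineOpen V) :
    hV.fromSpec ≫ f = Spec.map (CommRingCat.ofHom (sectionScalars f V)) := by
  rw [← (isAffineOpen_top SpecC).SpecMap_appLE_fromSpec f hV le_top, IsAffineOpen.fromSpec_top,
    Scheme.isoSpec_Spec_inv, ← Spec.map_comp]
  rfl

theorem specMap_fromSpec_comp_eq {V : Y.Opens} (hV : IsAffineOpen V) {R : Type} [CommRing R]
    (φ : Γ(Y, V) →+* R) : (Spec.map (CommRingCat.ofHom φ) ≫ hV.fromSpec) ≫ f =
      Spec.map (CommRingCat.ofHom (φ.comp (sectionScalars f V))) := by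
  rw [Category.assoc, fromSpec_comp_eq, ← Spec.map_comp]
  rfl

theorem smooth_spec_iff {R : Type} [CommRing R] [Algebra ℂ R] :
    Smooth (Spec.map (CommRingCat.ofHom (algebraMap ℂ R))) ↔ Algebra.Smooth ℂ R := by
  rw [HasRingHomProperty.Spec_iff (P := @Smooth), CommRingCat.hom_ofHom]
  exact RingHom.smooth_algebraMap

theorem smooth_sections [Smooth f] {V : Y.Opens} (hV : IsAffineOpen V) :
    letI := (sectionScalars f V).toAlgebra
    Algebra.Smooth ℂ Γ(Y, V) := by
  let := (sectionScalars f V).toAlgebra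
  rw [← smooth_spec_iff]
  have : Smooth (hV.fromSpec ≫ f) := inferInstance
  rw [fromSpec_comp_eq] at this
  exact this

theorem isNoetherianRing_sections [LocallyOfFiniteType f] {V : Y.Opens} (hV : IsAffineOpen V) :
    IsNoetherianRing Γ(Y, V) := by
  have : IsLocallyNoetherian Y := LocallyOfFiniteType.isLocallyNoetherian f
  exact IsLocallyNoetherian.component_noetherian ⟨V, hV⟩

theorem primeIdealOf_asIdeal_eq {V : Y.Opens} (hV : IsAffineOpen V) (y : Y) (hy : y ∈ V) :
    (hV.primeIdealOf ⟨y, hy⟩).asIdeal = ptIdeal V y hy := by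
  let := (germAt V y hy).toAlgebra
  have h : IsLocalization.AtPrime (Y.presheaf.stalk y) (hV.primeIdealOf ⟨y, hy⟩).asIdeal :=
    hV.isLocalization_stalk ⟨y, hy⟩
  exact (IsLocalization.AtPrime.under_maximalIdeal (Y.presheaf.stalk y) _).symm

theorem exists_ptIdeal_eq {V : Y.Opens} (hV : IsAffineOpen V) (p : Ideal Γ(Y, V)) (hp : p.IsPrime) :
    ∃ y, ∃ hy : y ∈ V, ptIdeal V y hy = p := by
  have hy : hV.fromSpec ⟨p, hp⟩ ∈ V := by
    have : hV.fromSpec ⟨p, hp⟩ ∈ Set.range hV.fromSpec := ⟨_, rfl⟩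
    rwa [hV.range_fromSpec] at this
  refine ⟨hV.fromSpec ⟨p, hp⟩, hy, ?_⟩
  rw [← primeIdealOf_asIdeal_eq hV]
  have h3 := hV.fromSpec_primeIdealOf ⟨_, hy⟩
  exact congrArg PrimeSpectrum.asIdeal (hV.fromSpec.isOpenEmbedding.injective h3)

end Scalars

/-! ### Differentials and derivations -/

section Diff

variable {k A : Type} [CommRing k] [CommRing A] [Algebra k A] [Algebra.Smooth k A]

theorem exists_derivation_frame (k A : Type) [CommRing k] [CommRing A] [Algebra k A]
    [Algebra.Smooth k A] : ∃ (n : ℕ) (D : Fin n → Derivation k A A) (ω : Fin n → Ω[A⁄k]),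
      ∀ x : A, KaehlerDifferential.D k A x = ∑ i, D i x • ω i := by
  obtain ⟨n, F, g, -, -, h⟩ := Module.Finite.exists_comp_eq_id_of_projective A (Ω[A⁄k])
  refine ⟨n, fun i => ((LinearMap.proj i).comp g).compDer (KaehlerDifferential.D k A),
    fun i => F (Pi.single i 1), fun x => ?_⟩
  have h1 := LinearMap.congr_fun h (KaehlerDifferential.D k A x)
  rw [LinearMap.comp_apply, LinearMap.id_apply] at h1
  conv_lhs => rw [← h1, LinearMap.pi_apply_eq_sum_univ F]
  exact Finset.sum_congr rfl fun i _ => by congr 2; ext j; simp [Pi.single_apply, eq_comm]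

variable {O : Type} [CommRing O] [IsLocalRing O] [Algebra A O] [Algebra k O] [IsScalarTower k A O]

theorem exists_derivation_notMem {x : A}
    (h : KaehlerDifferential.D k O (algebraMap A O x) ∉
      IsLocalRing.maximalIdeal O • (⊤ : Submodule O (Ω[O⁄k]))) :
    ∃ D : Derivation k A A, D x ∉ (IsLocalRing.maximalIdeal O).comap (algebraMap A O) := by
  obtain ⟨n, D, ω, hD⟩ := exists_derivation_frame k A
  by_contra! hc
  refine h ?_
  rw [← KaehlerDifferential.map_D k k A O, hD, map_sum]
  refine Submodule.sum_mem _ fun i _ => ?_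
  rw [map_smul, ← algebraMap_smul O (D i x) (KaehlerDifferential.map k k A O (ω i))]
  exact Submodule.smul_mem_smul (hc (D i)) Submodule.mem_top

theorem exists_derivations_notMem {x y : A}
    (h : ∀ u v : O, u • KaehlerDifferential.D k O (algebraMap A O x) +
        v • KaehlerDifferential.D k O (algebraMap A O y) ∈
      IsLocalRing.maximalIdeal O • (⊤ : Submodule O (Ω[O⁄k])) →
        u ∈ IsLocalRing.maximalIdeal O ∧ v ∈ IsLocalRing.maximalIdeal O) :
    ∃ D₁ D₂ : Derivation k A A, D₁ x * D₂ y - D₂ x * D₁ y ∉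
      (IsLocalRing.maximalIdeal O).comap (algebraMap A O) := by
  obtain ⟨n, D, ω, hD⟩ := exists_derivation_frame k A
  by_contra! hc
  obtain ⟨D₁, hD₁⟩ := exists_derivation_notMem (k := k) (A := A) (O := O) (x := x) (fun hx => by
    have := (h 1 0 (by simpa using hx)).1
    exact (Ideal.ne_top_iff_one _).mp (IsLocalRing.maximalIdeal.isMaximal O).ne_top this)
  suffices hs : algebraMap A O (D₁ y) • KaehlerDifferential.D k O (algebraMap A O x) +
      (-algebraMap A O (D₁ x)) • KaehlerDifferential.D k O (algebraMap A O y) ∈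
        IsLocalRing.maximalIdeal O • (⊤ : Submodule O (Ω[O⁄k])) by
    have h2 := (h _ _ hs).2
    rw [neg_mem_iff] at h2
    exact hD₁ h2
  have h1 : ∀ a x : A, algebraMap A O a • KaehlerDifferential.D k O (algebraMap A O x) =
      KaehlerDifferential.map k k A O (∑ i, (a * D i x) • ω i) := fun a x => by
    rw [← KaehlerDifferential.map_D k k A O, hD, algebraMap_smul, ← map_smul, Finset.smul_sum]
    simp only [mul_smul]
  rw [neg_smul, h1, h1, ← sub_eq_add_neg, ← map_sub, ← Finset.sum_sub_distrib, map_sum]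
  refine Submodule.sum_mem _ fun i _ => ?_
  rw [← sub_smul, map_smul,
    ← algebraMap_smul O (D₁ y * D i x - D₁ x * D i y) (KaehlerDifferential.map k k A O (ω i))]
  refine Submodule.smul_mem_smul ?_ Submodule.mem_top
  have := hc (D i) D₁
  rw [Ideal.mem_comap] at this
  convert this using 2
  ring

end Diff

/-! ### Local generators of the ideals -/

theorem Sec.germ_eq {B : Scheme.{0}} {P : Bundles B} {p q : ℤ} (s : Sec P p q) (i j : P.I) (b : B)
    (hi : b ∈ P.U i) (hj : b ∈ P.U j) :
    germAt _ b hi (s.val i) =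
      (Units.map (germAt (P.U i ⊓ P.U j) b ⟨hi, hj⟩).toMonoidHom (P.L i j) ^ p *
        Units.map (germAt (P.U i ⊓ P.U j) b ⟨hi, hj⟩).toMonoidHom (P.N i j) ^ q :
          (B.presheaf.stalk b)ˣ) * germAt _ b hj (s.val j) := by
  have h := congrArg (germAt (P.U i ⊓ P.U j) b ⟨hi, hj⟩) (s.compat i j)
  have h1 := germAt_res (inf_le_left : P.U i ⊓ P.U j ≤ P.U i) b ⟨hi, hj⟩ (s.val i)
  have h2 := germAt_res (inf_le_right : P.U i ⊓ P.U j ≤ P.U j) b ⟨hi, hj⟩ (s.val j)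
  rw [← map_zpow, ← map_zpow, ← map_mul]
  exact h1.symm.trans (h.trans ((map_mul _ _ _).trans (congrArg _ h2)))

theorem Sec.span_germ_eq {B : Scheme.{0}} {P : Bundles B} {p q : ℤ} (s : Sec P p q) (i j : P.I)
    (b : B) (hi : b ∈ P.U i) (hj : b ∈ P.U j) :
    Ideal.span {germAt _ b hi (s.val i)} = Ideal.span {germAt _ b hj (s.val j)} := by
  rw [s.germ_eq i j b hi hj]
  exact Ideal.span_singleton_mul_left_unit (Units.isUnit _) _

namespace TateData

variable {B : Scheme.{0}} {N : ℕ} (D : TateData B N)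

theorem limitBranch_eq (i : D.P.I) : D.limitBranch i = D.sppBranch i := by
  simp only [limitBranch, sppBranch, WeierstrassCurve.b₂, family]
  simp
  ring

theorem generatedOn_baseCenter (i : D.P.I) :
    GeneratedOn D.baseCenter (D.P.U i) ![D.σ.val i, D.a₁.val i] := by
  intro b hb
  refine le_antisymm (Ideal.span_le.mpr ?_) (Ideal.span_mono ?_)
  · rintro _ ⟨j, hj, rfl | rfl⟩
    · have h := Ideal.mem_span_singleton_self (germAt _ b hj (D.σ.val j))
      rw [← D.σ.span_germ_eq i j b hb hj] at h
      exact Ideal.span_mono (Set.singleton_subset_iff.mpr (Set.mem_range.mpr ⟨0, rfl⟩)) h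
    · have h := Ideal.mem_span_singleton_self (germAt _ b hj (D.a₁.val j))
      rw [← D.a₁.span_germ_eq i j b hb hj] at h
      exact Ideal.span_mono (Set.singleton_subset_iff.mpr (Set.mem_range.mpr ⟨1, rfl⟩)) h
  · rintro _ ⟨k, rfl⟩
    fin_cases k
    · exact ⟨i, hb, Or.inl rfl⟩
    · exact ⟨i, hb, Or.inr rfl⟩

variable {X : Scheme.{0}} {ρ : X ⟶ B} (C : DoubleCover D.P ρ D.limitBranch)

/-- The germ of `ξ` in two trivialisations. -/
theorem germ_xi_eq (i j : D.P.I) (x : X) (hi : x ∈ ρ ⁻¹ᵁ D.P.U i) (hj : x ∈ ρ ⁻¹ᵁ D.P.U j) :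
    germAt _ x hi (C.ξ i) = germAt (ρ ⁻¹ᵁ (D.P.U i ⊓ D.P.U j)) x ⟨hi, hj⟩
      ((ρ.app (D.P.U i ⊓ D.P.U j)).hom (D.P.L i j)) * germAt _ x hj (C.ξ j) := by
  have h := congrArg (germAt (ρ ⁻¹ᵁ (D.P.U i ⊓ D.P.U j)) x ⟨hi, hj⟩) (C.compat i j)
  have h1 := germAt_res (ρ.preimage_mono (inf_le_left : D.P.U i ⊓ D.P.U j ≤ D.P.U i)) x ⟨hi, hj⟩
    (C.ξ i)
  have h2 := germAt_res (ρ.preimage_mono (inf_le_right : D.P.U i ⊓ D.P.U j ≤ D.P.U j)) x ⟨hi, hj⟩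
    (C.ξ j)
  exact h1.symm.trans (h.trans ((map_mul _ _ _).trans (congrArg _ h2)))

theorem germ_a_eq (i j : D.P.I) (x : X) (hi : x ∈ ρ ⁻¹ᵁ D.P.U i) (hj : x ∈ ρ ⁻¹ᵁ D.P.U j) :
    germAt _ x hi ((ρ.app (D.P.U i)).hom (D.a₁.val i)) =
      germAt (ρ ⁻¹ᵁ (D.P.U i ⊓ D.P.U j)) x ⟨hi, hj⟩
      ((ρ.app (D.P.U i ⊓ D.P.U j)).hom (D.P.L i j)) *
        germAt _ x hj ((ρ.app (D.P.U j)).hom (D.a₁.val j)) := by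
  have h := congrArg (ρ.stalkMap x).hom (D.a₁.germ_eq i j (ρ x) hi hj)
  rw [map_mul, stalkMap_germAt ρ _ x hi, stalkMap_germAt ρ _ x hj] at h
  rw [h]
  congr 1
  rw [zpow_one, zpow_zero, mul_one]
  exact stalkMap_germAt ρ (D.P.U i ⊓ D.P.U j) x ⟨hi, hj⟩ _

theorem span_germ_sigma (i j : D.P.I) (x : X) (hi : x ∈ ρ ⁻¹ᵁ D.P.U i) (hj : x ∈ ρ ⁻¹ᵁ D.P.U j) :
    Ideal.span {germAt _ x hi ((ρ.app (D.P.U i)).hom (D.σ.val i))} =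
      Ideal.span {germAt _ x hj ((ρ.app (D.P.U j)).hom (D.σ.val j))} := by
  have h := congrArg (Ideal.map (ρ.stalkMap x).hom) (D.σ.span_germ_eq i j (ρ x) hi hj)
  rw [Ideal.map_span, Ideal.map_span, Set.image_singleton, Set.image_singleton,
    stalkMap_germAt ρ _ x hi, stalkMap_germAt ρ _ x hj] at h
  exact h

theorem generatedOn_coverCenter (i : D.P.I) :
    GeneratedOn (D.coverCenter C) (ρ ⁻¹ᵁ D.P.U i)
      ![(ρ.app (D.P.U i)).hom (D.σ.val i), (ρ.app (D.P.U i)).hom (D.a₁.val i), C.ξ i] := by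
  intro b hb
  refine le_antisymm (Ideal.span_le.mpr ?_) (Ideal.span_mono ?_)
  · rintro _ ⟨j, hj, rfl | rfl | rfl⟩
    · rw [D.germ_xi_eq C j i b hj hb]
      exact Ideal.mul_mem_left _ _ (Ideal.subset_span ⟨2, rfl⟩)
    · rw [D.germ_a_eq j i b hj hb]
      exact Ideal.mul_mem_left _ _ (Ideal.subset_span ⟨1, rfl⟩)
    · have h := Ideal.mem_span_singleton_self (germAt _ b hj ((ρ.app (D.P.U j)).hom (D.σ.val j)))
      rw [← D.span_germ_sigma i j b hb hj] at h
      exact Ideal.span_mono (Set.singleton_subset_iff.mpr (Set.mem_range.mpr ⟨0, rfl⟩)) h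
  · rintro _ ⟨k, rfl⟩
    fin_cases k
    · exact ⟨i, hb, Or.inr (Or.inr rfl)⟩
    · exact ⟨i, hb, Or.inr (Or.inl rfl)⟩
    · exact ⟨i, hb, Or.inl rfl⟩

theorem generatedOn_coverSigma (i : D.P.I) :
    GeneratedOn (D.coverSigma C) (ρ ⁻¹ᵁ D.P.U i)
      ![(ρ.app (D.P.U i)).hom (D.σ.val i)] := by
  intro b hb
  refine le_antisymm (Ideal.span_le.mpr ?_) (Ideal.span_mono ?_)
  · rintro _ ⟨j, hj, rfl⟩
    have h := Ideal.mem_span_singleton_self (germAt _ b hj ((ρ.app (D.P.U j)).hom (D.σ.val j)))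
    rw [← D.span_germ_sigma i j b hb hj] at h
    exact Ideal.span_mono (Set.singleton_subset_iff.mpr (Set.mem_range.mpr ⟨0, rfl⟩)) h
  · rintro _ ⟨k, rfl⟩
    fin_cases k
    exact ⟨i, hb, rfl⟩

theorem generatedOn_stack (s : ℤ) (i : D.P.I) :
    GeneratedOn (D.stack C s) (ρ ⁻¹ᵁ D.P.U i)
      ![(ρ.app (D.P.U i)).hom (D.σ.val i),
        C.ξ i - (s : Γ(X, ρ ⁻¹ᵁ D.P.U i)) * (ρ.app (D.P.U i)).hom (D.a₁.val i)] := by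
  intro b hb
  refine le_antisymm (Ideal.span_le.mpr ?_) (Ideal.span_mono ?_)
  · rintro _ ⟨j, hj, rfl | rfl⟩
    · have h := Ideal.mem_span_singleton_self (germAt _ b hj ((ρ.app (D.P.U j)).hom (D.σ.val j)))
      rw [← D.span_germ_sigma i j b hb hj] at h
      exact Ideal.span_mono (Set.singleton_subset_iff.mpr (Set.mem_range.mpr ⟨0, rfl⟩)) h
    · rw [map_sub, map_mul, map_intCast, D.germ_xi_eq C j i b hj hb, D.germ_a_eq j i b hj hb,
        mul_left_comm, ← mul_sub]
      refine Ideal.mul_mem_left _ _ (Ideal.subset_span ⟨1, ?_⟩)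
      rw [← map_intCast (germAt _ b hb), ← map_mul, ← map_sub]
      rfl
  · rintro _ ⟨k, rfl⟩
    fin_cases k
    · exact ⟨i, hb, Or.inl rfl⟩
    · exact ⟨i, hb, Or.inr rfl⟩

end TateData

/-! ### Affine patches -/

/-- The ring of functions upstairs as an algebra over the functions downstairs. -/
abbrev appAlgebra {X B : Scheme.{0}} (ρ : X ⟶ B) (V : B.Opens) : Algebra Γ(B, V) Γ(X, ρ ⁻¹ᵁ V) :=
  (ρ.app V).hom.toAlgebra

attribute [local instance] appAlgebra

theorem GeneratedOn.of_fin_two {Y : Scheme.{0}} {J : StalkIdeal Y} {W V : Y.Opens} {s a : Γ(Y, W)}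
    (h : GeneratedOn J W ![s, a]) (hV : V ≤ W) : GeneratedOn J V ![res hV s, res hV a] := by
  convert h.restrict hV using 1
  ext k
  fin_cases k <;> rfl

theorem GeneratedOn.of_fin_three {Y : Scheme.{0}} {J : StalkIdeal Y} {W V : Y.Opens}
    {s a x : Γ(Y, W)} (h : GeneratedOn J W ![s, a, x]) (hV : V ≤ W) :
    GeneratedOn J V ![res hV s, res hV a, res hV x] := by
  convert h.restrict hV using 1
  ext k
  fin_cases k <;> rfl

theorem GeneratedOn.zeroSet_iff {Y : Scheme.{0}} {J : StalkIdeal Y} {W : Y.Opens} {K : Type}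
    {f : K → Γ(Y, W)} (h : GeneratedOn J W f) {y : Y} (hy : y ∈ W) :
    y ∈ zeroSet J ↔ ∀ k, f k ∈ ptIdeal W y hy := by
  rw [show (y ∈ zeroSet J) = (J y ≠ ⊤) from rfl, h y hy]
  constructor
  · intro h1 k
    exact IsLocalRing.le_maximalIdeal h1 (Ideal.subset_span ⟨k, rfl⟩)
  · intro h1 h2
    refine (IsLocalRing.maximalIdeal.isMaximal (Y.presheaf.stalk y)).ne_top (top_le_iff.mp ?_)
    rw [← h2, Ideal.span_le]
    rintro _ ⟨k, rfl⟩
    exact h1 k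

theorem app_res {X B : Scheme.{0}} (ρ : X ⟶ B) {V W : B.Opens} (h : V ≤ W) (s : Γ(B, W)) :
    (ρ.app V).hom (res h s) = res (ρ.preimage_mono h) ((ρ.app W).hom s) := by
  have := ρ.naturality (homOfLE h).op
  exact congrArg (fun m => m.hom s) this

namespace TateData

variable {B : Scheme.{0}} {N : ℕ} {D : TateData B N}

/-- An affine open set on which the line bundles are trivialised. -/
structure Patch (D : TateData B N) where
  i : D.P.I
  V : B.Opens
  le : V ≤ D.P.U i
  affine : IsAffineOpen V

namespace Patch

variable (p : D.Patch)

/-- The section `σ` on a patch. -/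
def σ : Γ(B, p.V) := res p.le (D.σ.val p.i)

/-- The section `a₁` on a patch. -/
def a₁ : Γ(B, p.V) := res p.le (D.a₁.val p.i)

/-- The section `a₂₂` on a patch. -/
def a₂₂ : Γ(B, p.V) := res p.le (D.a₂₂.val p.i)

/-- The branch section on a patch. -/
abbrev h : Γ(B, p.V) := p.a₁ ^ 2 + 4 * p.σ ^ 2 * p.a₂₂

theorem h_eq : p.h = res p.le (D.sppBranch p.i) := by
  simp only [sppBranch, map_add, map_mul, map_pow, map_ofNat]
  rfl

theorem exists_mem (W : B.Opens) (b : B) (hb : b ∈ W) : ∃ p : D.Patch, b ∈ p.V ∧ p.V ≤ W := by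
  obtain ⟨i, hi⟩ := D.P.cover b
  obtain ⟨V, hV, hbV, hVW⟩ := TopologicalSpace.Opens.isBasis_iff_nbhd.mp B.isBasis_affineOpens
    (show b ∈ W ⊓ D.P.U i from ⟨hb, hi⟩)
  exact ⟨⟨i, V, hVW.trans inf_le_right, hV⟩, hbV, hVW.trans inf_le_left⟩

theorem generatedOn_base : GeneratedOn D.baseCenter p.V ![p.σ, p.a₁] :=
  (D.generatedOn_baseCenter p.i).of_fin_two p.le

variable {X : Scheme.{0}} {ρ : X ⟶ B} (C : DoubleCover D.P ρ D.limitBranch)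

/-- The coordinate of the double cover on a patch. -/
def ξ : Γ(X, ρ ⁻¹ᵁ p.V) := res (ρ.preimage_mono p.le) (C.ξ p.i)

theorem generatedOn_cover : GeneratedOn (D.coverCenter C) (ρ ⁻¹ᵁ p.V)
    ![algebraMap Γ(B, p.V) _ p.σ, algebraMap Γ(B, p.V) _ p.a₁, p.ξ C] := by
  have := (D.generatedOn_coverCenter C p.i).of_fin_three (ρ.preimage_mono p.le)
  rw [← app_res, ← app_res] at this
  exact this

theorem generatedOn_sigma : GeneratedOn (D.coverSigma C) (ρ ⁻¹ᵁ p.V)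
    ![algebraMap Γ(B, p.V) _ p.σ] := by
  have := (D.generatedOn_coverSigma C p.i).restrict (ρ.preimage_mono p.le)
  convert this using 1
  ext k
  fin_cases k
  exact app_res _ _ _

theorem generatedOn_stack (s : ℤ) : GeneratedOn (D.stack C s) (ρ ⁻¹ᵁ p.V)
    ![algebraMap Γ(B, p.V) _ p.σ, p.ξ C - (s : Γ(X, ρ ⁻¹ᵁ p.V)) *
      algebraMap Γ(B, p.V) _ p.a₁] := by
  have := (D.generatedOn_stack C s p.i).of_fin_two (ρ.preimage_mono p.le)
  rw [map_sub, map_mul, map_intCast, ← app_res, ← app_res] at this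
  exact this

theorem isQuadratic : IsQuadratic p.h (p.ξ C) := by
  have := C.isDoubleCoverOn p.i p.V p.le p.affine
  rw [limitBranch_eq, ← p.h_eq] at this
  exact ⟨this.1, this.2⟩

theorem isAffineOpen_preimage (C : DoubleCover D.P ρ D.limitBranch) : IsAffineOpen (ρ ⁻¹ᵁ p.V) :=
  have := C.affine
  p.affine.preimage ρ

theorem nontrivial_cover (C : DoubleCover D.P ρ D.limitBranch) [Nontrivial Γ(B, p.V)] :
    Nontrivial Γ(X, ρ ⁻¹ᵁ p.V) := by
  by_contra hn
  rw [not_nontrivial_iff_subsingleton] at hn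
  have := (p.isQuadratic C).eq_of_eq (p := 1) (q := 0) (p' := 0) (q' := 0)
    (Subsingleton.elim _ _)
  exact one_ne_zero this.1

theorem isDomain_cover (C : DoubleCover D.P ρ D.limitBranch) [IsIntegral X]
    [Nontrivial Γ(B, p.V)] : IsDomain Γ(X, ρ ⁻¹ᵁ p.V) := by
  have h := p.nontrivial_cover C
  have : Nonempty (ρ ⁻¹ᵁ p.V) := by
    by_contra hn
    have : ρ ⁻¹ᵁ p.V = ⊥ := by
      ext x
      simp only [TopologicalSpace.Opens.coe_bot, Set.mem_empty_iff_false, iff_false]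
      exact fun hx => hn ⟨⟨x, hx⟩⟩
    rw [this] at h
    exact not_subsingleton Γ(X, ⊥) inferInstance
  infer_instance

theorem isDomain_base [IsIntegral B] [h : Nontrivial Γ(B, p.V)] : IsDomain Γ(B, p.V) := by
  have : Nonempty p.V := by
    by_contra hn
    have : p.V = ⊥ := by
      ext x
      simp only [TopologicalSpace.Opens.coe_bot, Set.mem_empty_iff_false, iff_false]
      exact fun hx => hn ⟨⟨x, hx⟩⟩
    rw [this] at h
    exact not_subsingleton Γ(B, ⊥) inferInstance
  infer_instance

theorem sigma_mem_nonZeroDivisors (C : DoubleCover D.P ρ D.limitBranch) [IsIntegral X] [IsIntegral B] :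
    p.σ ∈ nonZeroDivisors Γ(B, p.V) := by
  rcases subsingleton_or_nontrivial Γ(B, p.V) with hs | hs
  · exact mem_nonZeroDivisors_iff_right.mpr fun x _ => Subsingleton.elim _ _
  have := p.isDomain_base
  have := p.isDomain_cover C
  refine mem_nonZeroDivisors_of_ne_zero fun h0 => ?_
  have H := p.isQuadratic C
  have h1 : (p.ξ C - algebraMap _ _ p.a₁) * (p.ξ C + algebraMap _ _ p.a₁) = 0 := by
    have := H.sq
    rw [Patch.h, h0] at this
    simp only [ne_eq, OfNat.ofNat_ne_zero, not_false_eq_true, zero_pow, mul_zero, zero_mul,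
      add_zero, map_pow] at this
    linear_combination this
  rcases mul_eq_zero.mp h1 with h2 | h2
  · have := H.eq_of_eq (p := -p.a₁) (q := 1) (p' := 0) (q' := 0) (by
      simp only [map_neg, map_one, map_zero]; linear_combination h2)
    exact one_ne_zero this.2
  · have := H.eq_of_eq (p := p.a₁) (q := 1) (p' := 0) (q' := 0) (by
      simp only [map_one, map_zero]; linear_combination h2)
    exact one_ne_zero this.2

variable (f : B ⟶ SpecC)

theorem sppGeneric [Smooth f] (hD : D.Generic f) :
    letI := (sectionScalars f p.V).toAlgebra
    SppGeneric p.σ p.a₁ p.a₂₂ := by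
  let := (sectionScalars f p.V).toAlgebra
  have := smooth_sections f p.affine
  have hz : ∀ (b : B) (hb : b ∈ p.V), b ∈ zeroSet D.baseCenter ↔
      p.σ ∈ ptIdeal p.V b hb ∧ p.a₁ ∈ ptIdeal p.V b hb := fun b hb => by
    rw [p.generatedOn_base.zeroSet_iff hb]
    exact Fin.forall_fin_two
  have key : ∀ (b : B) (hb : b ∈ p.V), letI := (scalars f b).toAlgebra
      letI := (germAt p.V b hb).toAlgebra
      IsScalarTower ℂ Γ(B, p.V) (B.presheaf.stalk b) := fun b hb => by
    let := (scalars f b).toAlgebra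
    let := (germAt p.V b hb).toAlgebra
    exact IsScalarTower.of_algebraMap_eq' (germAt_sectionScalars f p.V b hb).symm
  refine ⟨fun q hq h1 h2 => ?_, fun q hq h1 h2 h3 => ?_, fun q hq h1 h2 => ?_⟩
  all_goals
    obtain ⟨b, hb, rfl⟩ := exists_ptIdeal_eq p.affine q hq
    let := (scalars f b).toAlgebra
    let := (germAt p.V b hb).toAlgebra
    have := key b hb
  · refine exists_derivations_notMem (O := B.presheaf.stalk b) ?_
    have := hD.transverse p.i b (p.le hb) ((hz b hb).mpr ⟨h1, h2⟩)
    rw [← germAt_res p.le b hb, ← germAt_res p.le b hb] at this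
    exact this
  · refine exists_derivations_notMem (O := B.presheaf.stalk b) ?_
    have h4 := germAt_res p.le b hb (D.a₂₂.val p.i)
    have := hD.transverse_pinch p.i b (p.le hb) ((hz b hb).mpr ⟨h1, h2⟩) (h4 ▸ h3)
    rw [← germAt_res p.le b hb, ← germAt_res p.le b hb] at this
    exact this
  · refine exists_derivation_notMem (O := B.presheaf.stalk b) ?_
    have h4 := germAt_res p.le b hb (D.sppBranch p.i)
    rw [← p.h_eq] at h4
    have := hD.branch_smooth p.i b (p.le hb) (fun h => h1 ((hz b hb).mp h)) (h4 ▸ h2)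
    rw [← h4] at this
    exact this

theorem koszulExact (C : DoubleCover D.P ρ D.limitBranch) [Smooth f] (hD : D.Generic f) [IsIntegral X] [IsIntegral B] :
    KoszulExact p.σ p.a₁ := by
  let := (sectionScalars f p.V).toAlgebra
  have := isNoetherianRing_sections f p.affine
  exact (p.sppGeneric f hD).koszulExact (p.sigma_mem_nonZeroDivisors C)

end Patch

end TateData

/-! ### The two charts of the blow-ups -/

theorem fin_two_rev_eq : ∀ {k l : Fin 2}, l ≠ k → k.rev = l := by decide

section ChartRings

variable {A : Type} [CommRing A] (σ a₁ a₂₂ : A) (k : Fin 2)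

/-- The chart of the blow-up of `(σ, a₁)` on which the `k`-th generator divides the other one. -/
abbrev BaseChart : Type := SlopeChart (![σ, a₁] k) (![σ, a₁] k.rev)

/-- The homogeneous coordinates `s`, `a` on a chart of the blow-up of the base. -/
def chartCoord (l : Fin 2) : BaseChart σ a₁ k := if l = k then 1 else SlopeChart.t _ _

/-- The branch function `a² + 4 s² a₂₂` on a chart of the blow-up of the base. -/
abbrev chartBranch : BaseChart σ a₁ k :=
  chartCoord σ a₁ k 1 ^ 2 + 4 * chartCoord σ a₁ k 0 ^ 2 * algebraMap A _ a₂₂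

/-- The chart of the blow-up of the double cover. -/
abbrev CoverChart : Type := SqrtAlg (chartBranch σ a₁ a₂₂ k)

theorem chartCoord_self : chartCoord σ a₁ k k = 1 := if_pos rfl

theorem algebraMap_mul_chartCoord (l : Fin 2) : algebraMap A (BaseChart σ a₁ k) (![σ, a₁] l) =
    algebraMap A _ (![σ, a₁] k) * chartCoord σ a₁ k l := by
  by_cases h : l = k
  · subst h
    rw [chartCoord_self, mul_one]
  · rw [chartCoord, if_neg h, SlopeChart.algebraMap_mul_t]
    have := fin_two_rev_eq h
    subst this
    rfl

theorem algebraMap_branch : algebraMap A (BaseChart σ a₁ k) (a₁ ^ 2 + 4 * σ ^ 2 * a₂₂) =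
    algebraMap A _ (![σ, a₁] k) ^ 2 * chartBranch σ a₁ a₂₂ k := by
  have h0 := algebraMap_mul_chartCoord σ a₁ k 0
  have h1 := algebraMap_mul_chartCoord σ a₁ k 1
  simp only [Matrix.cons_val_zero, Matrix.cons_val_one] at h0 h1
  rw [map_add, map_mul, map_mul, map_pow, map_pow, map_ofNat (algebraMap A (BaseChart σ a₁ k)),
    h0, h1]
  ring

variable {σ a₁ a₂₂}

theorem isRingChart_baseChart (h : KoszulExact σ a₁) :
    IsRingChart ![σ, a₁] k (BaseChart σ a₁ k) := by
  refine SlopeChart.isRingChart (k' := k.rev) ?_ rfl rfl fun l => ?_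
  · fin_cases k
    · exact h
    · exact h.symm
  · by_cases hl : l = k
    · exact Or.inl (hl ▸ rfl)
    · exact Or.inr (fin_two_rev_eq hl ▸ rfl)

variable {A' : Type} [CommRing A'] [Algebra A A'] {ξ₀ : A'}

theorem exists_coverChartHom (H : IsQuadratic (a₁ ^ 2 + 4 * σ ^ 2 * a₂₂) ξ₀)
    (hK : KoszulExact σ a₁) : ∃ φ : A' →ₐ[A] CoverChart σ a₁ a₂₂ k,
      φ ξ₀ = algebraMap A _ (![σ, a₁] k) * AdjoinRoot.root _ ∧
      letI := φ.toRingHom.toAlgebra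
      IsRingChart ![algebraMap A A' σ, algebraMap A A' a₁, ξ₀] k.castSucc
        (CoverChart σ a₁ a₂₂ k) := by
  obtain ⟨φ, hφ⟩ := H.exists_lift
    (algebraMap A (CoverChart σ a₁ a₂₂ k) (![σ, a₁] k) * AdjoinRoot.root _) (by
      rw [mul_pow, SqrtAlg.root_sq,
        IsScalarTower.algebraMap_apply A (BaseChart σ a₁ k) (CoverChart σ a₁ a₂₂ k), ← map_pow,
        ← map_mul, ← algebraMap_branch, ← IsScalarTower.algebraMap_apply])
  refine ⟨φ, hφ, ?_⟩
  let := φ.toRingHom.toAlgebra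
  have : IsScalarTower A A' (CoverChart σ a₁ a₂₂ k) :=
    IsScalarTower.of_algebraMap_eq fun x => (φ.commutes x).symm
  have hS := isRingChart_baseChart k hK
  refine isRingChart_double H (SqrtAlg.isQuadratic (chartBranch σ a₁ a₂₂ k)) hS ?_ ?_
    ⟨2, rfl⟩ ?_ (algebraMap_branch σ a₁ a₂₂ k) hφ ?_
  · fin_cases k <;> rfl
  · intro l
    exact ⟨l.castSucc, by fin_cases l <;> rfl⟩
  · intro l
    fin_cases l
    · exact Or.inr ⟨0, rfl⟩
    · exact Or.inr ⟨1, rfl⟩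
    · exact Or.inl rfl
  · rw [IsScalarTower.algebraMap_apply A (BaseChart σ a₁ k) (CoverChart σ a₁ a₂₂ k)]
    exact mem_nonZeroDivisors_of_flat hS.nzd

variable [Algebra ℂ A]

theorem SppGeneric.smooth_baseChart (G : SppGeneric σ a₁ a₂₂) [Algebra.Smooth ℂ A] :
    Algebra.Smooth ℂ (BaseChart σ a₁ k) := by
  fin_cases k
  · exact G.smooth_slope_zero
  · exact G.smooth_slope_one

theorem SppGeneric.exists_derivation_chartBranch (G : SppGeneric σ a₁ a₂₂)
    (q : Ideal (BaseChart σ a₁ k)) (hq : q.IsPrime) (hc : chartBranch σ a₁ a₂₂ k ∈ q) :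
    ∃ δ : Derivation ℂ (BaseChart σ a₁ k) (BaseChart σ a₁ k), δ (chartBranch σ a₁ a₂₂ k) ∉ q := by
  fin_cases k
  · have h : chartBranch σ a₁ a₂₂ 0 =
        (SlopeChart.t σ a₁ ^ 2 + 4 * algebraMap A _ a₂₂ : SlopeChart σ a₁) := by
      have e : (if (1 : Fin 2) = 0 then (1 : SlopeChart σ a₁) else SlopeChart.t σ a₁) ^ 2 +
        4 * (if (0 : Fin 2) = 0 then (1 : SlopeChart σ a₁) else SlopeChart.t σ a₁) ^ 2 *
          algebraMap A (SlopeChart σ a₁) a₂₂ =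
          SlopeChart.t σ a₁ ^ 2 + 4 * algebraMap A _ a₂₂ := by simp
      exact e
    have := G.exists_derivation_zero q hq
    rw [← h] at this
    exact this hc
  · have h : chartBranch σ a₁ a₂₂ 1 =
        (1 + 4 * SlopeChart.t a₁ σ ^ 2 * algebraMap A _ a₂₂ : SlopeChart a₁ σ) := by
      have e : (if (1 : Fin 2) = 1 then (1 : SlopeChart a₁ σ) else SlopeChart.t a₁ σ) ^ 2 +
        4 * (if (0 : Fin 2) = 1 then (1 : SlopeChart a₁ σ) else SlopeChart.t a₁ σ) ^ 2 *
          algebraMap A (SlopeChart a₁ σ) a₂₂ =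
          1 + 4 * SlopeChart.t a₁ σ ^ 2 * algebraMap A _ a₂₂ := by simp
      exact e
    have := G.exists_derivation_one q hq
    rw [← h] at this
    exact this hc

theorem isUnit_two_of_complex {R : Type} [CommRing R] (φ : ℂ →+* R) : IsUnit (2 : R) := by
  rw [← map_ofNat φ]
  exact (isUnit_iff_ne_zero.mpr two_ne_zero).map φ

theorem SppGeneric.smooth_coverChart (G : SppGeneric σ a₁ a₂₂) [Algebra.Smooth ℂ A] :
    Algebra.Smooth ℂ (CoverChart σ a₁ a₂₂ k) := by
  have := G.smooth_baseChart k
  exact (SqrtAlg.isQuadratic (chartBranch σ a₁ a₂₂ k)).smooth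
    (isUnit_two_of_complex (algebraMap ℂ _)) (G.exists_derivation_chartBranch k)

end ChartRings

/-! ### Existence of the blow-ups -/

namespace TateData

variable {B : Scheme.{0}} {N : ℕ} {D : TateData B N} {X : Scheme.{0}} {ρ : X ⟶ B}
  (C : DoubleCover D.P ρ D.limitBranch)

theorem locallyFG_baseCenter : LocallyFG D.baseCenter := fun b => by
  obtain ⟨p, hb, -⟩ := Patch.exists_mem (D := D) ⊤ b trivial
  exact ⟨p.V, hb, 2, _, p.generatedOn_base⟩

theorem locallyFG_coverCenter : LocallyFG (D.coverCenter C) := fun x => by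
  obtain ⟨p, hb, -⟩ := Patch.exists_mem (D := D) ⊤ (ρ x) trivial
  exact ⟨ρ ⁻¹ᵁ p.V, hb, 3, _, p.generatedOn_cover C⟩

namespace Patch

variable (p : D.Patch)

/-- A chart of the blow-up of the base over a patch. -/
def baseChartMap (k : Fin 2) : Spec (CommRingCat.of (BaseChart p.σ p.a₁ k)) ⟶ B :=
  Spec.map (CommRingCat.ofHom (algebraMap Γ(B, p.V) _)) ≫ p.affine.fromSpec

theorem isChart_baseChartMap (hK : KoszulExact p.σ p.a₁) (k : Fin 2) :
    IsChart D.baseCenter p.V (![p.σ, p.a₁] k) (p.baseChartMap k) :=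
  isChart_of_isRingChart p.affine p.generatedOn_base (isRingChart_baseChart k hK)

/-- Functions on the double cover in a chart of its blow-up. -/
def coverChartHom (hK : KoszulExact p.σ p.a₁) (k : Fin 2) :
    Γ(X, ρ ⁻¹ᵁ p.V) →ₐ[Γ(B, p.V)] CoverChart p.σ p.a₁ p.a₂₂ k :=
  (exists_coverChartHom k (p.isQuadratic C) hK).choose

theorem coverChartHom_xi (hK : KoszulExact p.σ p.a₁) (k : Fin 2) :
    p.coverChartHom C hK k (p.ξ C) = algebraMap Γ(B, p.V) _ (![p.σ, p.a₁] k) * AdjoinRoot.root _ :=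
  (exists_coverChartHom k (p.isQuadratic C) hK).choose_spec.1

/-- A chart of the blow-up of the double cover over a patch. -/
def coverChartMap (hK : KoszulExact p.σ p.a₁) (k : Fin 2) :
    Spec (CommRingCat.of (CoverChart p.σ p.a₁ p.a₂₂ k)) ⟶ X :=
  Spec.map (CommRingCat.ofHom (p.coverChartHom C hK k).toRingHom) ≫
    (p.isAffineOpen_preimage C).fromSpec

/-- The local generators `σ`, `a₁`, `ξ` of the centre of the blow-up of the double cover. -/
abbrev coverGen : Fin 3 → Γ(X, ρ ⁻¹ᵁ p.V) :=
  ![algebraMap Γ(B, p.V) _ p.σ, algebraMap Γ(B, p.V) _ p.a₁, p.ξ C]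

theorem isChart_coverChartMap (hK : KoszulExact p.σ p.a₁) (k : Fin 2) :
    IsChart (D.coverCenter C) (ρ ⁻¹ᵁ p.V) (p.coverGen C k.castSucc) (p.coverChartMap C hK k) :=
  letI := (p.coverChartHom C hK k).toRingHom.toAlgebra
  isChart_of_isRingChart (p.isAffineOpen_preimage C) (p.generatedOn_cover C)
    (exists_coverChartHom k (p.isQuadratic C) hK).choose_spec.2

theorem exists_goodAt_base {T : Scheme.{0}} (g : T ⟶ B) (hc : IsCartier (pullIdeal g D.baseCenter))
    (t : T) (ht : g t ∈ p.V) : ∃ k, GoodAt D.baseCenter p.V (![p.σ, p.a₁] k) g t := by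
  obtain ⟨d, hd, he⟩ := hc t
  have h := (p.generatedOn_base.pullIdeal g) t ht
  obtain ⟨k, hk⟩ := exists_span_eq_of_isLocalRing _ hd (h.symm.trans he)
  exact ⟨k, ht, he.trans hk.symm, mem_nonZeroDivisors_of_span_eq hd hk.symm⟩

theorem exists_goodAt_cover {T : Scheme.{0}} (g : T ⟶ X)
    (hc : IsCartier (pullIdeal g (D.coverCenter C))) (t : T) (ht : g t ∈ ρ ⁻¹ᵁ p.V) :
    ∃ k : Fin 2, GoodAt (D.coverCenter C) (ρ ⁻¹ᵁ p.V) (p.coverGen C k.castSucc) g t := by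
  obtain ⟨d, hd, he⟩ := hc t
  have h := ((p.generatedOn_cover C).pullIdeal g) t ht
  let φ := (germAt (g ⁻¹ᵁ ρ ⁻¹ᵁ p.V) t ht).comp (g.app (ρ ⁻¹ᵁ p.V)).hom
  suffices hs : ∃ k : Fin 2, Ideal.span {φ (p.coverGen C k.castSucc)} = Ideal.span {d} by
    obtain ⟨k, hk⟩ := hs
    exact ⟨k, ht, he.trans hk.symm, mem_nonZeroDivisors_of_span_eq hd hk.symm⟩
  obtain ⟨k, hk⟩ := exists_span_eq_of_isLocalRing _ hd (h.symm.trans he)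
  change Ideal.span {φ (p.coverGen C k)} = _ at hk
  have hmem : ∀ l, φ (p.coverGen C k) ∣ φ (p.coverGen C l) := fun l => by
    rw [← Ideal.mem_span_singleton, hk, ← he, h]
    exact Ideal.subset_span ⟨l, rfl⟩
  have hnz := mem_nonZeroDivisors_of_span_eq hd hk.symm
  by_cases h2 : k = 2
  · subst h2
    obtain ⟨x, hx⟩ := hmem 0
    obtain ⟨y, hy⟩ := hmem 1
    have hsq := congrArg φ (p.isQuadratic C).sq
    simp only [map_add, map_mul, map_pow, map_ofNat] at hsq
    change φ (algebraMap _ _ p.σ) = φ (p.ξ C) * x at hx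
    change φ (algebraMap _ _ p.a₁) = φ (p.ξ C) * y at hy
    change φ (p.ξ C) ∈ _ at hnz
    rw [hx, hy] at hsq
    have h1 : y * y + x * (4 * x * φ (algebraMap _ _ p.a₂₂)) = 1 := by
      refine (mul_cancel_left_mem_nonZeroDivisors (pow_mem hnz 2)).mp ?_
      linear_combination -hsq
    rcases IsLocalRing.isUnit_or_isUnit_of_add_one h1 with hu | hu
    · refine ⟨1, ?_⟩
      rw [← hk]
      change Ideal.span {φ (algebraMap _ _ p.a₁)} = Ideal.span {φ (p.ξ C)}
      rw [hy, Ideal.span_singleton_mul_right_unit (isUnit_of_mul_isUnit_left hu)]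
    · refine ⟨0, ?_⟩
      rw [← hk]
      change Ideal.span {φ (algebraMap _ _ p.σ)} = Ideal.span {φ (p.ξ C)}
      rw [hx, Ideal.span_singleton_mul_right_unit (isUnit_of_mul_isUnit_left hu)]
  · obtain ⟨k, rfl⟩ : ∃ k' : Fin 2, k = k'.castSucc := by
      revert h2; clear hk hmem hnz; decide +revert
    exact ⟨k, hk⟩

end Patch

theorem exists_isBlowup_baseCenter (hK : ∀ p : D.Patch, KoszulExact p.σ p.a₁) :
    ∃ (B' : Scheme.{0}) (β : B' ⟶ B), IsBlowup D.baseCenter β :=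
  ChartCover.exists_isBlowup
    { fg := locallyFG_baseCenter
      κ := D.Patch × Fin 2
      W := fun x => x.1.V
      u := fun x => ![x.1.σ, x.1.a₁] x.2
      C := fun x => Spec (CommRingCat.of (BaseChart x.1.σ x.1.a₁ x.2))
      c := fun x => x.1.baseChartMap x.2
      isChart := fun x => x.1.isChart_baseChartMap (hK x.1) x.2
      covers := fun T g hc t => by
        obtain ⟨p, hp, -⟩ := Patch.exists_mem (D := D) ⊤ (g t) trivial
        obtain ⟨k, hk⟩ := p.exists_goodAt_base g hc t hp
        exact ⟨(p, k), hk⟩ }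

theorem exists_isBlowup_coverCenter (hK : ∀ p : D.Patch, KoszulExact p.σ p.a₁) :
    ∃ (X' : Scheme.{0}) (π : X' ⟶ X), IsBlowup (D.coverCenter C) π :=
  ChartCover.exists_isBlowup
    { fg := locallyFG_coverCenter C
      κ := D.Patch × Fin 2
      W := fun x => ρ ⁻¹ᵁ x.1.V
      u := fun x => x.1.coverGen C x.2.castSucc
      C := fun x => Spec (CommRingCat.of (CoverChart x.1.σ x.1.a₁ x.1.a₂₂ x.2))
      c := fun x => x.1.coverChartMap C (hK x.1) x.2
      isChart := fun x => x.1.isChart_coverChartMap C (hK x.1) x.2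
      covers := fun T g hc t => by
        obtain ⟨p, hp, -⟩ := Patch.exists_mem (D := D) ⊤ (ρ (g t)) trivial
        obtain ⟨k, hk⟩ := p.exists_goodAt_cover C g hc t hp
        exact ⟨(p, k), hk⟩ }

/-- The blow-up of the base is covered by its charts. -/
theorem exists_baseChart {B' : Scheme.{0}} {β : B' ⟶ B} (hβ : IsBlowup D.baseCenter β)
    (hK : ∀ p : D.Patch, KoszulExact p.σ p.a₁) (p : D.Patch) (y : B') (hy : β y ∈ p.V) :
    ∃ (k : Fin 2) (j : Spec (CommRingCat.of (BaseChart p.σ p.a₁ k)) ⟶ B'), IsOpenImmersion j ∧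
      j ≫ β = p.baseChartMap k ∧ ∃ q, j q = y := by
  obtain ⟨k, hk⟩ := p.exists_goodAt_base β hβ.cartier y hy
  obtain ⟨j, hj, h1, h2⟩ := hβ.exists_chart locallyFG_baseCenter (p.isChart_baseChartMap (hK p) k)
  have h3 : y ∈ Set.range j := by rw [h2]; exact hk
  exact ⟨k, j, hj, h1, h3⟩

/-- The blow-up of the double cover is covered by its charts. -/
theorem exists_coverChart {X' : Scheme.{0}} {π : X' ⟶ X} (hπ : IsBlowup (D.coverCenter C) π)
    (hK : ∀ p : D.Patch, KoszulExact p.σ p.a₁) (p : D.Patch) (y : X') (hy : ρ (π y) ∈ p.V) :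
    ∃ (k : Fin 2) (j : Spec (CommRingCat.of (CoverChart p.σ p.a₁ p.a₂₂ k)) ⟶ X'),
      IsOpenImmersion j ∧ j ≫ π = p.coverChartMap C (hK p) k ∧ ∃ q, j q = y := by
  obtain ⟨k, hk⟩ := p.exists_goodAt_cover C π hπ.cartier y hy
  obtain ⟨j, hj, h1, h2⟩ := hπ.exists_chart (locallyFG_coverCenter C)
    (p.isChart_coverChartMap C (hK p) k)
  have h3 : y ∈ Set.range j := by rw [h2]; exact hk
  exact ⟨k, j, hj, h1, h3⟩

/-! ### The explicit models -/

theorem hasCharts_resBase {B' : Scheme.{0}} {β : B' ⟶ B} (hβ : IsBlowup D.baseCenter β)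
    (p : D.Patch) (hK : KoszulExact p.σ p.a₁) :
    HasCharts β p.affine (ResBaseChart p.σ p.a₁) (resBaseCoord _ _) :=
  hβ.hasCharts locallyFG_baseCenter p.affine p.generatedOn_base (isRingChart_resBase hK)
    resBaseCoord_mul

variable {C} {X' : Scheme.{0}} {π : X' ⟶ X}

theorem hasCharts_resSpp (hπ : IsBlowup (D.coverCenter C) π) (p : D.Patch)
    (hK : KoszulExact p.σ p.a₁) (hV : IsAffineOpen (ρ ⁻¹ᵁ p.V)) :
    HasCharts π hV (ResSppChart (algebraMap Γ(B, p.V) _ p.σ) (algebraMap Γ(B, p.V) _ p.a₁)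
      (algebraMap Γ(B, p.V) _ p.a₂₂) (p.ξ C)) (resSppCoord _ _ _ _) :=
  hπ.hasCharts (locallyFG_coverCenter C) hV (p.generatedOn_cover C)
    (isRingChart_resSpp (p.isQuadratic C) hK) resSppCoord_mul

theorem hasCharts_smallRes (f : B ⟶ SpecC) (hπ : IsBlowup (D.coverCenter C) π) (p : D.Patch)
    (hK : KoszulExact p.σ p.a₁) (hV : IsAffineOpen (ρ ⁻¹ᵁ p.V)) :
    HasCharts π hV (SmallResChart (algebraMap Γ(B, p.V) _ p.a₁ + p.ξ C)
      (algebraMap Γ(B, p.V) _ p.a₁ - p.ξ C) (algebraMap Γ(B, p.V) _ p.σ)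
      (-4 * algebraMap Γ(B, p.V) _ p.a₂₂)) (smallResCoord _ _ _ _) := by
  obtain ⟨hf, hhf⟩ := (isUnit_two_of_complex (sectionScalars f p.V)).exists_right_inv
  refine hπ.hasCharts (locallyFG_coverCenter C) hV (f := smallGen _ _ _ _) ?_
    (isRingChart_smallRes (p.isQuadratic C) hK hhf rfl rfl rfl rfl) smallResCoord_mul
  intro x hx
  rw [p.generatedOn_cover C x hx]
  set γ := germAt (ρ ⁻¹ᵁ p.V) x hx
  have hhf' := congrArg (fun r => γ (algebraMap _ _ r)) hhf
  simp only [map_mul, map_one, map_ofNat] at hhf'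
  refine le_antisymm (Ideal.span_le.mpr ?_) (Ideal.span_le.mpr ?_)
  · have h0 : γ (algebraMap _ _ p.σ) ∈ Ideal.span (Set.range fun k => γ (smallGen
        (algebraMap Γ(B, p.V) _ p.a₁ + p.ξ C) (algebraMap Γ(B, p.V) _ p.a₁ - p.ξ C)
        (algebraMap Γ(B, p.V) _ p.σ) (-4 * algebraMap Γ(B, p.V) _ p.a₂₂) k)) :=
      Ideal.subset_span ⟨(1, 1), rfl⟩
    have h1 : γ (algebraMap _ _ p.a₁ + p.ξ C) ∈ Ideal.span (Set.range fun k => γ (smallGen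
        (algebraMap Γ(B, p.V) _ p.a₁ + p.ξ C) (algebraMap Γ(B, p.V) _ p.a₁ - p.ξ C)
        (algebraMap Γ(B, p.V) _ p.σ) (-4 * algebraMap Γ(B, p.V) _ p.a₂₂) k)) :=
      Ideal.subset_span ⟨(0, 1), rfl⟩
    have h2 : γ (algebraMap _ _ p.a₁ - p.ξ C) ∈ Ideal.span (Set.range fun k => γ (smallGen
        (algebraMap Γ(B, p.V) _ p.a₁ + p.ξ C) (algebraMap Γ(B, p.V) _ p.a₁ - p.ξ C)
        (algebraMap Γ(B, p.V) _ p.σ) (-4 * algebraMap Γ(B, p.V) _ p.a₂₂) k)) :=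
      Ideal.subset_span ⟨(1, 0), rfl⟩
    rw [map_add] at h1
    rw [map_sub] at h2
    rintro _ ⟨k, rfl⟩
    fin_cases k
    · exact h0
    · have := Ideal.mul_mem_left _ (γ (algebraMap _ _ hf)) (add_mem h1 h2)
      have e : γ (algebraMap _ _ p.a₁) = γ (algebraMap _ _ hf) *
          (γ (algebraMap _ _ p.a₁) + γ (p.ξ C) + (γ (algebraMap _ _ p.a₁) - γ (p.ξ C))) := by
        linear_combination (-γ (algebraMap _ _ p.a₁)) * hhf'
      rw [← e] at this
      exact this
    · have := Ideal.mul_mem_left _ (γ (algebraMap _ _ hf)) (sub_mem h1 h2)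
      have e : γ (p.ξ C) = γ (algebraMap _ _ hf) *
          (γ (algebraMap _ _ p.a₁) + γ (p.ξ C) - (γ (algebraMap _ _ p.a₁) - γ (p.ξ C))) := by
        linear_combination (-γ (p.ξ C)) * hhf'
      rw [← e] at this
      exact this
  · have h0 : γ (algebraMap _ _ p.σ) ∈ Ideal.span (Set.range fun k => γ (p.coverGen C k)) :=
      Ideal.subset_span ⟨0, rfl⟩
    have h1 : γ (algebraMap _ _ p.a₁) ∈ Ideal.span (Set.range fun k => γ (p.coverGen C k)) :=
      Ideal.subset_span ⟨1, rfl⟩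
    have h2 : γ (p.ξ C) ∈ Ideal.span (Set.range fun k => γ (p.coverGen C k)) :=
      Ideal.subset_span ⟨2, rfl⟩
    rintro _ ⟨⟨k, l⟩, rfl⟩
    fin_cases k <;> fin_cases l
    · change γ (algebraMap _ _ p.σ * (-4 * algebraMap _ _ p.a₂₂)) ∈ _
      rw [map_mul]
      exact Ideal.mul_mem_right _ _ h0
    · change γ (algebraMap _ _ p.a₁ + p.ξ C) ∈ _
      rw [map_add]
      exact add_mem h1 h2
    · change γ (algebraMap _ _ p.a₁ - p.ξ C) ∈ _
      rw [map_sub]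
      exact sub_mem h1 h2
    · exact h0

end TateData

/-! ### The complement of the centre -/

section Complement

variable {Y' Y : Scheme.{0}} {J : StalkIdeal Y} {π : Y' ⟶ Y}

theorem isClosed_zeroSet (hJ : LocallyFG J) : IsClosed (zeroSet J) := by
  rw [← isOpen_compl_iff, isOpen_iff_forall_mem_open]
  intro y hy
  obtain ⟨W, hyW, m, f, hf⟩ := hJ y
  have h := (hf.zeroSet_iff hyW).not.mp hy
  push Not at h
  obtain ⟨k, hk⟩ := h
  refine ⟨Y.basicOpen (f k), fun z hz => ?_, (Y.basicOpen (f k)).2, ?_⟩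
  · have hzW : z ∈ W := Y.basicOpen_le _ hz
    refine (hf.zeroSet_iff hzW).not.mpr fun h => ?_
    exact (notMem_ptIdeal.mpr ((Y.mem_basicOpen (f k) z hzW).mp hz)) (h k)
  · exact (Y.mem_basicOpen (f k) y hyW).mpr (notMem_ptIdeal.mp hk)

/-- The complement of the zero set of an ideal. -/
def centerCompl (hJ : LocallyFG J) : Y.Opens :=
  ⟨(zeroSet J)ᶜ, (isClosed_zeroSet hJ).isOpen_compl⟩

theorem mem_centerCompl {hJ : LocallyFG J} {y : Y} : y ∈ centerCompl hJ ↔ J y = ⊤ :=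
  not_not

theorem goodAt_centerCompl (hJ : LocallyFG J) {T : Scheme.{0}} (g : T ⟶ Y) (t : T) :
    GoodAt J (centerCompl hJ) 1 g t ↔ g t ∈ centerCompl hJ := by
  refine ⟨fun h => h.1, fun h => ⟨h, ?_, ?_⟩⟩
  · rw [map_one, map_one, Ideal.span_singleton_one, pullIdeal_top g J t (mem_centerCompl.mp h)]
  · rw [map_one, map_one]
    exact one_mem _

theorem isChart_centerCompl (hJ : LocallyFG J) :
    IsChart J (centerCompl hJ) 1 (centerCompl hJ).ι where
  mem y hy := by
    rw [mem_centerCompl.mp hy]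
    exact Submodule.mem_top
  good t := (goodAt_centerCompl hJ _ t).mpr t.2
  universal T g hg := by
    have hr : Set.range g ⊆ Set.range (centerCompl hJ).ι := by
      rintro _ ⟨t, rfl⟩
      rw [Scheme.Opens.range_ι]
      exact (hg t).1
    exact ⟨IsOpenImmersion.lift (centerCompl hJ).ι g hr, IsOpenImmersion.lift_fac _ _ _,
      fun l hl => by
        rw [← cancel_mono (centerCompl hJ).ι]
        exact hl.trans (IsOpenImmersion.lift_fac _ _ _).symm⟩

theorem IsBlowup.exists_complement (h : IsBlowup J π) (hJ : LocallyFG J) :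
    ∃ j : (centerCompl hJ : Scheme) ⟶ Y', IsOpenImmersion j ∧ j ≫ π = (centerCompl hJ).ι ∧
      Set.range j = π ⁻¹' (centerCompl hJ : Set Y) := by
  obtain ⟨j, hj, h1, h2⟩ := h.exists_chart hJ (isChart_centerCompl hJ)
  refine ⟨j, hj, h1, h2.trans ?_⟩
  ext y
  exact goodAt_centerCompl hJ π y

theorem IsBlowup.isIso_morphismRestrict (h : IsBlowup J π) (hJ : LocallyFG J) :
    IsIso (π ∣_ centerCompl hJ) := by
  obtain ⟨j, hj, h1, h2⟩ := h.exists_complement hJ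
  have hr : Set.range j ⊆ Set.range (π ⁻¹ᵁ centerCompl hJ).ι := by
    rw [Scheme.Opens.range_ι, h2]
    rfl
  refine ⟨IsOpenImmersion.lift (π ⁻¹ᵁ centerCompl hJ).ι j hr, ?_, ?_⟩
  · rw [← cancel_mono (π ⁻¹ᵁ centerCompl hJ).ι, Category.id_comp, Category.assoc,
      IsOpenImmersion.lift_fac]
    refine h.hom_ext ?_ (h.cartier.comp_openImmersion _ : IsCartier (pullIdeal
      ((π ⁻¹ᵁ centerCompl hJ).ι ≫ π) J)) |>.symm
    rw [Category.assoc, h1, morphismRestrict_ι]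
  · rw [← cancel_mono (centerCompl hJ).ι, Category.id_comp, Category.assoc, morphismRestrict_ι,
      IsOpenImmersion.lift_fac_assoc, h1]

theorem bijective_stalkMap_of_isIso (U : Y.Opens) [IsIso (π ∣_ U)] (y : Y') (hy : π y ∈ U) :
    Function.Bijective (π.stalkMap y).hom := by
  have e : (π ⁻¹ᵁ U).ι ≫ π = (π ∣_ U) ≫ U.ι := (morphismRestrict_ι π U).symm
  let y₀ : (π ⁻¹ᵁ U : Scheme) := ⟨y, hy⟩
  have h1 := stalkMap_bijective ((π ∣_ U) ≫ U.ι) y₀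
  have h2 : ⇑(((π ⁻¹ᵁ U).ι ≫ π).stalkMap y₀).hom =
      ⇑((π ⁻¹ᵁ U).ι.stalkMap y₀).hom ∘ ⇑(π.stalkMap y).hom :=
    funext fun s => ConcreteCategory.congr_hom (Scheme.Hom.stalkMap_comp (π ⁻¹ᵁ U).ι π y₀) s
  rw [← e, h2] at h1
  exact (Function.Bijective.of_comp_iff' (stalkMap_bijective (π ⁻¹ᵁ U).ι y₀) _).mp h1

theorem IsCartier.eq_top_of_genericPoint {S : Scheme.{0}} [IsIntegral S] {J : StalkIdeal S}
    (h : IsCartier J) : J (genericPoint S) = ⊤ := by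
  obtain ⟨d, hd, he⟩ := h (genericPoint S)
  have h0 : (d : S.functionField) ≠ 0 := nonZeroDivisors.ne_zero hd
  rw [he, Ideal.span_singleton_eq_top]
  exact (isUnit_iff_ne_zero.mpr h0 : IsUnit (d : S.functionField))

theorem IsBlowup.isIntegral (h : IsBlowup J π) (hJ : LocallyFG J) [IsIntegral Y]
    (hne : (centerCompl hJ : Set Y).Nonempty)
    (hloc : ∀ y : Y', ∃ (S : Scheme.{0}) (j : S ⟶ Y'), IsOpenImmersion j ∧ IsIntegral S ∧
      y ∈ Set.range j) : IsIntegral Y' := by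
  obtain ⟨j, hj, h1, h2⟩ := h.exists_complement hJ
  have : Nonempty (centerCompl hJ) := hne.to_subtype
  have hred : ∀ y : Y', _root_.IsReduced (Y'.presheaf.stalk y) := fun y => by
    obtain ⟨S, k, hk, hS, s, rfl⟩ := hloc y
    exact isReduced_of_injective _ (stalkMap_bijective k s).1
  have : IsReduced Y' := isReduced_of_isReduced_stalk Y'
  have hd : closure (Set.range j) = Set.univ := by
    rw [Set.eq_univ_iff_forall]
    intro y
    rw [mem_closure_iff]
    intro U hU hy
    obtain ⟨S, k, hk, hS, s, rfl⟩ := hloc y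
    refine ⟨k (genericPoint S), ?_, ?_⟩
    · exact ((genericPoint_spec S).mem_open_set_iff (hU.preimage k.continuous)).mpr
        ⟨s, trivial, hy⟩
    · rw [h2]
      change π (k (genericPoint S)) ∈ centerCompl hJ
      have hc := (h.cartier.comp_openImmersion k : IsCartier (pullIdeal (k ≫ π) J))
      have := hc.eq_top_of_genericPoint
      by_contra hn
      have hz : genericPoint S ∈ zeroSet (pullIdeal (k ≫ π) J) := by
        rw [zeroSet_pullIdeal]
        exact not_not.mp hn
      exact hz this
  have : PreirreducibleSpace Y' := by
    have h3 : IsPreirreducible (Set.range j) := by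
      rw [← Set.image_univ]
      exact (PreirreducibleSpace.isPreirreducible_univ).image _ j.continuous.continuousOn
    exact ⟨hd ▸ h3.closure⟩
  have : Nonempty Y' := ⟨j (Classical.arbitrary _)⟩
  have : IrreducibleSpace Y' := ⟨‹_›⟩
  exact isIntegral_of_irreducibleSpace_of_isReduced Y'

end Complement

/-! ### Properties that are local on the source -/

theorem of_forall_exists_openImmersion (P : MorphismProperty Scheme.{0}) [IsZariskiLocalAtSource P]
    {Y Z : Scheme.{0}} (g : Y ⟶ Z) (h : ∀ y : Y, ∃ (S : Scheme.{0}) (j : S ⟶ Y),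
      IsOpenImmersion j ∧ y ∈ Set.range j ∧ P (j ≫ g)) : P g := by
  choose S j hj hy hP using h
  let U : Y.OpenCover :=
    { I₀ := Y
      X := S
      f := j
      mem₀ := by
        rw [Scheme.presieve₀_mem_precoverage_iff]
        exact ⟨fun y => ⟨y, hy y⟩, hj⟩ }
  exact (IsZariskiLocalAtSource.iff_of_openCover (P := P) U).mpr hP

/-! ### Integrality of the chart rings -/

theorem isDomain_of_pow_mul {A R : Type} [CommRing A] [CommRing R] [IsDomain A] [Nontrivial R]
    (φ : A →+* R) (hφ : Function.Injective φ) {u : A} (hu : φ u ∈ nonZeroDivisors R)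
    (h : ∀ x : R, ∃ (n : ℕ) (a : A), φ u ^ n * x = φ a) : IsDomain R := by
  have : NoZeroDivisors R := ⟨fun {x y} hxy => by
    obtain ⟨n, a, ha⟩ := h x
    obtain ⟨m, b, hb⟩ := h y
    have hab : φ (a * b) = 0 := by
      rw [map_mul, ← ha, ← hb]
      linear_combination (φ u ^ n * φ u ^ m) * hxy
    rw [map_eq_zero_iff φ hφ, mul_eq_zero] at hab
    refine hab.imp (fun h0 => ?_) fun h0 => ?_
    · rw [h0, map_zero, mul_comm] at ha
      exact (mul_right_mem_nonZeroDivisors_eq_zero_iff (pow_mem hu n)).mp ha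
    · rw [h0, map_zero, mul_comm] at hb
      exact (mul_right_mem_nonZeroDivisors_eq_zero_iff (pow_mem hu m)).mp hb⟩
  exact NoZeroDivisors.to_isDomain R

theorem IsRingChart.injective {A R K : Type} [CommRing A] [CommRing R] [Algebra A R] [IsDomain A]
    [Nontrivial R] {f : K → A} {k : K} (h : IsRingChart f k R) :
    Function.Injective (algebraMap A R) := by
  have hk : f k ≠ 0 := fun h0 => by
    have := h.nzd
    rw [h0, map_zero] at this
    exact nonZeroDivisors.ne_zero this rfl
  have hk' : algebraMap A (FractionRing A) (f k) ≠ 0 :=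
    (map_ne_zero_iff _ (IsFractionRing.injective A (FractionRing A))).mpr hk
  obtain ⟨φ⟩ := h.exists_hom (FractionRing A) (mem_nonZeroDivisors_of_ne_zero hk')
    fun l => (isUnit_iff_ne_zero.mpr hk').dvd
  refine Function.Injective.of_comp (f := φ) ?_
  rw [← RingHom.coe_coe, ← RingHom.coe_comp, AlgHom.comp_algebraMap]
  exact IsFractionRing.injective A (FractionRing A)

section ChartDomain

variable {A : Type} [CommRing A]

theorem SlopeChart.exists_pow_mul {u v : A} (x : SlopeChart u v) :
    ∃ (n : ℕ) (a : A), algebraMap A _ u ^ n * x = algebraMap A _ a := by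
  obtain ⟨x, rfl⟩ := Ideal.Quotient.mk_surjective x
  induction x using Polynomial.induction_on' with
  | add p q hp hq =>
    obtain ⟨n, a, ha⟩ := hp
    obtain ⟨m, b, hb⟩ := hq
    refine ⟨n + m, u ^ m * a + u ^ n * b, ?_⟩
    rw [map_add, map_add, map_mul, map_mul, map_pow, map_pow, ← ha, ← hb]
    ring
  | monomial n a =>
    refine ⟨n, a * v ^ n, ?_⟩
    have h : (Ideal.Quotient.mk _ (Polynomial.monomial n a) : SlopeChart u v) =
        algebraMap A _ a * SlopeChart.t u v ^ n := by
      rw [← Polynomial.C_mul_X_pow_eq_monomial, map_mul, map_pow]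
      rfl
    rw [h, map_mul, map_pow, ← SlopeChart.algebraMap_mul_t]
    ring

theorem isDomain_baseChart {σ a₁ : A} [IsDomain A] (hK : KoszulExact σ a₁) (k : Fin 2)
    [Nontrivial (BaseChart σ a₁ k)] : IsDomain (BaseChart σ a₁ k) :=
  isDomain_of_pow_mul (algebraMap A _) (isRingChart_baseChart k hK).injective
    (isRingChart_baseChart k hK).nzd SlopeChart.exists_pow_mul

theorem isDomain_double {A' S R : Type} [CommRing A'] [CommRing S] [CommRing R] [Algebra A A']
    [Algebra A S] [Algebra A R] [Algebra A' R] [Algebra S R] [IsScalarTower A A' R]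
    [IsScalarTower A S R] [IsDomain A'] [Nontrivial R] {ξ₀ : A'} {c : S} {r : R} {u : A}
    (HS : IsQuadratic c r)
    (hS : ∀ x : S, ∃ (n : ℕ) (a : A), algebraMap A S u ^ n * x = algebraMap A S a)
    (hr : algebraMap A' R ξ₀ = algebraMap A R u * r)
    (hinj : Function.Injective (algebraMap A' R)) (hu : algebraMap A R u ∈ nonZeroDivisors R) :
    IsDomain R := by
  rw [IsScalarTower.algebraMap_apply A A' R] at hu
  refine isDomain_of_pow_mul (algebraMap A' R) hinj hu fun x => ?_
  obtain ⟨p, q, rfl⟩ := HS.exists_eq x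
  obtain ⟨n, a, ha⟩ := hS p
  obtain ⟨m, b, hb⟩ := hS q
  have ha' := congrArg (algebraMap S R) ha
  have hb' := congrArg (algebraMap S R) hb
  simp only [map_mul, map_pow, ← IsScalarTower.algebraMap_apply] at ha' hb'
  refine ⟨n + m + 1, algebraMap A A' (u ^ (m + 1) * a) + algebraMap A A' (u ^ n * b) * ξ₀, ?_⟩
  simp only [map_add, map_mul, map_pow, ← IsScalarTower.algebraMap_apply, hr, ← ha', ← hb']
  ring

theorem isDomain_coverChart {σ a₁ a₂₂ : A} {A' : Type} [CommRing A'] [Algebra A A'] [IsDomain A']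
    {k : Fin 2} [Nontrivial (CoverChart σ a₁ a₂₂ k)] {ξ₀ : A'}
    (φ : A' →ₐ[A] CoverChart σ a₁ a₂₂ k)
    (hφ : φ ξ₀ = algebraMap A _ (![σ, a₁] k) * AdjoinRoot.root _)
    (h : letI := φ.toRingHom.toAlgebra
      IsRingChart ![algebraMap A A' σ, algebraMap A A' a₁, ξ₀] k.castSucc
        (CoverChart σ a₁ a₂₂ k)) : IsDomain (CoverChart σ a₁ a₂₂ k) := by
  let := φ.toRingHom.toAlgebra
  have : IsScalarTower A A' (CoverChart σ a₁ a₂₂ k) :=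
    IsScalarTower.of_algebraMap_eq fun x => (φ.commutes x).symm
  have hk : ![algebraMap A A' σ, algebraMap A A' a₁, ξ₀] k.castSucc =
      algebraMap A A' (![σ, a₁] k) := by fin_cases k <;> rfl
  have hu := h.nzd
  rw [hk, ← IsScalarTower.algebraMap_apply] at hu
  exact isDomain_double (SqrtAlg.isQuadratic (chartBranch σ a₁ a₂₂ k)) SlopeChart.exists_pow_mul
    hφ h.injective hu

end ChartDomain

/-! ### The relative dimension is determined by the function field -/

section Rank

theorem rank_kaehler_of_formallyEtale (k S T : Type) [CommRing k] [CommRing S] [CommRing T]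
    [Algebra k S] [Algebra k T] [Algebra S T] [IsScalarTower k S T] [Nontrivial S] [Nontrivial T]
    [Module.Free S (Ω[S⁄k])] [Algebra.FormallyEtale S T] :
    Module.rank T (Ω[T⁄k]) = Module.rank S (Ω[S⁄k]) := by
  rw [← (KaehlerDifferential.tensorKaehlerEquivOfFormallyEtale k S T).rank_eq,
    Module.rank_baseChange, Cardinal.lift_id]

theorem rank_kaehler_away (k A K : Type) [CommRing k] [CommRing A] [Algebra k A] [IsDomain A]
    [Field K] [Algebra A K] [IsFractionRing A K] [Algebra k K] [IsScalarTower k A K] (s : A)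
    (hs : s ≠ 0) [Module.Free (Localization.Away s) (Ω[Localization.Away s⁄k])] :
    Module.rank K (Ω[K⁄k]) = Module.rank (Localization.Away s) (Ω[Localization.Away s⁄k]) := by
  have hu : IsUnit (algebraMap A K s) :=
    isUnit_iff_ne_zero.mpr ((map_ne_zero_iff _ (IsFractionRing.injective A K)).mpr hs)
  let := (IsLocalization.Away.lift (S := Localization.Away s) s hu).toAlgebra
  have : IsScalarTower A (Localization.Away s) K := IsScalarTower.of_algebraMap_eq fun x =>
    (IsLocalization.Away.lift_eq s hu x).symm
  have : IsScalarTower k (Localization.Away s) K := IsScalarTower.of_algebraMap_eq fun x => by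
    rw [IsScalarTower.algebraMap_apply k A (Localization.Away s),
      ← IsScalarTower.algebraMap_apply A (Localization.Away s) K,
      ← IsScalarTower.algebraMap_apply k A K]
  have : IsFractionRing (Localization.Away s) K :=
    IsFractionRing.isFractionRing_of_isDomain_of_isLocalization (Submonoid.powers s) _ K
  have : Algebra.FormallyEtale (Localization.Away s) K :=
    Algebra.FormallyEtale.of_isLocalization (nonZeroDivisors (Localization.Away s))
  have : Nontrivial (Localization.Away s) := (algebraMap (Localization.Away s) K).domain_nontrivial
  exact rank_kaehler_of_formallyEtale k _ K

theorem locally_standardSmooth_iff_rank (k A K : Type) [CommRing k] [CommRing A] [Algebra k A]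
    [IsDomain A] [Algebra.Smooth k A] [Field K] [Algebra A K] [IsFractionRing A K] [Algebra k K]
    [IsScalarTower k A K] (n : ℕ) :
    RingHom.Locally (RingHom.IsStandardSmoothOfRelativeDimension n) (algebraMap k A) ↔
      Module.rank K (Ω[K⁄k]) = n := by
  have key : ∀ s : A, s ≠ 0 → Nontrivial (Localization.Away s) := fun s hs =>
    (IsLocalization.injective (Localization.Away s)
      (powers_le_nonZeroDivisors_of_noZeroDivisors hs)).nontrivial
  have e : ∀ s : A, (algebraMap A (Localization.Away s)).comp (algebraMap k A) =
      algebraMap k (Localization.Away s) := fun s => (IsScalarTower.algebraMap_eq k A _).symm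
  constructor
  · rintro ⟨S, hS, h⟩
    obtain ⟨s, hs, h0⟩ : ∃ s ∈ S, s ≠ 0 := by
      by_contra! hc
      have : Ideal.span S ≤ ⊥ := Ideal.span_le.mpr fun s hs => hc s hs
      rw [hS] at this
      exact bot_ne_top (top_le_iff.mp this)
    have h1 := h s hs
    rw [e, RingHom.isStandardSmoothOfRelativeDimension_algebraMap] at h1
    have := key s h0
    have := Algebra.IsStandardSmoothOfRelativeDimension.isStandardSmooth n
      (R := k) (S := Localization.Away s)
    rw [rank_kaehler_away k A K s h0]
    exact Algebra.IsStandardSmoothOfRelativeDimension.rank_kaehlerDifferential n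
  · intro h
    obtain ⟨S, hS, hs⟩ := Algebra.Smooth.exists_span_eq_top_isStandardSmooth k A
    refine ⟨S \ {0}, ?_, fun s hs' => ?_⟩
    · rw [Ideal.span_sdiff_singleton_zero, hS]
    · rw [e]
      change RingHom.IsStandardSmoothOfRelativeDimension n (algebraMap k (Localization.Away s))
      rw [RingHom.isStandardSmoothOfRelativeDimension_algebraMap]
      have h0 : s ≠ 0 := hs'.2
      have := key s h0
      have := hs s hs'.1
      rw [Algebra.IsStandardSmoothOfRelativeDimension.iff_of_isStandardSmooth,
        ← rank_kaehler_away k A K s h0, h]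

theorem locally_standardSmooth_of_isAlgebraic (A R : Type) [CommRing A] [CommRing R] [Algebra ℂ A]
    [Algebra ℂ R] [Algebra A R] [IsScalarTower ℂ A R] [IsDomain A] [IsDomain R]
    [FaithfulSMul A R] [Algebra.IsAlgebraic A R] [Algebra.Smooth ℂ A] [Algebra.Smooth ℂ R] (n : ℕ)
    (h : RingHom.Locally (RingHom.IsStandardSmoothOfRelativeDimension n) (algebraMap ℂ A)) :
    RingHom.Locally (RingHom.IsStandardSmoothOfRelativeDimension n) (algebraMap ℂ R) := by
  rw [locally_standardSmooth_iff_rank ℂ A (FractionRing A)] at h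
  rw [locally_standardSmooth_iff_rank ℂ R (FractionRing R), ← h]
  let := FractionRing.liftAlgebra A (FractionRing R)
  have := FractionRing.isScalarTower_liftAlgebra A (FractionRing R)
  have : IsScalarTower ℂ (FractionRing A) (FractionRing R) :=
    IsScalarTower.of_algebraMap_eq fun x => by
      rw [IsScalarTower.algebraMap_apply ℂ A (FractionRing A),
        ← IsScalarTower.algebraMap_apply A (FractionRing A) (FractionRing R),
        ← IsScalarTower.algebraMap_apply ℂ A (FractionRing R)]
  have h1 : Algebra.IsAlgebraic A (FractionRing R) :=
    (IsFractionRing.isAlgebraic_iff' A R (FractionRing R)).mp inferInstance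
  have h2 : Algebra.IsAlgebraic (FractionRing A) (FractionRing R) :=
    (IsFractionRing.comap_isAlgebraic_iff (A := A)).mp h1
  have : CharZero (FractionRing A) := charZero_of_injective_algebraMap
    (algebraMap ℂ (FractionRing A)).injective
  have : Algebra.IsSeparable (FractionRing A) (FractionRing R) := inferInstance
  have := Algebra.FormallyEtale.of_isSeparable (FractionRing A) (FractionRing R)
  exact rank_kaehler_of_formallyEtale ℂ (FractionRing A) (FractionRing R)

theorem IsRingChart.ne_zero {A R K : Type} [CommRing A] [CommRing R] [Algebra A R]
    [Nontrivial R] {f : K → A} {k : K} (h : IsRingChart f k R) : f k ≠ 0 := fun h0 => by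
  have := h.nzd
  rw [h0, map_zero] at this
  exact nonZeroDivisors.ne_zero this rfl

theorem IsQuadratic.injective {A A' : Type} [CommRing A] [CommRing A'] [Algebra A A'] {h : A}
    {ξ : A'} (H : IsQuadratic h ξ) : Function.Injective (algebraMap A A') := fun p q e =>
  (H.eq_of_eq (q := 0) (q' := 0) (by rw [e])).1

theorem isAlgebraic_of_pow_mul {A R : Type} [CommRing A] [CommRing R] [Algebra A R] [IsDomain A]
    {u : A} (hu : u ≠ 0) (h : ∀ x : R, ∃ (n : ℕ) (a : A), algebraMap A R u ^ n * x =
      algebraMap A R a) : Algebra.IsAlgebraic A R := ⟨fun x => by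
  obtain ⟨n, a, ha⟩ := h x
  refine ⟨Polynomial.C (u ^ n) * Polynomial.X - Polynomial.C a, fun h0 => ?_, ?_⟩
  · have := congrArg (fun p => Polynomial.coeff p 1) h0
    simp only [Polynomial.coeff_sub, Polynomial.coeff_C_mul, Polynomial.coeff_X_one, mul_one,
      Polynomial.coeff_C_of_ne_zero one_ne_zero, sub_zero, Polynomial.coeff_zero] at this
    exact pow_ne_zero n hu this
  · simp [ha]⟩

end Rank

/-! ### Smoothness of the blow-ups -/

instance (n : ℕ) : IsZariskiLocalAtSource (@SmoothOfRelativeDimension.{0} n) :=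
  HasRingHomProperty.instIsZariskiLocalAtSource

theorem smoothOfRelativeDimension_spec_iff {R : Type} [CommRing R] [Algebra ℂ R] (n : ℕ) :
    SmoothOfRelativeDimension n (Spec.map (CommRingCat.ofHom (algebraMap ℂ R))) ↔
      RingHom.Locally (RingHom.IsStandardSmoothOfRelativeDimension n) (algebraMap ℂ R) := by
  rw [HasRingHomProperty.Spec_iff (P := @SmoothOfRelativeDimension n), CommRingCat.hom_ofHom]

theorem specMap_fromSpec_comp_of_comm {X B : Scheme.{0}} {ρ : X ⟶ B} {V : B.Opens}
    (hV : IsAffineOpen V) (hV' : IsAffineOpen (ρ ⁻¹ᵁ V)) {S R : Type} [CommRing S] [CommRing R]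
    (φ : Γ(X, ρ ⁻¹ᵁ V) →+* R) (ψ : S →+* R) (χ : Γ(B, V) →+* S)
    (h : φ.comp (ρ.app V).hom = ψ.comp χ) :
    (Spec.map (CommRingCat.ofHom φ) ≫ hV'.fromSpec) ≫ ρ =
      Spec.map (CommRingCat.ofHom ψ) ≫ Spec.map (CommRingCat.ofHom χ) ≫ hV.fromSpec := by
  have e : hV'.fromSpec ≫ ρ = Spec.map (ρ.app V) ≫ hV.fromSpec := by
    rw [← hV.SpecMap_appLE_fromSpec ρ hV' le_rfl, ← Scheme.Hom.app_eq_appLE]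
  have e3 : CommRingCat.ofHom (φ.comp (ρ.app V).hom) = CommRingCat.ofHom (ψ.comp χ) := by rw [h]
  rw [Category.assoc, e, ← Category.assoc, ← Category.assoc, ← Spec.map_comp, ← Spec.map_comp]
  exact congrArg (fun m => Spec.map m ≫ hV.fromSpec) e3

theorem locally_standardSmooth_sections {Y : Scheme.{0}} (f : Y ⟶ SpecC) (n : ℕ)
    [SmoothOfRelativeDimension n f] {V : Y.Opens} (hV : IsAffineOpen V) :
    RingHom.Locally (RingHom.IsStandardSmoothOfRelativeDimension n) (sectionScalars f V) := by
  have h : SmoothOfRelativeDimension n (hV.fromSpec ≫ f) :=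
    IsZariskiLocalAtSource.comp (P := @SmoothOfRelativeDimension n) ‹_› hV.fromSpec
  rw [fromSpec_comp_eq, HasRingHomProperty.Spec_iff (P := @SmoothOfRelativeDimension n)] at h
  exact h

namespace TateData

variable {B : Scheme.{0}} {N : ℕ} {D : TateData B N} {X : Scheme.{0}} {ρ : X ⟶ B}
  (f : B ⟶ SpecC)

namespace Patch

variable (p : D.Patch)

theorem baseChartMap_comp (k : Fin 2) : p.baseChartMap k ≫ f = Spec.map (CommRingCat.ofHom
    ((algebraMap Γ(B, p.V) (BaseChart p.σ p.a₁ k)).comp (sectionScalars f p.V))) :=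
  specMap_fromSpec_comp_eq f p.affine _

theorem coverChartMap_comp (C : DoubleCover D.P ρ D.limitBranch) (hK : KoszulExact p.σ p.a₁)
    (k : Fin 2) : p.coverChartMap C hK k ≫ ρ = Spec.map (CommRingCat.ofHom
      (algebraMap (BaseChart p.σ p.a₁ k) (CoverChart p.σ p.a₁ p.a₂₂ k))) ≫ p.baseChartMap k := by
  refine specMap_fromSpec_comp_of_comm p.affine (p.isAffineOpen_preimage C) _ _ _ ?_
  rw [← IsScalarTower.algebraMap_eq]
  exact (p.coverChartHom C hK k).comp_algebraMap

end Patch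

variable [IsIntegral B] [IsIntegral X]

theorem koszulExact (C : DoubleCover D.P ρ D.limitBranch) [Smooth f] (hD : D.Generic f) (p : D.Patch) : KoszulExact p.σ p.a₁ :=
  p.koszulExact f C hD

theorem smoothOfRelativeDimension_baseChart (n : ℕ) [SmoothOfRelativeDimension n f]
    (hD : D.Generic f) (hK : ∀ p : D.Patch, KoszulExact p.σ p.a₁) (p : D.Patch) (k : Fin 2)
    [Nontrivial (BaseChart p.σ p.a₁ k)] :
    IsDomain (BaseChart p.σ p.a₁ k) ∧ SmoothOfRelativeDimension n (p.baseChartMap k ≫ f) := by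
  have : Smooth f := SmoothOfRelativeDimension.smooth n f
  let := (sectionScalars f p.V).toAlgebra
  have := smooth_sections f p.affine
  have G := p.sppGeneric f hD
  have := G.smooth_baseChart k
  have : Nontrivial Γ(B, p.V) := (algebraMap _ (BaseChart p.σ p.a₁ k)).domain_nontrivial
  have := p.isDomain_base
  have := isDomain_baseChart (hK p) k
  have hinj := (isRingChart_baseChart k (hK p)).injective
  have : FaithfulSMul Γ(B, p.V) (BaseChart p.σ p.a₁ k) :=
    (faithfulSMul_iff_algebraMap_injective _ _).mpr hinj
  have := isAlgebraic_of_pow_mul (isRingChart_baseChart k (hK p)).ne_zero (R := BaseChart p.σ p.a₁ k) SlopeChart.exists_pow_mul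
  refine ⟨‹_›, ?_⟩
  rw [p.baseChartMap_comp]
  exact (smoothOfRelativeDimension_spec_iff n).mpr (locally_standardSmooth_of_isAlgebraic
    Γ(B, p.V) _ n (locally_standardSmooth_sections f n p.affine))

theorem smoothOfRelativeDimension_coverChart (C : DoubleCover D.P ρ D.limitBranch) (n : ℕ)
    [SmoothOfRelativeDimension n f]
    (hD : D.Generic f) (hK : ∀ p : D.Patch, KoszulExact p.σ p.a₁) (p : D.Patch) (k : Fin 2)
    [Nontrivial (CoverChart p.σ p.a₁ p.a₂₂ k)] :
    IsDomain (CoverChart p.σ p.a₁ p.a₂₂ k) ∧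
      SmoothOfRelativeDimension n (p.coverChartMap C (hK p) k ≫ ρ ≫ f) := by
  have : Smooth f := SmoothOfRelativeDimension.smooth n f
  let := (sectionScalars f p.V).toAlgebra
  have := smooth_sections f p.affine
  have G := p.sppGeneric f hD
  have := G.smooth_baseChart k
  have := G.smooth_coverChart k
  have : Nontrivial (BaseChart p.σ p.a₁ k) :=
    (algebraMap _ (CoverChart p.σ p.a₁ p.a₂₂ k)).domain_nontrivial
  have : Nontrivial Γ(B, p.V) := (algebraMap _ (BaseChart p.σ p.a₁ k)).domain_nontrivial
  have := p.isDomain_base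
  have := p.isDomain_cover C
  obtain ⟨hS, h⟩ := smoothOfRelativeDimension_baseChart f n hD hK p k
  have hR : IsDomain (CoverChart p.σ p.a₁ p.a₂₂ k) := isDomain_coverChart (p.coverChartHom C (hK p) k)
    (p.coverChartHom_xi C (hK p) k) (exists_coverChartHom k (p.isQuadratic C) (hK p)).choose_spec.2
  have : FaithfulSMul (BaseChart p.σ p.a₁ k) (CoverChart p.σ p.a₁ p.a₂₂ k) :=
    (faithfulSMul_iff_algebraMap_injective _ _).mpr (SqrtAlg.isQuadratic _).injective
  have : Module.Finite (BaseChart p.σ p.a₁ k) (CoverChart p.σ p.a₁ p.a₂₂ k) :=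
    (SqrtAlg.monic _).finite_adjoinRoot
  have : Algebra.IsAlgebraic (BaseChart p.σ p.a₁ k) (CoverChart p.σ p.a₁ p.a₂₂ k) := inferInstance
  refine ⟨‹_›, ?_⟩
  rw [← Category.assoc, p.coverChartMap_comp, Category.assoc, p.baseChartMap_comp, ← Spec.map_comp]
  rw [p.baseChartMap_comp] at h
  exact (smoothOfRelativeDimension_spec_iff n).mpr (locally_standardSmooth_of_isAlgebraic
    (BaseChart p.σ p.a₁ k) _ n ((smoothOfRelativeDimension_spec_iff n).mp h))

end TateData

/-! ### Singular points of double covers -/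

section Singular

theorem eq_zero_of_formallySmooth {k L O : Type} [CommRing k] [CommRing L] [IsLocalRing L]
    [CommRing O] [Algebra k L] [Algebra k O] (φ : L →ₐ[k] O) (hφ : Function.Surjective φ)
    {x a s c : L} (h0 : φ (x ^ 2 - (a ^ 2 + 4 * s ^ 2 * c)) = 0)
    (hker : ∀ y, φ y = 0 → x ^ 2 - (a ^ 2 + 4 * s ^ 2 * c) ∣ y)
    (hx : x ∈ IsLocalRing.maximalIdeal L) (ha : a ∈ IsLocalRing.maximalIdeal L)
    (hs : s ∈ IsLocalRing.maximalIdeal L) [Algebra.FormallySmooth k O] :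
    x ^ 2 - (a ^ 2 + 4 * s ^ 2 * c) = 0 := by
  obtain ⟨g, hg⟩ : ∃ g, g = x ^ 2 - (a ^ 2 + 4 * s ^ 2 * c) := ⟨_, rfl⟩
  rw [← hg] at h0 hker ⊢
  let I : Ideal L := Ideal.span {g ^ 2}
  let ψ : (L ⧸ I) →ₐ[k] O := Ideal.Quotient.liftₐ I φ fun y hy => by
    obtain ⟨z, rfl⟩ := Ideal.mem_span_singleton.mp hy
    rw [map_mul, map_pow, h0, zero_pow two_ne_zero, zero_mul]
  have hψ : Function.Surjective ψ := fun o => by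
    obtain ⟨y, rfl⟩ := hφ o
    exact ⟨Ideal.Quotient.mk I y, rfl⟩
  have hk : ∀ y : L, ψ (Ideal.Quotient.mk I y) = 0 → ∃ u, Ideal.Quotient.mk I y =
      Ideal.Quotient.mk I (g * u) := fun y hy => by
    obtain ⟨u, rfl⟩ := hker y hy
    exact ⟨u, rfl⟩
  have hnil : IsNilpotent (RingHom.ker ψ) := by
    refine ⟨2, ?_⟩
    rw [Ideal.zero_eq_bot, eq_bot_iff, pow_two, Ideal.mul_le]
    intro y hy z hz
    obtain ⟨y, rfl⟩ := Ideal.Quotient.mk_surjective y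
    obtain ⟨z, rfl⟩ := Ideal.Quotient.mk_surjective z
    obtain ⟨u, hu⟩ := hk y hy
    obtain ⟨v, hv⟩ := hk z hz
    rw [hu, hv, ← map_mul, Ideal.mem_bot, Ideal.Quotient.eq_zero_iff_mem]
    exact Ideal.mem_span_singleton.mpr ⟨u * v, by ring⟩
  let τ := Algebra.FormallySmooth.liftOfSurjective (AlgHom.id k O) ψ hψ hnil
  have hτ : ∀ y : L, ∃ u, τ (φ y) = Ideal.Quotient.mk I (y + g * u) := fun y => by
    obtain ⟨z, hz⟩ := Ideal.Quotient.mk_surjective (τ (φ y))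
    have h1 : ψ (τ (φ y)) = φ y :=
      Algebra.FormallySmooth.liftOfSurjective_apply (AlgHom.id k O) ψ hψ hnil (φ y)
    obtain ⟨u, hu⟩ := hk (z - y) (by
      rw [map_sub, map_sub, hz, h1]
      exact sub_self _)
    refine ⟨u, ?_⟩
    rw [map_add, ← hu, map_sub, hz]
    ring
  obtain ⟨u₁, h1⟩ := hτ x
  obtain ⟨u₂, h2⟩ := hτ a
  obtain ⟨u₃, h3⟩ := hτ s
  obtain ⟨u₄, h4⟩ := hτ c
  have h5 : τ (φ g) = 0 := by rw [h0, map_zero]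
  rw [hg] at h5
  simp only [map_sub, map_add, map_mul, map_pow, map_ofNat φ, map_ofNat τ, h1, h2, h3, h4] at h5
  rw [← map_ofNat (Ideal.Quotient.mk I) 4] at h5
  simp only [← map_sub, ← map_add, ← map_mul, ← map_pow] at h5
  rw [Ideal.Quotient.eq_zero_iff_mem, Ideal.mem_span_singleton] at h5
  obtain ⟨w, hw⟩ := h5
  have hgm : g ∈ IsLocalRing.maximalIdeal L := by
    rw [hg]
    refine sub_mem (Ideal.pow_mem_of_mem _ hx 2 two_pos) (add_mem
      (Ideal.pow_mem_of_mem _ ha 2 two_pos) (Ideal.mul_mem_right _ _ (Ideal.mul_mem_left _ _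
        (Ideal.pow_mem_of_mem _ hs 2 two_pos))))
  have hM : x * (-(2 * u₁)) + a * (2 * u₂) + g * (w - (u₁ ^ 2 - u₂ ^ 2) +
      4 * (2 * s * u₃ * u₄ + u₃ ^ 2 * c + g * u₃ ^ 2 * u₄)) +
      s * (4 * (s * u₄ + 2 * u₃ * c)) ∈ IsLocalRing.maximalIdeal L :=
    add_mem (add_mem (add_mem (Ideal.mul_mem_right _ _ hx) (Ideal.mul_mem_right _ _ ha))
      (Ideal.mul_mem_right _ _ hgm)) (Ideal.mul_mem_right _ _ hs)
  have hu : IsUnit (1 - (x * (-(2 * u₁)) + a * (2 * u₂) + g * (w - (u₁ ^ 2 - u₂ ^ 2) +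
      4 * (2 * s * u₃ * u₄ + u₃ ^ 2 * c + g * u₃ ^ 2 * u₄)) +
      s * (4 * (s * u₄ + 2 * u₃ * c)))) :=
    (IsLocalRing.isUnit_or_isUnit_one_sub_self _).resolve_left hM
  refine (hu.mul_left_eq_zero).mp ?_
  linear_combination hw + hg

theorem IsQuadratic.not_formallySmooth {k A A' O : Type} [CommRing k] [CommRing A] [CommRing A']
    [CommRing O] [Algebra k A] [Algebra k A'] [Algebra A A'] [IsScalarTower k A A'] [Algebra A' O]
    [Algebra k O] [IsScalarTower k A' O] {a s c : A} {ξ : A'}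
    (H : IsQuadratic (a ^ 2 + 4 * s ^ 2 * c) ξ) (p : Ideal A') [p.IsPrime]
    [IsLocalization.AtPrime O p] (ha : algebraMap A A' a ∈ p) (hs : algebraMap A A' s ∈ p)
    (hξ : ξ ∈ p) : ¬ Algebra.FormallySmooth k O := by
  intro hO
  obtain ⟨π, hπ, hC, hX, h0, hker⟩ := H.exists_presentation (k := k)
  let q := p.comap π
  have hq : ∀ y : q.primeCompl, IsUnit (((IsScalarTower.toAlgHom k A' O).comp π) y) := fun y =>
    IsLocalization.map_units O (⟨π y, y.2⟩ : p.primeCompl)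
  let L := Localization.AtPrime q
  let φ : L →ₐ[k] O := IsLocalization.liftAlgHom (M := q.primeCompl) hq
  have hφ : ∀ y, φ (algebraMap A[X] L y) = algebraMap A' O (π y) := fun y =>
    IsLocalization.lift_eq (M := q.primeCompl) hq y
  have hmem : ∀ {y}, algebraMap A[X] L y ∈ IsLocalRing.maximalIdeal L ↔ π y ∈ p := fun {y} =>
    IsLocalization.AtPrime.to_map_mem_maximal_iff L q y
  have hsub : ∀ y : L, ∃ (z t : A[X]), π t ∉ p ∧ y * algebraMap _ L t = algebraMap _ L z := fun y =>
    by
    obtain ⟨⟨z, t⟩, h⟩ := IsLocalization.surj q.primeCompl y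
    exact ⟨z, t, t.2, h⟩
  have hunit : ∀ t, π t ∉ p → IsUnit (algebraMap A[X] L t) := fun t ht =>
    IsLocalization.map_units L (⟨t, ht⟩ : q.primeCompl)
  have hsurj : Function.Surjective φ := fun o => by
    obtain ⟨⟨z, t⟩, h⟩ := IsLocalization.surj p.primeCompl o
    obtain ⟨z, rfl⟩ := hπ z
    obtain ⟨t', ht'⟩ := hπ t
    have ht : π t' ∉ p := by rw [ht']; exact t.2
    obtain ⟨e, he⟩ := (hunit t' ht).exists_right_inv
    refine ⟨algebraMap _ L z * e, ?_⟩
    have he' := congrArg φ he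
    rw [map_mul, hφ, map_one, ht'] at he'
    have h' : o * algebraMap A' O t = algebraMap A' O (π z) := h
    rw [map_mul, hφ, ← h', mul_assoc, he', mul_one]
  have hg : algebraMap A[X] L (Polynomial.X ^ 2 - Polynomial.C (a ^ 2 + 4 * s ^ 2 * c)) =
      algebraMap A[X] L Polynomial.X ^ 2 - (algebraMap _ L (Polynomial.C a) ^ 2 +
        4 * algebraMap _ L (Polynomial.C s) ^ 2 * algebraMap _ L (Polynomial.C c)) := by
    simp only [map_sub, map_add, map_mul, map_pow, map_ofNat Polynomial.C,
      map_ofNat (algebraMap A[X] L)]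
  have key := eq_zero_of_formallySmooth φ hsurj (x := algebraMap A[X] L Polynomial.X)
    (a := algebraMap _ L (Polynomial.C a)) (s := algebraMap _ L (Polynomial.C s))
    (c := algebraMap _ L (Polynomial.C c)) (by rw [← hg, hφ, h0, map_zero]) (fun y hy => by
      rw [← hg]
      obtain ⟨z, t, ht, hz⟩ := hsub y
      have h1 : algebraMap A' O (π z) = 0 := by rw [← hφ, ← hz, map_mul, hy, zero_mul]
      obtain ⟨⟨m, hm⟩, h2⟩ := (IsLocalization.map_eq_zero_iff p.primeCompl O _).mp h1
      obtain ⟨m', rfl⟩ := hπ m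
      rw [← map_mul] at h2
      obtain ⟨w, hw⟩ := hker _ h2
      obtain ⟨e, he⟩ := (hunit (t * m') (by
        rw [map_mul]; exact p.primeCompl.mul_mem ht hm)).exists_right_inv
      refine ⟨algebraMap _ L w * e, ?_⟩
      have hw' := congrArg (algebraMap A[X] L) hw
      rw [map_mul, map_mul] at hw'
      rw [map_mul] at he
      linear_combination (-y) * he + e * algebraMap _ L m' * hz + e * hw')
    (hmem.mpr (by rw [hX]; exact hξ)) (hmem.mpr (by rw [hC]; exact ha))
    (hmem.mpr (by rw [hC]; exact hs))
  rw [← hg, IsLocalization.map_eq_zero_iff q.primeCompl L] at key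
  obtain ⟨m, hm⟩ := key
  rw [mul_comm, (SqrtAlg.monic _).mul_right_eq_zero_iff] at hm
  exact m.2 (by rw [hm]; exact q.zero_mem)

end Singular

/-! ### The smooth part -/

theorem mem_smoothPart_of_openImmersion {Y S : Scheme.{0}} (f : Y ⟶ SpecC) (j : S ⟶ Y)
    [IsOpenImmersion j] [h : Smooth (j ≫ f)] (s : S) : j s ∈ smoothPart f := by
  refine TopologicalSpace.Opens.mem_sSup.mpr ⟨j.opensRange, ?_, ⟨s, rfl⟩⟩
  change Smooth (j.opensRange.ι ≫ f)
  have e : j.opensRange.ι ≫ f = j.isoOpensRange.inv ≫ j ≫ f := by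
    rw [← Category.assoc, Scheme.Hom.isoOpensRange_inv_comp]
  rw [e]
  infer_instance

theorem formallySmooth_stalk_of_mem_smoothPart {Y : Scheme.{0}} (f : Y ⟶ SpecC) (y : Y)
    (h : y ∈ smoothPart f) :
    letI := (scalars f y).toAlgebra
    Algebra.FormallySmooth ℂ (Y.presheaf.stalk y) := by
  let := (scalars f y).toAlgebra
  obtain ⟨(U : Y.Opens), hU, hyU⟩ := TopologicalSpace.Opens.mem_sSup.mp h
  have hU' : Smooth (U.ι ≫ f) := hU
  obtain ⟨(W : Y.Opens), hW', hyW, hWU⟩ :=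
    TopologicalSpace.Opens.isBasis_iff_nbhd.mp Y.isBasis_affineOpens hyU
  have hW : IsAffineOpen W := hW'
  let := (sectionScalars f W).toAlgebra
  let := (germAt W y hyW).toAlgebra
  have : IsScalarTower ℂ Γ(Y, W) (Y.presheaf.stalk y) :=
    IsScalarTower.of_algebraMap_eq' (germAt_sectionScalars f W y hyW).symm
  have hr : Set.range hW.fromSpec ⊆ Set.range U.ι := by
    rw [hW.range_fromSpec, Scheme.Opens.range_ι]
    exact hWU
  have hs : Smooth (hW.fromSpec ≫ f) := by
    rw [← IsOpenImmersion.lift_fac U.ι hW.fromSpec hr, Category.assoc]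
    have h1 : IsOpenImmersion (IsOpenImmersion.lift U.ι hW.fromSpec hr ≫ U.ι) := by
      rw [IsOpenImmersion.lift_fac]
      infer_instance
    have : IsOpenImmersion (IsOpenImmersion.lift U.ι hW.fromSpec hr) :=
      IsOpenImmersion.of_comp _ U.ι
    infer_instance
  rw [fromSpec_comp_eq] at hs
  have hs2 : Algebra.Smooth ℂ Γ(Y, W) := smooth_spec_iff.mp hs
  have := isLocalization_stalk hW y hyW
  have : Algebra.FormallySmooth Γ(Y, W) (Y.presheaf.stalk y) :=
    Algebra.FormallySmooth.of_isLocalization (ptIdeal W y hyW).primeCompl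
  exact Algebra.FormallySmooth.comp ℂ Γ(Y, W) _

namespace TateData

variable {B : Scheme.{0}} {N : ℕ} {D : TateData B N} {X : Scheme.{0}} {ρ : X ⟶ B}
  (C : DoubleCover D.P ρ D.limitBranch) (f : B ⟶ SpecC)

theorem Patch.mem_zeroSet_cover_iff (p : D.Patch) (x : X) (hx : x ∈ ρ ⁻¹ᵁ p.V) :
    x ∈ zeroSet (D.coverCenter C) ↔ algebraMap Γ(B, p.V) _ p.σ ∈ ptIdeal (ρ ⁻¹ᵁ p.V) x hx ∧
      algebraMap Γ(B, p.V) _ p.a₁ ∈ ptIdeal (ρ ⁻¹ᵁ p.V) x hx ∧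
      p.ξ C ∈ ptIdeal (ρ ⁻¹ᵁ p.V) x hx := by
  rw [(p.generatedOn_cover C).zeroSet_iff hx]
  constructor
  · exact fun h => ⟨h 0, h 1, h 2⟩
  · rintro ⟨h0, h1, h2⟩ k
    fin_cases k
    exacts [h0, h1, h2]

theorem isScalarTower_cover (V : B.Opens) :
    letI := (sectionScalars f V).toAlgebra
    letI := (sectionScalars (ρ ≫ f) (ρ ⁻¹ᵁ V)).toAlgebra
    IsScalarTower ℂ Γ(B, V) Γ(X, ρ ⁻¹ᵁ V) := by
  let := (sectionScalars f V).toAlgebra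
  let := (sectionScalars (ρ ≫ f) (ρ ⁻¹ᵁ V)).toAlgebra
  refine IsScalarTower.of_algebraMap_eq' ?_
  have := map_sectionScalars f ρ V (ρ ⁻¹ᵁ V) le_rfl
  rw [← Scheme.Hom.app_eq_appLE] at this
  exact this.symm

theorem compl_smoothPart [Smooth f] (hD : D.Generic f) :
    (smoothPart (ρ ≫ f) : Set X)ᶜ = zeroSet (D.coverCenter C) := by
  ext x
  obtain ⟨p, hx, -⟩ := Patch.exists_mem (D := D) ⊤ (ρ x) trivial
  replace hx : x ∈ ρ ⁻¹ᵁ p.V := hx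
  let := (sectionScalars f p.V).toAlgebra
  let := (sectionScalars (ρ ≫ f) (ρ ⁻¹ᵁ p.V)).toAlgebra
  have := isScalarTower_cover (ρ := ρ) f p.V
  have := smooth_sections f p.affine
  have H := p.isQuadratic C
  have hV := p.isAffineOpen_preimage C
  constructor
  · intro h
    by_contra hn
    rw [p.mem_zeroSet_cover_iff C x hx] at hn
    refine h ?_
    let P := ptIdeal (ρ ⁻¹ᵁ p.V) x hx
    have hP : Algebra.IsSmoothAt ℂ P := by
      refine H.formallySmooth P.primeCompl ?_
      have hu : ∀ z, z ∉ P → IsUnit (algebraMap _ (Localization.AtPrime P) z) := fun z hz =>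
        IsLocalization.map_units (Localization.AtPrime P) (⟨z, hz⟩ : P.primeCompl)
      by_cases hξ : p.ξ C ∈ P
      · right
        have hh : p.h ∈ P.comap (algebraMap Γ(B, p.V) _) := by
          rw [Ideal.mem_comap, ← H.sq]
          exact Ideal.pow_mem_of_mem _ hξ 2 two_pos
        obtain ⟨δ, hδ⟩ := (p.sppGeneric f hD).branch (P.comap (algebraMap Γ(B, p.V) _))
          inferInstance (fun h' => hn ⟨h'.1, h'.2, hξ⟩) hh
        exact ⟨δ, hu _ hδ⟩
      · left
        refine hu _ fun h2 => ?_
        rcases (inferInstance : P.IsPrime).mem_or_mem h2 with h3 | h3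
        · exact (inferInstance : P.IsPrime).ne_top
            (Ideal.eq_top_of_isUnit_mem _ h3 (isUnit_two_of_complex (algebraMap ℂ _)))
        · exact hξ h3
    have : Algebra.FinitePresentation ℂ Γ(X, ρ ⁻¹ᵁ p.V) := H.finitePresentation
    obtain ⟨g, hg, hgs⟩ := Algebra.IsSmoothAt.exists_notMem_smooth ℂ P
    have hgs' : Smooth ((Spec.map (CommRingCat.ofHom (algebraMap Γ(X, ρ ⁻¹ᵁ p.V)
        (Localization.Away g))) ≫ hV.fromSpec) ≫ ρ ≫ f) := by
      rw [specMap_fromSpec_comp_eq (ρ ≫ f) hV]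
      exact smooth_spec_iff.mpr hgs
    have hx2 : x ∈ Set.range (Spec.map (CommRingCat.ofHom (algebraMap Γ(X, ρ ⁻¹ᵁ p.V)
        (Localization.Away g))) ≫ hV.fromSpec) := by
      have h3 : hV.fromSpec (hV.primeIdealOf ⟨x, hx⟩) = x := hV.fromSpec_primeIdealOf ⟨x, hx⟩
      have h4 : hV.primeIdealOf ⟨x, hx⟩ ∈ Set.range (PrimeSpectrum.comap
          (algebraMap Γ(X, ρ ⁻¹ᵁ p.V) (Localization.Away g))) := by
        rw [PrimeSpectrum.localization_away_comap_range (Localization.Away g) g]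
        change g ∉ (hV.primeIdealOf ⟨x, hx⟩).asIdeal
        rw [primeIdealOf_asIdeal_eq hV]
        exact hg
      obtain ⟨q, hq⟩ := h4
      refine ⟨q, ?_⟩
      exact (congrArg hV.fromSpec hq).trans h3
    obtain ⟨q, hq⟩ := hx2
    rw [← hq]
    have : IsOpenImmersion (Spec.map (CommRingCat.ofHom (algebraMap Γ(X, ρ ⁻¹ᵁ p.V)
        (Localization.Away g)))) := IsOpenImmersion.of_isLocalization g
    exact mem_smoothPart_of_openImmersion (ρ ≫ f) _ q
  · intro hz h
    obtain ⟨h0, h1, h2⟩ := (p.mem_zeroSet_cover_iff C x hx).mp hz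
    let := (scalars (ρ ≫ f) x).toAlgebra
    let := (germAt (ρ ⁻¹ᵁ p.V) x hx).toAlgebra
    have : IsScalarTower ℂ Γ(X, ρ ⁻¹ᵁ p.V) (X.presheaf.stalk x) :=
      IsScalarTower.of_algebraMap_eq' (germAt_sectionScalars (ρ ≫ f) (ρ ⁻¹ᵁ p.V) x hx).symm
    have := isLocalization_stalk hV x hx
    exact H.not_formallySmooth (k := ℂ) (O := X.presheaf.stalk x) (ptIdeal (ρ ⁻¹ᵁ p.V) x hx)
      h1 h0 h2 (formallySmooth_stalk_of_mem_smoothPart (ρ ≫ f) x h)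

end TateData

/-! ### Properness of blow-ups -/

section Adjoin

variable {A R K : Type} [CommRing A] [CommRing R] [Algebra A R] {f : K → A} {k : K} {t : K → R}

theorem IsRingChart.adjoin_eq_top (h : IsRingChart f k R)
    (ht : ∀ l, algebraMap A R (f l) = algebraMap A R (f k) * t l) :
    Algebra.adjoin A (Set.range t) = ⊤ := by
  let S := Algebra.adjoin A (Set.range t)
  have hnzd : algebraMap A S (f k) ∈ nonZeroDivisors S := by
    refine mem_nonZeroDivisors_iff_right.mpr fun x hx => Subtype.ext ?_
    exact (mem_nonZeroDivisors_iff_right.mp h.nzd) (x : R) (congrArg Subtype.val hx)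
  obtain ⟨χ⟩ := h.exists_hom S hnzd fun l =>
    ⟨⟨t l, Algebra.subset_adjoin ⟨l, rfl⟩⟩, Subtype.ext (ht l)⟩
  have e := h.hom_ext R (S.val.comp χ) (AlgHom.id A R) h.nzd
  refine eq_top_iff.mpr fun x _ => ?_
  have := DFunLike.congr_fun e x
  rw [AlgHom.comp_apply, AlgHom.id_apply] at this
  rw [← this]
  exact (χ x).2

/-- A morphism from a ring chart with values in `F` takes its values in a subring `V` if it does so
on the coordinates. -/
theorem IsRingChart.exists_factor (h : IsRingChart f k R)
    (ht : ∀ l, algebraMap A R (f l) = algebraMap A R (f k) * t l) {V F : Type} [CommRing V]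
    [CommRing F] {i : V →+* F} (hi : Function.Injective i) (φ : R →+* F) (χ : A →+* V)
    (hχ : i.comp χ = φ.comp (algebraMap A R)) (hc : ∀ l, ∃ c, i c = φ (t l)) :
    ∃ φ' : R →+* V, i.comp φ' = φ := by
  have hm : ∀ x, ∃ c, i c = φ x := fun x => by
    have hx : x ∈ Algebra.adjoin A (Set.range t) := by rw [h.adjoin_eq_top ht]; trivial
    induction hx using Algebra.adjoin_induction with
    | mem x hx => obtain ⟨l, rfl⟩ := hx; exact hc l
    | algebraMap a => exact ⟨χ a, RingHom.congr_fun hχ a⟩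
    | add x y _ _ hx hy =>
      obtain ⟨a, ha⟩ := hx
      obtain ⟨b, hb⟩ := hy
      exact ⟨a + b, by rw [map_add, map_add, ha, hb]⟩
    | mul x y _ _ hx hy =>
      obtain ⟨a, ha⟩ := hx
      obtain ⟨b, hb⟩ := hy
      exact ⟨a * b, by rw [map_mul, map_mul, ha, hb]⟩
  choose g hg using hm
  exact ⟨{ toFun := g
           map_one' := hi (by rw [hg, map_one, map_one])
           map_mul' := fun x y => hi (by rw [hg, map_mul, map_mul, hg, hg])
           map_zero' := hi (by rw [hg, map_zero, map_zero])
           map_add' := fun x y => hi (by rw [hg, map_add, map_add, hg, hg]) },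
    RingHom.ext hg⟩

end Adjoin

/-- The morphism of spectra given by a ring homomorphism. -/
abbrev specHom {R F : Type} [CommRing R] [CommRing F] (φ : R →+* F) :
    Spec (CommRingCat.of F) ⟶ Spec (CommRingCat.of R) :=
  Spec.map (CommRingCat.ofHom φ)

theorem specHom_comp {R S F : Type} [CommRing R] [CommRing S] [CommRing F] (φ : R →+* S)
    (ψ : S →+* F) : specHom (ψ.comp φ) = specHom ψ ≫ specHom φ := by
  rw [specHom, CommRingCat.ofHom_comp, Spec.map_comp]

theorem specHom_injective {R F : Type} [CommRing R] [CommRing F] {φ ψ : R →+* F}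
    (h : specHom φ = specHom ψ) : φ = ψ := by
  have := congrArg CommRingCat.Hom.hom (Spec.map_injective h)
  exact this

theorem exists_specHom_eq {R F : Type} [CommRing R] [CommRing F]
    (g : Spec (CommRingCat.of F) ⟶ Spec (CommRingCat.of R)) : ∃ φ : R →+* F, specHom φ = g :=
  ⟨(Spec.preimage g).hom, Spec.map_preimage g⟩

/-- A morphism from the spectrum of a local ring factors through an open subscheme that contains the
image of the closed point. -/
theorem exists_lift_of_isLocalRing {F : Type} [CommRing F] [IsLocalRing F] {Y S : Scheme.{0}}
    (g : Spec (CommRingCat.of F) ⟶ Y) (j : S ⟶ Y) [IsOpenImmersion j]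
    (h : g (IsLocalRing.closedPoint F) ∈ Set.range j) : ∃ g' : Spec (CommRingCat.of F) ⟶ S,
      g' ≫ j = g := by
  have hr : Set.range g ⊆ Set.range j := by
    rintro _ ⟨x, rfl⟩
    have hx : x ⤳ IsLocalRing.closedPoint F := IsLocalRing.specializes_closedPoint x
    exact (hx.map g.continuous).mem_open j.isOpenEmbedding.isOpen_range h
  exact ⟨IsOpenImmersion.lift j g hr, IsOpenImmersion.lift_fac _ _ _⟩

section Glue

variable {Y' Y : Scheme.{0}} {J : StalkIdeal Y} {π : Y' ⟶ Y} {W : Y.Opens}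
  {hW : IsAffineOpen W} {K : Type} {f : K → Γ(Y, W)} {R : K → Type} [∀ k, CommRing (R k)]
  [∀ k, Algebra Γ(Y, W) (R k)] {t : ∀ k, K → R k} {j : ∀ k, Spec (CommRingCat.of (R k)) ⟶ Y'}

theorem exists_transition
    (hπ : IsBlowup J π) (h : ∀ k, IsRingChart f k (R k))
    (ht : ∀ k l, algebraMap Γ(Y, W) (R k) (f l) = algebraMap Γ(Y, W) (R k) (f k) * t k l)
    (hj : ∀ k, IsOpenImmersion (j k))
    (hjπ : ∀ k, j k ≫ π = specHom (algebraMap Γ(Y, W) (R k)) ≫ hW.fromSpec)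
    {F : Type} [CommRing F] {k l : K} (φ : R k →+* F) (hu : IsUnit (φ (t k l))) :
    ∃ ψ : R l →+* F, (∀ m, φ (t k l) * ψ (t l m) = φ (t k m)) ∧
      ψ.comp (algebraMap Γ(Y, W) (R l)) = φ.comp (algebraMap Γ(Y, W) (R k)) ∧
      specHom φ ≫ j k = specHom ψ ≫ j l := by
  let L := Localization.Away (t k l)
  have htu : IsUnit (algebraMap (R k) L (t k l)) := IsLocalization.Away.algebraMap_isUnit _
  have hk : algebraMap Γ(Y, W) L (f k) ∈ nonZeroDivisors L := by
    rw [IsScalarTower.algebraMap_apply Γ(Y, W) (R k) L]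
    exact mem_nonZeroDivisors_of_flat (h k).nzd
  have htL : ∀ m, algebraMap Γ(Y, W) L (f m) =
      algebraMap Γ(Y, W) L (f k) * algebraMap (R k) L (t k m) := fun m => by
    rw [IsScalarTower.algebraMap_apply Γ(Y, W) (R k) L, ht k m, map_mul,
      ← IsScalarTower.algebraMap_apply]
  have hl : algebraMap Γ(Y, W) L (f l) ∈ nonZeroDivisors L := by
    rw [htL]
    exact mul_mem hk htu.mem_nonZeroDivisors
  obtain ⟨χ⟩ := (h l).exists_hom L hl fun m => by
    rw [htL l, htL m, htu.mul_right_dvd]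
    exact dvd_mul_right _ _
  obtain ⟨φ', hφ'⟩ : ∃ φ' : L →+* F, φ'.comp (algebraMap (R k) L) = φ :=
    ⟨IsLocalization.Away.lift (t k l) hu, IsLocalization.Away.lift_comp (t k l) hu⟩
  have hχt : ∀ m, algebraMap (R k) L (t k l) * χ (t l m) = algebraMap (R k) L (t k m) := fun m => by
    refine (mul_cancel_left_mem_nonZeroDivisors hk).mp ?_
    rw [← mul_assoc, ← htL, ← htL, ← χ.commutes, ← χ.commutes, ← map_mul, ht l m]
  refine ⟨φ'.comp χ.toRingHom, fun m => ?_, ?_, ?_⟩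
  · rw [← hφ']
    exact (map_mul φ' _ _).symm.trans (congrArg φ' (hχt m))
  · rw [← hφ', RingHom.comp_assoc, RingHom.comp_assoc]
    congr 1
    rw [← IsScalarTower.algebraMap_eq]
    exact χ.comp_algebraMap
  · rw [← hφ', specHom_comp (algebraMap (R k) L) φ', specHom_comp χ.toRingHom φ', Category.assoc,
      Category.assoc]
    refine congrArg (specHom φ' ≫ ·) ?_
    have : IsOpenImmersion (specHom (algebraMap (R k) L)) :=
      IsOpenImmersion.of_isLocalization (t k l)
    have := hj k
    refine hπ.hom_ext ?_ (hπ.cartier.comp_openImmersion (specHom (algebraMap (R k) L) ≫ j k))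
    rw [Category.assoc, Category.assoc, hjπ, hjπ, ← Category.assoc, ← Category.assoc,
      ← specHom_comp, ← specHom_comp, ← IsScalarTower.algebraMap_eq]
    congr 2
    exact χ.comp_algebraMap.symm

theorem isUnit_of_chart_eq
    (hj : ∀ k, IsOpenImmersion (j k))
    (hov : ∀ k l, (j k) '' {q : PrimeSpectrum (R k) | t k l ∉ q.asIdeal} =
      Set.range (j k) ∩ Set.range (j l))
    {F : Type} [CommRing F] {k l : K} (φ : R k →+* F) (ψ : R l →+* F)
    (e : specHom φ ≫ j k = specHom ψ ≫ j l) : IsUnit (φ (t k l)) := by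
  by_contra hn
  obtain ⟨M, hM, hmem⟩ := exists_max_ideal_of_mem_nonunits hn
  let x : PrimeSpectrum F := ⟨M, hM.isPrime⟩
  have h1 : j k (PrimeSpectrum.comap φ x) = j l (PrimeSpectrum.comap ψ x) := by
    have := congrArg (fun g : Spec (CommRingCat.of F) ⟶ Y' => g x) e
    exact this
  have h2 : j k (PrimeSpectrum.comap φ x) ∈ (j k) '' {q : PrimeSpectrum (R k) | t k l ∉ q.asIdeal} := by
    rw [hov]
    exact ⟨⟨_, rfl⟩, ⟨_, h1.symm⟩⟩
  obtain ⟨q, hq, hq2⟩ := h2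
  have := hj k
  have := (j k).isOpenEmbedding.injective hq2
  subst this
  exact hq hmem

theorem transition_eq
    (hπ : IsBlowup J π) (h : ∀ k, IsRingChart f k (R k))
    (ht : ∀ k l, algebraMap Γ(Y, W) (R k) (f l) = algebraMap Γ(Y, W) (R k) (f k) * t k l)
    (hj : ∀ k, IsOpenImmersion (j k))
    (hjπ : ∀ k, j k ≫ π = specHom (algebraMap Γ(Y, W) (R k)) ≫ hW.fromSpec)
    (hov : ∀ k l, (j k) '' {q : PrimeSpectrum (R k) | t k l ∉ q.asIdeal} =
      Set.range (j k) ∩ Set.range (j l))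
    {F : Type} [CommRing F] {k l : K} (φ : R k →+* F) (ψ : R l →+* F)
    (e : specHom φ ≫ j k = specHom ψ ≫ j l) (m : K) : φ (t k l) * ψ (t l m) = φ (t k m) := by
  obtain ⟨ψ', h1, -, h2⟩ := exists_transition hπ h ht hj hjπ φ (isUnit_of_chart_eq hj hov φ ψ e)
  have := hj l
  have h3 := specHom_injective ((cancel_mono (j l)).mp (e.symm.trans h2))
  rw [h3]
  exact h1 m

theorem exists_chart_of_isLocalRing (hj : ∀ k, IsOpenImmersion (j k))
    (hcov : (⋃ k, Set.range (j k)) = π ⁻¹' (W : Set Y)) {F : Type} [CommRing F] [IsLocalRing F]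
    (g : Spec (CommRingCat.of F) ⟶ Y') (hg : π (g (IsLocalRing.closedPoint F)) ∈ W) :
    ∃ (k : K) (φ : R k →+* F), specHom φ ≫ j k = g := by
  have hg' : g (IsLocalRing.closedPoint F) ∈ ⋃ k, Set.range (j k) := by rw [hcov]; exact hg
  obtain ⟨k, hk⟩ := Set.mem_iUnion.mp hg'
  have := hj k
  obtain ⟨g', hg'⟩ := exists_lift_of_isLocalRing g (j k) hk
  obtain ⟨φ, hφ⟩ := exists_specHom_eq g'
  exact ⟨k, φ, by rw [hφ, hg']⟩

theorem exists_max_valuationRing {V F : Type} [CommRing V] [IsDomain V] [ValuationRing V] [Field F]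
    [Algebra V F] [IsFractionRing V F] [Finite K] (x : K → F) (k : K) (hk : x k = 1) :
    ∃ l, x l ≠ 0 ∧ ∀ m, ∃ c : V, x m = algebraMap V F c * x l := by
  have : Nonempty K := ⟨k⟩
  obtain ⟨l, hl⟩ := Finite.exists_max fun m => ValuationRing.valuation V F (x m)
  have key : ∀ m, ∃ c : V, x m = algebraMap V F c * x l := fun m => by
    obtain ⟨c, hc⟩ := hl m
    exact ⟨c, by rw [← hc, Algebra.smul_def]⟩
  refine ⟨l, fun h0 => ?_, key⟩
  obtain ⟨c, hc⟩ := key k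
  rw [hk, h0, mul_zero] at hc
  exact one_ne_zero hc

theorem IsBlowup.valuativeCriterion {Y' Y : Scheme.{0}} {J : StalkIdeal Y} {π : Y' ⟶ Y}
    (hπ : IsBlowup J π)
    (H : ∀ y : Y, ∃ (W : Y.Opens) (hW : IsAffineOpen W) (_ : y ∈ W) (K : Type) (_ : Finite K)
      (f : K → Γ(Y, W)) (R : K → Type) (_ : ∀ k, CommRing (R k)) (_ : ∀ k, Algebra Γ(Y, W) (R k))
      (t : ∀ k, K → R k), (∀ k, IsRingChart f k (R k)) ∧
      (∀ k l, algebraMap Γ(Y, W) (R k) (f l) = algebraMap Γ(Y, W) (R k) (f k) * t k l) ∧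
      HasCharts π hW R t) : ValuativeCriterion π := by
  intro S
  have hsq := S.commSq.w
  obtain ⟨W, hW, hyW, K, _, f, R, _, _, t, h, ht, j, hj, hjπ, hcov, hov⟩ :=
    H (S.i₂ (IsLocalRing.closedPoint S.R))
  obtain ⟨i₂, hi₂⟩ := exists_lift_of_isLocalRing S.i₂ hW.fromSpec
    (by rw [hW.range_fromSpec]; exact hyW)
  obtain ⟨χ, rfl⟩ := exists_specHom_eq i₂
  have hinj : Function.Injective (algebraMap S.R S.K) := IsFractionRing.injective S.R S.K
  have hgen : π (S.i₁ (IsLocalRing.closedPoint S.K)) ∈ W := by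
    have h1 : π (S.i₁ (IsLocalRing.closedPoint S.K)) =
        S.i₂ (specHom (algebraMap S.R S.K) (IsLocalRing.closedPoint S.K)) :=
      congrArg (fun g : Spec (CommRingCat.of S.K) ⟶ Y => g (IsLocalRing.closedPoint S.K)) hsq
    rw [h1]
    exact ((IsLocalRing.specializes_closedPoint (R := S.R) _).map S.i₂.continuous).mem_open W.2 hyW
  obtain ⟨k, φ, hφ⟩ := exists_chart_of_isLocalRing hj hcov S.i₁ hgen
  have hcomm : (algebraMap S.R S.K).comp χ = φ.comp (algebraMap Γ(Y, W) (R k)) := by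
    refine specHom_injective ((cancel_mono hW.fromSpec).mp ?_)
    rw [specHom_comp, specHom_comp, Category.assoc, Category.assoc, hi₂, ← hjπ k, ← hsq, ← hφ,
      Category.assoc]
  have hkk : φ (t k k) = 1 := by
    have : t k k = 1 := (mul_cancel_left_mem_nonZeroDivisors (h k).nzd).mp
      ((ht k k).symm.trans (mul_one _).symm)
    rw [this, map_one]
  have hex : Nonempty S.commSq.LiftStruct := by
    obtain ⟨l, hl, hmax⟩ := exists_max_valuationRing (V := S.R) (fun l => φ (t k l)) k hkk
    obtain ⟨ψ, h1, h2, h3⟩ := exists_transition hπ h ht hj hjπ φ (isUnit_iff_ne_zero.mpr hl)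
    obtain ⟨ψ', rfl⟩ := (h l).exists_factor (ht l) hinj ψ χ (hcomm.trans h2.symm) fun m => by
      obtain ⟨c, hc⟩ := hmax m
      refine ⟨c, mul_left_cancel₀ hl ?_⟩
      rw [h1, hc, mul_comm]
    refine ⟨⟨specHom ψ' ≫ j l, ?_, ?_⟩⟩
    · rw [← hφ, h3, specHom_comp, Category.assoc]
    · rw [Category.assoc, hjπ, ← Category.assoc, ← specHom_comp, ← hi₂]
      congr 2
      refine RingHom.ext fun a => hinj ?_
      exact RingHom.congr_fun (h2.trans hcomm.symm) a
  refine ⟨{ default := hex.some, uniq := fun l₁ => ?_ }⟩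
  generalize hex.some = l₂
  have hmem : ∀ l : S.commSq.LiftStruct, π (l.l (IsLocalRing.closedPoint S.R)) ∈ W := fun l => by
    have h1 : π (l.l (IsLocalRing.closedPoint S.R)) = S.i₂ (IsLocalRing.closedPoint S.R) :=
      congrArg (fun g : Spec (CommRingCat.of S.R) ⟶ Y => g (IsLocalRing.closedPoint S.R))
        l.fac_right
    rw [h1]
    exact hyW
  obtain ⟨k₁, φ₁, h₁⟩ := exists_chart_of_isLocalRing hj hcov l₁.l (hmem l₁)
  obtain ⟨k₂, φ₂, h₂⟩ := exists_chart_of_isLocalRing hj hcov l₂.l (hmem l₂)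
  have e : specHom ((algebraMap S.R S.K).comp φ₁) ≫ j k₁ =
      specHom ((algebraMap S.R S.K).comp φ₂) ≫ j k₂ := by
    rw [specHom_comp, specHom_comp, Category.assoc, Category.assoc, h₁, h₂]
    exact l₁.fac_left.trans l₂.fac_left.symm
  have h3 := transition_eq hπ h ht hj hjπ hov _ _ e k₁
  have hkk₁ : t k₁ k₁ = 1 := (mul_cancel_left_mem_nonZeroDivisors (h k₁).nzd).mp
      ((ht k₁ k₁).symm.trans (mul_one _).symm)
  have hu : IsUnit (φ₁ (t k₁ k₂)) := by
    refine IsUnit.of_mul_eq_one (φ₂ (t k₂ k₁)) (hinj ?_)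
    rw [map_mul, map_one]
    refine h3.trans ?_
    rw [hkk₁, map_one]
  obtain ⟨ψ, -, -, h4⟩ := exists_transition hπ h ht hj hjπ φ₁ hu
  have := hj k₂
  have h5 : (algebraMap S.R S.K).comp ψ = (algebraMap S.R S.K).comp φ₂ := by
    refine specHom_injective ((cancel_mono (j k₂)).mp ?_)
    rw [← e, specHom_comp, specHom_comp, Category.assoc, Category.assoc, h4]
  have h6 : ψ = φ₂ := RingHom.ext fun a => hinj (RingHom.congr_fun h5 a)
  refine CommSq.LiftStruct.ext ?_
  rw [← h₁, ← h₂, h4, h6]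

theorem IsBlowup.isProper {Y' Y : Scheme.{0}} {J : StalkIdeal Y} {π : Y' ⟶ Y}
    (hπ : IsBlowup J π) [QuasiSeparated π] [LocallyOfFiniteType π]
    (H : ∀ y : Y, ∃ (W : Y.Opens) (hW : IsAffineOpen W) (_ : y ∈ W) (K : Type) (_ : Finite K)
      (f : K → Γ(Y, W)) (R : K → Type) (_ : ∀ k, CommRing (R k)) (_ : ∀ k, Algebra Γ(Y, W) (R k))
      (t : ∀ k, K → R k), (∀ k, IsRingChart f k (R k)) ∧
      (∀ k l, algebraMap Γ(Y, W) (R k) (f l) = algebraMap Γ(Y, W) (R k) (f k) * t k l) ∧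
      HasCharts π hW R t) : IsProper π := by
  have : QuasiCompact π := by
    choose W hW hyW H' using H
    have hQ : HasAffineProperty (@QuasiCompact.{0}) fun X _ _ _ => CompactSpace X :=
      instHasAffinePropertyQuasiCompactCompactSpaceCarrierCarrierCommRingCat
    refine hQ.of_iSup_eq_top
      (fun y => (⟨W y, hW y⟩ : Y.affineOpens)) ?_ fun y => ?_
    · exact eq_top_iff.mpr fun y _ => TopologicalSpace.Opens.mem_iSup.mpr ⟨y, hyW y⟩
    · obtain ⟨K, _, f, R, _, _, t, -, -, j, -, -, hcov, -⟩ := H' y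
      have hc : IsCompact (π ⁻¹' (W y : Set Y)) := by
        rw [← hcov]
        exact isCompact_iUnion fun k => isCompact_range (j k).continuous
      exact isCompact_iff_compactSpace.mp hc
  exact IsProper.of_valuativeCriterion π (hπ.valuativeCriterion H)

end Glue

/-! ### The blow-ups are smooth varieties -/

namespace TateData

variable {B : Scheme.{0}} {N : ℕ} {D : TateData B N} {X : Scheme.{0}} {ρ : X ⟶ B}
  [IsIntegral B] [IsIntegral X]

theorem sigma_germ_mem_nonZeroDivisors (C : DoubleCover D.P ρ D.limitBranch) (p : D.Patch) (b : B)
    (hb : b ∈ p.V) : germAt p.V b hb p.σ ∈ nonZeroDivisors _ := by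
  have := isLocalization_stalk p.affine b hb
  let := (germAt p.V b hb).toAlgebra
  have : Module.Flat Γ(B, p.V) (B.presheaf.stalk b) :=
    IsLocalization.flat _ (ptIdeal p.V b hb).primeCompl
  exact mem_nonZeroDivisors_of_flat (p.sigma_mem_nonZeroDivisors C)

theorem nonempty_centerCompl_base (C : DoubleCover D.P ρ D.limitBranch) :
    (centerCompl (D.locallyFG_baseCenter) : Set B).Nonempty := by
  obtain ⟨p, hp, -⟩ := Patch.exists_mem (D := D) ⊤ (genericPoint B) trivial
  refine ⟨genericPoint B, mem_centerCompl.mpr ?_⟩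
  rw [p.generatedOn_base _ hp]
  have h0 : (germAt p.V (genericPoint B) hp p.σ : B.functionField) ≠ 0 :=
    nonZeroDivisors.ne_zero (sigma_germ_mem_nonZeroDivisors C p _ hp)
  exact Ideal.eq_top_of_isUnit_mem _ (Ideal.subset_span ⟨0, rfl⟩)
    (isUnit_iff_ne_zero.mpr h0 : IsUnit (germAt p.V (genericPoint B) hp p.σ : B.functionField))

theorem nonempty_centerCompl_cover (C : DoubleCover D.P ρ D.limitBranch) :
    (centerCompl (D.locallyFG_coverCenter C) : Set X).Nonempty := by
  obtain ⟨p, hp, -⟩ := Patch.exists_mem (D := D) ⊤ (ρ (genericPoint X)) trivial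
  replace hp : genericPoint X ∈ ρ ⁻¹ᵁ p.V := hp
  refine ⟨genericPoint X, mem_centerCompl.mpr ?_⟩
  have hV := p.isAffineOpen_preimage C
  have : Nontrivial Γ(X, ρ ⁻¹ᵁ p.V) := (germAt (ρ ⁻¹ᵁ p.V) _ hp).domain_nontrivial
  have : Nontrivial Γ(B, p.V) := (algebraMap _ Γ(X, ρ ⁻¹ᵁ p.V)).domain_nontrivial
  have := p.isDomain_cover C
  have hs : algebraMap _ Γ(X, ρ ⁻¹ᵁ p.V) p.σ ∈ nonZeroDivisors _ :=
    mem_nonZeroDivisors_of_ne_zero fun h0 =>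
      nonZeroDivisors.ne_zero (p.sigma_mem_nonZeroDivisors C)
        ((p.isQuadratic C).injective (h0.trans (map_zero _).symm))
  have := isLocalization_stalk hV _ hp
  let := (germAt (ρ ⁻¹ᵁ p.V) _ hp).toAlgebra
  have : Module.Flat Γ(X, ρ ⁻¹ᵁ p.V) (X.presheaf.stalk (genericPoint X)) :=
    IsLocalization.flat _ (ptIdeal (ρ ⁻¹ᵁ p.V) _ hp).primeCompl
  have h0 : (germAt (ρ ⁻¹ᵁ p.V) (genericPoint X) hp (algebraMap Γ(B, p.V) _ p.σ) :
      X.functionField) ≠ 0 :=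
    nonZeroDivisors.ne_zero (mem_nonZeroDivisors_of_flat hs)
  rw [p.generatedOn_cover C _ hp]
  exact Ideal.eq_top_of_isUnit_mem _ (Ideal.subset_span ⟨0, rfl⟩)
    (isUnit_iff_ne_zero.mpr h0 : IsUnit (germAt (ρ ⁻¹ᵁ p.V) (genericPoint X) hp
      (algebraMap Γ(B, p.V) _ p.σ) : X.functionField))

variable (f : B ⟶ SpecC) (n : ℕ)

theorem isIntegral_baseBlowup [SmoothOfRelativeDimension n f]
    (C : DoubleCover D.P ρ D.limitBranch) (hD : D.Generic f)
    (hK : ∀ p : D.Patch, KoszulExact p.σ p.a₁) {B' : Scheme.{0}} {β : B' ⟶ B}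
    (hβ : IsBlowup D.baseCenter β) : IsIntegral B' ∧ SmoothOfRelativeDimension n (β ≫ f) := by
  have key : ∀ y : B', ∃ (S : Scheme.{0}) (j : S ⟶ B'), IsOpenImmersion j ∧ IsIntegral S ∧
      y ∈ Set.range j ∧ SmoothOfRelativeDimension n (j ≫ β ≫ f) := fun y => by
    obtain ⟨p, hp, -⟩ := Patch.exists_mem (D := D) ⊤ (β y) trivial
    obtain ⟨k, j, hj, h1, q, hq⟩ := exists_baseChart hβ hK p y hp
    have : Nontrivial (BaseChart p.σ p.a₁ k) :=
      (PrimeSpectrum.nonempty_iff_nontrivial (R := BaseChart p.σ p.a₁ k)).mp ⟨q⟩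
    obtain ⟨h2, h3⟩ := smoothOfRelativeDimension_baseChart f n hD hK p k
    refine ⟨_, j, hj, inferInstance, ⟨q, hq⟩, ?_⟩
    rw [← Category.assoc, h1]
    exact h3
  refine ⟨hβ.isIntegral D.locallyFG_baseCenter (nonempty_centerCompl_base C) fun y => ?_,
    of_forall_exists_openImmersion (@SmoothOfRelativeDimension n) _ fun y => ?_⟩
  · obtain ⟨S, j, h1, h2, h3, -⟩ := key y
    exact ⟨S, j, h1, h2, h3⟩
  · obtain ⟨S, j, h1, -, h3, h4⟩ := key y
    exact ⟨S, j, h1, h3, h4⟩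

theorem isIntegral_coverBlowup [SmoothOfRelativeDimension n f]
    (C : DoubleCover D.P ρ D.limitBranch) (hD : D.Generic f)
    (hK : ∀ p : D.Patch, KoszulExact p.σ p.a₁) {X' : Scheme.{0}} {π : X' ⟶ X}
    (hπ : IsBlowup (D.coverCenter C) π) :
    IsIntegral X' ∧ SmoothOfRelativeDimension n (π ≫ ρ ≫ f) := by
  have key : ∀ y : X', ∃ (S : Scheme.{0}) (j : S ⟶ X'), IsOpenImmersion j ∧ IsIntegral S ∧
      y ∈ Set.range j ∧ SmoothOfRelativeDimension n (j ≫ π ≫ ρ ≫ f) := fun y => by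
    obtain ⟨p, hp, -⟩ := Patch.exists_mem (D := D) ⊤ (ρ (π y)) trivial
    obtain ⟨k, j, hj, h1, q, hq⟩ := exists_coverChart C hπ hK p y hp
    have : Nontrivial (CoverChart p.σ p.a₁ p.a₂₂ k) :=
      (PrimeSpectrum.nonempty_iff_nontrivial (R := CoverChart p.σ p.a₁ p.a₂₂ k)).mp ⟨q⟩
    obtain ⟨h2, h3⟩ := smoothOfRelativeDimension_coverChart f C n hD hK p k
    refine ⟨_, j, hj, inferInstance, ⟨q, hq⟩, ?_⟩
    rw [← Category.assoc, h1]
    exact h3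
  refine ⟨hπ.isIntegral (D.locallyFG_coverCenter C) (nonempty_centerCompl_cover C) fun y => ?_,
    of_forall_exists_openImmersion (@SmoothOfRelativeDimension n) _ fun y => ?_⟩
  · obtain ⟨S, j, h1, h2, h3, -⟩ := key y
    exact ⟨S, j, h1, h2, h3⟩
  · obtain ⟨S, j, h1, -, h3, h4⟩ := key y
    exact ⟨S, j, h1, h3, h4⟩

theorem isProper_coverBlowup [SmoothOfRelativeDimension n f]
    (C : DoubleCover D.P ρ D.limitBranch) (hD : D.Generic f)
    (hK : ∀ p : D.Patch, KoszulExact p.σ p.a₁) {X' : Scheme.{0}} {π : X' ⟶ X}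
    (hπ : IsBlowup (D.coverCenter C) π) : IsProper π := by
  have := (isIntegral_coverBlowup f n C hD hK hπ).2
  have : Smooth (π ≫ ρ ≫ f) := SmoothOfRelativeDimension.smooth n _
  have : LocallyOfFiniteType (π ≫ ρ ≫ f) := inferInstance
  have : IsLocallyNoetherian X' := LocallyOfFiniteType.isLocallyNoetherian (π ≫ ρ ≫ f)
  have : LocallyOfFiniteType π := locallyOfFiniteType_of_comp π (ρ ≫ f)
  refine hπ.isProper fun x => ?_
  obtain ⟨p, hp, -⟩ := Patch.exists_mem (D := D) ⊤ (ρ x) trivial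
  exact ⟨ρ ⁻¹ᵁ p.V, p.isAffineOpen_preimage C, hp, Fin 3, inferInstance, p.coverGen C, _, _, _, _,
    isRingChart_resSpp (p.isQuadratic C) (hK p), resSppCoord_mul,
    hasCharts_resSpp hπ p (hK p) (p.isAffineOpen_preimage C)⟩

theorem smoothPart_eq_centerCompl [Smooth f]
    (C : DoubleCover D.P ρ D.limitBranch) (hD : D.Generic f) :
    smoothPart (ρ ≫ f) = centerCompl (D.locallyFG_coverCenter C) := by
  refine TopologicalSpace.Opens.ext ?_
  change (smoothPart (ρ ≫ f) : Set X) = (zeroSet (D.coverCenter C))ᶜ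
  rw [← compl_smoothPart C f hD, compl_compl]

theorem isIso_smoothPart [Smooth f]
    (C : DoubleCover D.P ρ D.limitBranch) (hD : D.Generic f) {X' : Scheme.{0}}
    {π : X' ⟶ X} (hπ : IsBlowup (D.coverCenter C) π) : IsIso (π ∣_ smoothPart (ρ ≫ f)) := by
  rw [smoothPart_eq_centerCompl f C hD]
  exact hπ.isIso_morphismRestrict _

end TateData

/-! ### Coordinate systems and generators of the module of differential forms -/

section Lattice

variable {K L M : Type} [Field K] [AddCommGroup L] [Module K L] [AddCommGroup M] [Module K M]
  {n : ℕ}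

theorem alternatingMap_mem_span (S : Subring K) (f : L [⋀^Fin n]→ₗ[K] M) (v w : Fin n → L)
    (h : ∀ i, w i ∈ Submodule.span S (Set.range v)) : f w ∈ Submodule.span S {f v} := by
  choose c hc using fun i => (Submodule.mem_span_range_iff_exists_fun S).mp (h i)
  have e : w = fun i => ∑ j, (c i j : K) • v j := funext fun i => (hc i).symm
  rw [e]
  have h1 := f.toMultilinearMap.map_sum (fun i j => (c i j : K) • v j)
  rw [AlternatingMap.coe_multilinearMap] at h1
  rw [h1]
  refine Submodule.sum_mem _ fun r _ => ?_
  have h2 := f.toMultilinearMap.map_smul_univ (fun i => (c i (r i) : K)) fun i => v (r i)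
  rw [AlternatingMap.coe_multilinearMap] at h2
  rw [h2]
  have h3 : ∏ i, (c i (r i) : K) = ((∏ i, c i (r i) : S) : K) :=
    (map_prod S.subtype _ _).symm
  rw [h3]
  refine Submodule.smul_mem _ (∏ i, c i (r i) : S) ?_
  by_cases hr : Function.Injective r
  · have h4 := f.map_perm v (Equiv.ofBijective r ⟨hr, Finite.surjective_of_injective hr⟩)
    change f (fun i => v (r i)) = _ at h4
    rw [h4]
    have h5 : f v ∈ Submodule.span S {f v} := Submodule.mem_span_singleton_self _
    rcases Int.units_eq_one_or (Equiv.Perm.sign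
      (Equiv.ofBijective r ⟨hr, Finite.surjective_of_injective hr⟩)) with hs | hs
    · rw [hs, one_smul]; exact h5
    · rw [hs, Units.neg_smul, one_smul]; exact neg_mem h5
  · have : f (fun i => v (r i)) = 0 := by
      simp only [Function.Injective, not_forall] at hr
      obtain ⟨i, j, hij, hne⟩ := hr
      exact f.map_eq_zero_of_eq _ (by rw [hij]) hne
    rw [this]
    exact zero_mem _

end Lattice

section Generates

variable {k K : Type} [Field k] [Field K] [Algebra k K] {n : ℕ} {S : Subring K}

theorem generatesForms_of_coordinates (x : Fin n → S)
    (h : ∀ z : S, KaehlerDifferential.D k K z ∈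
      Submodule.span S (Set.range fun i => KaehlerDifferential.D k K (x i : K))) :
    GeneratesForms k K n S (exteriorPower.ιMulti K n fun i => KaehlerDifferential.D k K (x i : K)) := by
  refine le_antisymm (Submodule.span_mono ?_) (Submodule.span_le.mpr ?_)
  · rintro _ rfl
    exact ⟨x, rfl⟩
  · rintro _ ⟨a, rfl⟩
    exact alternatingMap_mem_span S (exteriorPower.ιMulti K n) _ _ fun i => h (a i)

theorem GeneratesForms.smul {η : ⋀[K]^n (Ω[K⁄k])} (h : GeneratesForms k K n S η) {c : K}
    (h0 : c ≠ 0) (hc : c ∈ S) (hc' : c⁻¹ ∈ S) : GeneratesForms k K n S (c • η) := by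
  rw [GeneratesForms, ← h]
  refine le_antisymm ?_ ?_
  · rw [Submodule.span_singleton_le_iff_mem]
    exact Submodule.smul_mem _ (⟨c, hc⟩ : S) (Submodule.mem_span_singleton_self _)
  · rw [Submodule.span_singleton_le_iff_mem]
    have := Submodule.smul_mem (Submodule.span S {c • η}) (⟨c⁻¹, hc'⟩ : S)
      (Submodule.mem_span_singleton_self _)
    rwa [Subring.smul_def, smul_smul, inv_mul_cancel₀ h0, one_smul] at this

end Generates

/-- The differentials of the `x i` generate those of all elements of `A`, up to the factor `g`. -/
def IsFrame (k : Type) {A I : Type} [CommRing k] [CommRing A] [Algebra k A] [Fintype I] (x : I → A)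
    (g : A) : Prop :=
  ∀ a, ∃ c : I → A, g • KaehlerDifferential.D k A a = ∑ i, c i • KaehlerDifferential.D k A (x i)

section Frame

variable {k A I : Type} [CommRing k] [CommRing A] [Algebra k A] [Fintype I]

/-- The elements of `A` the differential of which lies in `N`, up to the factor `g`. -/
def diffSubalgebra (k : Type) {A : Type} [CommRing k] [CommRing A] [Algebra k A] (g : A)
    (N : Submodule A (Ω[A⁄k])) : Subalgebra k A where
  carrier := {a | g • KaehlerDifferential.D k A a ∈ N}
  mul_mem' {a b} ha hb := by
    simp only [Set.mem_ofPred_eq] at ha hb ⊢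
    rw [Derivation.leibniz, smul_add, smul_comm g a, smul_comm g b]
    exact add_mem (N.smul_mem _ hb) (N.smul_mem _ ha)
  add_mem' {a b} ha hb := by
    simp only [Set.mem_ofPred_eq] at ha hb ⊢
    rw [map_add, smul_add]
    exact add_mem ha hb
  algebraMap_mem' c := by
    simp only [Set.mem_ofPred_eq]
    rw [Derivation.map_algebraMap, smul_zero]
    exact zero_mem _

theorem mem_diffSubalgebra {g : A} {N : Submodule A (Ω[A⁄k])} {a : A} :
    a ∈ diffSubalgebra k g N ↔ g • KaehlerDifferential.D k A a ∈ N := Iff.rfl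

theorem isFrame_iff {x : I → A} {g : A} : IsFrame k x g ↔ ∀ a, a ∈ diffSubalgebra k g
    (Submodule.span A (Set.range fun i => KaehlerDifferential.D k A (x i))) := by
  refine forall_congr' fun a => ?_
  rw [mem_diffSubalgebra, Submodule.mem_span_range_iff_exists_fun]
  exact exists_congr fun c => eq_comm

theorem map_D_eq_sum {k A R I : Type} [CommRing k] [CommRing A] [CommRing R] [Algebra k A]
    [Algebra k R] [Algebra A R] [IsScalarTower k A R] [Fintype I] {g c : A} {d x : I → A}
    (h : g • KaehlerDifferential.D k A c = ∑ i, d i • KaehlerDifferential.D k A (x i)) :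
    algebraMap A R g • KaehlerDifferential.D k R (algebraMap A R c) =
      ∑ i, algebraMap A R (d i) • KaehlerDifferential.D k R (algebraMap A R (x i)) := by
  have := congrArg (KaehlerDifferential.map k k A R) h
  simpa only [map_smul, map_sum, KaehlerDifferential.map_D, algebraMap_smul] using this

theorem IsFrame.map {x : I → A} {g : A} (h : IsFrame k x g) (R : Type) [CommRing R] [Algebra k R]
    [Algebra A R] [IsScalarTower k A R] (a : A) : ∃ c : I → A,
    algebraMap A R g • KaehlerDifferential.D k R (algebraMap A R a) =
      ∑ i, algebraMap A R (c i) • KaehlerDifferential.D k R (algebraMap A R (x i)) := by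
  obtain ⟨c, hc⟩ := h a
  exact ⟨c, map_D_eq_sum hc⟩

theorem IsFrame.algebraMap_mem {x : I → A} {g : A} (h : IsFrame k x g) (R : Type) [CommRing R]
    [Algebra k R] [Algebra A R] [IsScalarTower k A R] (a : A) :
    algebraMap A R g • KaehlerDifferential.D k R (algebraMap A R a) ∈
      Submodule.span R (Set.range fun i => KaehlerDifferential.D k R (algebraMap A R (x i))) := by
  obtain ⟨c, hc⟩ := h.map R a
  rw [hc]
  exact Submodule.sum_mem _ fun i _ => Submodule.smul_mem _ _ (Submodule.subset_span ⟨i, rfl⟩)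

theorem SlopeChart.eq_top_of_mem {u v : A} (T : Subalgebra k (SlopeChart u v))
    (h : ∀ a, algebraMap A _ a ∈ T) (ht : SlopeChart.t u v ∈ T) (z : SlopeChart u v) : z ∈ T := by
  obtain ⟨z, rfl⟩ := Ideal.Quotient.mk_surjective z
  induction z using Polynomial.induction_on' with
  | add p q hp hq => rw [map_add]; exact add_mem hp hq
  | monomial n a =>
    have e : (Ideal.Quotient.mk _ (Polynomial.monomial n a) : SlopeChart u v) =
        algebraMap A _ a * SlopeChart.t u v ^ n := by
      rw [← Polynomial.C_mul_X_pow_eq_monomial, map_mul, map_pow]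
      rfl
    rw [e]
    exact mul_mem (h a) (pow_mem ht n)

section Generated

variable {R : Type} [CommRing R] [Algebra k R] [Algebra A R] [IsScalarTower k A R] {t : R}

/-- If `R` is generated over `A` by `t = v / u`, then where `u` is invertible coordinates on `A` are
coordinates on `R`. -/
theorem IsFrame.adjoin_mul (hgen : ∀ T : Subalgebra k R, (∀ a, algebraMap A R a ∈ T) → t ∈ T →
    ∀ z, z ∈ T) {x : I → A} {g : A} (h : IsFrame k x g) {u v : A}
    (ht : algebraMap A R u * t = algebraMap A R v) :
    IsFrame k (fun i => algebraMap A R (x i)) (algebraMap A R (g * u)) := by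
  rw [isFrame_iff]
  set N := Submodule.span R (Set.range fun i => KaehlerDifferential.D k R (algebraMap A R (x i)))
  have hA := h.algebraMap_mem R
  refine hgen _ (fun a => ?_) ?_
  · rw [mem_diffSubalgebra, mul_comm, map_mul, mul_smul]
    exact N.smul_mem _ (hA a)
  · rw [mem_diffSubalgebra, map_mul, mul_smul]
    have e := congrArg (KaehlerDifferential.D k R) ht
    rw [Derivation.leibniz, ← eq_sub_iff_add_eq] at e
    rw [e, smul_sub, smul_comm _ t]
    exact sub_mem (hA v) (N.smul_mem _ (hA u))

/-- If `R` is generated over `A` by `t` with `x i * t = x j`, coordinates on `R` are obtained by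
replacing `x j` by `t`. -/
theorem IsFrame.adjoin_update [DecidableEq I] (hgen : ∀ T : Subalgebra k R,
    (∀ a, algebraMap A R a ∈ T) → t ∈ T → ∀ z, z ∈ T) {x : I → A} {g : A} (h : IsFrame k x g)
    {i j : I} (hij : i ≠ j) (ht : algebraMap A R (x i) * t = algebraMap A R (x j)) :
    IsFrame k (Function.update (fun l => algebraMap A R (x l)) j t) (algebraMap A R g) := by
  rw [isFrame_iff]
  set x' := Function.update (fun l => algebraMap A R (x l)) j t with hx'
  set N := Submodule.span R (Set.range fun l => KaehlerDifferential.D k R (x' l))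
  have hmem : ∀ l, KaehlerDifferential.D k R (x' l) ∈ N := fun l => Submodule.subset_span ⟨l, rfl⟩
  have htN : KaehlerDifferential.D k R t ∈ N := by
    have := hmem j
    rwa [hx', Function.update_self] at this
  have hne : ∀ l, l ≠ j → KaehlerDifferential.D k R (algebraMap A _ (x l)) ∈ N := fun l hl => by
    have := hmem l
    rwa [hx', Function.update_of_ne hl] at this
  have hx : ∀ l, KaehlerDifferential.D k R (algebraMap A _ (x l)) ∈ N := by
    intro l
    by_cases hl : l = j
    · rw [hl, ← ht, Derivation.leibniz]
      exact add_mem (N.smul_mem _ htN) (N.smul_mem _ (hne i hij))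
    · exact hne l hl
  refine hgen _ (fun a => ?_) (N.smul_mem _ htN)
  refine (Submodule.span_le.mpr ?_ : _ ≤ N) (h.algebraMap_mem R a)
  rintro _ ⟨l, rfl⟩
  exact hx l

end Generated

end Frame

section Wedge

variable {k K : Type} [Field k] [Field K] [Algebra k K] {n : ℕ}

/-- The form `dx₁ ∧ ⋯ ∧ dxₙ`. -/
def wedgeD (k : Type) {K : Type} [Field k] [Field K] [Algebra k K] {n : ℕ} (x : Fin n → K) :
    ⋀[K]^n (Ω[K⁄k]) :=
  exteriorPower.ιMulti K n fun i => KaehlerDifferential.D k K (x i)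

theorem smul_wedgeD (x : Fin n → K) (i : Fin n) (d : K) (c : Fin n → K) (r : K)
    (h : d • KaehlerDifferential.D k K r = ∑ j, c j • KaehlerDifferential.D k K (x j)) :
    c i • wedgeD k x = d • wedgeD k (Function.update x i r) := by
  have e : ∀ z, wedgeD k (Function.update x i z) = exteriorPower.ιMulti K n
      (Function.update (fun i => KaehlerDifferential.D k K (x i)) i (KaehlerDifferential.D k K z)) :=
    fun z => by
      rw [wedgeD]
      congr 1
      funext j
      by_cases hj : j = i
      · subst hj; rw [Function.update_self, Function.update_self]
      · rw [Function.update_of_ne hj, Function.update_of_ne hj]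
  rw [e, ← AlternatingMap.map_update_smul, h, AlternatingMap.map_update_sum,
    Finset.sum_eq_single i]
  · rw [AlternatingMap.map_update_smul, Function.update_eq_self]
    rfl
  · intro j _ hj
    rw [AlternatingMap.map_update_smul]
    rw [AlternatingMap.map_update_self _ _ hj.symm, smul_zero]
  · intro h
    exact absurd (Finset.mem_univ i) h

end Wedge

/-! ### Generators of the forms at a point of a double cover -/

/-- The subring `S` of the field `K` is the local ring of `R` at the prime ideal `q`. -/
structure IsLocalSubring {R K : Type} [CommRing R] [Field K] [Algebra R K] (q : Ideal R)
    (S : Subring K) : Prop where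
  algebraMap_mem : ∀ z, algebraMap R K z ∈ S
  ne_zero : ∀ z, z ∉ q → algebraMap R K z ≠ 0
  inv_mem : ∀ z, z ∉ q → (algebraMap R K z)⁻¹ ∈ S
  exists_eq : ∀ s ∈ S, ∃ v w, w ∉ q ∧ algebraMap R K w * s = algebraMap R K v

section

variable {k R K : Type} [Field k] [CommRing R] [Field K] [Algebra k R] [Algebra k K] [Algebra R K]
  [IsScalarTower k R K] {q : Ideal R} {S : Subring K} {n : ℕ}

theorem IsLocalSubring.generatesForms (hS : IsLocalSubring q S) {x : Fin n → R} {g : R}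
    (hx : IsFrame k x g) (hg : g ∉ q) :
    GeneratesForms k K n S (wedgeD k fun i => algebraMap R K (x i)) := by
  let y : Fin n → S := fun i => ⟨algebraMap R K (x i), hS.algebraMap_mem _⟩
  refine generatesForms_of_coordinates y fun z => ?_
  set N := Submodule.span S (Set.range fun i => KaehlerDifferential.D k K (y i : K))
  have hN : ∀ (c d : K) (m : Ω[K⁄k]), c ≠ 0 → c⁻¹ ∈ S → c • m ∈ N → m ∈ N := fun c _ m h0 hc hm => by
    have := N.smul_mem (⟨c⁻¹, hc⟩ : S) hm
    have e : (⟨c⁻¹, hc⟩ : S) • c • m = m := by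
      change c⁻¹ • c • m = m
      rw [smul_smul, inv_mul_cancel₀ h0, one_smul]
    rwa [e] at this
  have hR : ∀ a, KaehlerDifferential.D k K (algebraMap R K a) ∈ N := fun a => by
    obtain ⟨c, hc⟩ := hx.map K a
    refine hN _ 0 _ (hS.ne_zero g hg) (hS.inv_mem g hg) ?_
    rw [hc]
    exact Submodule.sum_mem _ fun i _ => N.smul_mem (⟨_, hS.algebraMap_mem (c i)⟩ : S)
      (Submodule.subset_span ⟨i, rfl⟩)
  obtain ⟨v, w, hw, e⟩ := hS.exists_eq z z.2
  refine hN _ 0 _ (hS.ne_zero w hw) (hS.inv_mem w hw) ?_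
  have e' := congrArg (KaehlerDifferential.D k K) e
  rw [Derivation.leibniz, ← eq_sub_iff_add_eq] at e'
  rw [e']
  exact sub_mem (hR v) (N.smul_mem z (hR w))

end

section Double

variable {k A R K : Type} [Field k] [CommRing A] [CommRing R] [Field K] [Algebra k A] [Algebra k R]
  [Algebra A R] [IsScalarTower k A R] [Algebra k K] [Algebra R K] [IsScalarTower k R K]
  {q : Ideal R} {S : Subring K} {n : ℕ} {c : A} {r : R}

theorem IsQuadratic.mem_of_mem (H : IsQuadratic c r) (T : Subalgebra k R)
    (h : ∀ a, algebraMap A R a ∈ T) (hr : r ∈ T) (z : R) : z ∈ T := by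
  obtain ⟨a, b, rfl⟩ := H.exists_eq z
  exact add_mem (h a) (mul_mem (h b) hr)

theorem IsQuadratic.two_smul_D (H : IsQuadratic c r) :
    (2 * r) • KaehlerDifferential.D k R r = KaehlerDifferential.D k R (algebraMap A R c) := by
  rw [← H.sq, Derivation.leibniz_pow, mul_smul, two_smul, two_nsmul, pow_one]

theorem IsQuadratic.isFrame_mul (H : IsQuadratic c r) {x : Fin n → A} {g : A}
    (hx : IsFrame k x g) : IsFrame k (fun i => algebraMap A R (x i)) (algebraMap A R g * (2 * r)) := by
  rw [isFrame_iff]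
  set N := Submodule.span R (Set.range fun i => KaehlerDifferential.D k R (algebraMap A R (x i)))
  have hA := hx.algebraMap_mem R
  refine H.mem_of_mem _ (fun a => ?_) ?_
  · rw [mem_diffSubalgebra, mul_comm, mul_smul]
    exact N.smul_mem _ (hA a)
  · rw [mem_diffSubalgebra, mul_smul, H.two_smul_D]
    exact hA c

theorem IsQuadratic.isFrame_update (H : IsQuadratic c r) {x : Fin n → A} {g : A}
    (hx : IsFrame k x g) {d : Fin n → A}
    (hd : g • KaehlerDifferential.D k A c = ∑ i, d i • KaehlerDifferential.D k A (x i)) (i : Fin n) :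
    IsFrame k (Function.update (fun i => algebraMap A R (x i)) i r) (algebraMap A R (d i * g)) := by
  rw [isFrame_iff]
  set x' := Function.update (fun i => algebraMap A R (x i)) i r with hx'
  set N := Submodule.span R (Set.range fun i => KaehlerDifferential.D k R (x' i))
  have hmem : ∀ l, KaehlerDifferential.D k R (x' l) ∈ N := fun l => Submodule.subset_span ⟨l, rfl⟩
  have hr : KaehlerDifferential.D k R r ∈ N := by
    have := hmem i
    rwa [hx', Function.update_self] at this
  have hne : ∀ l, l ≠ i → KaehlerDifferential.D k R (algebraMap A _ (x l)) ∈ N := fun l hl => by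
    have := hmem l
    rwa [hx', Function.update_of_ne hl] at this
  have hd' : algebraMap A R g • KaehlerDifferential.D k R (algebraMap A R c) =
      ∑ i, algebraMap A R (d i) • KaehlerDifferential.D k R (algebraMap A R (x i)) :=
    map_D_eq_sum hd
  have hi : algebraMap A R (d i) • KaehlerDifferential.D k R (algebraMap A R (x i)) ∈ N := by
    rw [← Finset.add_sum_erase _ _ (Finset.mem_univ i), ← sub_eq_iff_eq_add] at hd'
    rw [← hd', ← H.two_smul_D]
    exact sub_mem (N.smul_mem _ (N.smul_mem _ hr)) (Submodule.sum_mem _ fun j hj =>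
      N.smul_mem _ (hne j (Finset.ne_of_mem_erase hj)))
  have hall : ∀ l, algebraMap A R (d i) • KaehlerDifferential.D k R (algebraMap A R (x l)) ∈ N :=
    fun l => by
      by_cases hl : l = i
      · rw [hl]; exact hi
      · exact N.smul_mem _ (hne l hl)
  refine H.mem_of_mem _ (fun a => ?_) (N.smul_mem _ hr)
  rw [mem_diffSubalgebra, map_mul, mul_smul]
  obtain ⟨e, he⟩ := hx.map R a
  rw [he, Finset.smul_sum]
  refine Submodule.sum_mem _ fun l _ => ?_
  rw [smul_comm]
  exact N.smul_mem _ (hall l)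

/-- On a smooth double cover `r² = c`, the form `dx₁ ∧ ⋯ ∧ dxₙ / r` generates the regular forms. -/
theorem IsQuadratic.generatesForms [q.IsPrime] (H : IsQuadratic c r) (hS : IsLocalSubring q S)
    (h2 : IsUnit (2 : R)) (hr : algebraMap R K r ≠ 0) {x : Fin n → A} {g : A} (hx : IsFrame k x g)
    (hg : algebraMap A R g ∉ q) (hδ : algebraMap A R c ∈ q →
      ∃ δ : Derivation k A A, algebraMap A R (δ c) ∉ q) :
    GeneratesForms k K n S ((algebraMap R K r)⁻¹ • wedgeD k fun i =>
      algebraMap R K (algebraMap A R (x i))) := by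
  have hq2 : (2 : R) ∉ q := fun h => (inferInstance : q.IsPrime).ne_top
    (Ideal.eq_top_of_isUnit_mem _ h h2)
  have hmul : ∀ {a b : R}, a ∉ q → b ∉ q → a * b ∉ q := fun ha hb h =>
    ((inferInstance : q.IsPrime).mem_or_mem h).elim ha hb
  by_cases hrq : r ∈ q
  · obtain ⟨δ, hδ⟩ := hδ (by rw [← H.sq]; exact Ideal.pow_mem_of_mem _ hrq 2 two_pos)
    obtain ⟨d, hd⟩ := hx c
    obtain ⟨i, hi⟩ : ∃ i, algebraMap A R (d i) ∉ q := by
      by_contra! hc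
      have e := congrArg δ.liftKaehlerDifferential hd
      simp only [map_smul, map_sum, Derivation.liftKaehlerDifferential_comp_D, smul_eq_mul] at e
      have e' := congrArg (algebraMap A R) e
      rw [map_mul, map_sum] at e'
      refine hmul hg hδ ?_
      rw [e']
      refine Submodule.sum_mem _ fun i _ => ?_
      rw [map_mul]
      exact q.mul_mem_right _ (hc i)
    have hF := H.isFrame_update hx hd i
    have h1 := hS.generatesForms hF (by rw [map_mul]; exact hmul hi hg)
    have e1 : (fun j => algebraMap R K (Function.update (fun i => algebraMap A R (x i)) i r j)) =
        Function.update (fun i => algebraMap R K (algebraMap A R (x i))) i (algebraMap R K r) := by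
      funext j
      by_cases hj : j = i
      · subst hj; rw [Function.update_self, Function.update_self]
      · rw [Function.update_of_ne hj, Function.update_of_ne hj]
    rw [e1] at h1
    have h3 : (algebraMap R K (algebraMap A R g * (2 * r))) •
        KaehlerDifferential.D k K (algebraMap R K r) =
        ∑ i, algebraMap R K (algebraMap A R (d i)) •
          KaehlerDifferential.D k K (algebraMap R K (algebraMap A R (x i))) := by
      have h4 := map_D_eq_sum (R := R) hd
      rw [← H.two_smul_D, smul_smul] at h4
      exact map_D_eq_sum h4
    have h5 := smul_wedgeD _ i _ _ _ h3
    have hdi := hS.ne_zero _ hi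
    have hg2 : algebraMap A R g * 2 ∉ q := hmul hg hq2
    have h6 := h1.smul (c := algebraMap R K (algebraMap A R g * 2) *
        (algebraMap R K (algebraMap A R (d i)))⁻¹)
      (mul_ne_zero (hS.ne_zero _ hg2) (inv_ne_zero hdi))
      (mul_mem (hS.algebraMap_mem _) (hS.inv_mem _ hi)) (by
        rw [mul_inv, inv_inv]
        exact mul_mem (hS.inv_mem _ hg2) (hS.algebraMap_mem _))
    convert h6 using 1
    have h7 : ∀ ω ω' : ⋀[K]^n (Ω[K⁄k]), algebraMap R K (algebraMap A R (d i)) • ω =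
        algebraMap R K (algebraMap A R g * (2 * r)) • ω' → (algebraMap R K r)⁻¹ • ω =
        (algebraMap R K (algebraMap A R g * 2) * (algebraMap R K (algebraMap A R (d i)))⁻¹) • ω' := by
      intro ω ω' h
      have : ω = (algebraMap R K (algebraMap A R (d i)))⁻¹ •
          algebraMap R K (algebraMap A R g * (2 * r)) • ω' := by
        rw [← h, smul_smul, inv_mul_cancel₀ hdi, one_smul]
      rw [this, smul_smul, smul_smul]
      congr 1
      rw [← mul_assoc, map_mul _ _ r]
      field_simp
    exact h7 _ _ h5
  · have hF := H.isFrame_mul (R := R) hx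
    exact (hS.generatesForms hF (hmul hg (hmul hq2 hrq))).smul (inv_ne_zero hr) (hS.inv_mem _ hrq)
      (by rw [inv_inv]; exact hS.algebraMap_mem _)

end Double

/-! ### Existence of coordinates -/

section Exists

variable {k A T : Type} [CommRing k] [CommRing A] [Algebra k A] {n : ℕ}

/-- A family of functions whose differentials are independent at a point can be completed to a
system of coordinates near this point. -/
theorem exists_isFrame (b : Module.Basis (Fin n) A (Ω[A⁄k])) (p : Ideal A) [p.IsPrime] (y : T → A)
    (hy : LinearIndependent p.ResidueField fun t j =>
      algebraMap A p.ResidueField (b.repr (KaehlerDifferential.D k A (y t)) j)) :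
    ∃ (x : Fin n → A) (e : T → Fin n) (g : A), Function.Injective e ∧ (∀ t, x (e t) = y t) ∧
      g ∉ p ∧ IsFrame k x g := by
  let φ := algebraMap A p.ResidueField
  let d : A → Fin n → p.ResidueField := fun a j => φ (b.repr (KaehlerDifferential.D k A a) j)
  have hspan : ⊤ ≤ Submodule.span p.ResidueField (Set.range d) := by
    have h1 : ∀ ω : Ω[A⁄k], (fun j => φ (b.repr ω j)) ∈
        Submodule.span p.ResidueField (Set.range d) := fun ω => by
      have hω : ω ∈ Submodule.span A (Set.range (KaehlerDifferential.D k A)) := by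
        rw [KaehlerDifferential.span_range_derivation]; trivial
      induction hω using Submodule.span_induction with
      | mem ω hω => obtain ⟨a, rfl⟩ := hω; exact Submodule.subset_span ⟨a, rfl⟩
      | zero =>
        convert Submodule.zero_mem _ using 1
        funext j
        simp
      | add ω ω' _ _ h h' =>
        convert Submodule.add_mem _ h h' using 1
        funext j
        simp
      | smul a ω _ h =>
        convert Submodule.smul_mem _ (φ a) h using 1
        funext j
        simp
    intro v _
    rw [pi_eq_sum_univ v]
    refine Submodule.sum_mem _ fun i _ => Submodule.smul_mem _ _ ?_
    convert h1 (b i) using 1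
    funext j
    rw [b.repr_self, Finsupp.single_apply]
    split_ifs <;> simp
  have hyd : ∀ t, d (y t) ∈ Set.range d := fun t => ⟨y t, rfl⟩
  obtain ⟨s, hs1, hs2, hs3, hs4⟩ := exists_linearIndepOn_id_extension
    (LinearIndependent.linearIndepOn_id hy) (t := Set.range d) (by
      rintro _ ⟨t, rfl⟩; exact hyd t)
  let β : Module.Basis s p.ResidueField (Fin n → p.ResidueField) :=
    Module.Basis.mk hs4.linearIndependent (by
      simp only [id_eq, Subtype.range_coe_subtype, Set.ofPred_mem_eq]
      exact hspan.trans (Submodule.span_le.mpr hs3))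
  have hβ : ∀ i, β i = (i : Fin n → p.ResidueField) := fun i => Module.Basis.mk_apply _ _ i
  let ε : Fin n ≃ s := (Pi.basisFun p.ResidueField (Fin n)).indexEquiv β
  have hex : ∀ i, ∃ a, d a = (ε i : Fin n → p.ResidueField) ∧
      ∀ t, d (y t) = (ε i : Fin n → p.ResidueField) → a = y t := fun i => by
    by_cases h : ∃ t, d (y t) = (ε i : Fin n → p.ResidueField)
    · obtain ⟨t, ht⟩ := h
      exact ⟨y t, ht, fun t' ht' => congrArg y (hy.injective (ht.trans ht'.symm))⟩
    · obtain ⟨a, ha⟩ := hs1 (ε i).2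
      exact ⟨a, ha, fun t ht => absurd ⟨t, ht⟩ h⟩
  choose x hx1 hx2 using hex
  let e : T → Fin n := fun t => ε.symm ⟨d (y t), hs2 ⟨t, rfl⟩⟩
  have he : ∀ t, (ε (e t) : Fin n → p.ResidueField) = d (y t) := fun t => by
    simp only [e, Equiv.apply_symm_apply]
  let M : Matrix (Fin n) (Fin n) A := Matrix.of fun i j => b.repr (KaehlerDifferential.D k A (x i)) j
  refine ⟨x, e, M.det, fun t t' h => ?_, fun t => hx2 _ t (he t).symm, fun hdet => ?_, fun a => ?_⟩
  · exact hy.injective ((he t).symm.trans ((congrArg (fun i => (ε i : Fin n → p.ResidueField)) h).trans (he t')))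
  · have h1 : LinearIndependent p.ResidueField (M.map φ).row := by
      have h2 : LinearIndependent p.ResidueField (β ∘ ε) :=
        β.linearIndependent.comp ε ε.injective
      convert h2 using 1
      funext i
      rw [Function.comp_apply, hβ, ← hx1]
      rfl
    rw [Matrix.linearIndependent_rows_iff_isUnit, Matrix.isUnit_iff_isUnit_det,
      ← RingHom.mapMatrix_apply, ← RingHom.map_det] at h1
    exact h1.ne_zero (Ideal.algebraMap_residueField_eq_zero.mpr hdet)
  · let v : Fin n → A := fun j => b.repr (KaehlerDifferential.D k A a) j
    refine ⟨Matrix.vecMul v M.adjugate, b.ext_elem fun j => ?_⟩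
    have h1 : Matrix.vecMul (Matrix.vecMul v M.adjugate) M = M.det • v := by
      rw [Matrix.vecMul_vecMul, Matrix.adjugate_mul, Matrix.vecMul_smul, Matrix.vecMul_one]
    have h2 := congrFun h1 j
    rw [map_smul, map_sum, Finsupp.coe_finsetSum, Finset.sum_apply]
    simp only [map_smul, Finsupp.smul_apply, smul_eq_mul]
    exact h2.symm

/-- Independence of two differentials, in terms of derivations. -/
theorem linearIndependent_of_derivations (b : Module.Basis (Fin n) A (Ω[A⁄k])) (p : Ideal A)
    [p.IsPrime] {x y : A} (h : ∃ D₁ D₂ : Derivation k A A, D₁ x * D₂ y - D₂ x * D₁ y ∉ p) :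
    LinearIndependent p.ResidueField fun (t : Fin 2) j =>
      algebraMap A p.ResidueField (b.repr (KaehlerDifferential.D k A (![x, y] t)) j) := by
  obtain ⟨D₁, D₂, h⟩ := h
  have hne : algebraMap A p.ResidueField (D₁ x * D₂ y - D₂ x * D₁ y) ≠ 0 := fun h0 =>
    h (Ideal.algebraMap_residueField_eq_zero.mp h0)
  have key : ∀ (D : Derivation k A A) (u v : p.ResidueField),
      (u • fun j => algebraMap A p.ResidueField (b.repr (KaehlerDifferential.D k A x) j)) +
        (v • fun j => algebraMap A p.ResidueField (b.repr (KaehlerDifferential.D k A y) j)) = 0 →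
      u * algebraMap A p.ResidueField (D x) + v * algebraMap A p.ResidueField (D y) = 0 := by
    intro D u v huv
    have hD : ∀ a, D a = ∑ j, b.repr (KaehlerDifferential.D k A a) j *
        D.liftKaehlerDifferential (b j) := fun a => by
      have := congrArg D.liftKaehlerDifferential (b.sum_repr (KaehlerDifferential.D k A a))
      rw [Derivation.liftKaehlerDifferential_comp_D, map_sum] at this
      rw [← this]
      exact Finset.sum_congr rfl fun j _ => by rw [map_smul, smul_eq_mul]
    rw [hD x, hD y, map_sum, map_sum, Finset.mul_sum, Finset.mul_sum, ← Finset.sum_add_distrib]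
    refine Finset.sum_eq_zero fun j _ => ?_
    have := congrFun huv j
    simp only [Pi.add_apply, Pi.smul_apply, smul_eq_mul, Pi.zero_apply] at this
    rw [map_mul, map_mul]
    linear_combination algebraMap A p.ResidueField (D.liftKaehlerDifferential (b j)) * this
  rw [Fintype.linearIndependent_iff]
  intro w hw
  rw [Fin.sum_univ_two] at hw
  have h1 := key D₁ (w 0) (w 1) hw
  have h2 := key D₂ (w 0) (w 1) hw
  rw [map_sub, map_mul, map_mul] at hne
  have h3 : w 0 = 0 := (mul_eq_zero.mp (by
    linear_combination algebraMap A p.ResidueField (D₂ y) * h1 -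
      algebraMap A p.ResidueField (D₁ y) * h2)).resolve_right hne
  have h4 : w 1 = 0 := (mul_eq_zero.mp (by
    linear_combination algebraMap A p.ResidueField (D₁ x) * h2 -
      algebraMap A p.ResidueField (D₂ x) * h1)).resolve_right hne
  intro i
  fin_cases i
  exacts [h3, h4]

end Exists

section DoubleBlowup

variable {A R₀ R K : Type} [CommRing A] [CommRing R₀] [CommRing R] [Field K] [Algebra ℂ A]
  [Algebra ℂ R₀] [Algebra A R₀] [IsScalarTower ℂ A R₀] [Algebra ℂ R] [Algebra R₀ R]
  [IsScalarTower ℂ R₀ R] [Algebra ℂ K] [Algebra R K] [IsScalarTower ℂ R K]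
  {q : Ideal R} {S : Subring K} {n : ℕ} {t c : R₀} {r : R} {u v : A}

/-- The form `dx₁ ∧ ⋯ ∧ dxₙ / (u r)` generates the regular forms of the chart `r² = c` of the double
cover of the blow-up with slope `t = v / u`. -/
theorem generatesForms_of_slope [q.IsPrime] (hgen : ∀ T : Subalgebra ℂ R₀,
      (∀ a, algebraMap A R₀ a ∈ T) → t ∈ T → ∀ z, z ∈ T)
    (ht : algebraMap A R₀ u * t = algebraMap A R₀ v) (H : IsQuadratic c r)
    (hS : IsLocalSubring q S) (hr : algebraMap R K r ≠ 0)
    (hu : algebraMap R K (algebraMap R₀ R (algebraMap A R₀ u)) ≠ 0) {x : Fin n → A} {g : A}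
    (hx : IsFrame ℂ x g) (hg : algebraMap R₀ R (algebraMap A R₀ g) ∉ q)
    (hδ : algebraMap R₀ R c ∈ q → ∃ δ : Derivation ℂ R₀ R₀, algebraMap R₀ R (δ c) ∉ q)
    (hc : (∃ i j, i ≠ j ∧ x i = u ∧ x j = v) ∨ algebraMap R₀ R (algebraMap A R₀ u) ∉ q) :
    GeneratesForms ℂ K n S ((algebraMap R K (algebraMap R₀ R (algebraMap A R₀ u) * r))⁻¹ •
      wedgeD ℂ fun i => algebraMap R K (algebraMap R₀ R (algebraMap A R₀ (x i)))) := by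
  have h2 := isUnit_two_of_complex (algebraMap ℂ R)
  rcases hc with ⟨i, j, hij, rfl, rfl⟩ | hc
  · have h1 := H.generatesForms hS h2 hr (hx.adjoin_update hgen hij ht) hg hδ
    have e1 : (fun l => algebraMap R K (algebraMap R₀ R
          (Function.update (fun l => algebraMap A R₀ (x l)) j t l))) =
        Function.update (fun l => algebraMap R K (algebraMap R₀ R (algebraMap A R₀ (x l)))) j
          (algebraMap R K (algebraMap R₀ R t)) := by
      funext l
      by_cases hl : l = j
      · subst hl; rw [Function.update_self, Function.update_self]
      · rw [Function.update_of_ne hl, Function.update_of_ne hl]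
    rw [e1] at h1
    convert h1 using 1
    rw [map_mul, mul_inv, mul_comm, mul_smul]
    congr 1
    rw [inv_smul_eq_iff₀ hu]
    have h3 := smul_wedgeD (k := ℂ) (fun l => algebraMap R K (algebraMap R₀ R (algebraMap A R₀ (x l))))
      j (algebraMap R K (algebraMap R₀ R (algebraMap A R₀ (x i))))
      (Function.update (Pi.single i (-algebraMap R K (algebraMap R₀ R t))) j 1)
      (algebraMap R K (algebraMap R₀ R t)) (by
        rw [← Finset.add_sum_erase _ _ (Finset.mem_univ j), Function.update_self, one_smul,
          Finset.sum_eq_single i]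
        · rw [Function.update_of_ne hij, Pi.single_eq_same, neg_smul, ← sub_eq_add_neg,
            eq_sub_iff_add_eq, ← Derivation.leibniz, ← map_mul, ← map_mul, ht]
        · intro l hl hli
          rw [Function.update_of_ne (Finset.ne_of_mem_erase hl), Pi.single_eq_of_ne hli, zero_smul]
        · intro h
          exact absurd (Finset.mem_erase.mpr ⟨hij, Finset.mem_univ i⟩) h)
    rw [Function.update_self, one_smul] at h3
    exact h3
  · have hg' : algebraMap R₀ R (algebraMap A R₀ (g * u)) ∉ q := by
      rw [map_mul, map_mul]
      exact fun h => ((inferInstance : q.IsPrime).mem_or_mem h).elim hg hc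
    have h1 := H.generatesForms hS h2 hr (hx.adjoin_mul hgen ht) hg' hδ
    have h3 := h1.smul (inv_ne_zero hu) (hS.inv_mem _ hc)
      (by rw [inv_inv]; exact hS.algebraMap_mem _)
    rwa [smul_smul, ← mul_inv, ← map_mul] at h3

end DoubleBlowup

/-! ### Crepancy -/

section FunctionField

variable {T Y : Scheme.{0}} [IsIntegral T]

/-- A function downstairs as a rational function upstairs. -/
def toFunctionField (g : T ⟶ Y) (W : Y.Opens) [Nonempty (g ⁻¹ᵁ W)] :
    Γ(Y, W) →+* T.functionField :=
  (T.germToFunctionField (g ⁻¹ᵁ W)).hom.comp (g.app W).hom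

theorem algebraMap_stalkMap_germAt (g : T ⟶ Y) (W : Y.Opens) [Nonempty (g ⁻¹ᵁ W)] (t : T)
    (ht : g t ∈ W) (s : Γ(Y, W)) : algebraMap (T.presheaf.stalk t) T.functionField
      ((g.stalkMap t).hom (germAt W (g t) ht s)) = toFunctionField g W s :=
  (congrArg _ (stalkMap_germAt g W t ht s)).trans
    (Scheme.algebraMap_germ_eq_germToFunctionField T (U := g ⁻¹ᵁ W) (x := t) ht _)

theorem toFunctionField_sectionScalars (g : T ⟶ Y) (f : Y ⟶ SpecC) (W : Y.Opens)
    [Nonempty (g ⁻¹ᵁ W)] (c : ℂ) :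
    toFunctionField g W (sectionScalars f W c) = scalars (g ≫ f) (genericPoint T) c := by
  have h1 := RingHom.congr_fun (map_sectionScalars f g W (g ⁻¹ᵁ W) le_rfl) c
  rw [← germAt_sectionScalars (g ≫ f) (g ⁻¹ᵁ W) (genericPoint T)
    (((genericPoint_spec T).mem_open_set_iff (g ⁻¹ᵁ W).isOpen).mpr
      (let ⟨t⟩ := ‹Nonempty (g ⁻¹ᵁ W)›; ⟨t.1, trivial, t.2⟩)),
    RingHom.comp_apply, ← h1, RingHom.comp_apply, ← Scheme.Hom.app_eq_appLE]
  rfl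

/-- The local rings of an affine chart inside the function field. -/
theorem exists_chart_functionField {R : Type} [CommRing R] [IsDomain R]
    (j : Spec (CommRingCat.of R) ⟶ T) [IsOpenImmersion j] (q : PrimeSpectrum R) :
    ∃ ψ : R →+* T.functionField, Function.Injective ψ ∧
      (letI := ψ.toAlgebra
       IsLocalSubring q.asIdeal (algebraMap (T.presheaf.stalk (j q)) T.functionField).range) ∧
      ∀ (Y : Scheme.{0}) (g : T ⟶ Y) (W : Y.Opens) (hW : IsAffineOpen W)
        [Nonempty (g ⁻¹ᵁ W)] (φ : Γ(Y, W) →+* R),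
        j ≫ g = Spec.map (CommRingCat.ofHom φ) ≫ hW.fromSpec →
          ∀ s, ψ (φ s) = toFunctionField g W s := by
  let e : T.presheaf.stalk (j q) ≃+* (Spec (CommRingCat.of R)).presheaf.stalk q :=
    RingEquiv.ofBijective (j.stalkMap q).hom (stalkMap_bijective j q)
  let α := algebraMap (T.presheaf.stalk (j q)) T.functionField
  have hα : Function.Injective α := IsFractionRing.injective _ _
  let := (germSpec q).toAlgebra
  have := isLocalization_stalk_spec q
  have hγ : Function.Injective (germSpec q) :=
    IsLocalization.injective _ q.asIdeal.primeCompl_le_nonZeroDivisors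
  let ψ : R →+* T.functionField := α.comp (e.symm.toRingHom.comp (germSpec q))
  have hψ : Function.Injective ψ := hα.comp (e.symm.injective.comp hγ)
  let := ψ.toAlgebra
  refine ⟨ψ, hψ, ⟨fun z => ⟨_, rfl⟩, fun z hz h0 => hz ?_, fun z hz => ?_, ?_⟩, ?_⟩
  · rw [hψ (h0.trans (map_zero ψ).symm)]
    exact zero_mem _
  · obtain ⟨u, hu⟩ := (isUnit_germSpec.mpr hz).map e.symm
    refine ⟨(u⁻¹ : (T.presheaf.stalk (j q))ˣ), eq_inv_of_mul_eq_one_left ?_⟩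
    change α _ * α (e.symm (germSpec q z)) = 1
    rw [← map_mul, ← hu, Units.inv_mul, map_one]
  · rintro _ ⟨t, rfl⟩
    obtain ⟨⟨v, w⟩, h⟩ := IsLocalization.surj q.asIdeal.primeCompl (e t)
    refine ⟨v, w, w.2, ?_⟩
    change α (e.symm (germSpec q w)) * α t = α (e.symm (germSpec q v))
    change e t * germSpec q w = germSpec q v at h
    rw [← h, map_mul, RingEquiv.symm_apply_apply, ← map_mul, mul_comm]
  · intro Y g W hW _ φ hg s
    have key : ∀ (m : Spec (CommRingCat.of R) ⟶ Y) (hm : m = Spec.map (CommRingCat.ofHom φ) ≫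
        hW.fromSpec), ∃ h : m q ∈ W, (m.stalkMap q).hom (germAt W (m q) h s) =
          germSpec q (φ s) := by
      rintro _ rfl
      exact ⟨specMap_fromSpec_mem hW φ q, stalkMap_specMap_fromSpec hW φ q s⟩
    obtain ⟨h, hs⟩ := key _ hg
    replace hs := (ConcreteCategory.congr_hom (Scheme.Hom.stalkMap_comp j g q)
      (germAt W _ h s)).symm.trans hs
    rw [← algebraMap_stalkMap_germAt g W (j q) h s]
    change α (e.symm (germSpec q (φ s))) = _
    rw [← hs]
    exact congrArg α (e.symm_apply_apply _)

end FunctionField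

/-- A smooth variety is covered by affine open sets with free differentials. -/
theorem exists_basis_of_smooth {Y : Scheme.{0}} (f : Y ⟶ SpecC) (n : ℕ)
    [SmoothOfRelativeDimension n f] {V : Y.Opens} (hV : IsAffineOpen V) (y : Y) (hy : y ∈ V) :
    ∃ V' : Y.Opens, y ∈ V' ∧ V' ≤ V ∧ IsAffineOpen V' ∧
      letI := (sectionScalars f V').toAlgebra
      Nonempty (Module.Basis (Fin n) Γ(Y, V') (Ω[Γ(Y, V')⁄ℂ])) := by
  obtain ⟨s, hs, h⟩ := locally_standardSmooth_sections f n hV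
  obtain ⟨r, hr, hry⟩ : ∃ r ∈ s, r ∉ ptIdeal V y hy := by
    by_contra! hc
    exact (inferInstance : (ptIdeal V y hy).IsPrime).ne_top
      (top_le_iff.mp (hs ▸ Ideal.span_le.mpr hc))
  have hyr : y ∈ Y.basicOpen r := (Y.mem_basicOpen r y hy).mpr (notMem_ptIdeal.mp hry)
  have hle := Y.basicOpen_le r
  refine ⟨Y.basicOpen r, hyr, hle, hV.basicOpen r, ?_⟩
  let := (sectionScalars f (Y.basicOpen r)).toAlgebra
  let := (res hle).toAlgebra
  have : IsLocalization.Away r Γ(Y, Y.basicOpen r) := hV.isLocalization_basicOpen r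
  let e : Localization.Away r ≃ₐ[Γ(Y, V)] Γ(Y, Y.basicOpen r) :=
    IsLocalization.algEquiv (Submonoid.powers r) _ _
  have h2 := RingHom.isStandardSmoothOfRelativeDimension_respectsIso.1 _ e.toRingEquiv (h r hr)
  have h3 : (e.toRingEquiv.toRingHom).comp ((algebraMap Γ(Y, V) (Localization.Away r)).comp
      (sectionScalars f V)) = algebraMap ℂ Γ(Y, Y.basicOpen r) := by
    ext c
    refine (e.commutes _).trans ?_
    exact res_res _ _ _
  rw [h3, RingHom.isStandardSmoothOfRelativeDimension_algebraMap] at h2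
  have : Algebra.IsStandardSmooth ℂ Γ(Y, Y.basicOpen r) := h2.isStandardSmooth
  have : Nontrivial Γ(Y, Y.basicOpen r) := (germAt _ y hyr).domain_nontrivial
  exact ⟨Module.finBasisOfFinrankEq _ _ (Module.finrank_eq_of_rank_eq
    (Algebra.IsStandardSmoothOfRelativeDimension.rank_kaehlerDifferential n))⟩

section Chart

theorem isUnit_stalkMap_iff {T Y : Scheme.{0}} (g : T ⟶ Y) (t : T) (s : Y.presheaf.stalk (g t)) :
    IsUnit ((g.stalkMap t).hom s) ↔ IsUnit s :=
  isUnit_map_iff _ _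

theorem algebraMap_mem_iff_of_specMap {Y : Scheme.{0}} {W : Y.Opens} (hW : IsAffineOpen W)
    {R : Type} [CommRing R] (φ : Γ(Y, W) →+* R) (m : Spec (CommRingCat.of R) ⟶ Y)
    (hm : m = Spec.map (CommRingCat.ofHom φ) ≫ hW.fromSpec) (q : PrimeSpectrum R) (b : Y)
    (hb : b ∈ W) (h : m q = b) (a : Γ(Y, W)) : φ a ∈ q.asIdeal ↔ a ∈ ptIdeal W b hb := by
  subst hm
  subst h
  have h1 := stalkMap_specMap_fromSpec hW φ q a
  have h2 := isUnit_germSpec (q := q) (r := φ a)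
  rw [← h1] at h2
  rw [← not_iff_not, notMem_ptIdeal, ← h2]
  exact isUnit_stalkMap_iff _ _ _

theorem algebraMap_mem_of_slope {A R₀ R : Type} [CommRing A] [CommRing R₀] [CommRing R] [Algebra A R₀]
    [Algebra R₀ R] [Algebra A R] [IsScalarTower A R₀ R] {u v : A} {t : R₀}
    (ht : algebraMap A R₀ u * t = algebraMap A R₀ v) {q : Ideal R} (h : algebraMap A R u ∈ q) :
    algebraMap A R v ∈ q := by
  rw [IsScalarTower.algebraMap_apply A R₀ R] at h ⊢
  rw [← ht, map_mul]
  exact Ideal.mul_mem_right _ _ h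

/-- The rational form `dx₁ ∧ ⋯ ∧ dxₙ / ξ`. -/
def residueForm {T X B : Scheme.{0}} [IsIntegral T] [Algebra ℂ T.functionField] (π : T ⟶ X)
    (ρ : X ⟶ B) (V : B.Opens) [Nonempty (π ⁻¹ᵁ ρ ⁻¹ᵁ V)] (ξ : Γ(X, ρ ⁻¹ᵁ V)) {n : ℕ}
    (x : Fin n → Γ(B, V)) : ⋀[T.functionField]^n (Ω[T.functionField⁄ℂ]) :=
  (toFunctionField π (ρ ⁻¹ᵁ V) ξ)⁻¹ • wedgeD ℂ fun i =>
    toFunctionField π (ρ ⁻¹ᵁ V) (algebraMap Γ(B, V) _ (x i))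

theorem generatesForms_of_chart {T X B : Scheme.{0}} [IsIntegral T] {π : T ⟶ X} {ρ : X ⟶ B}
    (f : B ⟶ SpecC) [Algebra ℂ T.functionField]
    (hT : algebraMap ℂ T.functionField = scalars (π ≫ ρ ≫ f) (genericPoint T))
    {V : B.Opens} (hV' : IsAffineOpen (ρ ⁻¹ᵁ V)) [Nonempty (π ⁻¹ᵁ ρ ⁻¹ᵁ V)]
    [Algebra ℂ Γ(B, V)] (hV : algebraMap ℂ Γ(B, V) = sectionScalars f V) {R₀ R : Type}
    [CommRing R₀] [CommRing R] [IsDomain R] [Algebra Γ(B, V) R₀] [Algebra R₀ R] [Algebra Γ(B, V) R]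
    [IsScalarTower Γ(B, V) R₀ R] [Algebra ℂ R₀] [IsScalarTower ℂ Γ(B, V) R₀] [Algebra ℂ R]
    [IsScalarTower ℂ R₀ R] (φ : Γ(X, ρ ⁻¹ᵁ V) →ₐ[Γ(B, V)] R) {j : Spec (CommRingCat.of R) ⟶ T}
    [IsOpenImmersion j]
    (hj : j ≫ π = Spec.map (CommRingCat.ofHom φ.toRingHom) ≫ hV'.fromSpec) {u v : Γ(B, V)} {t c : R₀}
    {r : R} {ξ : Γ(X, ρ ⁻¹ᵁ V)} (hξ : φ ξ = algebraMap _ R u * r)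
    (hgen : ∀ T : Subalgebra ℂ R₀, (∀ a, algebraMap Γ(B, V) R₀ a ∈ T) → t ∈ T → ∀ z, z ∈ T)
    (ht : algebraMap Γ(B, V) R₀ u * t = algebraMap Γ(B, V) R₀ v) (H : IsQuadratic c r)
    (hu : algebraMap Γ(B, V) R u ≠ 0)
    (hδ : ∀ q : Ideal R₀, q.IsPrime → c ∈ q → ∃ δ : Derivation ℂ R₀ R₀, δ c ∉ q)
    {n : ℕ} {x : Fin n → Γ(B, V)} {g : Γ(B, V)} (hx : IsFrame ℂ x g) (q : PrimeSpectrum R)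
    (hg : algebraMap Γ(B, V) R g ∉ q.asIdeal)
    (hc : (∃ i j, i ≠ j ∧ x i = u ∧ x j = v) ∨ algebraMap Γ(B, V) R u ∉ q.asIdeal) :
    GeneratesForms ℂ T.functionField n
      (algebraMap (T.presheaf.stalk (j q)) T.functionField).range (residueForm π ρ V ξ x) := by
  obtain ⟨ψ, hψ, hS, hcomp⟩ := exists_chart_functionField j q
  let := ψ.toAlgebra
  replace hcomp := hcomp X π (ρ ⁻¹ᵁ V) hV' φ.toRingHom hj
  have hA : ∀ a, toFunctionField π (ρ ⁻¹ᵁ V) (algebraMap Γ(B, V) _ a) =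
      ψ (algebraMap R₀ R (algebraMap Γ(B, V) R₀ a)) := fun a => by
    rw [← hcomp, ← IsScalarTower.algebraMap_apply]
    exact congrArg ψ (φ.commutes a)
  have hξ' : toFunctionField π (ρ ⁻¹ᵁ V) ξ =
      ψ (algebraMap R₀ R (algebraMap Γ(B, V) R₀ u) * r) := by
    rw [← hcomp, ← IsScalarTower.algebraMap_apply, ← hξ]
    rfl
  have htower : IsScalarTower ℂ R T.functionField := by
    refine IsScalarTower.of_algebraMap_eq fun c => ?_
    rw [IsScalarTower.algebraMap_apply ℂ R₀ R, IsScalarTower.algebraMap_apply ℂ Γ(B, V) R₀, hT]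
    refine Eq.trans ?_ (hA _)
    refine (toFunctionField_sectionScalars π (ρ ≫ f) (ρ ⁻¹ᵁ V) c).symm.trans ?_
    refine congrArg _ ?_
    have := RingHom.congr_fun (map_sectionScalars f ρ V (ρ ⁻¹ᵁ V) le_rfl) c
    rw [← this, RingHom.comp_apply, ← Scheme.Hom.app_eq_appLE, hV]
    rfl
  rw [IsScalarTower.algebraMap_apply Γ(B, V) R₀ R] at hu hg hc
  rw [residueForm, hξ']
  simp only [hA]
  refine generatesForms_of_slope hgen ht H hS ?_ ?_ hx hg ?_ hc
  · have := (algebraMap R₀ R).domain_nontrivial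
    refine (map_ne_zero_iff _ hψ).mpr fun h0 => one_ne_zero (α := R₀)
      (H.eq_of_eq (p := 0) (q := 1) (p' := 0) (q' := 0) (by rw [h0, mul_zero, mul_zero])).2
  · exact (map_ne_zero_iff _ hψ).mpr hu
  · exact fun h => hδ (q.asIdeal.comap (algebraMap R₀ R)) inferInstance h

end Chart

namespace TateData

variable {B : Scheme.{0}} {N : ℕ} {D : TateData B N} {X : Scheme.{0}} {ρ : X ⟶ B}

theorem Patch.algebraMap_mem_iff (p : D.Patch) (C : DoubleCover D.P ρ D.limitBranch)
    (hK : KoszulExact p.σ p.a₁) (k : Fin 2) (q : PrimeSpectrum (CoverChart p.σ p.a₁ p.a₂₂ k))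
    (b : B) (hb : b ∈ p.V) (h : (p.coverChartMap C hK k ≫ ρ) q = b) (a : Γ(B, p.V)) :
    algebraMap Γ(B, p.V) (CoverChart p.σ p.a₁ p.a₂₂ k) a ∈ q.asIdeal ↔ a ∈ ptIdeal p.V b hb := by
  refine algebraMap_mem_iff_of_specMap p.affine (algebraMap Γ(B, p.V) _) _ ?_ q b hb h a
  rw [p.coverChartMap_comp, baseChartMap, ← Category.assoc, ← Spec.map_comp,
    IsScalarTower.algebraMap_eq _ (BaseChart p.σ p.a₁ k)]
  rfl

variable [IsIntegral B] [IsIntegral X] (f : B ⟶ SpecC) (n : ℕ)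

theorem Patch.generatesForms [Smooth f] (p : D.Patch) (C : DoubleCover D.P ρ D.limitBranch)
    (hD : D.Generic f) (hK : ∀ p : D.Patch, KoszulExact p.σ p.a₁) {X' : Scheme.{0}} [IsIntegral X']
    {π : X' ⟶ X} (hπ : IsBlowup (D.coverCenter C) π) [Nonempty (π ⁻¹ᵁ ρ ⁻¹ᵁ p.V)] (y : X')
    (hy : ρ (π y) ∈ p.V) {x : Fin n → Γ(B, p.V)} {g : Γ(B, p.V)}
    (hx : letI := (sectionScalars f p.V).toAlgebra
      IsFrame ℂ x g) (hg : g ∉ ptIdeal p.V (ρ (π y)) hy)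
    (hc : (∃ i j, i ≠ j ∧ x i = p.σ ∧ x j = p.a₁) ∨
      ¬ (p.σ ∈ ptIdeal p.V (ρ (π y)) hy ∧ p.a₁ ∈ ptIdeal p.V (ρ (π y)) hy)) :
    letI := (scalars (π ≫ ρ ≫ f) (genericPoint X')).toAlgebra
    GeneratesForms ℂ X'.functionField n
      (algebraMap (X'.presheaf.stalk y) X'.functionField).range (residueForm π ρ p.V (p.ξ C) x) := by
  let := (scalars (π ≫ ρ ≫ f) (genericPoint X')).toAlgebra
  let := (sectionScalars f p.V).toAlgebra
  have := smooth_sections f p.affine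
  have G := p.sppGeneric f hD
  obtain ⟨k, j, hj, h1, q, rfl⟩ := exists_coverChart C hπ hK p y hy
  have : Nontrivial (CoverChart p.σ p.a₁ p.a₂₂ k) :=
    (PrimeSpectrum.nonempty_iff_nontrivial (R := CoverChart p.σ p.a₁ p.a₂₂ k)).mp ⟨q⟩
  have : Nontrivial Γ(B, p.V) := (algebraMap _ (CoverChart p.σ p.a₁ p.a₂₂ k)).domain_nontrivial
  have := p.isDomain_base
  have := p.isDomain_cover C
  have hring := (exists_coverChartHom k (p.isQuadratic C) (hK p)).choose_spec.2
  have hR : IsDomain (CoverChart p.σ p.a₁ p.a₂₂ k) := isDomain_coverChart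
    (p.coverChartHom C (hK p) k) (p.coverChartHom_xi C (hK p) k) hring
  have hq := p.algebraMap_mem_iff C (hK p) k q (ρ (π (j q))) hy (by
    rw [← h1]; rfl)
  refine generatesForms_of_chart f rfl (p.isAffineOpen_preimage C) rfl (p.coverChartHom C (hK p) k)
    h1 (p.coverChartHom_xi C (hK p) k) (fun T h ht z => SlopeChart.eq_top_of_mem T h ht z)
    (SlopeChart.algebraMap_mul_t _ _) (SqrtAlg.isQuadratic _) ?_
    (G.exists_derivation_chartBranch k) hx q ((hq g).not.mpr hg) ?_
  · rw [IsScalarTower.algebraMap_apply Γ(B, p.V) (BaseChart p.σ p.a₁ k)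
      (CoverChart p.σ p.a₁ p.a₂₂ k)]
    exact nonZeroDivisors.ne_zero
      (mem_nonZeroDivisors_of_flat (isRingChart_baseChart k (hK p)).nzd)
  · rcases hc with ⟨i, j, hij, hi, hj⟩ | hc
    · refine Or.inl ?_
      revert k
      intro k
      fin_cases k
      · intros; exact ⟨i, j, hij, hi, hj⟩
      · intros; exact ⟨j, i, hij.symm, hj, hi⟩
    · refine Or.inr fun h => hc ?_
      have hv := algebraMap_mem_of_slope (SlopeChart.algebraMap_mul_t (![p.σ, p.a₁] k)
        (![p.σ, p.a₁] k.rev)) h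
      have h1 := (hq _).mp h
      have h2 := (hq _).mp hv
      clear * - h1 h2
      revert h1 h2
      fin_cases k
      · exact fun h1 h2 => ⟨h1, h2⟩
      · exact fun h1 h2 => ⟨h2, h1⟩

theorem isCrepant_coverBlowup [SmoothOfRelativeDimension n f]
    (C : DoubleCover D.P ρ D.limitBranch) (hD : D.Generic f)
    (hK : ∀ p : D.Patch, KoszulExact p.σ p.a₁) {X' : Scheme.{0}} [IsIntegral X']
    {π : X' ⟶ X} (hπ : IsBlowup (D.coverCenter C) π) : IsCrepant (ρ ≫ f) π n := by
  have : Smooth f := SmoothOfRelativeDimension.smooth n f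
  let := (scalars (π ≫ ρ ≫ f) (genericPoint X')).toAlgebra
  have hloc : ∀ x : X, ∃ (p : D.Patch) (hb : ρ x ∈ p.V) (c : Fin n → Γ(B, p.V)) (g : Γ(B, p.V)),
      (letI := (sectionScalars f p.V).toAlgebra
       IsFrame ℂ c g) ∧ g ∉ ptIdeal p.V (ρ x) hb ∧
      ((∃ i j, i ≠ j ∧ c i = p.σ ∧ c j = p.a₁) ∨
        ∀ b' (h : b' ∈ p.V), ¬ (p.σ ∈ ptIdeal p.V b' h ∧ p.a₁ ∈ ptIdeal p.V b' h)) := by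
    intro x
    have hshrink : ∀ W : B.Opens, ρ x ∈ W → ∃ p : D.Patch, ρ x ∈ p.V ∧ p.V ≤ W ∧
        letI := (sectionScalars f p.V).toAlgebra
        Nonempty (Module.Basis (Fin n) Γ(B, p.V) (Ω[Γ(B, p.V)⁄ℂ])) := fun W hW => by
      obtain ⟨p, hp, hpW⟩ := Patch.exists_mem (D := D) W (ρ x) hW
      obtain ⟨V', h1, h2, h3, h4⟩ := exists_basis_of_smooth f n p.affine (ρ x) hp
      exact ⟨⟨p.i, V', h2.trans p.le, h3⟩, h1, h2.trans hpW, h4⟩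
    have hz : ∀ (p : D.Patch) (b : B) (hb : b ∈ p.V), b ∈ zeroSet D.baseCenter ↔
        p.σ ∈ ptIdeal p.V b hb ∧ p.a₁ ∈ ptIdeal p.V b hb := fun p b hb => by
      rw [p.generatedOn_base.zeroSet_iff hb]
      exact Fin.forall_fin_two
    by_cases hx : ρ x ∈ zeroSet D.baseCenter
    · obtain ⟨p, hp, -, ⟨b⟩⟩ := hshrink ⊤ trivial
      let := (sectionScalars f p.V).toAlgebra
      obtain ⟨h1, h2⟩ := (hz p _ hp).mp hx
      obtain ⟨c, e, g, he, hc, hg, hF⟩ := exists_isFrame b (ptIdeal p.V (ρ x) hp) _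
        (linearIndependent_of_derivations b _ ((p.sppGeneric f hD).transverse _ inferInstance h1 h2))
      exact ⟨p, hp, c, g, hF, hg, Or.inl ⟨e 0, e 1, he.ne (by decide), hc 0, hc 1⟩⟩
    · obtain ⟨p, hp, hpW, ⟨b⟩⟩ := hshrink (centerCompl D.locallyFG_baseCenter)
        (mem_centerCompl.mpr (not_not.mp hx))
      let := (sectionScalars f p.V).toAlgebra
      obtain ⟨c, e, g, -, -, hg, hF⟩ := exists_isFrame b (ptIdeal p.V (ρ x) hp)
        (fun t : Empty => t.elim) linearIndependent_empty_type
      refine ⟨p, hp, c, g, hF, hg, Or.inr fun b' h h' => ?_⟩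
      exact (hz p b' h).mpr h' (mem_centerCompl.mp (hpW h))
  intro x
  obtain ⟨p, hb, c, g, hF, hg, hc⟩ := hloc x
  refine ⟨ρ ⁻¹ᵁ B.basicOpen g, (B.mem_basicOpen g _ hb).mpr (notMem_ptIdeal.mp hg), ?_⟩
  by_cases hne : Nonempty (π ⁻¹ᵁ ρ ⁻¹ᵁ p.V)
  · refine ⟨residueForm π ρ p.V (p.ξ C) c, fun y hy => ?_⟩
    have hyV : ρ (π y) ∈ p.V := B.basicOpen_le g hy
    have hyg : g ∉ ptIdeal p.V (ρ (π y)) hyV :=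
      notMem_ptIdeal.mpr ((B.mem_basicOpen g _ hyV).mp hy)
    have key := p.generatesForms f n C hD hK hπ y hyV hF hyg (hc.imp_right fun h => h _ hyV)
    refine ⟨fun hs => ?_, key⟩
    have := isIso_smoothPart f C hD hπ
    have hr : ((algebraMap (X'.presheaf.stalk y) X'.functionField).comp (π.stalkMap y).hom).range =
        (algebraMap (X'.presheaf.stalk y) X'.functionField).range := by
      refine SetLike.coe_injective ?_
      rw [RingHom.coe_range, RingHom.coe_range, RingHom.coe_comp,
        (bijective_stalkMap_of_isIso (smoothPart (ρ ≫ f)) y hs).2.range_comp]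
    rw [hr]
    exact key
  · exact ⟨0, fun y hy => (hne ⟨⟨y, B.basicOpen_le g hy⟩⟩).elim⟩

theorem isCrepantResolution_coverBlowup [SmoothOfRelativeDimension n f]
    (C : DoubleCover D.P ρ D.limitBranch) (hD : D.Generic f)
    (hK : ∀ p : D.Patch, KoszulExact p.σ p.a₁) {X' : Scheme.{0}}
    {π : X' ⟶ X} (hπ : IsBlowup (D.coverCenter C) π) : IsCrepantResolution (ρ ≫ f) π n :=
  have : Smooth f := SmoothOfRelativeDimension.smooth n f
  have h := isIntegral_coverBlowup f n C hD hK hπ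
  have := h.1
  ⟨h.1, h.2, isProper_coverBlowup f n C hD hK hπ, isIso_smoothPart f C hD hπ,
    isCrepant_coverBlowup f n C hD hK hπ⟩

end TateData

/-! ### Localising quadratic extensions -/

namespace IsQuadratic

section Ring

variable {A M : Type} [CommRing A] [CommRing M] [Algebra A M] {c : A} {r : M}

theorem of_unit (H : IsQuadratic c r) {e : A} (he : IsUnit e) {h : A} {ξ : M}
    (hξ : ξ = algebraMap A M e * r) (hsq : ξ ^ 2 = algebraMap A M h) : IsQuadratic h ξ where
  sq := hsq
  exists_unique z := by
    obtain ⟨e', he'⟩ := he.exists_right_inv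
    have hA : algebraMap A M e * algebraMap A M e' = 1 := by rw [← map_mul, he', map_one]
    obtain ⟨p, q, rfl⟩ := H.exists_eq z
    refine ⟨(p, q * e'), ?_, fun pq h' => ?_⟩
    · simp only [hξ, map_mul]
      linear_combination (-algebraMap A M q * r) * hA
    · obtain ⟨h1, h2⟩ := H.eq_of_eq (p' := pq.1) (q' := pq.2 * e) (h'.trans (by
        rw [hξ, map_mul]; ring))
      refine Prod.ext h1.symm ?_
      rw [h2, mul_assoc, he', mul_one]

theorem of_bijective (H : IsQuadratic c r) {A' M' : Type} [CommRing A'] [CommRing M']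
    [Algebra A' M'] (e : A' →+* A) (e' : M' →+* M) (he : Function.Bijective e)
    (he' : Function.Bijective e') (hc : ∀ a, e' (algebraMap A' M' a) = algebraMap A M (e a))
    {c' : A'} {r' : M'} (h1 : e c' = c) (h2 : e' r' = r) : IsQuadratic c' r' where
  sq := he'.1 (by rw [map_pow, h2, hc, h1, H.sq])
  exists_unique z := by
    obtain ⟨p, q, h⟩ := H.exists_eq (e' z)
    obtain ⟨p, rfl⟩ := he.2 p
    obtain ⟨q, rfl⟩ := he.2 q
    refine ⟨(p, q), he'.1 (by rw [h, map_add, map_mul, hc, hc, h2]), fun pq h' => ?_⟩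
    rw [h', map_add, map_mul, hc, hc, h2] at h
    obtain ⟨h3, h4⟩ := H.eq_of_eq h
    exact Prod.ext (he.1 h3) (he.1 h4)

end Ring

section Localization

variable {A M : Type} [CommRing A] [CommRing M] [Algebra A M] {c : A} {r : M}

theorem of_isLocalization (H : IsQuadratic c r) (f : A) (A' M' : Type) [CommRing A'] [CommRing M']
    [Algebra A A'] [Algebra M M'] [Algebra A' M'] [Algebra A M'] [IsScalarTower A M M']
    [IsScalarTower A A' M'] [IsLocalization.Away f A'] [IsLocalization.Away (algebraMap A M f) M'] :
    IsQuadratic (algebraMap A A' c) (algebraMap M M' r) where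
  sq := by
    rw [← map_pow, H.sq, ← IsScalarTower.algebraMap_apply, ← IsScalarTower.algebraMap_apply]
  exists_unique z := by
    have hf : IsUnit (algebraMap A A' f) := IsLocalization.Away.algebraMap_isUnit f
    have hcomm : ∀ a, algebraMap A' M' (algebraMap A A' a) = algebraMap M M' (algebraMap A M a) :=
      fun a => by rw [← IsScalarTower.algebraMap_apply, ← IsScalarTower.algebraMap_apply]
    have hinj : ∀ p q : A', algebraMap A' M' p + algebraMap A' M' q * algebraMap M M' r = 0 →
        p = 0 ∧ q = 0 := by
      intro p q h
      obtain ⟨n, p', hp⟩ := IsLocalization.Away.surj f p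
      obtain ⟨m, q', hq⟩ := IsLocalization.Away.surj f q
      have h1 : algebraMap M M' (algebraMap A M (p' * f ^ m) + algebraMap A M (q' * f ^ n) * r) =
          algebraMap M M' 0 := by
        have e1 := congrArg (algebraMap A' M') hp
        have e2 := congrArg (algebraMap A' M') hq
        simp only [map_mul, map_pow, hcomm] at e1 e2
        simp only [map_add, map_mul, map_pow, map_zero]
        linear_combination (algebraMap M M' (algebraMap A M f)) ^ (n + m) * h -
          (algebraMap M M' (algebraMap A M f)) ^ m * e1 -
          (algebraMap M M' (algebraMap A M f)) ^ n * algebraMap M M' r * e2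
      obtain ⟨⟨_, l, rfl⟩, hl⟩ := (IsLocalization.eq_iff_exists
        (Submonoid.powers (algebraMap A M f)) M').mp h1
      have hl' : algebraMap A M (f ^ l * (p' * f ^ m)) + algebraMap A M (f ^ l * (q' * f ^ n)) * r =
          algebraMap A M 0 + algebraMap A M 0 * r := by
        simp only [map_mul, map_pow, mul_zero, map_zero, zero_mul, add_zero] at hl ⊢
        linear_combination hl
      obtain ⟨h2, h3⟩ := H.eq_of_eq hl'
      replace h2 := congrArg (algebraMap A A') h2
      replace h3 := congrArg (algebraMap A A') h3
      simp only [map_mul, map_pow, map_zero, ← hp, ← hq, ← mul_assoc] at h2 h3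
      constructor
      · rwa [(hf.pow _).mul_left_eq_zero, (hf.pow _).mul_left_eq_zero, (hf.pow _).mul_right_eq_zero]
          at h2
      · rwa [(hf.pow _).mul_left_eq_zero, (hf.pow _).mul_left_eq_zero, (hf.pow _).mul_right_eq_zero]
          at h3
    obtain ⟨n, z', hz⟩ := IsLocalization.Away.surj (algebraMap A M f) z
    obtain ⟨p, q, rfl⟩ := H.exists_eq z'
    obtain ⟨g, hg⟩ := (hf.pow n).exists_right_inv
    have hg' := congrArg (algebraMap A' M') hg
    simp only [map_mul, map_pow, map_one, hcomm] at hg'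
    have key : z = algebraMap A' M' (algebraMap A A' p * g) +
        algebraMap A' M' (algebraMap A A' q * g) * algebraMap M M' r := by
      simp only [map_mul, map_add, hcomm] at hz ⊢
      linear_combination algebraMap A' M' g * hz - z * hg'
    refine ⟨(_, _), key, fun pq h => ?_⟩
    obtain ⟨h1, h2⟩ := hinj (pq.1 - algebraMap A A' p * g) (pq.2 - algebraMap A A' q * g) (by
      rw [map_sub, map_sub]; linear_combination key - h)
    exact Prod.ext (sub_eq_zero.mp h1) (sub_eq_zero.mp h2)

/-- An extension is quadratic if it is so locally. -/
theorem of_localized (hsq : r ^ 2 = algebraMap A M c) (s : Set A) (hs : Ideal.span s = ⊤)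
    (h : ∀ f ∈ s, ∃ (A' M' : Type) (_ : CommRing A') (_ : CommRing M') (_ : Algebra A A')
      (_ : Algebra M M') (_ : Algebra A' M') (_ : Algebra A M') (_ : IsScalarTower A M M')
      (_ : IsScalarTower A A' M') (_ : IsLocalization.Away f A')
      (_ : IsLocalization.Away (algebraMap A M f) M') (c' : A'),
      IsQuadratic c' (algebraMap M M' r)) : IsQuadratic c r where
  sq := hsq
  exists_unique z := by
    have htop : ∀ I : Ideal A, (∀ f ∈ s, ∃ n : ℕ, f ^ n ∈ I) → (1 : A) ∈ I := fun I hI => by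
      rw [← Ideal.eq_top_iff_one, ← Ideal.radical_eq_top, ← top_le_iff, ← hs, Ideal.span_le]
      exact hI
    have hinj : ∀ p q : A, algebraMap A M p + algebraMap A M q * r = 0 → p = 0 ∧ q = 0 := by
      intro p q h0
      have key := htop (Submodule.annihilator (Ideal.span {p, q})) fun f hf => by
        obtain ⟨A', M', _, _, _, _, _, _, _, _, _, _, c', H⟩ := h f hf
        have e := congrArg (algebraMap M M') h0
        rw [map_add, map_mul, ← IsScalarTower.algebraMap_apply, ← IsScalarTower.algebraMap_apply,
          IsScalarTower.algebraMap_apply A A' M', IsScalarTower.algebraMap_apply A A' M'] at e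
        obtain ⟨h2, h3⟩ := H.eq_of_eq (p' := 0) (q' := 0) (e.trans (by simp))
        rw [← map_zero (algebraMap A A')] at h2 h3
        obtain ⟨⟨_, l, rfl⟩, hl⟩ := (IsLocalization.eq_iff_exists (Submonoid.powers f) A').mp h2
        obtain ⟨⟨_, m, rfl⟩, hm⟩ := (IsLocalization.eq_iff_exists (Submonoid.powers f) A').mp h3
        refine ⟨l + m, ?_⟩
        rw [Ideal.span, Submodule.mem_annihilator_span]
        rintro ⟨x, rfl | rfl⟩
        · simp only [mul_zero] at hl
          simp only [smul_eq_mul, pow_add]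
          linear_combination f ^ m * hl
        · simp only [mul_zero] at hm
          simp only [smul_eq_mul, pow_add]
          linear_combination f ^ l * hm
      rw [Ideal.span, Submodule.mem_annihilator_span] at key
      exact ⟨(one_mul p).symm.trans (key ⟨p, Or.inl rfl⟩),
        (one_mul q).symm.trans (key ⟨q, Or.inr rfl⟩)⟩
    obtain ⟨p, q, hpq⟩ : ∃ p q : A, z = algebraMap A M p + algebraMap A M q * r := by
      let N : Submodule A M := Submodule.span A {1, r}
      have hN : ∀ x ∈ N, ∃ p q : A, x = algebraMap A M p + algebraMap A M q * r := fun x hx => by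
        obtain ⟨p, q, rfl⟩ := Submodule.mem_span_pair.mp hx
        exact ⟨p, q, by rw [Algebra.smul_def, Algebra.smul_def, mul_one]⟩
      have key := htop (N.colon {z}) fun f hf => by
        obtain ⟨A', M', _, _, _, _, _, _, _, _, _, _, c', H⟩ := h f hf
        obtain ⟨p', q', e⟩ := H.exists_eq (algebraMap M M' z)
        obtain ⟨n, p, hp⟩ := IsLocalization.Away.surj f p'
        obtain ⟨m, q, hq⟩ := IsLocalization.Away.surj f q'
        have e1 := congrArg (algebraMap A' M') hp
        have e2 := congrArg (algebraMap A' M') hq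
        simp only [map_mul, map_pow, ← IsScalarTower.algebraMap_apply] at e1 e2
        rw [IsScalarTower.algebraMap_apply A M M', IsScalarTower.algebraMap_apply A M M' p] at e1
        rw [IsScalarTower.algebraMap_apply A M M', IsScalarTower.algebraMap_apply A M M' q] at e2
        have h1 : algebraMap M M' (algebraMap A M (f ^ (n + m)) * z) = algebraMap M M'
            (algebraMap A M (f ^ m * p) + algebraMap A M (f ^ n * q) * r) := by
          simp only [map_mul, map_add, map_pow, pow_add]
          linear_combination algebraMap M M' (algebraMap A M f) ^ n *
            algebraMap M M' (algebraMap A M f) ^ m * e +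
            algebraMap M M' (algebraMap A M f) ^ m * e1 +
            algebraMap M M' (algebraMap A M f) ^ n * algebraMap M M' r * e2
        obtain ⟨⟨_, l, rfl⟩, hl⟩ := (IsLocalization.eq_iff_exists
          (Submonoid.powers (algebraMap A M f)) M').mp h1
        refine ⟨l + (n + m), Submodule.mem_colon_singleton.mpr (Submodule.mem_span_pair.mpr
          ⟨f ^ l * (f ^ m * p), f ^ l * (f ^ n * q), ?_⟩)⟩
        simp only [Algebra.smul_def, map_mul, map_pow, pow_add, mul_one] at hl ⊢
        linear_combination -hl
      obtain ⟨p, q, e⟩ := hN _ (Submodule.mem_colon_singleton.mp key)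
      exact ⟨p, q, by rw [← e, one_smul]⟩
    refine ⟨(p, q), hpq, fun pq' h => ?_⟩
    obtain ⟨h1, h2⟩ := hinj (pq'.1 - p) (pq'.2 - q) (by
      rw [map_sub, map_sub]; linear_combination hpq - h)
    exact Prod.ext (sub_eq_zero.mp h1) (sub_eq_zero.mp h2)

end Localization

section Sections

variable {X B : Scheme.{0}} {ρ : X ⟶ B}

theorem restrict_basicOpen [IsAffineHom ρ] {V : B.Opens} (hV : IsAffineOpen V) {c : Γ(B, V)}
    {ξ : Γ(X, ρ ⁻¹ᵁ V)} (H : IsQuadratic c ξ) {W : B.Opens} (f : Γ(B, V)) (h : W = B.basicOpen f)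
    (hW : W ≤ V) : IsQuadratic (res hW c) (res (ρ.preimage_mono hW) ξ) := by
  let := (res hW).toAlgebra
  let := (res (ρ.preimage_mono hW)).toAlgebra
  let : Algebra Γ(B, V) Γ(X, ρ ⁻¹ᵁ W) :=
    ((res (ρ.preimage_mono hW)).comp (ρ.app V).hom).toAlgebra
  have : IsScalarTower Γ(B, V) Γ(X, ρ ⁻¹ᵁ V) Γ(X, ρ ⁻¹ᵁ W) := IsScalarTower.of_algebraMap_eq' rfl
  have : IsScalarTower Γ(B, V) Γ(B, W) Γ(X, ρ ⁻¹ᵁ W) :=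
    IsScalarTower.of_algebraMap_eq fun a => (app_res ρ hW a).symm
  have : IsLocalization.Away f Γ(B, W) := hV.isLocalization_of_eq_basicOpen f (homOfLE hW) h
  have : IsLocalization.Away (algebraMap Γ(B, V) Γ(X, ρ ⁻¹ᵁ V) f) Γ(X, ρ ⁻¹ᵁ W) :=
    (hV.preimage ρ).isLocalization_of_eq_basicOpen _ (homOfLE (ρ.preimage_mono hW))
      (h ▸ Scheme.preimage_basicOpen ρ f)
  exact H.of_isLocalization f Γ(B, W) Γ(X, ρ ⁻¹ᵁ W)

theorem of_basicOpen [IsAffineHom ρ] {V : B.Opens} (hV : IsAffineOpen V) {c : Γ(B, V)}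
    {ξ : Γ(X, ρ ⁻¹ᵁ V)} (hsq : ξ ^ 2 = algebraMap Γ(B, V) _ c)
    (h : ∀ b ∈ V, ∃ (f : Γ(B, V)) (c' : Γ(B, B.basicOpen f)), b ∈ B.basicOpen f ∧
      IsQuadratic c' (res (ρ.preimage_mono (B.basicOpen_le f)) ξ)) : IsQuadratic c ξ := by
  refine of_localized hsq {f | ∃ c' : Γ(B, B.basicOpen f),
    IsQuadratic c' (res (ρ.preimage_mono (B.basicOpen_le f)) ξ)} ?_ ?_
  · refine hV.self_le_iSup_basicOpen_iff.mp fun b hb => ?_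
    obtain ⟨f, c', hf, H⟩ := h b hb
    exact TopologicalSpace.Opens.mem_iSup.mpr ⟨⟨f, c', H⟩, hf⟩
  · rintro f ⟨c', H⟩
    have hW := B.basicOpen_le f
    let := (res hW).toAlgebra
    let := (res (ρ.preimage_mono hW)).toAlgebra
    let : Algebra Γ(B, V) Γ(X, ρ ⁻¹ᵁ B.basicOpen f) :=
      ((res (ρ.preimage_mono hW)).comp (ρ.app V).hom).toAlgebra
    exact ⟨Γ(B, B.basicOpen f), Γ(X, ρ ⁻¹ᵁ B.basicOpen f), inferInstance, inferInstance,
      inferInstance, inferInstance, inferInstance, inferInstance,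
      IsScalarTower.of_algebraMap_eq' rfl,
      IsScalarTower.of_algebraMap_eq fun a => (app_res ρ hW a).symm,
      hV.isLocalization_basicOpen f,
      (hV.preimage ρ).isLocalization_of_eq_basicOpen _ (homOfLE (ρ.preimage_mono hW))
        (Scheme.preimage_basicOpen ρ f), c', H⟩

end Sections

end IsQuadratic

/-! ### The involution -/

section AppLE

variable {S T Y : Scheme.{0}}

theorem appLE_res (g : T ⟶ Y) {W W' : Y.Opens} {V : T.Opens} (h : V ≤ g ⁻¹ᵁ W) (hW : W ≤ W')
    (s : Γ(Y, W')) : (g.appLE W V h).hom (res hW s) =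
      (g.appLE W' V (h.trans (g.preimage_mono hW))).hom s :=
  congrArg (fun m => m.hom s) (g.map_appLE h (homOfLE hW).op)

theorem res_appLE (g : T ⟶ Y) {W : Y.Opens} {V V' : T.Opens} (h : V ≤ g ⁻¹ᵁ W) (hV : V' ≤ V)
    (s : Γ(Y, W)) : res hV ((g.appLE W V h).hom s) = (g.appLE W V' (hV.trans h)).hom s :=
  congrArg (fun m => m.hom s) (g.appLE_map h (homOfLE hV).op)

theorem appLE_appLE (k : S ⟶ T) (g : T ⟶ Y) {W : Y.Opens} {V : T.Opens} {U : S.Opens}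
    (h : V ≤ g ⁻¹ᵁ W) (h' : U ≤ k ⁻¹ᵁ V) (s : Γ(Y, W)) :
    (k.appLE V U h').hom ((g.appLE W V h).hom s) =
      ((k ≫ g).appLE W U (h'.trans (k.preimage_mono h))).hom s :=
  congrArg (fun m => m.hom s) (Scheme.Hom.appLE_comp_appLE k g W V U h h')

theorem appLE_congr {g g' : T ⟶ Y} (e : g = g') {W : Y.Opens} {V : T.Opens} (h : V ≤ g ⁻¹ᵁ W)
    (s : Γ(Y, W)) : (g.appLE W V h).hom s = (g'.appLE W V (e ▸ h)).hom s := by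
  subst e
  rfl

theorem app_eq_appLE (g : T ⟶ Y) {W : Y.Opens} (s : Γ(Y, W)) :
    (g.app W).hom s = (g.appLE W (g ⁻¹ᵁ W) le_rfl).hom s := by
  rw [Scheme.Hom.app_eq_appLE]

theorem hom_eq_of_appLE {g g' : T ⟶ Y} (H : ∀ t : T, ∃ (W : Y.Opens) (V : T.Opens) (h : V ≤ g ⁻¹ᵁ W)
    (h' : V ≤ g' ⁻¹ᵁ W), t ∈ V ∧ IsAffineOpen W ∧ (g.appLE W V h).hom = (g'.appLE W V h').hom) :
    g = g' := by
  refine Scheme.hom_ext_of_forall g g' fun t => ?_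
  obtain ⟨W, V, h, h', ht, hW, e⟩ := H t
  refine ⟨V, ht, ?_⟩
  have h1 : ∀ (m : T ⟶ Y) (hm : V ≤ m ⁻¹ᵁ W), ⊤ ≤ (V.ι ≫ m) ⁻¹ᵁ W := fun m hm x _ => hm x.2
  rw [eq_toAffine hW _ (h1 g h), eq_toAffine hW _ (h1 g' h')]
  congr 1
  ext s
  have hV : ⊤ ≤ V.ι ⁻¹ᵁ V := fun x _ => x.2
  rw [← appLE_appLE V.ι g h hV, ← appLE_appLE V.ι g' h' hV, e]

theorem id_appLE {W : T.Opens} (h : W ≤ 𝟙 T ⁻¹ᵁ W) (s : Γ(T, W)) :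
    ((𝟙 T : T ⟶ T).appLE W W h).hom s = s :=
  congrArg (fun m => m.hom s) (T.presheaf.map_id _)

theorem pullIdeal_eq_of_generatedOn {g : T ⟶ Y} {J : StalkIdeal Y} {J' : StalkIdeal T} {W : Y.Opens}
    {V : T.Opens} {K : Type} {f : K → Γ(Y, W)} {f' : K → Γ(T, V)} (hJ : GeneratedOn J W f)
    (hJ' : GeneratedOn J' V f') (h : V ≤ g ⁻¹ᵁ W)
    (hf : ∀ k, (g.appLE W V h).hom (f k) = f' k ∨ (g.appLE W V h).hom (f k) = -f' k)
    (t : T) (ht : t ∈ V) : pullIdeal g J t = J' t := by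
  rw [hJ' t ht, pullIdeal, hJ (g t) (h ht), Ideal.map_span, ← Set.range_comp, Ideal.span, Ideal.span,
    Submodule.span_range_eq_iSup, Submodule.span_range_eq_iSup]
  refine iSup_congr fun k => ?_
  change Ideal.span {(g.stalkMap t).hom (germAt W (g t) (h ht) (f k))} = Ideal.span _
  rw [stalkMap_germAt_appLE g W V h t ht]
  rcases hf k with e | e
  · rw [e]
  · rw [e, map_neg, Ideal.span_singleton_neg]

end AppLE

namespace TateData

variable {B : Scheme.{0}} {N : ℕ} {D : TateData B N} {X : Scheme.{0}} {ρ : X ⟶ B}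
  {C : DoubleCover D.P ρ D.limitBranch} {ι : X ⟶ X}

theorem Patch.iota_xi (p : D.Patch) (hι : C.IsInvolution ι) (h : ρ ⁻¹ᵁ p.V ≤ ι ⁻¹ᵁ ρ ⁻¹ᵁ p.V) :
    (ι.appLE (ρ ⁻¹ᵁ p.V) (ρ ⁻¹ᵁ p.V) h).hom (p.ξ C) = -p.ξ C := by
  obtain ⟨e, he⟩ := hι
  rw [Patch.ξ, appLE_res, ← map_neg, ← he p.i, res_appLE]

theorem Patch.iota_algebraMap (p : D.Patch) (e : ι ≫ ρ = ρ)
    (h : ρ ⁻¹ᵁ p.V ≤ ι ⁻¹ᵁ ρ ⁻¹ᵁ p.V) (a : Γ(B, p.V)) :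
    (ι.appLE (ρ ⁻¹ᵁ p.V) (ρ ⁻¹ᵁ p.V) h).hom (algebraMap Γ(B, p.V) _ a) =
      algebraMap Γ(B, p.V) _ a := by
  change (ι.appLE _ _ h).hom ((ρ.app p.V).hom a) = (ρ.app p.V).hom a
  rw [app_eq_appLE, appLE_appLE, appLE_congr e]

theorem iota_comp_iota (hι : C.IsInvolution ι) : ι ≫ ι = 𝟙 X := by
  obtain ⟨e, -⟩ := id hι
  refine hom_eq_of_appLE fun x => ?_
  obtain ⟨p, hx, -⟩ := Patch.exists_mem (D := D) ⊤ (ρ x) trivial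
  have h := preimage_le_of_over e p.V
  refine ⟨ρ ⁻¹ᵁ p.V, ρ ⁻¹ᵁ p.V, h.trans (ι.preimage_mono h), le_rfl, hx,
    p.isAffineOpen_preimage C, (p.isQuadratic C).hom_ext (RingHom.ext fun a => ?_) ?_⟩
  · rw [RingHom.comp_apply, RingHom.comp_apply, ← appLE_appLE ι ι h h, p.iota_algebraMap e,
      p.iota_algebraMap e]
    exact (id_appLE _ _).symm
  · rw [← appLE_appLE ι ι h h, p.iota_xi hι, map_neg, p.iota_xi hι, neg_neg]
    exact (id_appLE _ _).symm

/-- The ideals `(σ, ξ - s a₁)` are permuted by the involution. -/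
theorem pullIdeal_iota_stack (hι : C.IsInvolution ι) (s : ℤ) :
    pullIdeal ι (D.stack C s) = D.stack C (-s) := by
  obtain ⟨e, -⟩ := id hι
  funext x
  obtain ⟨p, hx, -⟩ := Patch.exists_mem (D := D) ⊤ (ρ x) trivial
  have h := preimage_le_of_over e p.V
  refine pullIdeal_eq_of_generatedOn (p.generatedOn_stack C s) (p.generatedOn_stack C (-s)) h
    (Fin.forall_fin_two.mpr ⟨Or.inl (p.iota_algebraMap e h _), Or.inr ?_⟩) x hx
  change (ι.appLE _ _ h).hom (p.ξ C - _) = -(p.ξ C - _)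
  rw [map_sub, map_mul, p.iota_xi hι h, map_intCast, p.iota_algebraMap e h, Int.cast_neg]
  ring

theorem pullIdeal_iota_coverCenter (hι : C.IsInvolution ι) :
    pullIdeal ι (D.coverCenter C) = D.coverCenter C := by
  obtain ⟨e, -⟩ := id hι
  funext x
  obtain ⟨p, hx, -⟩ := Patch.exists_mem (D := D) ⊤ (ρ x) trivial
  have h := preimage_le_of_over e p.V
  refine pullIdeal_eq_of_generatedOn (p.generatedOn_cover C) (p.generatedOn_cover C) h ?_ x hx
  intro k
  fin_cases k
  · exact Or.inl (p.iota_algebraMap e h _)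
  · exact Or.inl (p.iota_algebraMap e h _)
  · exact Or.inr (p.iota_xi hι h)

/-! ### The double cover of the blown-up base -/

theorem pullIdeal_comp_baseCenter {T : Scheme.{0}} {g : T ⟶ X}
    (hc : IsCartier (pullIdeal g (D.coverCenter C))) :
    pullIdeal (g ≫ ρ) D.baseCenter = pullIdeal g (D.coverCenter C) := by
  funext t
  obtain ⟨p, ht, -⟩ := Patch.exists_mem (D := D) ⊤ (ρ (g t)) trivial
  obtain ⟨k, ht', hk, -⟩ := p.exists_goodAt_cover C g hc t ht
  have h1 : ∀ l, germAt (ρ ⁻¹ᵁ p.V) (g t) ht (algebraMap Γ(B, p.V) _ (![p.σ, p.a₁] l)) ∈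
      pullIdeal ρ D.baseCenter (g t) := fun l => by
    rw [p.generatedOn_base.pullIdeal ρ (g t) ht]
    exact Ideal.subset_span ⟨l, rfl⟩
  rw [pullIdeal_comp]
  refine le_antisymm (Ideal.map_mono ?_) ?_
  · rw [p.generatedOn_base.pullIdeal ρ (g t) ht, p.generatedOn_cover C (g t) ht, Ideal.span_le]
    rintro _ ⟨l, rfl⟩
    fin_cases l
    · exact Ideal.subset_span ⟨0, rfl⟩
    · exact Ideal.subset_span ⟨1, rfl⟩
  · rw [hk, Ideal.span_singleton_le_iff_mem, ← stalkMap_germAt g _ t ht]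
    refine Ideal.mem_map_of_mem _ ?_
    convert h1 k using 2
    fin_cases k <;> rfl

/-- The blow-up of the double cover maps to the blow-up of the base, and the involution lifts. -/
theorem exists_coverMap {X' B' : Scheme.{0}} {π : X' ⟶ X} {β : B' ⟶ B}
    (hπ : IsBlowup (D.coverCenter C) π) (hβ : IsBlowup D.baseCenter β) (hι : C.IsInvolution ι) :
    ∃ (ρ' : X' ⟶ B') (ι' : X' ⟶ X'), ρ' ≫ β = π ≫ ρ ∧ ι' ≫ π = π ≫ ι ∧ ι' ≫ ι' = 𝟙 X' ∧
      ι' ≫ ρ' = ρ' := by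
  have hc : IsCartier (pullIdeal (π ≫ ρ) D.baseCenter) :=
    pullIdeal_comp_baseCenter hπ.cartier ▸ hπ.cartier
  have hc' : IsCartier (pullIdeal (π ≫ ι) (D.coverCenter C)) := by
    rw [pullIdeal_comp, pullIdeal_iota_coverCenter hι]
    exact hπ.cartier
  obtain ⟨ρ', h1, -⟩ := hβ.universal _ _ hc
  obtain ⟨ι', h2, -⟩ := hπ.universal _ _ hc'
  have h3 : (ι' ≫ ι') ≫ π = 𝟙 X' ≫ π := by
    rw [Category.assoc, h2, ← Category.assoc, h2, Category.assoc, iota_comp_iota hι,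
      Category.comp_id, Category.id_comp]
  have h4 : (ι' ≫ ρ') ≫ β = ρ' ≫ β := by
    rw [Category.assoc, h1, ← Category.assoc, h2, Category.assoc, hι.choose]
  refine ⟨ρ', ι', h1, h2, hπ.hom_ext h3 ?_, hβ.hom_ext h4 ?_⟩
  · rw [h3, Category.id_comp]
    exact hπ.cartier
  · rw [h4, h1]
    exact hc

end TateData

section Charts

variable {T Y : Scheme.{0}}

/-- Functions on the image of an affine chart. -/
def chartSections {R : Type} [CommRing R] (j : Spec (CommRingCat.of R) ⟶ T) (W : T.Opens)
    (h : ⊤ ≤ j ⁻¹ᵁ W) : Γ(T, W) →+* R :=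
  (Scheme.ΓSpecIso (CommRingCat.of R)).hom.hom.comp (j.appLE W ⊤ h).hom

theorem chartSections_bijective {R : Type} [CommRing R] (j : Spec (CommRingCat.of R) ⟶ T)
    [IsOpenImmersion j] (W : T.Opens) (hW : j.opensRange = W) (h : ⊤ ≤ j ⁻¹ᵁ W) :
    Function.Bijective (chartSections j W h) := by
  obtain rfl : j ''ᵁ ⊤ = W := by rw [← hW, Scheme.Hom.image_top_eq_opensRange]
  have h1 : (j.appLE (j ''ᵁ ⊤) ⊤ h) = (j.appIso ⊤).hom := (j.appIso_hom' ⊤).symm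
  rw [chartSections, h1]
  exact (ConcreteCategory.bijective_of_isIso (Scheme.ΓSpecIso (CommRingCat.of R)).hom).comp
    (ConcreteCategory.bijective_of_isIso (j.appIso ⊤).hom)

theorem chartSections_specMap {R₀ R : Type} [CommRing R₀] [CommRing R] (φ : R₀ →+* R)
    {j : Spec (CommRingCat.of R₀) ⟶ Y} {W : Y.Opens} (h : ⊤ ≤ j ⁻¹ᵁ W)
    (h' : ⊤ ≤ (Spec.map (CommRingCat.ofHom φ) ≫ j) ⁻¹ᵁ W) (s : Γ(Y, W)) :
    chartSections (Spec.map (CommRingCat.ofHom φ) ≫ j) W h' s = φ (chartSections j W h s) := by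
  have h1 : ⊤ ≤ Spec.map (CommRingCat.ofHom φ) ⁻¹ᵁ ⊤ := le_rfl
  rw [chartSections, RingHom.comp_apply, ← appLE_appLE _ j h h1]
  have := Scheme.ΓSpecIso_naturality (CommRingCat.ofHom φ)
  refine Eq.trans ?_ (congrArg (fun m => m.hom ((j.appLE W ⊤ h).hom s)) this)
  rw [Scheme.Hom.appTop, Scheme.Hom.app_eq_appLE]
  rfl

theorem chartSections_fromSpec {R : Type} [CommRing R] {W : Y.Opens} (hW : IsAffineOpen W)
    (φ : Γ(Y, W) →+* R) (m : Spec (CommRingCat.of R) ⟶ Y)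
    (hm : m = Spec.map (CommRingCat.ofHom φ) ≫ hW.fromSpec) (h : ⊤ ≤ m ⁻¹ᵁ W) (s : Γ(Y, W)) :
    chartSections m W h s = φ s := by
  rw [specMap_fromSpec_eq_toAffine] at hm
  subst hm
  rw [chartSections, toAffine_appLE]
  exact congrArg (fun m => m.hom (φ s)) (Scheme.ΓSpecIso (CommRingCat.of R)).inv_hom_id

theorem chartSections_appLE {R : Type} [CommRing R] (j : Spec (CommRingCat.of R) ⟶ T) (g : T ⟶ Y)
    {W : T.Opens} (h : ⊤ ≤ j ⁻¹ᵁ W) {V : Y.Opens} (hV : W ≤ g ⁻¹ᵁ V) (s : Γ(Y, V)) :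
    chartSections j W h ((g.appLE V W hV).hom s) =
      chartSections (j ≫ g) V (h.trans (j.preimage_mono hV)) s := by
  rw [chartSections, RingHom.comp_apply, appLE_appLE]
  rfl

/-- A quadratic extension of charts, as an extension of the rings of functions. -/
theorem exists_isQuadratic_of_chart {R₀ R : Type} [CommRing R₀] [CommRing R] [Algebra R₀ R] {c : R₀}
    {r : R} (H : IsQuadratic c r) (g : T ⟶ Y) {j : Spec (CommRingCat.of R₀) ⟶ Y}
    [IsOpenImmersion j] {j' : Spec (CommRingCat.of R) ⟶ T} [IsOpenImmersion j']
    (e : j' ≫ g = Spec.map (CommRingCat.ofHom (algebraMap R₀ R)) ≫ j)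
    (hr : j'.opensRange = g ⁻¹ᵁ j.opensRange) (h' : ⊤ ≤ j' ⁻¹ᵁ (g ⁻¹ᵁ j.opensRange)) :
    ∃ (c₀ : Γ(Y, j.opensRange)) (r₀ : Γ(T, g ⁻¹ᵁ j.opensRange)),
      chartSections j' _ h' r₀ = r ∧ IsQuadratic c₀ r₀ := by
  have h : ⊤ ≤ j ⁻¹ᵁ j.opensRange := fun x _ => ⟨x, rfl⟩
  have hb := chartSections_bijective j _ rfl h
  have hb' := chartSections_bijective j' _ hr h'
  obtain ⟨c₀, hc⟩ := hb.2 c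
  obtain ⟨r₀, hr₀⟩ := hb'.2 r
  refine ⟨c₀, r₀, hr₀, H.of_bijective _ _ hb hb' (fun a => ?_) hc hr₀⟩
  change chartSections j' _ h' ((g.app _).hom a) = _
  rw [app_eq_appLE, chartSections_appLE, ← chartSections_specMap (algebraMap R₀ R) h
    (fun x _ => ⟨_, rfl⟩)]
  exact congrArg (Scheme.ΓSpecIso (CommRingCat.of R)).hom.hom (appLE_congr e _ _)

/-- Two sections which generate the same invertible ideal differ by a unit. -/
theorem exists_unit_of_span_germAt_eq {W : T.Opens} {u w : Γ(T, W)}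
    (hw : ∀ (t : T) (ht : t ∈ W), germAt W t ht w ∈ nonZeroDivisors _)
    (h : ∀ (t : T) (ht : t ∈ W), Ideal.span {germAt W t ht u} = Ideal.span {germAt W t ht w}) :
    ∃ e, IsUnit e ∧ u = w * e := by
  have hu : ∀ (t : T) (ht : t ∈ W), germAt W t ht u ∈ nonZeroDivisors _ := fun t ht =>
    mem_nonZeroDivisors_of_span_eq (hw t ht) (h t ht).symm
  obtain ⟨e, he⟩ := dvd_of_germAt_dvd hw fun t ht =>
    Ideal.mem_span_singleton.mp ((h t ht) ▸ Ideal.mem_span_singleton_self _)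
  obtain ⟨e', he'⟩ := dvd_of_germAt_dvd hu fun t ht =>
    Ideal.mem_span_singleton.mp ((h t ht).symm ▸ Ideal.mem_span_singleton_self _)
  refine ⟨e, IsUnit.of_mul_eq_one e' ?_, he⟩
  refine (mul_cancel_left_mem_nonZeroDivisors (mem_nonZeroDivisors_of_germAt hw)).mp ?_
  rw [mul_one, ← mul_assoc, ← he, ← he']

end Charts

namespace TateData

variable {B : Scheme.{0}} {N : ℕ} {D : TateData B N} {X : Scheme.{0}} {ρ : X ⟶ B}
  {C : DoubleCover D.P ρ D.limitBranch} {X' B' : Scheme.{0}} {π : X' ⟶ X} {β : B' ⟶ B}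
  {ρ' : X' ⟶ B'}

theorem exists_lift_charts (hπ : IsBlowup (D.coverCenter C) π) (hβ : IsBlowup D.baseCenter β)
    (e : ρ' ≫ β = π ≫ ρ) {V : B.Opens} {u : Γ(B, V)} {u' : Γ(X, ρ ⁻¹ᵁ V)} (hu : u' = (ρ.app V).hom u)
    {S S' : Scheme.{0}} {m : S ⟶ B} {m' : S' ⟶ X} {κ : S' ⟶ S} (hm : IsChart D.baseCenter V u m)
    (hm' : IsChart (D.coverCenter C) (ρ ⁻¹ᵁ V) u' m') (hκ : m' ≫ ρ = κ ≫ m) :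
    ∃ (j : S ⟶ B') (j' : S' ⟶ X'), IsOpenImmersion j ∧ IsOpenImmersion j' ∧ j' ≫ π = m' ∧
      j' ≫ ρ' = κ ≫ j ∧ Set.range j = {y | GoodAt D.baseCenter V u β y} ∧
      Set.range j' = ρ' ⁻¹' Set.range j := by
  obtain ⟨j, hj, h1, h2⟩ := hβ.exists_chart locallyFG_baseCenter hm
  obtain ⟨j', hj', h1', h2'⟩ := hπ.exists_chart (locallyFG_coverCenter C) hm'
  have hcar : IsCartier (pullIdeal (π ≫ ρ) D.baseCenter) :=
    pullIdeal_comp_baseCenter hπ.cartier ▸ hπ.cartier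
  have h3 : (j' ≫ ρ') ≫ β = (κ ≫ j) ≫ β := by
    rw [Category.assoc, e, ← Category.assoc, h1', hκ, Category.assoc, h1]
  refine ⟨j, j', hj, hj', h1', hβ.hom_ext h3 ?_, h2, ?_⟩
  · rw [Category.assoc, e]
    exact hcar.comp_openImmersion j'
  · ext y
    rw [h2', h2]
    change _ ↔ GoodAt D.baseCenter V u β (ρ' y)
    rw [← goodAt_comp hm.mem ρ' β hβ.cartier (e ▸ hcar) y, e]
    change GenAt _ _ _ _ ↔ GenAt (pullIdeal (π ≫ ρ) D.baseCenter) _ _ _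
    rw [pullIdeal_comp_baseCenter hπ.cartier, hu]
    rfl

/-- The charts of the two blow-ups correspond to each other. -/
theorem exists_charts (hπ : IsBlowup (D.coverCenter C) π) (hβ : IsBlowup D.baseCenter β)
    (e : ρ' ≫ β = π ≫ ρ) (hK : ∀ p : D.Patch, KoszulExact p.σ p.a₁) (p : D.Patch) (b : B')
    (hb : β b ∈ p.V) :
    ∃ (k : Fin 2) (R₀ R : Type) (_ : CommRing R₀) (_ : CommRing R) (_ : Algebra R₀ R) (c : R₀) (r : R)
      (φ : Γ(X, ρ ⁻¹ᵁ p.V) →+* R) (j : Spec (CommRingCat.of R₀) ⟶ B')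
      (j' : Spec (CommRingCat.of R) ⟶ X'), IsQuadratic c r ∧
      φ (p.ξ C) = φ (algebraMap Γ(B, p.V) _ (![p.σ, p.a₁] k)) * r ∧ IsOpenImmersion j ∧
      IsOpenImmersion j' ∧
      j' ≫ π = Spec.map (CommRingCat.ofHom φ) ≫ (p.isAffineOpen_preimage C).fromSpec ∧
      j' ≫ ρ' = Spec.map (CommRingCat.ofHom (algebraMap R₀ R)) ≫ j ∧
      Set.range j = {y | GoodAt D.baseCenter p.V (![p.σ, p.a₁] k) β y} ∧
      Set.range j' = ρ' ⁻¹' Set.range j ∧ b ∈ Set.range j := by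
  obtain ⟨k, hk⟩ := p.exists_goodAt_base β hβ.cartier b hb
  have hg : p.coverGen C k.castSucc = (ρ.app p.V).hom (![p.σ, p.a₁] k) := by
    fin_cases k <;> rfl
  obtain ⟨j, j', h1, h2, h3, h4, h5, h6⟩ := exists_lift_charts hπ hβ e hg
    (p.isChart_baseChartMap (hK p) k) (p.isChart_coverChartMap C (hK p) k)
    (p.coverChartMap_comp C (hK p) k)
  refine ⟨k, BaseChart p.σ p.a₁ k, CoverChart p.σ p.a₁ p.a₂₂ k, _, _, _, _, _,
    (p.coverChartHom C (hK p) k).toRingHom, j, j', SqrtAlg.isQuadratic _, ?_, h1, h2, h3, h4, h5,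
    h6, h5 ▸ hk⟩
  refine (p.coverChartHom_xi C (hK p) k).trans ?_
  congr 1
  exact ((p.coverChartHom C (hK p) k).commutes _).symm

theorem isAffineHom_coverMap (hπ : IsBlowup (D.coverCenter C) π) (hβ : IsBlowup D.baseCenter β)
    (e : ρ' ≫ β = π ≫ ρ) (hK : ∀ p : D.Patch, KoszulExact p.σ p.a₁) : IsAffineHom ρ' := by
  refine isAffineHom_of_forall_exists_isAffineOpen _ fun b => ?_
  obtain ⟨p, hb, -⟩ := Patch.exists_mem (D := D) ⊤ (β b) trivial
  obtain ⟨k, R₀, R, _, _, _, -, -, -, j, j', -, -, hj, hj', -, -, -, h, hbj⟩ := exists_charts hπ hβ e hK p b hb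
  refine ⟨j.opensRange, hbj, isAffineOpen_opensRange j, ?_⟩
  have : ρ' ⁻¹ᵁ j.opensRange = j'.opensRange := TopologicalSpace.Opens.ext h.symm
  rw [this]
  exact isAffineOpen_opensRange j'

theorem xi_sq (C : DoubleCover D.P ρ D.limitBranch) (i : D.P.I) :
    C.ξ i ^ 2 = (ρ.app (D.P.U i)).hom (D.sppBranch i) := by
  refine section_ext fun x hx => ?_
  obtain ⟨V, hV, hxV, hVU⟩ := TopologicalSpace.Opens.isBasis_iff_nbhd.mp B.isBasis_affineOpens
    (show ρ x ∈ D.P.U i from hx)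
  replace hxV : x ∈ ρ ⁻¹ᵁ V := hxV
  let p : D.Patch := ⟨i, V, hVU, hV⟩
  have := congrArg (germAt (ρ ⁻¹ᵁ V) x hxV) (p.isQuadratic C).sq
  rw [p.h_eq, Patch.ξ, ← map_pow] at this
  change germAt (ρ ⁻¹ᵁ V) x hxV (res (ρ.preimage_mono hVU) _) =
    germAt (ρ ⁻¹ᵁ V) x hxV ((ρ.app V).hom (res hVU (D.sppBranch i))) at this
  rwa [app_res, germAt_res, germAt_res] at this

end TateData

namespace TateData

variable {B : Scheme.{0}} {N : ℕ} {D : TateData B N} {X : Scheme.{0}} {ρ : X ⟶ B}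
  {C : DoubleCover D.P ρ D.limitBranch} {X' B' : Scheme.{0}} {π : X' ⟶ X} {β : B' ⟶ B}
  {ρ' : X' ⟶ B'}

theorem exists_isDoubleCoverOn (hπ : IsBlowup (D.coverCenter C) π)
    (hβ : IsBlowup D.baseCenter β) (e : ρ' ≫ β = π ≫ ρ)
    (hK : ∀ p : D.Patch, KoszulExact p.σ p.a₁) (i : D.P.I) (V : B'.Opens)
    (hV : V ≤ β ⁻¹ᵁ D.P.U i) (w : Γ(B', V)) (hVa : IsAffineOpen V)
    (hw : ∀ (b : B') (hb : b ∈ V), pullIdeal β D.baseCenter b = Ideal.span {germAt V b hb w}) :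
    ∃ (h' : Γ(B', V)) (ξ' : Γ(X', ρ' ⁻¹ᵁ V)),
      w ^ 2 * h' = (β.appLE (D.P.U i) V hV).hom (D.sppBranch i) ∧
      (ρ'.app V).hom w * ξ' = (π.appLE (ρ ⁻¹ᵁ D.P.U i) (ρ' ⁻¹ᵁ V)
        (preimage_le_of_square e hV)).hom (C.ξ i) ∧ IsDoubleCoverOn ρ' V h' ξ' := by
  have := isAffineHom_coverMap hπ hβ e hK
  have hwn : ∀ (b : B') (hb : b ∈ V), germAt V b hb w ∈ nonZeroDivisors _ := fun b hb => by
    obtain ⟨d, hd, hd'⟩ := hβ.cartier b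
    exact mem_nonZeroDivisors_of_span_eq hd (hd'.symm.trans (hw b hb))
  have hw' : ∀ (y : X') (hy : y ∈ ρ' ⁻¹ᵁ V), pullIdeal π (D.coverCenter C) y =
      Ideal.span {germAt (ρ' ⁻¹ᵁ V) y hy ((ρ'.app V).hom w)} := fun y hy => by
    rw [← pullIdeal_comp_baseCenter hπ.cartier, ← e, pullIdeal_comp]
    change (pullIdeal β D.baseCenter (ρ' y)).map _ = _
    rw [hw _ hy, Ideal.map_span, Set.image_singleton, stalkMap_germAt ρ' V y hy]
  have hwn' : ∀ (y : X') (hy : y ∈ ρ' ⁻¹ᵁ V),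
      germAt (ρ' ⁻¹ᵁ V) y hy ((ρ'.app V).hom w) ∈ nonZeroDivisors _ := fun y hy => by
    obtain ⟨d, hd, hd'⟩ := hπ.cartier y
    exact mem_nonZeroDivisors_of_span_eq hd (hd'.symm.trans (hw' y hy))
  obtain ⟨h', hh'⟩ : w ^ 2 ∣ (β.appLE (D.P.U i) V hV).hom (D.sppBranch i) := by
    refine dvd_of_germAt_dvd (fun b hb => ?_) fun b hb => ?_
    · rw [map_pow]
      exact pow_mem (hwn b hb) 2
    · let ψ : Γ(B, D.P.U i) →+* B'.presheaf.stalk b :=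
        (β.stalkMap b).hom.comp (germAt (D.P.U i) (β b) (hV hb))
      have hmem : ∀ k, germAt V b hb w ∣ ψ (![D.σ.val i, D.a₁.val i] k) := fun k => by
        rw [← Ideal.mem_span_singleton, ← hw b hb]
        refine Ideal.mem_map_of_mem _ ?_
        rw [D.generatedOn_baseCenter i (β b) (hV hb)]
        exact Ideal.subset_span ⟨k, rfl⟩
      obtain ⟨s, hs⟩ := hmem 0
      obtain ⟨a, ha⟩ := hmem 1
      rw [← stalkMap_germAt_appLE β _ V hV b hb]
      change _ ∣ ψ (D.sppBranch i)
      simp only [Matrix.cons_val_zero, Matrix.cons_val_one] at hs ha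
      simp only [sppBranch, map_add, map_mul, map_pow, hs, ha]
      exact ⟨a ^ 2 + ψ 4 * s ^ 2 * ψ (D.a₂₂.val i), by ring⟩
  obtain ⟨ξ', hξ'⟩ : (ρ'.app V).hom w ∣ (π.appLE (ρ ⁻¹ᵁ D.P.U i) (ρ' ⁻¹ᵁ V)
      (preimage_le_of_square e hV)).hom (C.ξ i) := by
    refine dvd_of_germAt_dvd hwn' fun y hy => ?_
    rw [← Ideal.mem_span_singleton, ← hw' y hy, ← stalkMap_germAt_appLE π _ _ _ y hy]
    refine Ideal.mem_map_of_mem _ ?_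
    rw [D.generatedOn_coverCenter C i (π y) (preimage_le_of_square e hV hy)]
    exact Ideal.subset_span ⟨2, rfl⟩
  have hbase : ∀ {W : B.Opens} {V' : B'.Opens} (hV' : V' ≤ β ⁻¹ᵁ W) (s : Γ(B, W)),
      (ρ'.app V').hom ((β.appLE W V' hV').hom s) = (π.appLE (ρ ⁻¹ᵁ W) (ρ' ⁻¹ᵁ V')
        (preimage_le_of_square e hV')).hom ((ρ.app W).hom s) := fun hV' s => by
    rw [app_eq_appLE, app_eq_appLE, appLE_appLE, appLE_appLE, appLE_congr e]
  refine ⟨h', ξ', hh'.symm, hξ'.symm, ?_⟩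
  suffices H : IsQuadratic h' ξ' from ⟨H.sq, H.exists_unique⟩
  have hsq : ξ' ^ 2 = (ρ'.app V).hom h' := by
    refine (mul_cancel_left_mem_nonZeroDivisors
      (pow_mem (mem_nonZeroDivisors_of_germAt hwn') 2)).mp ?_
    rw [← mul_pow, ← hξ', ← map_pow, xi_sq, ← hbase hV, hh', map_mul, map_pow]
  refine IsQuadratic.of_basicOpen hVa hsq fun b hb => ?_
  obtain ⟨V₀, hV₀, hbV₀, hVU⟩ := TopologicalSpace.Opens.isBasis_iff_nbhd.mp B.isBasis_affineOpens
    (show β b ∈ D.P.U i from hV hb)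
  let p : D.Patch := ⟨i, V₀, hVU, hV₀⟩
  obtain ⟨k, R₀, R, _, _, _, c, r, φ, j, j', H, hφ, hj, hj', h1, h2, h3, h4, hbj⟩ :=
    exists_charts hπ hβ e hK p b hbV₀
  have hO : j'.opensRange = ρ' ⁻¹ᵁ j.opensRange := TopologicalSpace.Opens.ext h4
  have hle : ⊤ ≤ j' ⁻¹ᵁ (ρ' ⁻¹ᵁ j.opensRange) := fun x _ => hO.le ⟨x, rfl⟩
  obtain ⟨c₀, r₀, hr₀, H₀⟩ := exists_isQuadratic_of_chart H ρ' h2 hO hle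
  have hOβ : j.opensRange ≤ β ⁻¹ᵁ p.V := fun y hy => (h3.le hy).1
  have hOπ := preimage_le_of_square e hOβ
  have hrel : (π.appLE (ρ ⁻¹ᵁ p.V) (ρ' ⁻¹ᵁ j.opensRange) hOπ).hom (p.ξ C) =
      (ρ'.app j.opensRange).hom ((β.appLE p.V _ hOβ).hom (![p.σ, p.a₁] k)) * r₀ := by
    refine (chartSections_bijective j' _ hO hle).1 ?_
    rw [map_mul, hr₀, hbase hOβ, chartSections_appLE, chartSections_appLE,
      chartSections_fromSpec _ φ _ h1, chartSections_fromSpec _ φ _ h1, hφ]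
    rfl
  obtain ⟨f, g, hfg, hbf⟩ := exists_basicOpen_le_affine_inter hVa (isAffineOpen_opensRange j) b
    ⟨hb, hbj⟩
  have hf := B'.basicOpen_le f
  have hg : B'.basicOpen f ≤ j.opensRange := hfg.le.trans (B'.basicOpen_le g)
  have H₁ := H₀.restrict_basicOpen (isAffineOpen_opensRange j) g hfg hg
  obtain ⟨ε, hε, hu⟩ := exists_unit_of_span_germAt_eq (w := res hf w)
    (u := res hg ((β.appLE p.V _ hOβ).hom (![p.σ, p.a₁] k)))
    (fun t ht => by rw [germAt_res]; exact hwn t (hf ht)) (fun t ht => by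
      rw [germAt_res, germAt_res, ← hw t (hf ht)]
      obtain ⟨h5, h6, -⟩ := h3.le (hg ht)
      rw [h6, app_eq_appLE, ← res_appLE β le_rfl hOβ, germAt_res])
  refine ⟨f, res hf h', hbf, H₁.of_unit hε ?_ ?_⟩
  · refine (mul_cancel_left_mem_nonZeroDivisors (mem_nonZeroDivisors_of_germAt
      (u := res (ρ'.preimage_mono hf) ((ρ'.app V).hom w)) fun y hy => by
        rw [germAt_res]; exact hwn' y _)).mp ?_
    rw [← map_mul, ← hξ', res_appLE]
    have h7 := congrArg (res (ρ'.preimage_mono hg)) hrel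
    rw [map_mul, ← app_res ρ' hg, hu, res_appLE, Patch.ξ, appLE_res, map_mul, app_res] at h7
    rw [← mul_assoc]
    exact h7
  · rw [← map_pow, hsq, ← app_res]
    rfl

end TateData

/-! ## The discriminant of the family -/

section Discriminant

open Polynomial

variable {R : Type} [CommRing R] (a s b c d e g p q r : R)

/-- The Weierstrass curve over `R[ε]` with the coefficients `a`, `s (ε b + s c)`, `ε p d`, `ε q e`
and `ε² r g`. -/
def epsilonFamily : WeierstrassCurve R[X] where
  a₁ := C a
  a₂ := C s * (X * C b + C s * C c)
  a₃ := C p * (X * C d)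
  a₄ := C q * (X * C e)
  a₆ := C r * (X ^ 2 * C g)

theorem dvd_b₄_epsilonFamily : X ∣ (epsilonFamily a s b c d e g p q r).b₄ :=
  ⟨2 * (C q * C e) + C a * (C p * C d), by simp only [WeierstrassCurve.b₄, epsilonFamily]; ring⟩

theorem dvd_b₆_epsilonFamily : X ^ 2 ∣ (epsilonFamily a s b c d e g p q r).b₆ :=
  ⟨(C p * C d) ^ 2 + 4 * (C r * C g), by
    simp only [WeierstrassCurve.b₆, epsilonFamily]; ring⟩

theorem discriminant_epsilonFamily : ∃ Q : R[X],
    (epsilonFamily a s b c d e g p q r).Δ = X ^ 2 * Q ∧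
      Q.coeff 0 = (a ^ 2 + 4 * s ^ 2 * c) ^ 2 * (q ^ 2 * e ^ 2 + a * (p * d * (q * e)) -
        s ^ 2 * c * (p * d) ^ 2 - (a ^ 2 + 4 * s ^ 2 * c) * (r * g)) := by
  set u : R[X] := C a ^ 2 + 4 * (C s * (X * C b + C s * C c)) with hu
  set v : R[X] := 2 * (C q * C e) + C a * (C p * C d) with hv
  set w : R[X] := (C p * C d) ^ 2 + 4 * (C r * C g) with hw
  refine ⟨-u ^ 2 * (u * (C r * C g) - C a * (C p * C d) * (C q * C e) +
    C s * (X * C b + C s * C c) * (C p * C d) ^ 2 - (C q * C e) ^ 2) - 8 * (X * v ^ 3) -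
    27 * (X ^ 2 * w ^ 2) + 9 * (X * (u * v * w)), ?_, ?_⟩
  · simp only [WeierstrassCurve.Δ, WeierstrassCurve.b₂, WeierstrassCurve.b₄, WeierstrassCurve.b₆,
      WeierstrassCurve.b₈, epsilonFamily, hu, hv, hw]
    ring
  · rw [coeff_zero_eq_eval_zero]
    simp only [hu, hv, hw, eval_add, eval_sub, eval_mul, eval_pow, eval_neg, eval_C, eval_X,
      eval_ofNat]
    ring

end Discriminant

namespace TateData

variable {B : Scheme.{0}} {N : ℕ} (D : TateData B N)

theorem weak_coupling (i : D.P.I) :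
    Polynomial.X ∣ (D.family i).b₄ ∧ Polynomial.X ^ 2 ∣ (D.family i).b₆ ∧
      (D.family i).Δ.coeff 0 = 0 ∧ (D.family i).Δ.coeff 1 = 0 ∧
      (D.family i).Δ.coeff 2 = D.sppBranch i ^ 2 * D.σ.val i ^ N * D.residualBrane i := by
  have hF : D.family i = epsilonFamily (D.a₁.val i) (D.σ.val i) (D.a₂₁.val i) (D.a₂₂.val i)
      (D.a₃'.val i) (D.a₄'.val i) (D.a₆'.val i) (D.σ.val i ^ (N / 2))
      (D.σ.val i ^ ((N + 1) / 2)) (D.σ.val i ^ N) := rfl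
  rw [hF]
  obtain ⟨Q, hQ, h0⟩ := discriminant_epsilonFamily (D.a₁.val i) (D.σ.val i) (D.a₂₁.val i)
    (D.a₂₂.val i) (D.a₃'.val i) (D.a₄'.val i) (D.a₆'.val i) (D.σ.val i ^ (N / 2))
    (D.σ.val i ^ ((N + 1) / 2)) (D.σ.val i ^ N)
  refine ⟨dvd_b₄_epsilonFamily .., dvd_b₆_epsilonFamily .., ?_, ?_, ?_⟩
  · rw [hQ, Polynomial.coeff_X_pow_mul', if_neg (by norm_num)]
  · rw [hQ, Polynomial.coeff_X_pow_mul', if_neg (by norm_num)]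
  · rw [hQ, Polynomial.coeff_X_pow_mul', if_pos le_rfl, Nat.sub_self, h0]
    unfold sppBranch residualBrane
    clear h0 hQ Q hF
    generalize D.a₃'.val i = d, D.a₄'.val i = e, D.a₆'.val i = g
    rcases Nat.even_or_odd' N with ⟨m, rfl | rfl⟩
    · rw [if_pos (even_two_mul m), show 2 * m / 2 = m by omega, show (2 * m + 1) / 2 = m by omega]
      ring
    · rw [if_neg (Nat.not_even_iff_odd.2 ⟨m, rfl⟩), show (2 * m + 1) / 2 = m by omega,
        show (2 * m + 1 + 1) / 2 = m + 1 by omega]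
      ring

end TateData

/-! ## The stack on the double cover -/

namespace IsQuadratic

variable {A A' : Type} [CommRing A] [CommRing A'] [Algebra A A'] {h : A} {ξ : A'}

theorem koszulExact (H : IsQuadratic h ξ) {u v : A} (hK : KoszulExact u v) :
    KoszulExact (algebraMap A A' u) (algebraMap A A' v) := by
  intro x y hxy
  obtain ⟨x₀, x₁, rfl⟩ := H.exists_eq x
  obtain ⟨y₀, y₁, rfl⟩ := H.exists_eq y
  obtain ⟨h0, h1⟩ := H.eq_of_eq (p := u * x₀) (q := u * x₁) (p' := v * y₀) (q' := v * y₁) (by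
    simp only [map_mul]; linear_combination hxy)
  obtain ⟨c, rfl, rfl⟩ := hK _ _ h0
  obtain ⟨d, rfl, rfl⟩ := hK _ _ h1
  exact ⟨algebraMap A A' c + algebraMap A A' d * ξ, by simp only [map_mul]; ring,
    by simp only [map_mul]; ring⟩

theorem mem_nonZeroDivisors (H : IsQuadratic h ξ) {u : A} (hu : u ∈ nonZeroDivisors A) :
    algebraMap A A' u ∈ nonZeroDivisors A' := by
  rw [mem_nonZeroDivisors_iff_left]
  intro x hx
  obtain ⟨x₀, x₁, rfl⟩ := H.exists_eq x
  obtain ⟨h0, h1⟩ := H.eq_of_eq (p := u * x₀) (q := u * x₁) (p' := 0) (q' := 0) (by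
    simp only [map_mul, map_zero]; linear_combination hx)
  rw [mem_nonZeroDivisors_iff_left] at hu
  rw [hu _ h0, hu _ h1]
  simp

theorem finite (H : IsQuadratic h ξ) : Module.Finite A A' := by
  classical
  refine ⟨{1, ξ}, Submodule.eq_top_iff'.mpr fun z => ?_⟩
  obtain ⟨p, q, rfl⟩ := H.exists_eq z
  rw [Finset.coe_pair, Submodule.mem_span_pair]
  exact ⟨p, q, by simp only [Algebra.smul_def, mul_one]⟩

theorem dvd_of_mem_span {s b m p q : A} (H : IsQuadratic (b ^ 2 + s * m) ξ)
    (hz : algebraMap A A' p + algebraMap A A' q * ξ ∈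
      Ideal.span {algebraMap A A' s, ξ - algebraMap A A' b}) : s ∣ p + q * b := by
  obtain ⟨u, v, huv⟩ := Ideal.mem_span_pair.mp hz
  obtain ⟨u₀, u₁, rfl⟩ := H.exists_eq u
  obtain ⟨v₀, v₁, rfl⟩ := H.exists_eq v
  have hsq := H.sq
  simp only [map_add, map_mul, map_pow] at hsq
  obtain ⟨rfl, rfl⟩ := H.eq_of_eq (p := p) (q := q) (p' := s * u₀ + v₁ * (b ^ 2 + s * m) - b * v₀)
    (q' := s * u₁ + v₀ - b * v₁) (by
    simp only [map_mul, map_add, map_sub, map_pow]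
    linear_combination -huv + algebraMap A A' v₁ * hsq)
  exact ⟨u₀ + v₁ * m + u₁ * b, by ring⟩

/-- The inverse image of `s = 0` is the union of `s = ξ - a = 0` and `s = ξ + a = 0`. -/
theorem span_inf_span {s a c : A} (H : IsQuadratic (a ^ 2 + 4 * s ^ 2 * c) ξ)
    (hK : KoszulExact s a) (h2 : IsUnit (2 : A)) :
    Ideal.span {algebraMap A A' s, ξ - algebraMap A A' a} ⊓
      Ideal.span {algebraMap A A' s, ξ + algebraMap A A' a} = Ideal.span {algebraMap A A' s} := by
  refine le_antisymm (fun z hz => ?_) (le_inf ?_ ?_)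
  · obtain ⟨p, q, rfl⟩ := H.exists_eq z
    obtain ⟨k, hk⟩ := dvd_of_mem_span (s := s) (b := a) (m := 4 * s * c)
      (by convert H using 1; ring) hz.1
    obtain ⟨l, hl⟩ := dvd_of_mem_span (s := s) (b := -a) (p := p) (q := q) (m := 4 * s * c)
      (by convert H using 1; ring) (by rw [map_neg, sub_neg_eq_add]; exact hz.2)
    obtain ⟨e, he⟩ := h2.exists_left_inv
    obtain ⟨d, -, rfl⟩ := hK (e * (k - l)) q (by
      linear_combination -e * hk + e * hl + q * a * he)
    rw [Ideal.mem_span_singleton]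
    refine ⟨algebraMap A A' (e * (k + l)) + algebraMap A A' d * ξ, ?_⟩
    have hp : p = s * (e * (k + l)) := by linear_combination e * hk + e * hl - p * he
    rw [hp]
    simp only [map_mul]
    ring
  all_goals exact Ideal.span_mono (Set.singleton_subset_iff.mpr (Set.mem_insert _ _))

end IsQuadratic

theorem ringKrullDim_eq_two {O : Type} [CommRing O] [IsLocalRing O] [IsNoetherianRing O] {s a : O}
    (hs : s ∈ IsLocalRing.maximalIdeal O) (ha : a ∈ IsLocalRing.maximalIdeal O)
    (hd : s ∈ nonZeroDivisors O) (hK : KoszulExact s a)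
    (h : ∀ Q : Ideal O, Q.IsPrime → s ∈ Q → a ∈ Q → Q = IsLocalRing.maximalIdeal O) :
    ringKrullDim O = 2 := by
  have : Nontrivial (O ⧸ Ideal.span {s}) := Ideal.Quotient.nontrivial_iff.mpr
    (ne_top_of_le_ne_top (IsLocalRing.maximalIdeal.isMaximal O).ne_top
      ((Ideal.span_singleton_le_iff_mem _).mpr hs))
  have : IsLocalRing (O ⧸ Ideal.span {s}) :=
    .of_surjective' (Ideal.Quotient.mk _) Ideal.Quotient.mk_surjective
  let a' := Ideal.Quotient.mk (Ideal.span {s}) a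
  have ha' : a' ∈ IsLocalRing.maximalIdeal (O ⧸ Ideal.span {s}) := by
    have : IsLocalHom (Ideal.Quotient.mk (Ideal.span {s})) :=
      .of_surjective _ Ideal.Quotient.mk_surjective
    exact map_nonunit _ a ha
  have hd' : a' ∈ nonZeroDivisors (O ⧸ Ideal.span {s}) := mem_nonZeroDivisors_quotient fun y hy => by
    obtain ⟨x, hx⟩ := Ideal.mem_span_singleton.mp hy
    obtain ⟨c, -, rfl⟩ := hK x y hx.symm
    exact Ideal.mem_span_singleton.mpr ⟨c, rfl⟩
  let T := (O ⧸ Ideal.span {s}) ⧸ Ideal.span {a'}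
  have : Nontrivial T := Ideal.Quotient.nontrivial_iff.mpr
    (ne_top_of_le_ne_top (IsLocalRing.maximalIdeal.isMaximal _).ne_top
      ((Ideal.span_singleton_le_iff_mem _).mpr ha'))
  let φ : O →+* T := (Ideal.Quotient.mk _).comp (Ideal.Quotient.mk _)
  have hφ : Function.Surjective φ :=
    Ideal.Quotient.mk_surjective.comp Ideal.Quotient.mk_surjective
  have hT : ringKrullDim T = 0 := by
    rw [← ringKrullDimZero_iff_ringKrullDim_eq_zero]
    refine .mk₀ fun I hI => ?_
    have := h (I.comap φ) (Ideal.comap_isPrime φ I)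
      (by
        rw [Ideal.mem_comap]
        convert I.zero_mem
        change Ideal.Quotient.mk _ (Ideal.Quotient.mk _ s) = 0
        rw [Ideal.Quotient.eq_zero_iff_mem.mpr (Ideal.mem_span_singleton_self s), map_zero])
      (by
        rw [Ideal.mem_comap]
        convert I.zero_mem
        exact Ideal.Quotient.eq_zero_iff_mem.mpr (Ideal.mem_span_singleton_self a'))
    have hm : (I.comap φ).IsMaximal := this ▸ IsLocalRing.maximalIdeal.isMaximal O
    rw [← Ideal.map_comap_of_surjective φ hφ I]
    exact (Ideal.map_eq_top_or_isMaximal_of_surjective φ hφ hm).resolve_left (by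
      rw [Ideal.map_comap_of_surjective φ hφ]
      exact hI.ne_top)
  rw [← ringKrullDim_quotient_span_singleton_succ_eq_ringKrullDim_of_mem_nonZeroDivisors hd hs,
    ← ringKrullDim_quotient_span_singleton_succ_eq_ringKrullDim_of_mem_nonZeroDivisors hd' ha', hT]
  rfl

theorem specializes_of_ptIdeal_le {Y : Scheme.{0}} {V : Y.Opens} (hV : IsAffineOpen V) {x y : Y}
    {hx : x ∈ V} {hy : y ∈ V} (h : ptIdeal V y hy ≤ ptIdeal V x hx) : y ⤳ x := by
  rw [← primeIdealOf_asIdeal_eq hV, ← primeIdealOf_asIdeal_eq hV] at h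
  have := ((PrimeSpectrum.le_iff_specializes (hV.primeIdealOf ⟨y, hy⟩)
    (hV.primeIdealOf ⟨x, hx⟩)).mp h).map hV.fromSpec.continuous
  rwa [hV.fromSpec_primeIdealOf, hV.fromSpec_primeIdealOf] at this

namespace TateData

variable {B : Scheme.{0}} {N : ℕ} {D : TateData B N} {X : Scheme.{0}} {ρ : X ⟶ B}
  (C : DoubleCover D.P ρ D.limitBranch)

theorem Patch.isUnit_two (p : D.Patch) (f : B ⟶ SpecC) : IsUnit (2 : Γ(B, p.V)) :=
  isUnit_two_of_complex (sectionScalars f p.V)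

theorem coverSigma_eq_inf (f : B ⟶ SpecC) (hK : ∀ p : D.Patch, KoszulExact p.σ p.a₁) (x : X) :
    D.coverSigma C x = D.stack C 1 x ⊓ D.stack C (-1) x := by
  obtain ⟨p, hx, -⟩ := Patch.exists_mem (D := D) ⊤ (ρ x) trivial
  replace hx : x ∈ ρ ⁻¹ᵁ p.V := hx
  let := (germAt (ρ ⁻¹ᵁ p.V) x hx).toAlgebra
  have := isLocalization_stalk (p.isAffineOpen_preimage C) x hx
  have key := congrArg (Ideal.map (algebraMap _ (X.presheaf.stalk x)))
    ((p.isQuadratic C).span_inf_span (hK p) (p.isUnit_two f))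
  rw [IsLocalization.map_inf (ptIdeal (ρ ⁻¹ᵁ p.V) x hx).primeCompl] at key
  have e : ∀ {K : Type} (g : K → Γ(X, ρ ⁻¹ᵁ p.V)), Ideal.span (Set.range fun k => germAt _ x hx (g k)) =
      (Ideal.span (Set.range g)).map (algebraMap _ (X.presheaf.stalk x)) := fun g => by
    rw [Ideal.map_span, ← Set.range_comp]; rfl
  rw [p.generatedOn_sigma C x hx, p.generatedOn_stack C 1 x hx, p.generatedOn_stack C (-1) x hx,
    e, e, e]
  simp only [Matrix.range_cons, Matrix.range_empty, Set.union_empty, Set.singleton_union,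
    Int.cast_one, Int.cast_neg, one_mul, neg_mul, sub_neg_eq_add]
  exact key.symm

theorem preimage_iota_stack {ι : X ⟶ X} (hι : C.IsInvolution ι) (s : ℤ) :
    ι ⁻¹' zeroSet (D.stack C s) = zeroSet (D.stack C (-s)) := by
  rw [← zeroSet_pullIdeal, pullIdeal_iota_stack hι]

theorem Patch.mem_zeroSet_stack_iff (p : D.Patch) (s : ℤ) (x : X) (hx : x ∈ ρ ⁻¹ᵁ p.V) :
    x ∈ zeroSet (D.stack C s) ↔ algebraMap Γ(B, p.V) _ p.σ ∈ ptIdeal (ρ ⁻¹ᵁ p.V) x hx ∧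
      p.ξ C - (s : Γ(X, ρ ⁻¹ᵁ p.V)) * algebraMap Γ(B, p.V) _ p.a₁ ∈
        ptIdeal (ρ ⁻¹ᵁ p.V) x hx := by
  rw [(p.generatedOn_stack C s).zeroSet_iff hx]
  exact Fin.forall_fin_two

theorem zeroSet_stack_inter (f : B ⟶ SpecC) :
    zeroSet (D.stack C 1) ∩ zeroSet (D.stack C (-1)) = zeroSet (D.coverCenter C) := by
  ext x
  obtain ⟨p, hx, -⟩ := Patch.exists_mem (D := D) ⊤ (ρ x) trivial
  replace hx : x ∈ ρ ⁻¹ᵁ p.V := hx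
  rw [Set.mem_inter_iff, p.mem_zeroSet_stack_iff C _ x hx, p.mem_zeroSet_stack_iff C _ x hx,
    p.mem_zeroSet_cover_iff C x hx]
  simp only [Int.cast_one, Int.cast_neg, one_mul, neg_mul, sub_neg_eq_add]
  constructor
  · rintro ⟨⟨hs, h1⟩, -, h2⟩
    have hu : IsUnit (2 : Γ(X, ρ ⁻¹ᵁ p.V)) := isUnit_two_of_complex (sectionScalars (ρ ≫ f) _)
    have hm : ∀ z, 2 * z ∈ ptIdeal (ρ ⁻¹ᵁ p.V) x hx → z ∈ ptIdeal (ρ ⁻¹ᵁ p.V) x hx := fun z hz =>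
      (Ideal.unit_mul_mem_iff_mem _ hu).mp hz
    refine ⟨hs, hm _ ?_, hm _ ?_⟩
    · convert sub_mem h2 h1 using 1; ring
    · convert add_mem h1 h2 using 1; ring
  · rintro ⟨hs, ha, hξ⟩
    exact ⟨⟨hs, sub_mem hξ ha⟩, hs, add_mem hξ ha⟩

theorem ringKrullDim_stalk_eq_two (f : B ⟶ SpecC) [LocallyOfFiniteType f] [IsIntegral X]
    [IsIntegral B] (hK : ∀ p : D.Patch, KoszulExact p.σ p.a₁) (x : X)
    (hx : x ∈ zeroSet (D.coverCenter C))
    (hmax : ∀ y ∈ zeroSet (D.coverCenter C), y ⤳ x → y = x) :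
    ringKrullDim (X.presheaf.stalk x) = 2 := by
  obtain ⟨p, hxp, -⟩ := Patch.exists_mem (D := D) ⊤ (ρ x) trivial
  replace hxp : x ∈ ρ ⁻¹ᵁ p.V := hxp
  have hV := p.isAffineOpen_preimage C
  have H := p.isQuadratic C
  let := (germAt (ρ ⁻¹ᵁ p.V) x hxp).toAlgebra
  have := isLocalization_stalk hV x hxp
  have : Module.Flat Γ(X, ρ ⁻¹ᵁ p.V) (X.presheaf.stalk x) :=
    IsLocalization.flat _ (ptIdeal (ρ ⁻¹ᵁ p.V) x hxp).primeCompl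
  have := H.finite
  obtain ⟨hs, ha, -⟩ := (p.mem_zeroSet_cover_iff C x hxp).mp hx
  have : IsNoetherianRing (X.presheaf.stalk x) := by
    have := isNoetherianRing_sections f p.affine
    have := isNoetherian_of_isNoetherianRing_of_finite Γ(B, p.V) Γ(X, ρ ⁻¹ᵁ p.V)
    have : IsNoetherianRing Γ(X, ρ ⁻¹ᵁ p.V) := isNoetherian_of_tower Γ(B, p.V) this
    exact IsLocalization.isNoetherianRing (ptIdeal (ρ ⁻¹ᵁ p.V) x hxp).primeCompl _ this
  refine ringKrullDim_eq_two (s := germAt (ρ ⁻¹ᵁ p.V) x hxp (algebraMap Γ(B, p.V) _ p.σ))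
    (a := germAt (ρ ⁻¹ᵁ p.V) x hxp (algebraMap Γ(B, p.V) _ p.a₁)) hs ha
    (mem_nonZeroDivisors_of_flat (H.mem_nonZeroDivisors (p.sigma_mem_nonZeroDivisors C)))
    (H.koszulExact (hK p)).of_flat fun Q hQ h1 h2 => ?_
  let P := Q.comap (germAt (ρ ⁻¹ᵁ p.V) x hxp)
  have hP : P.IsPrime := Ideal.comap_isPrime _ Q
  obtain ⟨y, hy, hyP⟩ := exists_ptIdeal_eq hV P hP
  have hle : P ≤ ptIdeal (ρ ⁻¹ᵁ p.V) x hxp :=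
    Ideal.comap_mono (IsLocalRing.le_maximalIdeal hQ.ne_top)
  have hξ : p.ξ C ∈ P := by
    refine hP.mem_of_pow_mem 2 ?_
    rw [H.sq]
    simp only [map_add, map_mul, map_pow]
    exact add_mem (Ideal.pow_mem_of_mem P h2 2 two_pos) (Ideal.mul_mem_right _ _
      (Ideal.mul_mem_left _ _ (Ideal.pow_mem_of_mem P h1 2 two_pos)))
  have hyx := hmax y ((p.mem_zeroSet_cover_iff C y hy).mpr
    (by rw [hyP]; exact ⟨h1, h2, hξ⟩)) (specializes_of_ptIdeal_le hV (hyP.le.trans hle))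
  subst hyx
  rw [← IsLocalization.map_under (ptIdeal (ρ ⁻¹ᵁ p.V) y hxp).primeCompl _ Q,
    ← IsLocalization.map_under (ptIdeal (ρ ⁻¹ᵁ p.V) y hxp).primeCompl _
      (IsLocalRing.maximalIdeal (X.presheaf.stalk y))]
  exact congrArg _ hyP.symm

end TateData

/-! ## The proper transforms of the stack -/

section LocalRing

variable {O : Type} [CommRing O]

theorem colon_span_singleton_mul {d s t : O} (hd : d ∈ nonZeroDivisors O) :
    (Ideal.span {d * s, d * t}).colon (Ideal.span {d} : Set O) = Ideal.span {s, t} := by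
  ext z
  rw [Ideal.mem_colon_span_singleton, Ideal.mem_span_pair, Ideal.mem_span_pair]
  constructor
  · rintro ⟨u, v, h⟩
    exact ⟨u, v, (mul_cancel_left_mem_nonZeroDivisors hd).mp (by linear_combination h)⟩
  · rintro ⟨u, v, rfl⟩
    exact ⟨u, v, by ring⟩

/-- The decomposition of the total transform of `σ = 0`, in a local ring of the blow-up. -/
theorem stack_decomposition [IsLocalRing O] (h2 : IsUnit (2 : O)) {σ a ξ c d : O}
    (hsq : ξ ^ 2 = a ^ 2 + 4 * σ ^ 2 * c) (hd : d ∈ nonZeroDivisors O) (hda : d = σ ∨ d = a)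
    (hσ : d ∣ σ) (ha : d ∣ a) (hξ : d ∣ ξ) :
    ((Ideal.span {σ, ξ - a}).colon (Ideal.span {d} : Set O) = ⊤ ∨
      (Ideal.span {σ, ξ + a}).colon (Ideal.span {d} : Set O) = ⊤) ∧
    Ideal.span {σ} = Ideal.span {d} * (Ideal.span {σ, ξ - a}).colon (Ideal.span {d} : Set O) *
      (Ideal.span {σ, ξ + a}).colon (Ideal.span {d} : Set O) := by
  obtain ⟨s, rfl⟩ := hσ
  obtain ⟨α, rfl⟩ := ha
  obtain ⟨r, rfl⟩ := hξ
  have hr : r ^ 2 = α ^ 2 + 4 * s ^ 2 * c :=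
    (mul_cancel_left_mem_nonZeroDivisors (pow_mem hd 2)).mp (by linear_combination hsq)
  rw [← mul_sub, ← mul_add, colon_span_singleton_mul hd, colon_span_singleton_mul hd]
  have ht : ∀ {x y : O}, IsUnit x → Ideal.span {x, y} = ⊤ := fun hx =>
    Ideal.eq_top_of_isUnit_mem _ (Ideal.subset_span (Set.mem_insert _ _)) hx
  have ht' : ∀ {x y : O}, IsUnit y → Ideal.span {x, y} = ⊤ := fun hx =>
    Ideal.eq_top_of_isUnit_mem _ (Ideal.subset_span (Set.mem_insert_of_mem _ rfl)) hx
  have hle : ∀ {x : O}, s ∣ x → Ideal.span {s, x} = Ideal.span {s} := fun hx =>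
    le_antisymm (Ideal.span_le.mpr (by
      rintro _ (rfl | rfl)
      exacts [Ideal.mem_span_singleton_self _, Ideal.mem_span_singleton.mpr hx]))
      (Ideal.span_mono (Set.singleton_subset_iff.mpr (Set.mem_insert _ _)))
  rcases hda with h | h
  · obtain rfl : s = 1 := ((mul_cancel_left_mem_nonZeroDivisors hd).mp
      (show d * 1 = d * s by rw [mul_one, ← h])).symm
    rw [ht isUnit_one, ht isUnit_one]
    exact ⟨Or.inl rfl, by simp only [Ideal.mul_top, mul_one]⟩
  · obtain rfl : α = 1 := ((mul_cancel_left_mem_nonZeroDivisors hd).mp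
      (show d * 1 = d * α by rw [mul_one, ← h])).symm
    rcases IsLocalRing.isUnit_or_isUnit_of_isUnit_add
      (show IsUnit ((1 - r) + (r + 1)) by convert h2 using 1; ring) with hu | hu
    · rw [show 1 - r = -(r - 1) by ring, IsUnit.neg_iff] at hu
      have : s ∣ r + 1 := (hu.dvd_mul_left).mp ⟨4 * s * c, by linear_combination hr⟩
      rw [ht' hu, hle this, Ideal.mul_top, Ideal.span_singleton_mul_span_singleton]
      exact ⟨Or.inl rfl, rfl⟩
    · have : s ∣ r - 1 := (hu.dvd_mul_left).mp ⟨4 * s * c, by linear_combination hr⟩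
      rw [ht' hu, hle this, Ideal.mul_top, Ideal.span_singleton_mul_span_singleton]
      exact ⟨Or.inr rfl, rfl⟩

end LocalRing

/-- In the chart of the blow-up on which `u` generates the centre, the proper transform of the
stack has no component in the exceptional divisor. -/
theorem exists_prime_of_slope {A R : Type} [CommRing A] [CommRing R] {u v : A}
    [Algebra (SlopeChart u v) R] [Algebra A R] [IsScalarTower A (SlopeChart u v) R]
    {c : SlopeChart u v} {r : R} (H : IsQuadratic c r) (hK : KoszulExact u v) (e : ℤ)
    (he : e ^ 2 = 1) (hc : ∃ d, c = 1 + SlopeChart.t u v * d) (q : Ideal R) [q.IsPrime]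
    (ht : algebraMap _ R (SlopeChart.t u v) ∈ q) (hr : r - e ∈ q) :
    ∃ Q : Ideal R, Q.IsPrime ∧ Q ≤ q ∧ algebraMap _ R (SlopeChart.t u v) ∈ Q ∧ r - e ∈ Q ∧
      algebraMap A R u ∉ Q := by
  let T := A ⧸ Ideal.span {v}
  have hv : algebraMap A T v = 0 :=
    Ideal.Quotient.eq_zero_iff_mem.mpr (Ideal.mem_span_singleton_self v)
  have hnzd : algebraMap A T u ∈ nonZeroDivisors T := mem_nonZeroDivisors_quotient fun y hy => by
    obtain ⟨x, hx⟩ := Ideal.mem_span_singleton.mp hy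
    obtain ⟨k, rfl, -⟩ := hK y x hx
    exact Ideal.mem_span_singleton.mpr ⟨k, rfl⟩
  let χ : SlopeChart u v →ₐ[A] T := SlopeChart.lift (0 : T) (by rw [mul_zero, hv])
  have hχ : χ (SlopeChart.t u v) = 0 := SlopeChart.lift_t _ _
  let := χ.toRingHom.toAlgebra
  obtain ⟨φ, hφ⟩ := H.exists_lift (C := T) (e : T) (by
    obtain ⟨d, rfl⟩ := hc
    change _ = χ _
    rw [map_add, map_mul, hχ, zero_mul, map_one, add_zero, ← Int.cast_pow, he, Int.cast_one])
  have hφS : ∀ z, φ (algebraMap _ R z) = χ z := φ.commutes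
  have hφA : ∀ z, φ (algebraMap A R z) = algebraMap A T z := fun z => by
    rw [IsScalarTower.algebraMap_apply A (SlopeChart u v) R, hφS, χ.commutes]
  have hker : RingHom.ker φ ≤ q := fun g hg => by
    obtain ⟨s₀, s₁, rfl⟩ := H.exists_eq g
    have hS : ∀ s : SlopeChart u v, ∃ p w, s = algebraMap A _ p + SlopeChart.t u v * w := fun s => by
      obtain ⟨P, rfl⟩ := Ideal.Quotient.mk_surjective s
      refine ⟨P.coeff 0, Ideal.Quotient.mk _ P.divX, ?_⟩
      conv_lhs => rw [← P.X_mul_divX_add, map_add, map_mul, add_comm]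
      rfl
    obtain ⟨p₀, w₀, rfl⟩ := hS s₀
    obtain ⟨p₁, w₁, rfl⟩ := hS s₁
    rw [RingHom.mem_ker, map_add, map_mul, hφ, hφS, hφS] at hg
    simp only [map_add, map_mul, hχ, zero_mul, add_zero, AlgHom.commutes] at hg
    have hg' : algebraMap A T (p₀ + p₁ * e) = 0 := by
      rw [map_add, map_mul, map_intCast]; exact hg
    obtain ⟨m, hm⟩ := Ideal.mem_span_singleton.mp (Ideal.Quotient.eq_zero_iff_mem.mp hg')
    have hm' := congrArg (algebraMap A R) hm
    rw [map_add, map_mul, map_mul, map_intCast,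
      IsScalarTower.algebraMap_apply A (SlopeChart u v) R v, ← SlopeChart.algebraMap_mul_t,
      map_mul] at hm'
    have : algebraMap _ R (algebraMap A (SlopeChart u v) p₀ + SlopeChart.t u v * w₀) +
        algebraMap _ R (algebraMap A (SlopeChart u v) p₁ + SlopeChart.t u v * w₁) * r =
      algebraMap _ R (SlopeChart.t u v) * (algebraMap _ R w₀ + algebraMap _ R w₁ * r +
        algebraMap _ R (algebraMap A (SlopeChart u v) u) * algebraMap A R m) +
        (r - e) * algebraMap A R p₁ := by
      simp only [map_add, map_mul, ← IsScalarTower.algebraMap_apply A (SlopeChart u v) R] at hm' ⊢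
      linear_combination hm'
    rw [this]
    exact add_mem (Ideal.mul_mem_right _ _ ht) (Ideal.mul_mem_right _ _ hr)
  obtain ⟨Q, hQ, h1, h2⟩ := Ideal.exists_le_prime_disjoint (RingHom.ker φ)
    (q.primeCompl ⊔ Submonoid.powers (algebraMap A R u)) (by
      rw [Set.disjoint_left]
      intro x hx hM
      obtain ⟨y, hy, _, ⟨n, rfl⟩, rfl⟩ := Submonoid.mem_sup.mp hM
      refine hy (hker ?_)
      have hx' : φ (y * algebraMap A R u ^ n) = 0 := hx
      rw [map_mul, map_pow, hφA] at hx'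
      exact (mul_right_mem_nonZeroDivisors_eq_zero_iff (pow_mem hnzd n)).mp hx')
  refine ⟨Q, hQ, fun x hx => ?_, h1 ?_, h1 ?_, fun hx => ?_⟩
  · by_contra hn
    exact Set.disjoint_left.mp h2 hx (Submonoid.mem_sup_left (S := q.primeCompl) hn)
  · exact (hφS _).trans hχ
  · rw [RingHom.mem_ker, map_sub, map_intCast, hφ, sub_self]
  · exact Set.disjoint_left.mp h2 hx (Submonoid.mem_sup_right ⟨1, pow_one _⟩)

section Chart

variable {T Y : Scheme.{0}} {W : Y.Opens} {R : Type} [CommRing R]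

theorem stalkMap_chart (hW : IsAffineOpen W) (φ : Γ(Y, W) →+* R)
    (j : Spec (CommRingCat.of R) ⟶ T) (g : T ⟶ Y)
    (hj : j ≫ g = Spec.map (CommRingCat.ofHom φ) ≫ hW.fromSpec) (q : PrimeSpectrum R)
    (hq : j q ∈ g ⁻¹ᵁ W) (x : Γ(Y, W)) :
    (j.stalkMap q).hom (germAt (g ⁻¹ᵁ W) (j q) hq ((g.app W).hom x)) = germSpec q (φ x) := by
  have key : ∀ (m : Spec (CommRingCat.of R) ⟶ Y),
      m = Spec.map (CommRingCat.ofHom φ) ≫ hW.fromSpec → ∀ hm : m q ∈ W,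
      (m.stalkMap q).hom (germAt W (m q) hm x) = germSpec q (φ x) := by
    rintro _ rfl hm
    exact stalkMap_specMap_fromSpec hW φ q x
  rw [← key _ hj hq]
  exact (stalkMap_germAt j (g ⁻¹ᵁ W) q hq _).trans (stalkMap_germAt (j ≫ g) W q hq x).symm

theorem germAt_mem_span_of_chart (hW : IsAffineOpen W) (φ : Γ(Y, W) →+* R)
    (j : Spec (CommRingCat.of R) ⟶ T) [IsOpenImmersion j] (g : T ⟶ Y)
    (hj : j ≫ g = Spec.map (CommRingCat.ofHom φ) ≫ hW.fromSpec) (q : PrimeSpectrum R)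
    (hq : j q ∈ g ⁻¹ᵁ W) {x₁ x₂ : Γ(Y, W)} {z : R} (h : φ x₁ = φ x₂ * z) (hz : z ∉ q.asIdeal) :
    germAt (g ⁻¹ᵁ W) (j q) hq ((g.app W).hom x₂) ∈
      Ideal.span {germAt (g ⁻¹ᵁ W) (j q) hq ((g.app W).hom x₁)} := by
  obtain ⟨w, hw⟩ := (isUnit_germSpec.mpr hz).exists_right_inv
  obtain ⟨w', rfl⟩ := (stalkMap_bijective j q).2 w
  rw [Ideal.mem_span_singleton]
  refine ⟨w', (stalkMap_bijective j q).1 ?_⟩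
  have e := stalkMap_chart hW φ j g hj q hq
  refine (e x₂).trans (Eq.trans ?_ (map_mul _ _ _).symm)
  refine Eq.trans ?_ (congrArg (· * _) (e x₁)).symm
  have h' := congrArg (germSpec q) h
  rw [map_mul] at h'
  refine Eq.trans ?_ (congrArg (· * _) h').symm
  rw [mul_assoc]
  exact (mul_one _).symm.trans (congrArg (_ * ·) hw.symm)

end Chart

namespace TateData

variable {B : Scheme.{0}} {N : ℕ} {D : TateData B N} {X X' : Scheme.{0}} {ρ : X ⟶ B}
  (C : DoubleCover D.P ρ D.limitBranch) {π : X' ⟶ X}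

/-- The local generators `σ`, `ξ - s a₁` of the ideal of the stack. -/
abbrev Patch.stackGen (p : D.Patch) (s : ℤ) : Fin 2 → Γ(X, ρ ⁻¹ᵁ p.V) :=
  ![algebraMap Γ(B, p.V) _ p.σ, p.ξ C - (s : Γ(X, ρ ⁻¹ᵁ p.V)) * algebraMap Γ(B, p.V) _ p.a₁]

theorem mem_zeroSet_properTransformIdeal_iff (s : ℤ) (y : X') :
    y ∈ zeroSet (D.properTransformIdeal C π s) ↔
      ¬ pullIdeal π (D.coverCenter C) y ≤ pullIdeal π (D.stack C s) y :=
  not_congr (Submodule.colon_eq_top_iff_subset _)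

theorem stack_le_coverCenter (s : ℤ) (x : X) : D.stack C s x ≤ D.coverCenter C x := by
  obtain ⟨p, hx, -⟩ := Patch.exists_mem (D := D) ⊤ (ρ x) trivial
  rw [p.generatedOn_cover C x hx, p.generatedOn_stack C s x hx, Ideal.span_le]
  rintro _ ⟨k, rfl⟩
  fin_cases k
  · exact Ideal.subset_span ⟨0, rfl⟩
  · change germAt _ x hx (p.ξ C - (s : Γ(X, ρ ⁻¹ᵁ p.V)) * algebraMap Γ(B, p.V) _ p.a₁) ∈ _
    rw [map_sub, map_mul]
    exact sub_mem (Ideal.subset_span ⟨2, rfl⟩)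
      (Ideal.mul_mem_left _ _ (Ideal.subset_span ⟨1, rfl⟩))

theorem notMem_zeroSet_properTransformIdeal_iff (hc : IsCartier (pullIdeal π (D.coverCenter C)))
    (s : ℤ) (p : D.Patch) (y : X') (hy : π y ∈ ρ ⁻¹ᵁ p.V) :
    y ∉ zeroSet (D.properTransformIdeal C π s) ↔
      ∃ k, GoodAt (D.coverCenter C) (ρ ⁻¹ᵁ p.V) (p.stackGen C s k) π y := by
  rw [mem_zeroSet_properTransformIdeal_iff, not_not]
  have hg := (p.generatedOn_stack C s).pullIdeal π y hy
  constructor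
  · intro h
    obtain ⟨d, hd, he⟩ := hc y
    have h1 : pullIdeal π (D.stack C s) y = Ideal.span {d} :=
      (le_antisymm (Ideal.map_mono (stack_le_coverCenter C s (π y))) h).trans he
    obtain ⟨k, hk⟩ := exists_span_eq_of_isLocalRing _ hd (hg.symm.trans h1)
    exact ⟨k, hy, he.trans hk.symm, mem_nonZeroDivisors_of_span_eq hd hk.symm⟩
  · rintro ⟨k, _, h, -⟩
    rw [hg]
    refine h.le.trans ((Ideal.span_singleton_le_iff_mem _).mpr ?_)
    exact Ideal.subset_span ⟨k, rfl⟩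

theorem isClosed_zeroSet_properTransformIdeal (hπ : IsBlowup (D.coverCenter C) π) (s : ℤ) :
    IsClosed (zeroSet (D.properTransformIdeal C π s)) := by
  rw [← isOpen_compl_iff]
  have : (zeroSet (D.properTransformIdeal C π s))ᶜ = ⋃ (p : D.Patch) (k : Fin 2),
      {y | GoodAt (D.coverCenter C) (ρ ⁻¹ᵁ p.V) (p.stackGen C s k) π y} := by
    ext y
    rw [Set.mem_compl_iff, Set.mem_iUnion]
    obtain ⟨p, hp, -⟩ := Patch.exists_mem (D := D) ⊤ (ρ (π y)) trivial
    constructor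
    · intro h
      obtain ⟨k, hk⟩ := (notMem_zeroSet_properTransformIdeal_iff C hπ.cartier s p y hp).mp h
      exact ⟨p, Set.mem_iUnion.mpr ⟨k, hk⟩⟩
    · rintro ⟨p, h⟩
      obtain ⟨k, hk⟩ := Set.mem_iUnion.mp h
      exact (notMem_zeroSet_properTransformIdeal_iff C hπ.cartier s p y hk.1).mpr ⟨k, hk⟩
  rw [this]
  exact isOpen_iUnion fun p => isOpen_iUnion fun k =>
    isOpen_genAt ((locallyFG_coverCenter C).pullIdeal π) hπ.cartier _ _

theorem properTransform_subset (hπ : IsBlowup (D.coverCenter C) π) (s : ℤ) :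
    D.properTransform C π s ⊆ zeroSet (D.properTransformIdeal C π s) := by
  refine closure_minimal ?_ (isClosed_zeroSet_properTransformIdeal C hπ s)
  rintro y ⟨h1, h2⟩
  rw [mem_zeroSet_properTransformIdeal_iff]
  intro h
  have e : pullIdeal π (D.coverCenter C) y = ⊤ := by
    rw [← Set.mem_preimage, ← zeroSet_pullIdeal] at h2
    exact not_not.mp h2
  rw [← Set.mem_preimage, ← zeroSet_pullIdeal] at h1
  exact h1 (top_le_iff.mp (e ▸ h))

theorem chartCoord_one_zero {A : Type} [CommRing A] (σ a₁ : A) :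
    chartCoord σ a₁ 1 0 = SlopeChart.t _ _ := if_neg (by decide)

theorem Patch.mem_properTransform_of_chart (p : D.Patch) {R : Type} [CommRing R]
    [Algebra Γ(B, p.V) R] (φ : Γ(X, ρ ⁻¹ᵁ p.V) →ₐ[Γ(B, p.V)] R) {t r : R} {s : ℤ}
    (hξ : φ (p.ξ C) = algebraMap Γ(B, p.V) R p.a₁ * r)
    (hσ : algebraMap Γ(B, p.V) R p.σ = algebraMap Γ(B, p.V) R p.a₁ * t)
    (j : Spec (CommRingCat.of R) ⟶ X') [IsOpenImmersion j]
    (hj : j ≫ π = Spec.map (CommRingCat.ofHom φ.toRingHom) ≫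
      (p.isAffineOpen_preimage C).fromSpec) (q : PrimeSpectrum R)
    (hQ : t ∈ q.asIdeal → r - s ∈ q.asIdeal → ∃ Q : Ideal R, Q.IsPrime ∧ Q ≤ q.asIdeal ∧ t ∈ Q ∧
      r - s ∈ Q ∧ algebraMap Γ(B, p.V) R p.a₁ ∉ Q)
    (hk : GoodAt (D.coverCenter C) (ρ ⁻¹ᵁ p.V) (algebraMap Γ(B, p.V) _ p.a₁) π (j q))
    (hy : j q ∈ zeroSet (D.properTransformIdeal C π s)) : j q ∈ D.properTransform C π s := by
  have hV := p.isAffineOpen_preimage C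
  obtain ⟨hp, hk1, -⟩ := hk
  rw [mem_zeroSet_properTransformIdeal_iff, hk1, Ideal.span_singleton_le_iff_mem,
    (p.generatedOn_stack C s).pullIdeal π (j q) hp] at hy
  have ha : φ (algebraMap _ _ p.a₁) = algebraMap Γ(B, p.V) R p.a₁ := φ.commutes _
  have hσ' : φ (algebraMap _ _ p.σ) = φ (algebraMap _ _ p.a₁) * t := by
    rw [ha, ← hσ]
    exact φ.commutes _
  have hξ' : φ (p.ξ C - (s : Γ(X, ρ ⁻¹ᵁ p.V)) * algebraMap _ _ p.a₁) =
      φ (algebraMap _ _ p.a₁) * (r - s) := by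
    rw [map_sub, map_mul, map_intCast, hξ, ha]
    ring
  have key := fun (k : Fin 2) z (h : φ (p.stackGen C s k) = φ (algebraMap _ _ p.a₁) * z) => by
    by_contra hz
    exact hy (Ideal.span_mono (by rintro _ rfl; exact ⟨k, rfl⟩)
      (germAt_mem_span_of_chart hV φ.toRingHom j π hj q hp h hz))
  obtain ⟨Q, hQp, hQq, h1, h2, h3⟩ := hQ (key 0 t hσ') (key 1 (r - s) hξ')
  let q' : PrimeSpectrum R := ⟨Q, hQp⟩
  have hmem : (j ≫ π) q' ∈ ρ ⁻¹ᵁ p.V := by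
    rw [hj]
    exact specMap_fromSpec_mem hV φ.toRingHom _
  have hiff := algebraMap_mem_iff_of_specMap hV φ.toRingHom (j ≫ π) hj q' _ hmem rfl
  have hspec : j q' ⤳ j q :=
    ((PrimeSpectrum.le_iff_specializes q' q).mp hQq).map j.continuous
  suffices h4 : j q' ∈ π ⁻¹' (zeroSet (D.stack C s) \ zeroSet (D.coverCenter C)) by
    exact closure_mono (Set.singleton_subset_iff.mpr h4) hspec.mem_closure
  refine ⟨?_, ?_⟩
  · refine (p.mem_zeroSet_stack_iff C s _ hmem).mpr ⟨(hiff _).mp ?_, (hiff _).mp ?_⟩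
    · exact (congrArg (· ∈ Q) hσ').mpr (Q.mul_mem_left _ h1)
    · exact (congrArg (· ∈ Q) hξ').mpr (Q.mul_mem_left _ h2)
  · intro h
    refine h3 ?_
    rw [← ha]
    exact (hiff _).mpr ((p.mem_zeroSet_cover_iff C _ hmem).mp h).2.1

theorem exists_prime_coverChart {A : Type} [CommRing A] {σ a₁ a₂₂ : A} (hK : KoszulExact σ a₁)
    {s : ℤ} (hs : s ^ 2 = 1) (q : Ideal (CoverChart σ a₁ a₂₂ 1)) [q.IsPrime]
    (ht : algebraMap _ (CoverChart σ a₁ a₂₂ 1) (chartCoord σ a₁ 1 0) ∈ q)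
    (hr : AdjoinRoot.root _ - (s : CoverChart σ a₁ a₂₂ 1) ∈ q) :
    ∃ Q : Ideal (CoverChart σ a₁ a₂₂ 1), Q.IsPrime ∧ Q ≤ q ∧
      algebraMap _ (CoverChart σ a₁ a₂₂ 1) (chartCoord σ a₁ 1 0) ∈ Q ∧
      AdjoinRoot.root _ - (s : CoverChart σ a₁ a₂₂ 1) ∈ Q ∧
      algebraMap A (CoverChart σ a₁ a₂₂ 1) (![σ, a₁] 1) ∉ Q := by
  rw [chartCoord_one_zero] at ht ⊢
  refine exists_prime_of_slope (SqrtAlg.isQuadratic (chartBranch σ a₁ a₂₂ 1)) hK.symm s hs ?_ q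
    ht hr
  refine ⟨4 * SlopeChart.t _ _ * algebraMap A _ a₂₂, ?_⟩
  rw [chartBranch, chartCoord_self, chartCoord_one_zero]
  ring

theorem subset_properTransform (hπ : IsBlowup (D.coverCenter C) π)
    (hK : ∀ p : D.Patch, KoszulExact p.σ p.a₁) (s : ℤ) (hs : s ^ 2 = 1) :
    zeroSet (D.properTransformIdeal C π s) ⊆ D.properTransform C π s := by
  intro y hy
  obtain ⟨p, hp, -⟩ := Patch.exists_mem (D := D) ⊤ (ρ (π y)) trivial
  replace hp : π y ∈ ρ ⁻¹ᵁ p.V := hp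
  obtain ⟨k, hk⟩ := p.exists_goodAt_cover C π hπ.cartier y hp
  obtain rfl : k = 1 := by
    by_contra h
    obtain rfl : k = 0 := by omega
    exact (notMem_zeroSet_properTransformIdeal_iff C hπ.cartier s p y hp).mpr ⟨0, hk⟩ hy
  obtain ⟨j, hj, h1, h2⟩ := hπ.exists_chart (locallyFG_coverCenter C)
    (p.isChart_coverChartMap C (hK p) 1)
  obtain ⟨q, rfl⟩ : y ∈ Set.range j := by rw [h2]; exact hk
  have hσ : algebraMap Γ(B, p.V) (CoverChart p.σ p.a₁ p.a₂₂ 1) p.σ =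
      algebraMap Γ(B, p.V) _ p.a₁ * algebraMap _ _ (chartCoord p.σ p.a₁ 1 0) := by
    have := congrArg (algebraMap _ (CoverChart p.σ p.a₁ p.a₂₂ 1))
      (algebraMap_mul_chartCoord p.σ p.a₁ 1 0)
    rwa [map_mul, ← IsScalarTower.algebraMap_apply, ← IsScalarTower.algebraMap_apply] at this
  exact p.mem_properTransform_of_chart C (p.coverChartHom C (hK p) 1)
    (p.coverChartHom_xi C (hK p) 1) hσ j h1 q (@exists_prime_coverChart _ _ _ _ _ (hK p) _ hs q.asIdeal q.2) hk hy

theorem zeroSet_properTransformIdeal (hπ : IsBlowup (D.coverCenter C) π)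
    (hK : ∀ p : D.Patch, KoszulExact p.σ p.a₁) (s : ℤ) (hs : s ^ 2 = 1) :
    zeroSet (D.properTransformIdeal C π s) = D.properTransform C π s :=
  (subset_properTransform C hπ hK s hs).antisymm (properTransform_subset C hπ s)

/-- At each point of the blow-up one of the two proper transforms is empty, and the total
transform of `σ = 0` decomposes. -/
theorem properTransformIdeal_decomposition (f : B ⟶ SpecC) (hπ : IsBlowup (D.coverCenter C) π)
    (y : X') : (D.properTransformIdeal C π 1 y = ⊤ ∨ D.properTransformIdeal C π (-1) y = ⊤) ∧
      pullIdeal π (D.coverSigma C) y = pullIdeal π (D.coverCenter C) y *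
        D.properTransformIdeal C π 1 y * D.properTransformIdeal C π (-1) y := by
  obtain ⟨p, hp, -⟩ := Patch.exists_mem (D := D) ⊤ (ρ (π y)) trivial
  replace hp : π y ∈ ρ ⁻¹ᵁ p.V := hp
  obtain ⟨k, _, hk, hd⟩ := p.exists_goodAt_cover C π hπ.cartier y hp
  obtain ⟨ψ, hψ⟩ : ∃ ψ, ψ = (germAt (π ⁻¹ᵁ ρ ⁻¹ᵁ p.V) y hp).comp (π.app (ρ ⁻¹ᵁ p.V)).hom :=
    ⟨_, rfl⟩
  have e : ∀ x, germAt (π ⁻¹ᵁ ρ ⁻¹ᵁ p.V) y hp ((π.app (ρ ⁻¹ᵁ p.V)).hom x) = ψ x := fun x => by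
    rw [hψ]; rfl
  have hs := fun s => (p.generatedOn_stack C s).pullIdeal π y hp
  have hσ := (p.generatedOn_sigma C).pullIdeal π y hp
  have hc := (p.generatedOn_cover C).pullIdeal π y hp
  simp only [e] at hk hd hs hσ hc
  have hdvd : ∀ l, ψ (p.coverGen C k.castSucc) ∣ ψ (p.coverGen C l) := fun l => by
    rw [← Ideal.mem_span_singleton, ← hk, hc]
    exact Ideal.subset_span ⟨l, rfl⟩
  have hsq := congrArg ψ (p.isQuadratic C).sq
  simp only [map_add, map_mul, map_pow, map_ofNat] at hsq
  have h2 : IsUnit (2 : X'.presheaf.stalk y) := isUnit_two_of_complex (scalars (π ≫ ρ ≫ f) y)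
  have hk0 : ψ (p.coverGen C k.castSucc) = ψ (algebraMap _ _ p.σ) ∨
      ψ (p.coverGen C k.castSucc) = ψ (algebraMap _ _ p.a₁) := by
    clear hdvd hd hk
    fin_cases k
    exacts [Or.inl rfl, Or.inr rfl]
  have key := stack_decomposition h2 hsq hd hk0 (hdvd 0) (hdvd 1) (hdvd 2)
  have h3 : ∀ g : Fin 2 → Γ(X, ρ ⁻¹ᵁ p.V), Set.range (fun k => ψ (g k)) = {ψ (g 0), ψ (g 1)} :=
    fun g => by
      ext z
      simp only [Set.mem_range, Fin.exists_fin_two, Set.mem_insert_iff, Set.mem_singleton_iff,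
        eq_comm]
  have h4 : ∀ g : Fin 1 → Γ(X, ρ ⁻¹ᵁ p.V), Set.range (fun k => ψ (g k)) = {ψ (g 0)} :=
    fun g => Set.range_unique
  simp only [properTransformIdeal, hs, hσ, hk, h3, h4, Matrix.cons_val_zero, Matrix.cons_val_one,
    map_sub, map_add, Int.cast_one, Int.cast_neg, one_mul, neg_mul, sub_neg_eq_add,
    Matrix.cons_val_fin_one]
  exact key

theorem disjoint_properTransform (f : B ⟶ SpecC) (hπ : IsBlowup (D.coverCenter C) π) :
    Disjoint (D.properTransform C π 1) (D.properTransform C π (-1)) := by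
  rw [Set.disjoint_left]
  intro y h1 h2
  rcases (properTransformIdeal_decomposition C f hπ y).1 with h | h
  · exact properTransform_subset C hπ _ h1 h
  · exact properTransform_subset C hπ _ h2 h

theorem preimage_properTransform {ι : X ⟶ X} (hι : C.IsInvolution ι) {ι' : X' ⟶ X'}
    (h1 : ι' ≫ π = π ≫ ι) (h2 : ι' ≫ ι' = 𝟙 X') (s : ℤ) :
    ι' ⁻¹' D.properTransform C π s = D.properTransform C π (-s) := by
  have : IsIso ι' := ⟨ι', h2, h2⟩
  have hc : ι ⁻¹' zeroSet (D.coverCenter C) = zeroSet (D.coverCenter C) := by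
    rw [← zeroSet_pullIdeal, pullIdeal_iota_coverCenter hι]
  have e : ∀ S : Set X, ι' ⁻¹' (π ⁻¹' S) = π ⁻¹' (ι ⁻¹' S) := fun S => by
    rw [← Set.preimage_comp, ← Set.preimage_comp]
    exact congrArg (fun m : X' ⟶ X => m ⁻¹' S) h1
  rw [properTransform, properTransform, ← preimage_iota_stack C hι, ← hc, ← Set.preimage_sdiff,
    ← e, hc]
  exact (ι'.homeomorph.preimage_closure _)

end TateData

end
end SppLimit

theorem mainTheorem4 {B : AlgebraicGeometry.Scheme.{0}} (f : B ⟶ SppLimit.SpecC) [IsIntegral B]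
    [IsSeparated f] [QuasiCompact f] (n : ℕ) [SmoothOfRelativeDimension n f]
    (N : ℕ) (D : SppLimit.TateData B N) (hD : D.Generic f)
    {X : AlgebraicGeometry.Scheme.{0}} [IsIntegral X] (ρ : X ⟶ B)
    (C : SppLimit.DoubleCover D.P ρ D.limitBranch) (ι : X ⟶ X) (hι : C.IsInvolution ι) :
    -- the limit is a weak coupling limit, with branch section and leading discriminant as stated
    (∀ i, D.limitBranch i = D.sppBranch i ∧
      Polynomial.X ∣ (D.family i).b₄ ∧ Polynomial.X ^ 2 ∣ (D.family i).b₆ ∧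
      (D.family i).Δ.coeff 0 = 0 ∧ (D.family i).Δ.coeff 1 = 0 ∧
      (D.family i).Δ.coeff 2 = D.sppBranch i ^ 2 * D.σ.val i ^ N * D.residualBrane i) ∧
    -- the double cover is the suspended pinch point
    (∀ i, C.ξ i ^ 2 = (ρ.app (D.P.U i)).hom (D.a₁.val i) ^ 2 +
      4 * (ρ.app (D.P.U i)).hom (D.σ.val i) ^ 2 * (ρ.app (D.P.U i)).hom (D.a₂₂.val i)) ∧
    -- its singular locus is `ξ = a₁ = σ = 0`, of pure codimension two
    ((SppLimit.smoothPart (ρ ≫ f) : Set X)ᶜ = SppLimit.zeroSet (D.coverCenter C)) ∧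
    (∀ x ∈ SppLimit.zeroSet (D.coverCenter C),
      (∀ y ∈ SppLimit.zeroSet (D.coverCenter C), y ⤳ x → y = x) →
        ringKrullDim (X.presheaf.stalk x) = 2) ∧
    -- the stack and its image in the double cover
    (∀ x, D.coverSigma C x = D.stack C 1 x ⊓ D.stack C (-1) x) ∧
    (ι ⁻¹' SppLimit.zeroSet (D.stack C 1) = SppLimit.zeroSet (D.stack C (-1))) ∧
    (SppLimit.zeroSet (D.stack C 1) ∩ SppLimit.zeroSet (D.stack C (-1)) =
      SppLimit.zeroSet (D.coverCenter C)) ∧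
    -- the blow-ups of the double cover and of the base
    ∃ (X' B' : AlgebraicGeometry.Scheme.{0}) (π : X' ⟶ X) (β : B' ⟶ B) (ρ' : X' ⟶ B')
      (ι' : X' ⟶ X') (e : ρ' ≫ β = π ≫ ρ),
      SppLimit.IsBlowup (D.coverCenter C) π ∧ SppLimit.IsBlowup D.baseCenter β ∧
      -- the blow-up is a crepant resolution
      SppLimit.IsCrepantResolution (ρ ≫ f) π n ∧
      -- the orientifold involution lifts
      ι' ≫ π = π ≫ ι ∧ ι' ≫ ι' = 𝟙 X' ∧ ι' ≫ ρ' = ρ' ∧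
      -- the blow-up is a double cover of the (smooth) blown-up base, with `h' = h / w²`
      SmoothOfRelativeDimension n (β ≫ f) ∧ IsAffineHom ρ' ∧
      (∀ (i : D.P.I) (V : B'.Opens) (hV : V ≤ β ⁻¹ᵁ D.P.U i) (w : Γ(B', V)), IsAffineOpen V →
        (∀ (b : B') (hb : b ∈ V), SppLimit.pullIdeal β D.baseCenter b =
          Ideal.span {SppLimit.germAt V b hb w}) →
        ∃ (h' : Γ(B', V)) (ξ' : Γ(X', ρ' ⁻¹ᵁ V)),
          w ^ 2 * h' = (β.appLE (D.P.U i) V hV).hom (D.sppBranch i) ∧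
          (ρ'.app V).hom w * ξ' = (π.appLE (ρ ⁻¹ᵁ D.P.U i) (ρ' ⁻¹ᵁ V)
            (SppLimit.preimage_le_of_square e hV)).hom (C.ξ i) ∧
          SppLimit.IsDoubleCoverOn ρ' V h' ξ') ∧
      -- explicit equations of the blown-up base and of the resolution, in homogeneous coordinates
      (∀ (i : D.P.I) (V : B.Opens) (hV : V ≤ D.P.U i) (hVa : IsAffineOpen V),
        SppLimit.HasCharts β hVa
          (SppLimit.ResBaseChart (SppLimit.res hV (D.σ.val i)) (SppLimit.res hV (D.a₁.val i)))
          (SppLimit.resBaseCoord _ _)) ∧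
      (∀ (i : D.P.I) (V : B.Opens) (hV : V ≤ D.P.U i) (hVa : IsAffineOpen (ρ ⁻¹ᵁ V)),
        IsAffineOpen V →
        SppLimit.HasCharts π hVa
          (SppLimit.ResSppChart ((ρ.app V).hom (SppLimit.res hV (D.σ.val i)))
            ((ρ.app V).hom (SppLimit.res hV (D.a₁.val i)))
            ((ρ.app V).hom (SppLimit.res hV (D.a₂₂.val i)))
            (SppLimit.res (ρ.preimage_mono hV) (C.ξ i)))
          (SppLimit.resSppCoord _ _ _ _)) ∧
      -- it is the orientifold-invariant small resolution inside `X × ℙ¹ × ℙ¹`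
      (∀ (i : D.P.I) (V : B.Opens) (hV : V ≤ D.P.U i) (hVa : IsAffineOpen (ρ ⁻¹ᵁ V)),
        IsAffineOpen V →
        SppLimit.HasCharts π hVa
          (SppLimit.SmallResChart
            ((ρ.app V).hom (SppLimit.res hV (D.a₁.val i)) +
              SppLimit.res (ρ.preimage_mono hV) (C.ξ i))
            ((ρ.app V).hom (SppLimit.res hV (D.a₁.val i)) -
              SppLimit.res (ρ.preimage_mono hV) (C.ξ i))
            ((ρ.app V).hom (SppLimit.res hV (D.σ.val i)))
            (-4 * (ρ.app V).hom (SppLimit.res hV (D.a₂₂.val i))))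
          (SppLimit.smallResCoord _ _ _ _)) ∧
      -- the proper transforms of the stack and of its image: exchanged, disjoint, and together
      -- with the exceptional divisor they make up the total transform of `σ = 0`
      (ι' ⁻¹' D.properTransform C π 1 = D.properTransform C π (-1)) ∧
      Disjoint (D.properTransform C π 1) (D.properTransform C π (-1)) ∧
      (∀ s : ℤ, s = 1 ∨ s = -1 →
        SppLimit.zeroSet (D.properTransformIdeal C π s) = D.properTransform C π s) ∧
      (∀ y, SppLimit.pullIdeal π (D.coverSigma C) y =
        SppLimit.pullIdeal π (D.coverCenter C) y * D.properTransformIdeal C π 1 y *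
          D.properTransformIdeal C π (-1) y) := by
  have : Smooth f := SmoothOfRelativeDimension.smooth n f
  have hK := D.koszulExact f C hD
  obtain ⟨X', π, hπ⟩ := SppLimit.TateData.exists_isBlowup_coverCenter C hK
  obtain ⟨B', β, hβ⟩ := SppLimit.TateData.exists_isBlowup_baseCenter hK
  obtain ⟨ρ', ι', e, h1, h2, h3⟩ := SppLimit.TateData.exists_coverMap hπ hβ hι
  refine ⟨fun i => ⟨D.limitBranch_eq i, D.weak_coupling i⟩, fun i => ?_,
    SppLimit.TateData.compl_smoothPart C f hD,
    SppLimit.TateData.ringKrullDim_stalk_eq_two C f hK,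
    SppLimit.TateData.coverSigma_eq_inf C f hK,
    SppLimit.TateData.preimage_iota_stack C hι 1,
    SppLimit.TateData.zeroSet_stack_inter C f,
    X', B', π, β, ρ', ι', e, hπ, hβ,
    SppLimit.TateData.isCrepantResolution_coverBlowup f n C hD hK hπ, h1, h2, h3,
    (SppLimit.TateData.isIntegral_baseBlowup f n C hD hK hβ).2,
    SppLimit.TateData.isAffineHom_coverMap hπ hβ e hK,
    SppLimit.TateData.exists_isDoubleCoverOn hπ hβ e hK,
    fun i V hV hVa => SppLimit.TateData.hasCharts_resBase hβ ⟨i, V, hV, hVa⟩ (hK _),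
    fun i V hV hVa hVb => SppLimit.TateData.hasCharts_resSpp hπ ⟨i, V, hV, hVb⟩ (hK _) hVa,
    fun i V hV hVa hVb => SppLimit.TateData.hasCharts_smallRes f hπ ⟨i, V, hV, hVb⟩ (hK _) hVa,
    SppLimit.TateData.preimage_properTransform C hι h1 h2 1,
    SppLimit.TateData.disjoint_properTransform C f hπ,
    fun s hs => SppLimit.TateData.zeroSet_properTransformIdeal C hπ hK s
      (by rcases hs with rfl | rfl <;> rfl),
    fun y => (SppLimit.TateData.properTransformIdeal_decomposition C f hπ y).2⟩
  rw [SppLimit.TateData.xi_sq, SppLimit.TateData.sppBranch]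
  simp only [map_add, map_mul, map_pow, map_ofNat]
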